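/- **Setting.** Let $m\in\mathbb N$ and $1<p<m$. Fix a profile $\psi$, smooth on $[0,\infty)$, with $\operatorname{supp}\psi=[0,t_b]$, $\psi'<0$ on $[0,t_b)$ and $\psi'\le-\xi$ on $[0,t_a)$, where $2<t_a<t_b$ and $\xi>0$. Let $\mathcal N\subset\mathbb R^L$ be a compact smooth embedded submanifold without boundary, and let $\Omega\subset\mathbb R^m$ be open. $W^{1,p}(\Omega,\mathcal N)$ is the set of $u\in W^{1,p}(\Omega,\mathbb R^L)$ with $u(y)\in\mathcal N$ for a.e. $y$. A map $u\in W^{1,p}(\Omega,\mathcal N)$ is *$p$-minimizing* if $\int_\Omega|\nabla u|^p\le\int_\Omega|\nabla v|^p$ for every $v\in W^{1,p}(\Omega,\mathcal N)$ that equals $u$ a.e. outside some compact subset of $\Omega$ (here $|\nabla u|$ is the Euclidean norm of the matrix of partial derivatives). Its normalized energy is $$\theta(x,r)=r^{p-m}\int_\Omega\psi\Big(\frac{|y-x|}r\Big)|\nabla u(y)|^p\,dy .$$ For a linear subspace $W$ with orthonormal basis $(v_i)$ put $|\nabla_Wu|=\big(\sum_i|\langle\nabla u,v_i\rangle|^2\big)^{1/2}$.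 The map $u$ is *$(\eta,k)$-invariant in $B_r(x)$* if $r^{p-m}\int_{B_r(x)}|\nabla_Wu|^p\,dy<\eta$ for some $k$-dimensional linear subspace $W\subset\mathbb R^m$. For a positive Radon measure $\mu$ on $\Omega$, the $k$-dimensional Jones number is $$\beta^k_\mu(x,r)=\Big(r^{-k}\inf_A\int_{B_r(x)}\frac{\operatorname{dist}(y,A)^2}{r^2}\,d\mu(y)\Big)^{1/2},$$ the infimum being over the $k$-dimensional affine subspaces $A$ of $\mathbb R^m$. **Theorem (Estimates on $\beta^k_\mu$).** Let $\eta>0$, $\sigma>1$ and $0<\bar r\le1$. For every target $\mathcal N$ there is a constant $C$, depending only on $m,p,\eta,\sigma,\bar r$, the fixed profile $\psi$ and the fixed target $\mathcal N$, and independent of $\mathcal N$ when $p\ge2$, such that the following holds. Let $k\in\{1,\dots,m\}$, let $u\in W^{1,p}(\Omega,\mathcal N)$ be $p$-minimizing, let $r>0$, let $x$ be such that $B_{(1+\sigma t_b)r}(x)\subset\Omega$, and suppose that $u$ is not $(\eta,k+1)$-invariant in $B_{\bar rr}(x)$. Then for every positive Radon measure $\mu$ on $\Omega$ the function $y\mapsto\theta(y,\sigma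 r)-\theta(y,r)$ is $\mu$-integrable on $B_r(x)$ and $$\beta^k_\mu(x,r)^2\le C\,r^{-k}\int_{B_r(x)}\big(\theta(y,\sigma r)-\theta(y,r)\big)\,d\mu(y).$$ -/

import Mathlib

open MeasureTheory Metric Set
open scoped ContDiff

noncomputable section

/-- `ℝᵐ` with its Euclidean norm. -/
abbrev Euc (m : ℕ) : Type := EuclideanSpace ℝ (Fin m)

/-! ### The target: closed smooth submanifolds of `ℝᴸ` -/

/-- `N ⊆ ℝᴸ` is a compact smooth embedded submanifold without boundary (of some dimension `n`):
around each of its points there is a smooth diffeomorphism `Φ` between open sets of `ℝᴸ` that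
straightens `N` to an `n`-dimensional linear subspace `V`. Its Riemannian metric is the one induced
by `ℝᴸ`. -/
def IsClosedSubmanifold {L : ℕ} (N : Set (Euc L)) : Prop :=
  IsCompact N ∧
    ∃ n : ℕ, ∀ q ∈ N, ∃ (Φ : OpenPartialHomeomorph (Euc L) (Euc L)) (V : Submodule ℝ (Euc L)),
      q ∈ Φ.source ∧ ContDiffOn ℝ ∞ Φ Φ.source ∧ ContDiffOn ℝ ∞ Φ.symm Φ.target ∧
      Module.finrank ℝ V = n ∧ ∀ z ∈ Φ.source, (z ∈ N ↔ Φ z ∈ V)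

/-! ### Sobolev maps -/

/-- `G` is a weak gradient of `u` on the open set `Ω` (`G z` is a linear map, `e ↦ ∂ₑ u (z)`):
`∫_Ω (∂ₑ φ) u = - ∫_Ω φ ∂ₑ u` for all test functions `φ ∈ C_c^∞(Ω)` and all directions `e`. -/
def IsWeakGradient {m L : ℕ} (Ω : Set (Euc m)) (u : Euc m → Euc L)
    (G : Euc m → Euc m →L[ℝ] Euc L) : Prop :=
  LocallyIntegrableOn u Ω volume ∧ LocallyIntegrableOn G Ω volume ∧
    ∀ φ : Euc m → ℝ, ContDiff ℝ ∞ φ → HasCompactSupport φ → tsupport φ ⊆ Ω → ∀ e : Euc m,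
      ∫ z in Ω, (fderiv ℝ φ z e) • u z = - ∫ z in Ω, φ z • G z e

open Classical in
/-- The weak gradient `∇u` of `u` on `Ω`. It is unique up to equality almost everywhere on `Ω`
when it exists (and is set to `0` when it does not). -/
def weakGrad {m L : ℕ} (Ω : Set (Euc m)) (u : Euc m → Euc L) : Euc m → Euc m →L[ℝ] Euc L :=
  if h : ∃ G, IsWeakGradient Ω u G then h.choose else 0

/-- `u ∈ W^{1,p}(Ω, N)`: `u` and its weak gradient are in `L^p(Ω)`, and `u ∈ N` a.e. in `Ω`. -/
structure MemW1p {m L : ℕ} (p : ℝ) (Ω : Set (Euc m)) (N : Set (Euc L))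
    (u : Euc m → Euc L) : Prop where
  memLp : MemLp u (ENNReal.ofReal p) (volume.restrict Ω)
  exists_weakGradient : ∃ G, IsWeakGradient Ω u G
  memLp_weakGrad : MemLp (weakGrad Ω u) (ENNReal.ofReal p) (volume.restrict Ω)
  mem_target : ∀ᵐ z ∂(volume.restrict Ω), u z ∈ N

/-- For a linear map `A` (a gradient) and a linear subspace `W`, the Euclidean norm `|A_W|` of the
restriction of `A` to `W`: the square root of `∑ᵢ |A vᵢ|²` for an orthonormal basis `(vᵢ)` of `W`. -/
def normAlong {m L : ℕ} (W : Submodule ℝ (Euc m)) (A : Euc m →L[ℝ] Euc L) : ℝ :=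
  Real.sqrt (∑ i, ‖A (stdOrthonormalBasis ℝ W i : Euc m)‖ ^ 2)

theorem sum_sq_norm_onb {m L : ℕ} {ι : Type*} [Fintype ι] (W : Submodule ℝ (Euc m))
    (A : Euc m →L[ℝ] Euc L) (c : OrthonormalBasis ι ℝ W) :
    ∑ i, ‖A (c i : Euc m)‖ ^ 2 =
      ∑ j, ‖((A.comp W.subtypeL).adjoint ((stdOrthonormalBasis ℝ (Euc L)) j))‖ ^ 2 := by
  have h1 : ∀ i, ‖A (c i : Euc m)‖ ^ 2 = ∑ j, ‖inner ℝ (c i)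
      ((A.comp W.subtypeL).adjoint ((stdOrthonormalBasis ℝ (Euc L)) j))‖ ^ 2 := by
    intro i
    rw [← (stdOrthonormalBasis ℝ (Euc L)).sum_sq_norm_inner_left]
    refine Finset.sum_congr rfl fun j _ => ?_
    rw [ContinuousLinearMap.adjoint_inner_right]
    rfl
  simp_rw [h1]
  rw [Finset.sum_comm]
  exact Finset.sum_congr rfl fun j _ => c.sum_sq_norm_inner_right _

/-- `normAlong` may be computed in any orthonormal basis of `W`. -/
theorem normAlong_eq {m L : ℕ} {ι : Type*} [Fintype ι] (W : Submodule ℝ (Euc m))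
    (A : Euc m →L[ℝ] Euc L) (b : OrthonormalBasis ι ℝ W) :
    normAlong W A = Real.sqrt (∑ i, ‖A (b i : Euc m)‖ ^ 2) := by
  unfold normAlong
  rw [sum_sq_norm_onb W A b, sum_sq_norm_onb W A (stdOrthonormalBasis ℝ W)]

/-- `|∇u (z)|`, the Euclidean (Hilbert-Schmidt) norm of the full gradient. -/
def gradNorm {m L : ℕ} (Ω : Set (Euc m)) (u : Euc m → Euc L) (z : Euc m) : ℝ :=
  normAlong ⊤ (weakGrad Ω u z)

/-- The full gradient norm is `(∑ᵢ |∂ᵢ u|²)^{1/2}`. -/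
theorem gradNorm_eq {m L : ℕ} (Ω : Set (Euc m)) (u : Euc m → Euc L) (z : Euc m) :
    gradNorm Ω u z =
      Real.sqrt (∑ i, ‖weakGrad Ω u z (EuclideanSpace.single i (1 : ℝ))‖ ^ 2) := by
  unfold gradNorm
  rw [normAlong_eq ⊤ _ ((EuclideanSpace.basisFun (Fin m) ℝ).map
    (LinearIsometryEquiv.ofTop (Euc m) ⊤ rfl).symm)]
  simp

/-! ### `p`-energy, minimizers, normalized energy, almost invariance -/

/-- The `p`-energy `∫_Ω |∇u|^p`. -/
def pEnergy {m L : ℕ} (p : ℝ) (Ω : Set (Euc m)) (u : Euc m → Euc L) : ℝ :=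
  ∫ z in Ω, gradNorm Ω u z ^ p

/-- `u` is a `p`-energy minimizing map in `W^{1,p}(Ω, N)`: it has least energy among all maps of
`W^{1,p}(Ω, N)` that agree with it a.e. outside some compact subset of `Ω`. -/
def IsPMinimizing {m L : ℕ} (p : ℝ) (Ω : Set (Euc m)) (N : Set (Euc L))
    (u : Euc m → Euc L) : Prop :=
  MemW1p p Ω N u ∧
    ∀ (K : Set (Euc m)) (v : Euc m → Euc L), IsCompact K → K ⊆ Ω → MemW1p p Ω N v →
      (∀ᵐ z ∂(volume.restrict (Ω \ K)), v z = u z) → pEnergy p Ω u ≤ pEnergy p Ω v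

/-- The admissible profiles `ψ` (only the values on `[0, ∞)` matter): `ψ` is smooth on `[0, ∞)`, its
support is `[0, t_b]`, `ψ' < 0` on `[0, t_b)`, `ψ' ≤ -ξ` on `[0, t_a)`, where `2 < t_a < t_b` and
`ξ > 0`. -/
structure IsProfile (ψ : ℝ → ℝ) (ta tb ξ : ℝ) : Prop where
  two_lt_ta : 2 < ta
  ta_lt_tb : ta < tb
  xi_pos : 0 < ξ
  smooth : ContDiffOn ℝ ∞ ψ (Ici 0)
  support_eq : closure {t | 0 ≤ t ∧ ψ t ≠ 0} = Icc 0 tb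
  deriv_neg : ∀ t ∈ Ico 0 tb, derivWithin ψ (Ici 0) t < 0
  deriv_le : ∀ t ∈ Ico 0 ta, derivWithin ψ (Ici 0) t ≤ -ξ

/-- The normalized energy `θ(x, r) = r^{p-m} ∫_Ω ψ(|y - x| / r) |∇u(y)|^p dy`. -/
def normalizedEnergy {m L : ℕ} (p : ℝ) (ψ : ℝ → ℝ) (Ω : Set (Euc m)) (u : Euc m → Euc L)
    (x : Euc m) (r : ℝ) : ℝ :=
  r ^ (p - m) * ∫ y in Ω, ψ (‖y - x‖ / r) * gradNorm Ω u y ^ p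

/-- `u` is `(η, k)`-invariant in the ball `B_r(x) ⊆ Ω`: for some `k`-dimensional linear subspace `W`,
`r^{p-m} ∫_{B_r(x)} |∇_W u|^p < η`. -/
def IsAlmostInvariant {m L : ℕ} (p : ℝ) (Ω : Set (Euc m)) (u : Euc m → Euc L)
    (η : ℝ) (k : ℕ) (x : Euc m) (r : ℝ) : Prop :=
  ∃ W : Submodule ℝ (Euc m), Module.finrank ℝ W = k ∧
    r ^ (p - m) * ∫ y in ball x r, normAlong W (weakGrad Ω u y) ^ p < η

/-! ### Jones numbers -/

/-- `μ` restricts to a positive Radon measure on the open set `Ω`: a Borel measure that is finite on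
the compact subsets of `Ω`. -/
def IsRadonOn {m : ℕ} (Ω : Set (Euc m)) (μ : Measure (Euc m)) : Prop :=
  ∀ K : Set (Euc m), IsCompact K → K ⊆ Ω → μ K < ⊤

/-- The `k`-dimensional Jones number
`β^k_μ(x, r) = (r^{-k} inf_A ∫_{B_r(x)} dist(y, A)² / r² dμ(y))^{1/2}`, the infimum being over the
`k`-dimensional affine subspaces `A`. -/
def jonesNumber {m : ℕ} (k : ℕ) (μ : Measure (Euc m)) (x : Euc m) (r : ℝ) : ℝ :=
  Real.sqrt ((r ^ k)⁻¹ *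
    sInf {I : ℝ | ∃ A : AffineSubspace ℝ (Euc m), (A : Set (Euc m)).Nonempty ∧
      Module.finrank ℝ A.direction = k ∧
      I = ∫ y in ball x r, infDist y (A : Set (Euc m)) ^ 2 / r ^ 2 ∂μ})

end

/-! ### Mollification and continuity of translations in `L¹`. -/

section L1Mollification
open Filter Topology

variable {m : ℕ} {F : Type*} [NormedAddCommGroup F]

/-! Everything passes through one quadratic quantity, the radial energy `D(y) = ∫_{B_r(x)}
|∇u(z)|^{p-2} |∇u(z)(z - y)|² dz`. It is bounded above by the energy drop at `y`, and its
`μ`-average is bounded below by the Jones number.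

Upper bound. Comparing `u` with `u ∘ (id + tX)⁻¹` shows that the inner first variation vanishes
(`IsPMinimizing.first_variation`). For `X(z) = ψ(|z - y|/s)(z - y)` this is the monotonicity
formula: `∂ₛθ(y, s)` is the integral of `|∇u|^{p-2}|∇u(z - y)|²` against a nonnegative weight, and
on `B_r(x)` that weight is bounded below because `ψ' ≤ -ξ` on `[0, t_a)` with `t_a > 2`. Integrating
over `s ∈ [r, σr]` gives `c r^{p-m-2} D(y) ≤ θ(y, σr) - θ(y, r)` (`IsPMinimizing.energy_drop`).

Lower bound. Let `l₁ ≥ … ≥ l_m` be the second moments of `μ` on `B_r(x)` about its centre of mass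
along the principal axes `bᵢ`. The plane through the centre of mass spanned by the first `k` axes
shows `β² ≤ m r^{-k-2} l_{k+1}`. On the other hand `lᵢ|A bᵢ|² ≤ ∫ |A(z - y)|² dμ(y)` for every
linear `A` and every `z` (`exists_principal_axes`). With `A = ∇u(z)` and `W` the span of the first
`k + 1` axes, Fubini yields `l_{k+1} ∫ |∇u|^{p-2}|∇_W u|² ≤ (k + 1) ∫ D dμ`. Hence it is enough to
prove the coercivity `∫_{B_r(x)} |∇u|^{p-2}|∇_W u|² ≥ c₀ r^{m-p}` for all `W` of dimension `k + 1`
(`jonesNumber_sq_le_of_coercive`).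

Coercivity. The lack of invariance bounds `∫ |∇_W u|^p` from below. If `p ≥ 2`, then `|∇_W u|^p ≤
|∇u|^{p-2}|∇_W u|²` pointwise and the target plays no role. If `p < 2`, this inequality fails, and a
small multiple of `∫ |∇u|^p` has to be absorbed; this requires the scale invariant bound `∫_{B_r(x)}
|∇u|^p ≤ E r^{m-p}`, with `E` depending on the target (`IsClosedSubmanifold.exists_energy_bound`).

The energy bound. The competitor is deformed inside the target to a constant on a smaller ball, so
that only the energy of an annulus remains, and hole filling finishes. The target may have any
topology, so the deformation uses a map into it that factors through a graph: a grid of `ℝᴸ` is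
collapsed to its vertices and edges, and the edges are sent to paths in the target. Such a map is
singular only on a set of codimension two, with Lipschitz constant of order one over the distance to
that set. For `p < 2` this is `p`-integrable on average over translations of the grid, so some
translation is good. Since the map is not Lipschitz, the weak gradient of the composition is
obtained from difference quotients (`exists_weakGradient_of_increment_le`). Since the target may be
disconnected, `u` is first shown to stay in one class of points linked by short jumps
(`exists_chainClass`). -/

theorem tendsto_lintegral_translate_sub {f : Euc m → F} (hf : Integrable f) :
    Tendsto (fun s : Euc m => ∫⁻ z, ‖f (z + s) - f z‖ₑ) (𝓝 0) (𝓝 0) := by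
  have : Fact ((1 : ENNReal) ≤ 1) := ⟨le_rfl⟩
  have : Fact ((1 : ENNReal) ≠ ⊤) := ⟨by simp⟩
  set g : Lp F 1 (volume : Measure (Euc m)) := hf.toL1 f with hg
  have h0 : Continuous (fun s : Euc m => (DomAddAct.mk s : (Euc m)ᵈᵃᵃ)) :=
    DomAddAct.continuous_mk
  -- Translations act continuously on `L¹`; the claim is this continuity at `s = 0`, rewritten for a
  -- representative of the class.
  have h1 : Continuous (fun s : Euc m => (DomAddAct.mk s : (Euc m)ᵈᵃᵃ) +ᵥ g) :=
    h0.vadd continuous_const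
  have h2 := (h1.edist (continuous_const (y := g))).tendsto 0
  simp only [DomAddAct.mk_zero, zero_vadd, edist_self] at h2
  refine h2.congr fun s => ?_
  rw [Lp.edist_def, eLpNorm_one_eq_lintegral_enorm]
  refine lintegral_congr_ae ?_
  have e1 := DomAddAct.vadd_Lp_ae_eq (DomAddAct.mk s) g
  have e2 := hf.coeFn_toL1
  have e3 : ∀ᵐ z, g (s + z) = f (s + z) :=
    (measurePreserving_add_left volume s).quasiMeasurePreserving.ae e2
  filter_upwards [e1, e2, e3] with z h1 h2 h3
  simp only [Pi.sub_apply, h1]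
  rw [h2]
  have : (DomAddAct.mk.symm (DomAddAct.mk s) +ᵥ z) = s + z := rfl
  rw [this, h3, add_comm]

variable [NormedSpace ℝ F]

/-- A radial mollifier supported in the closed ball of radius `2⁻ⁿ`. -/
noncomputable def mollBump (m n : ℕ) : ContDiffBump (0 : Euc m) where
  rIn := (1 / 2) ^ (n + 1)
  rOut := (1 / 2) ^ n
  rIn_pos := by positivity
  rIn_lt_rOut := by
    rw [pow_succ]
    have : (0 : ℝ) < (1 / 2) ^ n := by positivity
    linarith

noncomputable def moll (n : ℕ) (f : Euc m → F) : Euc m → F :=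
  convolution ((mollBump m n).normed volume) f (ContinuousLinearMap.lsmul ℝ ℝ) volume

theorem moll_contDiff (n : ℕ) {f : Euc m → F} (hf : LocallyIntegrable f) :
    ContDiff ℝ ∞ (moll n f) :=
  (mollBump m n).hasCompactSupport_normed.contDiff_convolution_left _
    (mollBump m n).contDiff_normed hf

/-- The kernel is a probability density supported at scale `2⁻ⁿ`, so `moll n f z - f z` is an
average of the differences `f (z - t) - f z`. Tonelli turns the bound on each translate into a bound
on the average. -/
theorem lintegral_moll_sub_le [CompleteSpace F] (n : ℕ) {f : Euc m → F} (hf : Integrable f) {b : ENNReal}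
    (hb : ∀ s : Euc m, ‖s‖ < (1 / 2) ^ n → ∫⁻ z, ‖f (z + s) - f z‖ₑ ≤ b) :
    ∫⁻ z, ‖moll n f z - f z‖ₑ ≤ b := by
  set ρ : Euc m → ℝ := (mollBump m n).normed volume with hρ
  have hρc : Continuous ρ := (mollBump m n).continuous_normed
  have hint : ∫ t, ρ t = 1 := (mollBump m n).integral_normed
  have hρi : Integrable ρ := hρc.integrable_of_hasCompactSupport (mollBump m n).hasCompactSupport_normed
  have hlint : ∫⁻ t, ‖ρ t‖ₑ = 1 := by
    rw [← ofReal_integral_norm_eq_lintegral_enorm hρi]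
    have : ∀ t, ‖ρ t‖ = ρ t := fun t => by
      rw [Real.norm_eq_abs, abs_of_nonneg ((mollBump m n).nonneg_normed t)]
    simp_rw [this, hint]; simp
  have hpt : ∀ z, ‖moll n f z - f z‖ₑ ≤ ∫⁻ t, ‖ρ t‖ₑ * ‖f (z - t) - f z‖ₑ := by
    intro z
    have hex : Integrable (fun t => ρ t • f (z - t)) :=
      (mollBump m n).hasCompactSupport_normed.convolutionExists_left
        (ContinuousLinearMap.lsmul ℝ ℝ) hρc hf.locallyIntegrable z
    have : moll n f z - f z = ∫ t, ρ t • (f (z - t) - f z) := by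
      simp_rw [smul_sub]
      rw [integral_sub hex (hρi.smul_const _), integral_smul_const, hint, one_smul]
      rfl
    rw [this]
    refine (enorm_integral_le_lintegral_enorm _).trans (le_of_eq ?_)
    simp_rw [enorm_smul]
  calc ∫⁻ z, ‖moll n f z - f z‖ₑ ≤ ∫⁻ z, ∫⁻ t, ‖ρ t‖ₑ * ‖f (z - t) - f z‖ₑ :=
        lintegral_mono hpt
    _ = ∫⁻ t, ∫⁻ z, ‖ρ t‖ₑ * ‖f (z - t) - f z‖ₑ := by
        refine lintegral_lintegral_swap ?_
        have h1 : AEMeasurable (fun q : Euc m × Euc m => ‖ρ q.2‖ₑ) (volume.prod volume) :=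
          (hρc.comp continuous_snd).enorm.measurable.aemeasurable
        have h2 : AEStronglyMeasurable (fun q : Euc m × Euc m => f (q.1 - q.2))
            (volume.prod volume) :=
          hf.1.comp_quasiMeasurePreserving (f := fun q : Euc m × Euc m => q.1 - q.2)
            (quasiMeasurePreserving_sub_of_right_invariant (volume : Measure (Euc m)) volume)
        have h3 : AEStronglyMeasurable (fun q : Euc m × Euc m => f q.1)
            (volume.prod volume) :=
          hf.1.comp_quasiMeasurePreserving (Measure.quasiMeasurePreserving_fst
              (μ := (volume : Measure (Euc m))) (ν := (volume : Measure (Euc m))))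
        exact h1.mul (h2.sub h3).enorm
    _ = ∫⁻ t, ‖ρ t‖ₑ * ∫⁻ z, ‖f (z - t) - f z‖ₑ := by
        refine lintegral_congr fun t => lintegral_const_mul' _ _ (by simp)
    _ ≤ ∫⁻ t, ‖ρ t‖ₑ * b := by
        refine lintegral_mono fun t => ?_
        by_cases ht : ‖t‖ < (1 / 2) ^ n
        · have := hb (-t) (by simpa using ht)
          simp_rw [← sub_eq_add_neg] at this
          gcongr
        · have : ρ t = 0 := by
            have : t ∉ Function.support ρ := by
              rw [hρ, (mollBump m n).support_normed_eq]
              simpa [mollBump] using ht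
            simpa using this
          simp [this]
    _ = b := by
        rw [lintegral_mul_const'' _ hρi.1.enorm, hlint, one_mul]

theorem tendsto_lintegral_moll_sub [CompleteSpace F] {f : Euc m → F} (hf : Integrable f) :
    Tendsto (fun n => ∫⁻ z, ‖moll n f z - f z‖ₑ) atTop (𝓝 0) := by
  rw [ENNReal.tendsto_nhds_zero]
  intro ε hε
  have h := (ENNReal.tendsto_nhds_zero.1 (tendsto_lintegral_translate_sub hf)) ε hε
  obtain ⟨δ, hδ, hδ'⟩ := Metric.eventually_nhds_iff.1 h
  obtain ⟨n₀, hn₀⟩ := exists_pow_lt_of_lt_one hδ (by norm_num : (1 / 2 : ℝ) < 1)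
  filter_upwards [eventually_ge_atTop n₀] with n hn
  refine lintegral_moll_sub_le n hf fun s hs => hδ' ?_
  rw [dist_zero_right]
  calc ‖s‖ < (1 / 2) ^ n := hs
    _ ≤ (1 / 2) ^ n₀ := pow_le_pow_of_le_one (by norm_num) (by norm_num) hn
    _ < δ := hn₀

end L1Mollification


/-! ### Smooth approximation of weakly differentiable maps. -/

section WeakGradientApprox
open Filter Topology

variable {m L : ℕ}

theorem integrable_indicator_of_compact {F : Type*} [NormedAddCommGroup F] {Ω S : Set (Euc m)}
    {f : Euc m → F} (hf : LocallyIntegrableOn f Ω) (hS : IsCompact S) (hSΩ : S ⊆ Ω) :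
    Integrable (S.indicator f) :=
  (integrable_indicator_iff hS.measurableSet).2 (hf.integrableOn_compact_subset hSΩ hS)

/-- Differentiating the convolution puts the derivative on the kernel. The kernel reflected about
`z` is a test function supported in the small ball around `z`, so the definition of the weak
gradient moves the derivative to `u`. Cutting off to `S` gives global integrability and is not felt
at `z`, because the small ball lies in `S`. -/
theorem fderiv_moll_eq {Ω : Set (Euc m)} {u : Euc m → Euc L} {G : Euc m → Euc m →L[ℝ] Euc L}
    (h : IsWeakGradient Ω u G) {S : Set (Euc m)} (hS : IsCompact S) (hSΩ : S ⊆ Ω)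
    {n : ℕ} {z : Euc m} (hz : closedBall z ((1 / 2) ^ n) ⊆ S) :
    fderiv ℝ (moll n (S.indicator u)) z = moll n (S.indicator G) z := by
  set ρ : Euc m → ℝ := (mollBump m n).normed volume with hρ
  have hρs : ContDiff ℝ ∞ ρ := (mollBump m n).contDiff_normed
  have hρc : HasCompactSupport ρ := (mollBump m n).hasCompactSupport_normed
  have hρt : tsupport ρ = closedBall 0 ((1 / 2) ^ n) := (mollBump m n).tsupport_normed_eq
  have hU : Integrable (S.indicator u) :=
    integrable_indicator_of_compact h.1 hS hSΩ
  have hGi : Integrable (S.indicator G) :=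
    integrable_indicator_of_compact h.2.1 hS hSΩ
  have hD := hρc.hasFDerivAt_convolution_left (ContinuousLinearMap.lsmul ℝ ℝ)
    (hρs.of_le (by simp)) hU.locallyIntegrable z
  have hmoll : moll n (S.indicator u) =
    convolution ρ (S.indicator u) (ContinuousLinearMap.lsmul ℝ ℝ) volume := rfl
  rw [hmoll, hD.fderiv]
  ext1 e
  have hex : ConvolutionExistsAt (fderiv ℝ ρ) (S.indicator u) z
      ((ContinuousLinearMap.lsmul ℝ ℝ).precompL (Euc m)) volume :=
    (hρc.fderiv ℝ).convolutionExists_left _ (hρs.continuous_fderiv (by simp))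
      hU.locallyIntegrable z
  have hexG : ConvolutionExistsAt ρ (S.indicator G) z (ContinuousLinearMap.lsmul ℝ ℝ) volume :=
      hρc.convolutionExists_left
        (ContinuousLinearMap.lsmul ℝ ℝ) hρs.continuous hGi.locallyIntegrable z
  set φ : Euc m → ℝ := fun y => ρ (z - y) with hφ
  have hφs : ContDiff ℝ ∞ φ := hρs.comp (contDiff_const.sub contDiff_id)
  have hφt : tsupport φ ⊆ closedBall z ((1 / 2) ^ n) := by
    refine closure_minimal ?_ isClosed_closedBall
    intro y hy
    have : z - y ∈ tsupport ρ := subset_tsupport _ hy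
    rw [hρt, mem_closedBall_zero_iff] at this
    rwa [mem_closedBall, dist_comm, dist_eq_norm]
  have hφc : HasCompactSupport φ := (isCompact_closedBall z _).of_isClosed_subset
    (isClosed_tsupport _) hφt
  have hfd : ∀ y, fderiv ℝ φ y e = - fderiv ℝ ρ (z - y) e := by
    intro y
    have h1 : HasFDerivAt (fun y : Euc m => z - y) (-ContinuousLinearMap.id ℝ (Euc m)) y :=
      (hasFDerivAt_id y).const_sub z
    have h2 := ((hρs.differentiable (by simp)) (z - y)).hasFDerivAt.comp y h1
    change fderiv ℝ (ρ ∘ fun y => z - y) y e = _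
    rw [h2.fderiv]
    simp
  have key := h.2.2 φ hφs hφc (hφt.trans (hz.trans hSΩ)) e
  have hφ0 : ∀ y, y ∉ S → φ y = 0 := fun y hy =>
    image_eq_zero_of_notMem_tsupport fun hy' => hy (hz (hφt hy'))
  have hφ1 : ∀ y, y ∉ S → fderiv ℝ φ y = 0 := fun y hy =>
    image_eq_zero_of_notMem_tsupport fun hy' => hy (hz (hφt (tsupport_fderiv_subset ℝ hy')))
  rw [setIntegral_eq_integral_of_forall_compl_eq_zero
      (fun y hy => by rw [hφ1 y (fun h => hy (hSΩ h))]; simp),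
    setIntegral_eq_integral_of_forall_compl_eq_zero
      (fun y hy => by rw [hφ0 y (fun h => hy (hSΩ h))]; simp)] at key
  have l1 : (convolution (fderiv ℝ ρ) (S.indicator u)
      ((ContinuousLinearMap.lsmul ℝ ℝ).precompL (Euc m)) volume z) e =
      - ∫ y, (fderiv ℝ φ y e) • u y := by
    rw [convolution_def, ContinuousLinearMap.integral_apply hex,
      ← integral_sub_left_eq_self _ volume z, ← integral_neg]
    refine integral_congr_ae (Eventually.of_forall fun y => ?_)
    simp only [ContinuousLinearMap.precompL_apply, ContinuousLinearMap.lsmul_apply, sub_sub_cancel]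
    by_cases hy : y ∈ S
    · rw [indicator_of_mem hy, hfd]; simp
    · rw [indicator_of_notMem hy, hφ1 y hy]; simp
  have l2 : (moll n (S.indicator G) z) e = ∫ y, φ y • G y e := by
    change (convolution ρ (S.indicator G) (ContinuousLinearMap.lsmul ℝ ℝ) volume z) e = _
    rw [convolution_def, ContinuousLinearMap.integral_apply hexG,
      ← integral_sub_left_eq_self _ volume z]
    refine integral_congr_ae (Eventually.of_forall fun y => ?_)
    simp only [ContinuousLinearMap.lsmul_apply, sub_sub_cancel]
    by_cases hy : y ∈ S
    · rw [indicator_of_mem hy]; rfl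
    · rw [indicator_of_notMem hy, hφ0 y hy]; simp
  rw [l1, l2, key, neg_neg]

/-- Smooth approximation of a weakly differentiable map on a compact subset of `Ω`. -/
theorem exists_smooth_approx {Ω : Set (Euc m)} (hΩ : IsOpen Ω) {u : Euc m → Euc L}
    {G : Euc m → Euc m →L[ℝ] Euc L}
    (h : IsWeakGradient Ω u G) {K : Set (Euc m)} (hK : IsCompact K) (hKΩ : K ⊆ Ω) :
    ∃ U : ℕ → Euc m → Euc L, (∀ n, ContDiff ℝ ∞ (U n)) ∧
      Tendsto (fun n => ∫⁻ z in K, ‖U n z - u z‖ₑ) atTop (𝓝 0) ∧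
      Tendsto (fun n => ∫⁻ z in K, ‖fderiv ℝ (U n) z - G z‖ₑ) atTop (𝓝 0) ∧
      ((∀ z ∈ Ω, G z = 0) → ∀ᶠ n in atTop, ∀ z ∈ K, fderiv ℝ (U n) z = 0) := by
  obtain ⟨δ, hδ, hδΩ⟩ := hK.exists_cthickening_subset_open hΩ hKΩ
  set S := cthickening δ K with hS
  have hSc : IsCompact S := hK.cthickening
  have hKS : K ⊆ S := self_subset_cthickening K
  have hU : Integrable (S.indicator u) :=
    integrable_indicator_of_compact h.1 hSc hδΩ
  have hGi : Integrable (S.indicator G) :=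
    integrable_indicator_of_compact h.2.1 hSc hδΩ
  obtain ⟨n₀, hn₀⟩ := exists_pow_lt_of_lt_one hδ (by norm_num : (1 / 2 : ℝ) < 1)
  have hfd : ∀ n, n₀ ≤ n → ∀ z ∈ K, fderiv ℝ (moll n (S.indicator u)) z =
      moll n (S.indicator G) z := by
    intro n hn z hz
    refine fderiv_moll_eq h hSc hδΩ ?_
    refine (closedBall_subset_closedBall ?_).trans (closedBall_subset_cthickening hz δ)
    exact (pow_le_pow_of_le_one (by norm_num) (by norm_num) hn).trans hn₀.le
  refine ⟨fun n => moll n (S.indicator u), fun n => moll_contDiff n hU.locallyIntegrable,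
    ?_, ?_, ?_⟩
  · refine tendsto_of_tendsto_of_tendsto_of_le_of_le tendsto_const_nhds
      (tendsto_lintegral_moll_sub hU) (fun _ => zero_le) fun n => ?_
    refine le_trans (le_of_eq ?_) (setLIntegral_le_lintegral K _)
    refine setLIntegral_congr_fun hK.measurableSet fun z hz => ?_
    simp only [indicator_of_mem (hKS hz)]
  · refine tendsto_of_tendsto_of_tendsto_of_le_of_le' tendsto_const_nhds
      (tendsto_lintegral_moll_sub hGi) (Eventually.of_forall fun _ => zero_le) ?_
    filter_upwards [eventually_ge_atTop n₀] with n hn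
    refine le_trans (le_of_eq ?_) (setLIntegral_le_lintegral K _)
    refine setLIntegral_congr_fun hK.measurableSet fun z hz => ?_
    simp only [indicator_of_mem (hKS hz), hfd n hn z hz]
  -- If the weak gradient is zero, the approximations have derivative exactly zero on `K`, not
  -- merely small in `L¹`; this is what makes them constant on balls.
  · intro hG
    filter_upwards [eventually_ge_atTop n₀] with n hn z hz
    have : S.indicator G = 0 := by
      ext1 y
      by_cases hy : y ∈ S
      · rw [indicator_of_mem hy, hG y (hδΩ hy)]; rfl
      · rw [indicator_of_notMem hy]; rfl
    rw [hfd n hn z hz, this]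
    simp [moll]

end WeakGradientApprox


/-! ### First order Taylor expansion in `L¹`, and maps with zero weak gradient. -/

section DifferenceQuotients
open Filter Topology

variable {m L : ℕ}

theorem enorm_add_add_neg_le {F : Type*} [NormedAddCommGroup F] (a b c : F) :
    ‖a + b + -c‖ₑ ≤ ‖a‖ₑ + ‖b‖ₑ + ‖c‖ₑ := by
  refine (enorm_add_le _ _).trans ?_
  rw [enorm_neg]
  gcongr
  exact enorm_add_le _ _

theorem lintegral_translate_compact_le {F : Type*} [NormedAddCommGroup F] {K : Set (Euc m)}
    (hK : MeasurableSet K) {δ : ℝ} {w : Euc m} (hw : ‖w‖ ≤ δ) (f : Euc m → F) :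
    ∫⁻ z in K, ‖f (z + w)‖ₑ ≤ ∫⁻ z in cthickening δ K, ‖f z‖ₑ := by
  rw [← lintegral_indicator hK, ← lintegral_indicator isClosed_cthickening.measurableSet,
    ← lintegral_add_right_eq_self ((cthickening δ K).indicator fun z => ‖f z‖ₑ) w]
  refine lintegral_mono fun z => ?_
  by_cases hz : z ∈ K
  · rw [indicator_of_mem hz, indicator_of_mem]
    refine mem_cthickening_of_dist_le (z + w) z δ K hz ?_
    simpa using hw
  · rw [indicator_of_notMem hz]; exact zero_le

/-- The fundamental theorem of calculus on the segment from `z` to `z + w`, followed by Tonelli. The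
number `b` is an `L¹` modulus of continuity of the derivative. -/
theorem lintegral_smooth_taylor_le {U : Euc m → Euc L} (hU : ContDiff ℝ ∞ U) (K : Set (Euc m))
    (w : Euc m) {b : ENNReal}
    (hb : ∀ s ∈ Icc (0 : ℝ) 1, ∫⁻ z in K, ‖fderiv ℝ U (z + s • w) - fderiv ℝ U z‖ₑ ≤ b) :
    ∫⁻ z in K, ‖U (z + w) - U z - fderiv ℝ U z w‖ₑ ≤ b * ‖w‖ₑ := by
  have hc : Continuous (fderiv ℝ U) := hU.continuous_fderiv (by simp)
  have hpt : ∀ z, ‖U (z + w) - U z - fderiv ℝ U z w‖ₑ ≤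
      ∫⁻ s in Icc (0 : ℝ) 1, ‖fderiv ℝ U (z + s • w) - fderiv ℝ U z‖ₑ * ‖w‖ₑ := by
    intro z
    have hd : ∀ s ∈ uIcc (0 : ℝ) 1, HasDerivAt (fun s : ℝ => U (z + s • w) - s • fderiv ℝ U z w)
        ((fderiv ℝ U (z + s • w) - fderiv ℝ U z) w) s := by
      intro s _
      have h1 : HasDerivAt (fun s : ℝ => z + s • w) w s := by
        simpa using ((hasDerivAt_id s).smul_const w).const_add z
      have h2 := ((hU.differentiable (by simp)) (z + s • w)).hasFDerivAt.comp_hasDerivAt s h1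
      have h3 := (hasDerivAt_id s).smul_const (fderiv ℝ U z w)
      refine (h2.sub h3).congr_deriv ?_
      simp
    have hcont : Continuous fun s : ℝ => (fderiv ℝ U (z + s • w) - fderiv ℝ U z) w := by
      fun_prop
    have := intervalIntegral.integral_eq_sub_of_hasDerivAt hd (hcont.intervalIntegrable _ _)
    have e : U (z + w) - U z - fderiv ℝ U z w =
        ∫ s in (0 : ℝ)..1, (fderiv ℝ U (z + s • w) - fderiv ℝ U z) w := by
      rw [this]; simp; abel
    rw [e, intervalIntegral.integral_of_le zero_le_one, ← integral_Icc_eq_integral_Ioc]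
    refine (enorm_integral_le_lintegral_enorm _).trans (lintegral_mono fun s => ?_)
    exact ContinuousLinearMap.le_opENorm _ _
  calc ∫⁻ z in K, ‖U (z + w) - U z - fderiv ℝ U z w‖ₑ
      ≤ ∫⁻ z in K, ∫⁻ s in Icc (0 : ℝ) 1, ‖fderiv ℝ U (z + s • w) - fderiv ℝ U z‖ₑ * ‖w‖ₑ :=
        lintegral_mono hpt
    _ = ∫⁻ s in Icc (0 : ℝ) 1, ∫⁻ z in K, ‖fderiv ℝ U (z + s • w) - fderiv ℝ U z‖ₑ * ‖w‖ₑ := by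
        refine lintegral_lintegral_swap ?_
        have : Continuous fun q : Euc m × ℝ =>
            ‖fderiv ℝ U (q.1 + q.2 • w) - fderiv ℝ U q.1‖ₑ := by
          fun_prop
        exact (this.measurable.mul_const _).aemeasurable
    _ ≤ ∫⁻ s in Icc (0 : ℝ) 1, b * ‖w‖ₑ := by
        refine setLIntegral_mono measurable_const fun s hs => ?_
        rw [lintegral_mul_const' _ _ (by simp)]
        gcongr
        exact hb s hs
    _ = b * ‖w‖ₑ := by simp

/-- The expansion holds for smooth approximations, whose derivatives inherit the `L¹` modulus of
continuity of `G` up to the error `d n`. The error `c n` carries no factor `‖w‖`, so `w` is fixed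
before `n → ∞`; the threshold on `‖w‖` depends on `G` alone and survives the limit. -/
theorem lintegral_increment_sub_le {Ω : Set (Euc m)} (hΩ : IsOpen Ω) {u : Euc m → Euc L}
    {G : Euc m → Euc m →L[ℝ] Euc L} (h : IsWeakGradient Ω u G) {K : Set (Euc m)}
    (hK : IsCompact K) (hKΩ : K ⊆ Ω) {ε : ENNReal} (hε : 0 < ε) :
    ∃ δ > 0, ∀ w : Euc m, ‖w‖ < δ → ∫⁻ z in K, ‖u (z + w) - u z - G z w‖ₑ ≤ ε * ‖w‖ₑ := by
  obtain ⟨δ₁, hδ₁, hδΩ⟩ := hK.exists_cthickening_subset_open hΩ hKΩ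
  set S := cthickening δ₁ K with hS
  have hSc : IsCompact S := hK.cthickening
  have hKS : K ⊆ S := self_subset_cthickening K
  have hGi : Integrable (S.indicator G) := integrable_indicator_of_compact h.2.1 hSc hδΩ
  obtain ⟨δ₂, hδ₂, hδ₂'⟩ := Metric.eventually_nhds_iff.1
    ((ENNReal.tendsto_nhds_zero.1 (tendsto_lintegral_translate_sub hGi)) ε hε)
  obtain ⟨U, hU, hU0, hU1, -⟩ := exists_smooth_approx hΩ h hSc hδΩ
  refine ⟨min δ₁ δ₂, lt_min hδ₁ hδ₂, fun w hw => ?_⟩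
  have hw1 : ‖w‖ ≤ δ₁ := (hw.trans_le (min_le_left _ _)).le
  have hw2 : ‖w‖ < δ₂ := hw.trans_le (min_le_right _ _)
  set c := fun n => ∫⁻ z in S, ‖U n z - u z‖ₑ with hc
  set d := fun n => ∫⁻ z in S, ‖fderiv ℝ (U n) z - G z‖ₑ with hd
  have hum : AEStronglyMeasurable u (volume.restrict S) :=
    (h.1.integrableOn_compact_subset hδΩ hSc).1
  have hGm : AEStronglyMeasurable G (volume.restrict S) :=
    (h.2.1.integrableOn_compact_subset hδΩ hSc).1
  have hres : volume.restrict K ≤ volume.restrict S := Measure.restrict_mono hKS le_rfl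
  have hshift : ∀ {s : ℝ}, s ∈ Icc (0 : ℝ) 1 → ‖s • w‖ ≤ ‖w‖ := by
    intro s hs
    rw [norm_smul, Real.norm_eq_abs, abs_of_nonneg hs.1]
    exact mul_le_of_le_one_left (norm_nonneg _) hs.2
  have hqmp : ∀ s ∈ Icc (0 : ℝ) 1, Measure.QuasiMeasurePreserving (fun z : Euc m => z + s • w)
      (volume.restrict K) (volume.restrict S) := by
    intro s hs
    refine ⟨by fun_prop, ?_⟩
    refine Measure.AbsolutelyContinuous.mk fun A hA hA0 => ?_
    rw [Measure.map_apply (by fun_prop) hA, Measure.restrict_apply' hK.measurableSet]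
    rw [Measure.restrict_apply hA] at hA0
    refine measure_mono_null (t := (fun z : Euc m => z + s • w) ⁻¹' (A ∩ S)) ?_ ?_
    · rintro z ⟨hz1, hz2⟩
      refine ⟨hz1, mem_cthickening_of_dist_le (z + s • w) z δ₁ K hz2 ?_⟩
      simpa using (hshift hs).trans hw1
    · rw [measure_preimage_add_right]; exact hA0
  have key : ∀ n, ∫⁻ z in K, ‖u (z + w) - u z - G z w‖ₑ ≤
      c n + c n + d n * ‖w‖ₑ + (d n + ε + d n) * ‖w‖ₑ := by
    intro n
    have hUc := (hU n).continuous
    have hDc : Continuous (fderiv ℝ (U n)) := (hU n).continuous_fderiv (by simp)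
    have h1 : ∫⁻ z in K, ‖U n (z + w) - U n z - fderiv ℝ (U n) z w‖ₑ ≤ (d n + ε + d n) * ‖w‖ₑ := by
      refine lintegral_smooth_taylor_le (hU n) K w fun s hs => ?_
      have m1 : AEMeasurable (fun z => ‖fderiv ℝ (U n) (z + s • w) - G (z + s • w)‖ₑ)
          (volume.restrict K) :=
        ((hDc.aestronglyMeasurable.sub hGm).comp_quasiMeasurePreserving (hqmp s hs)).enorm
      have m2 : AEMeasurable (fun z => ‖G (z + s • w) - G z‖ₑ) (volume.restrict K) :=
        ((hGm.comp_quasiMeasurePreserving (hqmp s hs)).sub (hGm.mono_measure hres)).enorm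
      calc ∫⁻ z in K, ‖fderiv ℝ (U n) (z + s • w) - fderiv ℝ (U n) z‖ₑ
          ≤ ∫⁻ z in K, (‖fderiv ℝ (U n) (z + s • w) - G (z + s • w)‖ₑ + ‖G (z + s • w) - G z‖ₑ
              + ‖fderiv ℝ (U n) z - G z‖ₑ) := by
            refine lintegral_mono fun z => ?_
            have : fderiv ℝ (U n) (z + s • w) - fderiv ℝ (U n) z =
              ((fderiv ℝ (U n) (z + s • w) - G (z + s • w)) + (G (z + s • w) - G z))
                + -(fderiv ℝ (U n) z - G z) := by abel
            rw [this]
            exact enorm_add_add_neg_le _ _ _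
        _ = (∫⁻ z in K, ‖fderiv ℝ (U n) (z + s • w) - G (z + s • w)‖ₑ)
            + (∫⁻ z in K, ‖G (z + s • w) - G z‖ₑ) + ∫⁻ z in K, ‖fderiv ℝ (U n) z - G z‖ₑ := by
            have m12 : AEMeasurable (fun z => ‖fderiv ℝ (U n) (z + s • w) - G (z + s • w)‖ₑ +
              ‖G (z + s • w) - G z‖ₑ) (volume.restrict K) := m1.add m2
            rw [lintegral_add_left' m12, lintegral_add_left' m1]
        _ ≤ d n + ε + d n := by
            gcongr
            · exact lintegral_translate_compact_le hK.measurableSet ((hshift hs).trans hw1)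
                (fun z => fderiv ℝ (U n) z - G z)
            · refine le_trans ?_ (hδ₂' (y := s • w) ?_)
              · refine le_trans (le_of_eq ?_) (setLIntegral_le_lintegral K _)
                refine setLIntegral_congr_fun hK.measurableSet fun z hz => ?_
                have : z + s • w ∈ S := mem_cthickening_of_dist_le (z + s • w) z δ₁ K hz (by
                  simpa using (hshift hs).trans hw1)
                simp only [indicator_of_mem (hKS hz), indicator_of_mem this]
              · rw [dist_zero_right]; exact (hshift hs).trans_lt hw2
            · exact lintegral_mono' hres le_rfl
    have hq1 := hqmp 1 (by simp)
    simp only [one_smul] at hq1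
    have m1 : AEMeasurable (fun z => ‖U n (z + w) - u (z + w)‖ₑ) (volume.restrict K) :=
      ((hUc.aestronglyMeasurable.sub hum).comp_quasiMeasurePreserving hq1).enorm
    have m2 : AEMeasurable (fun z => ‖U n z - u z‖ₑ) (volume.restrict K) :=
      (hUc.aestronglyMeasurable.sub (hum.mono_measure hres)).enorm
    have m3 : AEMeasurable (fun z => ‖fderiv ℝ (U n) z - G z‖ₑ * ‖w‖ₑ) (volume.restrict K) :=
      (hDc.aestronglyMeasurable.sub (hGm.mono_measure hres)).enorm.mul_const _
    calc ∫⁻ z in K, ‖u (z + w) - u z - G z w‖ₑ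
        ≤ ∫⁻ z in K, (‖U n (z + w) - u (z + w)‖ₑ + ‖U n z - u z‖ₑ
            + ‖fderiv ℝ (U n) z - G z‖ₑ * ‖w‖ₑ
            + ‖U n (z + w) - U n z - fderiv ℝ (U n) z w‖ₑ) := by
          refine lintegral_mono fun z => ?_
          have : u (z + w) - u z - G z w = -(U n (z + w) - u (z + w)) + (U n z - u z)
            + ((fderiv ℝ (U n) z - G z) w) + (U n (z + w) - U n z - fderiv ℝ (U n) z w) := by
            simp; abel
          rw [this]
          refine (enorm_add_le _ _).trans ?_
          gcongr
          refine (enorm_add_le _ _).trans ?_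
          gcongr
          · refine (enorm_add_le _ _).trans ?_
            rw [enorm_neg]
          · exact ContinuousLinearMap.le_opENorm _ _
      _ = (∫⁻ z in K, ‖U n (z + w) - u (z + w)‖ₑ) + (∫⁻ z in K, ‖U n z - u z‖ₑ)
            + (∫⁻ z in K, ‖fderiv ℝ (U n) z - G z‖ₑ) * ‖w‖ₑ
            + ∫⁻ z in K, ‖U n (z + w) - U n z - fderiv ℝ (U n) z w‖ₑ := by
          have m12 : AEMeasurable (fun z => ‖U n (z + w) - u (z + w)‖ₑ + ‖U n z - u z‖ₑ)
            (volume.restrict K) := m1.add m2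
          have m123 : AEMeasurable (fun z => ‖U n (z + w) - u (z + w)‖ₑ + ‖U n z - u z‖ₑ +
            ‖fderiv ℝ (U n) z - G z‖ₑ * ‖w‖ₑ) (volume.restrict K) := m12.add m3
          rw [lintegral_add_left' m123, lintegral_add_left' m12,
            lintegral_add_left' m1, lintegral_mul_const' _ _ (by simp)]
      _ ≤ _ := by
          gcongr
          · exact lintegral_translate_compact_le hK.measurableSet hw1 (fun z => U n z - u z)
          · exact lintegral_mono' hres le_rfl
          · exact lintegral_mono' hres le_rfl
  have hlim : Tendsto (fun n => c n + c n + d n * ‖w‖ₑ + (d n + ε + d n) * ‖w‖ₑ) atTop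
      (𝓝 (0 + 0 + 0 * ‖w‖ₑ + (0 + ε + 0) * ‖w‖ₑ)) := by
    refine ((hU0.add hU0).add (ENNReal.Tendsto.mul_const hU1 (by simp))).add
      (ENNReal.Tendsto.mul_const ((hU1.add tendsto_const_nhds).add hU1) (by simp))
  simp only [zero_add, add_zero, zero_mul] at hlim
  exact ge_of_tendsto' hlim key

/-- The smooth approximations are eventually constant on the ball by convexity, and a subsequence
converges to `u` almost everywhere, so almost all values of `u` are the same limit. -/
theorem ae_const_of_weakGradient_zero {Ω : Set (Euc m)} (hΩ : IsOpen Ω) {u : Euc m → Euc L}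
    (h : IsWeakGradient Ω u 0) {x : Euc m} {R : ℝ} (hR : 0 < R) (hx : closedBall x R ⊆ Ω) :
    ∃ c, ∀ᵐ z ∂(volume.restrict (closedBall x R)), u z = c := by
  obtain ⟨U, hU, hU0, -, hU2⟩ := exists_smooth_approx hΩ h (isCompact_closedBall x R) hx
  have hconst : ∀ᶠ n in atTop, ∀ z ∈ closedBall x R, U n z = U n x := by
    filter_upwards [hU2 fun z _ => rfl] with n hn z hz
    have := (convex_closedBall x R).norm_image_sub_le_of_norm_fderiv_le (𝕜 := ℝ) (f := U n) (C := 0)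
      (fun y _ => (hU n).differentiable (by simp) y) (fun y hy => by rw [hn y hy]; simp)
      (mem_closedBall_self hR.le) hz
    rw [zero_mul] at this
    exact sub_eq_zero.1 (norm_le_zero_iff.1 this)
  have hum : AEStronglyMeasurable u (volume.restrict (closedBall x R)) :=
    (h.1.integrableOn_compact_subset hx (isCompact_closedBall x R)).1
  have hm : TendstoInMeasure (volume.restrict (closedBall x R)) U atTop u := by
    refine tendstoInMeasure_of_tendsto_eLpNorm (p := 1) one_ne_zero
      (fun n => (hU n).continuous.aestronglyMeasurable) hum ?_
    simpa only [eLpNorm_one_eq_lintegral_enorm] using! hU0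
  obtain ⟨ns, hns, hae⟩ := hm.exists_seq_tendsto_ae
  have hae' : ∀ᵐ z ∂(volume.restrict (closedBall x R)),
      Tendsto (fun k => U (ns k) x) atTop (𝓝 (u z)) := by
    filter_upwards [hae, ae_restrict_mem isClosed_closedBall.measurableSet] with z hz hzb
    refine hz.congr' ?_
    filter_upwards [hns.tendsto_atTop.eventually hconst] with k hk using hk z hzb
  have : (ae (volume.restrict (closedBall x R))).NeBot := by
    rw [ae_restrict_neBot]
    exact (measure_closedBall_pos _ _ hR).ne'
  obtain ⟨z₀, hz₀⟩ := hae'.exists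
  exact ⟨u z₀, hae'.mono fun z hz => tendsto_nhds_unique hz hz₀⟩

end DifferenceQuotients


/-! ### Distributional derivatives dominated by an integrable function. -/

section Domination
open Filter Topology

variable {m L : ℕ}

/-- The space of smooth compactly supported functions. -/
def testFunctions (m : ℕ) : Submodule ℝ (Euc m → ℝ) where
  carrier := {φ | ContDiff ℝ ∞ φ ∧ HasCompactSupport φ}
  add_mem' := fun ha hb => ⟨ha.1.add hb.1, ha.2.add hb.2⟩
  zero_mem' := ⟨contDiff_const, HasCompactSupport.zero⟩
  smul_mem' := fun c _ ha => ⟨contDiff_const.smul ha.1, ha.2.smul_left (f := fun _ => c)⟩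

/-- The value of a mollification is the integral of `f` against a nonnegative test function, and a
subsequence of mollifications converges to `f` almost everywhere. -/
theorem ae_nonneg_of_forall_test {f : Euc m → ℝ} (hf : Integrable f)
    (h : ∀ φ ∈ testFunctions m, (∀ z, 0 ≤ φ z) → 0 ≤ ∫ z, φ z * f z) : ∀ᵐ z, 0 ≤ f z := by
  have hm : TendstoInMeasure volume (fun n => moll n f) atTop f := by
    refine tendstoInMeasure_of_tendsto_eLpNorm (p := 1) one_ne_zero
      (fun n => (moll_contDiff n hf.locallyIntegrable).continuous.aestronglyMeasurable) hf.1 ?_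
    simpa only [eLpNorm_one_eq_lintegral_enorm] using! tendsto_lintegral_moll_sub hf
  obtain ⟨ns, -, hae⟩ := hm.exists_seq_tendsto_ae
  filter_upwards [hae] with z hz
  refine ge_of_tendsto' hz fun k => ?_
  set ρ : Euc m → ℝ := (mollBump m (ns k)).normed volume with hρ
  have : moll (ns k) f z = ∫ t, ρ (z - t) * f t := by
    change convolution ρ f (ContinuousLinearMap.lsmul ℝ ℝ) volume z = _
    rw [convolution_def, ← integral_sub_left_eq_self _ volume z]
    simp
  rw [this]
  refine h _ ⟨(mollBump m (ns k)).contDiff_normed.comp (contDiff_const.sub contDiff_id), ?_⟩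
    fun t => (mollBump m (ns k)).nonneg_normed _
  exact (mollBump m (ns k)).hasCompactSupport_normed.comp_homeomorph (Homeomorph.subLeft z)

/-- The bound forces `ℓ` to vanish on the kernel of `J`, so `ℓ` descends to a bounded functional on
the range of `J`; Hahn–Banach extends it. -/
theorem exists_continuous_factor {V X : Type*} [AddCommGroup V] [Module ℝ V]
    [NormedAddCommGroup X] [NormedSpace ℝ X] (J : V →ₗ[ℝ] X) (ℓ : V →ₗ[ℝ] ℝ) (M : ℝ)
    (hJ : ∀ φ, |ℓ φ| ≤ M * ‖J φ‖) : ∃ f : StrongDual ℝ X, ∀ φ, f (J φ) = ℓ φ := by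
  obtain ⟨s, hs⟩ := J.rangeRestrict.exists_rightInverse_of_surjective
    (LinearMap.range_eq_top.2 J.surjective_rangeRestrict)
  have hsJ : ∀ y : LinearMap.range J, J (s y) = y := fun y =>
    congrArg Subtype.val (LinearMap.congr_fun hs y)
  let f₀ : StrongDual ℝ (LinearMap.range J) := (ℓ.comp s).mkContinuous M fun y => by
    rw [Real.norm_eq_abs]
    refine (hJ (s y)).trans (le_of_eq ?_)
    rw [hsJ]; rfl
  obtain ⟨f, hf, -⟩ := exists_extension_norm_eq (LinearMap.range J) f₀
  refine ⟨f, fun φ => ?_⟩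
  have h1 := hf ⟨J φ, LinearMap.mem_range_self J φ⟩
  have h2 : f₀ ⟨J φ, LinearMap.mem_range_self J φ⟩ = ℓ (s ⟨J φ, LinearMap.mem_range_self J φ⟩) :=
    rfl
  rw [h2] at h1
  change f (J φ) = _ at h1
  rw [h1]
  have h3 := hJ (s ⟨J φ, LinearMap.mem_range_self J φ⟩ - φ)
  rw [map_sub, map_sub, hsJ, sub_self, norm_zero, mul_zero] at h3
  exact sub_eq_zero.1 (abs_nonpos_iff.1 h3)

/-- Riesz representation in `L²(g dx)`. The measure `g dx` is finite, so domination by its `L¹` norm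
gives boundedness in `L²`, where the functional is represented by some `h₀`; the density is `g h₀`.
Testing `g ± g h₀` against nonnegative functions then recovers the pointwise bound. -/
theorem exists_density {g : Euc m → ℝ} (hg : Integrable g) (hg0 : ∀ z, 0 ≤ g z)
    (ℓ : testFunctions m →ₗ[ℝ] ℝ) (hℓ : ∀ φ : testFunctions m, |ℓ φ| ≤ ∫ z, |φ.1 z| * g z) :
    ∃ H : Euc m → ℝ, Integrable H ∧ (∀ᵐ z, |H z| ≤ g z) ∧
      ∀ φ : testFunctions m, ℓ φ = ∫ z, φ.1 z * H z := by
  set ν : Measure (Euc m) := volume.withDensity (fun z => ENNReal.ofReal (g z)) with hν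
  have : IsFiniteMeasure ν := isFiniteMeasure_withDensity_ofReal hg.2
  have hgm : AEMeasurable (fun z => ENNReal.ofReal (g z)) := hg.1.aemeasurable.ennreal_ofReal
  have hν_int : ∀ f : Euc m → ℝ, ∫ z, f z ∂ν = ∫ z, g z * f z := by
    intro f
    rw [hν, integral_withDensity_eq_integral_toReal_smul₀ hgm (by simp)]
    simp only [ENNReal.toReal_ofReal (hg0 _), smul_eq_mul]
  have hmem : ∀ (φ : testFunctions m), MemLp φ.1 2 ν := fun φ =>
    φ.2.1.continuous.memLp_of_hasCompactSupport φ.2.2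
  let J : testFunctions m →ₗ[ℝ] Lp ℝ 2 ν :=
    { toFun := fun φ => (hmem φ).toLp
      map_add' := fun φ χ => MemLp.toLp_add _ _
      map_smul' := fun c φ => MemLp.toLp_const_smul _ _ }
  set M : ℝ := (ν univ ^ (1 / 2 : ℝ)).toReal with hM
  have hJ : ∀ φ, |ℓ φ| ≤ M * ‖J φ‖ := by
    intro φ
    refine (hℓ φ).trans ?_
    have h1 : ∫ z, |φ.1 z| * g z = ∫ z, ‖φ.1 z‖ ∂ν := by
      rw [hν_int]; simp only [Real.norm_eq_abs, mul_comm]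
    have h2 : eLpNorm φ.1 1 ν ≤ eLpNorm φ.1 2 ν * ν univ ^ (1 / 2 : ℝ) := by
      refine (eLpNorm_le_eLpNorm_mul_rpow_measure_univ (p := 1) (q := 2) (by norm_num)
        (hmem φ).1).trans (le_of_eq ?_)
      norm_num
    have h3 : ∫ z, ‖φ.1 z‖ ∂ν = (eLpNorm φ.1 1 ν).toReal := by
      rw [eLpNorm_one_eq_lintegral_enorm, integral_norm_eq_lintegral_enorm (hmem φ).1]
    rw [h1, h3]
    have hfin : ν univ ^ (1 / 2 : ℝ) ≠ ⊤ := ENNReal.rpow_ne_top_of_nonneg (by norm_num)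
      (measure_ne_top _ _)
    calc _ ≤ (eLpNorm φ.1 2 ν * ν univ ^ (1 / 2 : ℝ)).toReal :=
          ENNReal.toReal_mono (ENNReal.mul_ne_top (hmem φ).2.ne hfin) h2
      _ = M * ‖J φ‖ := by
          rw [ENNReal.toReal_mul, mul_comm]
          congr 1
          exact (Lp.norm_toLp _ (hmem φ)).symm
  obtain ⟨f, hfJ⟩ := exists_continuous_factor J ℓ M hJ
  set h₀ : Lp ℝ 2 ν := (InnerProductSpace.toDual ℝ (Lp ℝ 2 ν)).symm f with hh₀
  have hrep : ∀ φ : testFunctions m, ℓ φ = ∫ z, φ.1 z * (g z * h₀ z) := by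
    intro φ
    rw [← hfJ φ, ← InnerProductSpace.toDual_symm_apply, L2.inner_def]
    have : ∫ z, inner ℝ (h₀ z) (J φ z) ∂ν = ∫ z, φ.1 z * h₀ z ∂ν := by
      refine integral_congr_ae ?_
      filter_upwards [(hmem φ).coeFn_toLp] with z hz
      have : J φ z = φ.1 z := hz
      rw [this]; simp
    rw [this, hν_int]
    refine integral_congr_ae (Eventually.of_forall fun z => ?_)
    simp only; ring
  have hHi : Integrable (fun z => g z * h₀ z) := by
    have h1 : Integrable (h₀ : Euc m → ℝ) ν := (Lp.memLp h₀).integrable (by norm_num)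
    have h2 := (integrable_withDensity_iff_integrable_smul₀' hgm (by simp)).1 h1
    simpa only [ENNReal.toReal_ofReal (hg0 _), smul_eq_mul] using h2
  refine ⟨_, hHi, ?_, hrep⟩
  have hi : ∀ {φ : Euc m → ℝ}, φ ∈ testFunctions m → ∀ {f : Euc m → ℝ}, Integrable f →
      Integrable (fun z => φ z * f z) := by
    intro φ hφ f hf
    obtain ⟨B, hB⟩ := hφ.2.exists_bound_of_continuous hφ.1.continuous
    exact hf.bdd_mul hφ.1.continuous.aestronglyMeasurable (Eventually.of_forall hB)
  have h1 : ∀ᵐ z, 0 ≤ g z - g z * h₀ z := by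
    refine ae_nonneg_of_forall_test (hg.sub hHi) fun φ hφ hφ0 => ?_
    simp_rw [mul_sub]
    rw [integral_sub (hi hφ hg) (hi hφ hHi), ← hrep ⟨φ, hφ⟩]
    have := (le_abs_self _).trans (hℓ ⟨φ, hφ⟩)
    simp only [abs_of_nonneg (hφ0 _)] at this
    linarith
  have h2 : ∀ᵐ z, 0 ≤ g z + g z * h₀ z := by
    refine ae_nonneg_of_forall_test (hg.add hHi) fun φ hφ hφ0 => ?_
    simp_rw [mul_add]
    rw [integral_add (hi hφ hg) (hi hφ hHi), ← hrep ⟨φ, hφ⟩]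
    have := (neg_le_abs _).trans (hℓ ⟨φ, hφ⟩)
    simp only [abs_of_nonneg (hφ0 _)] at this
    linarith
  filter_upwards [h1, h2] with z h1 h2
  rw [abs_le]
  constructor <;> linarith

/-- A directional derivative in the sense of distributions that is dominated by an integrable
function is a function with the same domination. -/
theorem exists_weak_partial_of_dominated {w : Euc m → Euc L} (hw : Integrable w) {g : Euc m → ℝ}
    (hg : Integrable g) (hg0 : ∀ z, 0 ≤ g z) (e : Euc m)
    (h : ∀ φ ∈ testFunctions m, ‖∫ z, fderiv ℝ φ z e • w z‖ ≤ ∫ z, |φ z| * g z) :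
    ∃ H : Euc m → Euc L, Integrable H ∧ (∀ᵐ z, ‖H z‖ ≤ L * g z) ∧
      ∀ φ ∈ testFunctions m, ∫ z, fderiv ℝ φ z e • w z = - ∫ z, φ z • H z := by
  have hfi : ∀ φ ∈ testFunctions m, Integrable (fun z => fderiv ℝ φ z e • w z) := by
    intro φ hφ
    have hc : Continuous fun z => fderiv ℝ φ z e :=
      (hφ.1.continuous_fderiv (by simp)).clm_apply continuous_const
    obtain ⟨B, hB⟩ := (hφ.2.fderiv_apply (𝕜 := ℝ) e).exists_bound_of_continuous hc
    exact hw.bdd_smul _ hc.aestronglyMeasurable (Eventually.of_forall hB)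
  have hcomp : ∀ φ ∈ testFunctions m, ∀ i, (∫ z, fderiv ℝ φ z e • w z) i =
      ∫ z, fderiv ℝ φ z e * w z i := by
    intro φ hφ i
    exact ((EuclideanSpace.proj i : Euc L →L[ℝ] ℝ).integral_comp_comm (hfi φ hφ)).symm
  have hfi' : ∀ φ ∈ testFunctions m, ∀ i, Integrable (fun z => fderiv ℝ φ z e * w z i) := by
    intro φ hφ i
    exact (EuclideanSpace.proj i : Euc L →L[ℝ] ℝ).integrable_comp (hfi φ hφ)
  have hi : ∀ i : Fin L, ∃ H : Euc m → ℝ, Integrable H ∧ (∀ᵐ z, |H z| ≤ g z) ∧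
      ∀ φ : testFunctions m, - ∫ z, fderiv ℝ φ.1 z e * w z i = ∫ z, φ.1 z * H z := by
    intro i
    let ℓ : testFunctions m →ₗ[ℝ] ℝ :=
      { toFun := fun φ => - ∫ z, fderiv ℝ φ.1 z e * w z i
        map_add' := by
          intro φ χ
          rw [← neg_add, ← integral_add (hfi' _ φ.2 i) (hfi' _ χ.2 i)]
          congr 1
          refine integral_congr_ae (Eventually.of_forall fun z => ?_)
          simp only [Submodule.coe_add]
          rw [fderiv_add ((φ.2.1.differentiable (by simp)) z) ((χ.2.1.differentiable (by simp)) z)]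
          simp [add_mul]
        map_smul' := by
          intro c φ
          simp only [RingHom.id_apply, smul_eq_mul, mul_neg]
          rw [← integral_const_mul]
          congr 1
          refine integral_congr_ae (Eventually.of_forall fun z => ?_)
          simp only [Submodule.coe_smul]
          rw [fderiv_const_smul ((φ.2.1.differentiable (by simp)) z)]
          simp [mul_assoc] }
    refine exists_density hg hg0 ℓ fun φ => ?_
    change |- ∫ z, fderiv ℝ φ.1 z e * w z i| ≤ _
    rw [abs_neg, ← hcomp φ.1 φ.2 i]
    exact (PiLp.norm_apply_le _ i).trans (h φ.1 φ.2)
  choose H hHi hHb hHe using hi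
  have hHc : ∀ i, Integrable (fun z => H i z • (EuclideanSpace.single i (1 : ℝ) : Euc L)) :=
    fun i => (hHi i).smul_const _
  have hHI : Integrable (fun z => ∑ i, H i z • (EuclideanSpace.single i (1 : ℝ) : Euc L)) :=
    integrable_finsetSum _ fun i _ => hHc i
  refine ⟨fun z => ∑ i, H i z • EuclideanSpace.single i (1 : ℝ), hHI, ?_, ?_⟩
  · filter_upwards [ae_all_iff.2 hHb] with z hz
    refine (norm_sum_le _ _).trans ?_
    calc ∑ i, ‖H i z • (EuclideanSpace.single i (1 : ℝ) : Euc L)‖ ≤ ∑ _i : Fin L, g z := by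
          refine Finset.sum_le_sum fun i _ => ?_
          rw [norm_smul, PiLp.norm_single]
          simpa using hz i
      _ = L * g z := by simp
  · intro φ hφ
    obtain ⟨B, hB⟩ := hφ.2.exists_bound_of_continuous hφ.1.continuous
    have hint : Integrable (fun z => φ z • ∑ i, H i z • (EuclideanSpace.single i (1 : ℝ) : Euc L)) :=
      hHI.bdd_smul _ hφ.1.continuous.aestronglyMeasurable (Eventually.of_forall hB)
    ext i
    rw [hcomp φ hφ i, PiLp.neg_apply]
    have := (EuclideanSpace.proj i : Euc L →L[ℝ] ℝ).integral_comp_comm hint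
    rw [show (∫ z, φ z • ∑ i, H i z • (EuclideanSpace.single i (1 : ℝ) : Euc L)) i = _ from this.symm,
      ← neg_neg (∫ z, fderiv ℝ φ z e * w z i), hHe i ⟨φ, hφ⟩]
    congr 1
    refine integral_congr_ae (Eventually.of_forall fun z => ?_)
    simp

end Domination


/-! ### Calculus of weak gradients: uniqueness, restriction, sums, `C¹` maps. -/

section WeakGradientBasics
open Filter Topology

variable {m L : ℕ} {Ω : Set (Euc m)} {u : Euc m → Euc L} {G : Euc m → Euc m →L[ℝ] Euc L}

theorem setIntegral_smul_of_tsupport {F : Type*} [NormedAddCommGroup F] [NormedSpace ℝ F]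
    {φ : Euc m → ℝ} (h : tsupport φ ⊆ Ω) (f : Euc m → F) :
    ∫ z in Ω, φ z • f z = ∫ z, φ z • f z :=
  setIntegral_eq_integral_of_forall_compl_eq_zero fun z hz => by
    rw [image_eq_zero_of_notMem_tsupport fun h' => hz (h h'), zero_smul]

theorem setIntegral_fderiv_smul_of_tsupport {F : Type*} [NormedAddCommGroup F] [NormedSpace ℝ F]
    {φ : Euc m → ℝ} (h : tsupport φ ⊆ Ω) (e : Euc m) (f : Euc m → F) :
    ∫ z in Ω, fderiv ℝ φ z e • f z = ∫ z, fderiv ℝ φ z e • f z :=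
  setIntegral_eq_integral_of_forall_compl_eq_zero fun z hz => by
    rw [image_eq_zero_of_notMem_tsupport fun h' => hz (h (tsupport_fderiv_subset ℝ h'))]
    simp

theorem integrable_smul_of_locallyIntegrableOn {F : Type*} [NormedAddCommGroup F]
    [NormedSpace ℝ F] {φ : Euc m → ℝ} (hφ : Continuous φ) (hc : HasCompactSupport φ)
    (hs : tsupport φ ⊆ Ω) {f : Euc m → F} (hf : LocallyIntegrableOn f Ω) :
    Integrable (fun z => φ z • f z) := by
  have h1 : Integrable ((tsupport φ).indicator f) := integrable_indicator_of_compact hf hc hs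
  obtain ⟨B, hB⟩ := hc.exists_bound_of_continuous hφ
  refine (h1.bdd_smul _ hφ.aestronglyMeasurable (Eventually.of_forall hB)).congr
    (Eventually.of_forall fun z => ?_)
  by_cases hz : z ∈ tsupport φ
  · simp only [Pi.smul_apply', indicator_of_mem hz]
  · simp only [Pi.smul_apply', indicator_of_notMem hz, image_eq_zero_of_notMem_tsupport hz, zero_smul, smul_zero]

theorem integrable_fderiv_smul_of_locallyIntegrableOn {F : Type*} [NormedAddCommGroup F]
    [NormedSpace ℝ F] {φ : Euc m → ℝ} (hφ : ContDiff ℝ ∞ φ) (hc : HasCompactSupport φ)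
    (hs : tsupport φ ⊆ Ω) {f : Euc m → F} (hf : LocallyIntegrableOn f Ω) (e : Euc m) :
    Integrable (fun z => fderiv ℝ φ z e • f z) :=
  integrable_smul_of_locallyIntegrableOn (φ := fun z => fderiv ℝ φ z e)
    ((hφ.continuous_fderiv (by simp)).clm_apply continuous_const) (hc.fderiv_apply (𝕜 := ℝ) e)
    ((tsupport_fderiv_apply_subset ℝ e).trans hs) hf

theorem integrable_smul_clm_apply {φ : Euc m → ℝ} (hφ : Continuous φ) (hc : HasCompactSupport φ)
    (hs : tsupport φ ⊆ Ω) (hG : LocallyIntegrableOn G Ω) (e : Euc m) :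
    Integrable (fun z => φ z • G z e) :=
  (ContinuousLinearMap.apply ℝ (Euc L) e).integrable_comp
    (integrable_smul_of_locallyIntegrableOn hφ hc hs hG)

theorem IsWeakGradient.ae_unique (hΩ : IsOpen Ω) {G' : Euc m → Euc m →L[ℝ] Euc L}
    (h : IsWeakGradient Ω u G) (h' : IsWeakGradient Ω u G') :
    ∀ᵐ z ∂(volume.restrict Ω), G z = G' z := by
  rw [ae_restrict_iff' hΩ.measurableSet]
  have := hΩ.ae_eq_zero_of_integral_contDiff_smul_eq_zero (μ := volume) (f := fun z => G z - G' z)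
    (h.2.1.sub h'.2.1) ?_
  · filter_upwards [this] with z hz hzΩ using sub_eq_zero.1 (hz hzΩ)
  intro φ hφ hc hs
  have hi := integrable_smul_of_locallyIntegrableOn hφ.continuous hc hs (h.2.1.sub h'.2.1)
  ext1 e
  have h1 := h.2.2 φ hφ hc hs e
  rw [h'.2.2 φ hφ hc hs e, neg_inj, setIntegral_smul_of_tsupport hs,
    setIntegral_smul_of_tsupport hs] at h1
  have h2 := (ContinuousLinearMap.apply ℝ (Euc L) e).integral_comp_comm hi
  change (ContinuousLinearMap.apply ℝ (Euc L) e) _ = _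
  refine h2.symm.trans ?_
  have h3 : ∀ z, (ContinuousLinearMap.apply ℝ (Euc L) e) (φ z • (G - G') z) =
      φ z • G z e - φ z • G' z e := fun z => by simp [smul_sub]
  simp_rw [h3]
  rw [integral_sub (integrable_smul_clm_apply hφ.continuous hc hs h.2.1 e)
    (integrable_smul_clm_apply hφ.continuous hc hs h'.2.1 e), h1, sub_self]
  rfl

theorem IsWeakGradient.weakGrad (h : IsWeakGradient Ω u G) :
    IsWeakGradient Ω u (weakGrad Ω u) := by
  have h' : ∃ G, IsWeakGradient Ω u G := ⟨G, h⟩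
  rw [_root_.weakGrad, dif_pos h']
  exact h'.choose_spec

theorem IsWeakGradient.weakGrad_ae_eq (hΩ : IsOpen Ω) (h : IsWeakGradient Ω u G) :
    ∀ᵐ z ∂(volume.restrict Ω), _root_.weakGrad Ω u z = G z :=
  h.weakGrad.ae_unique hΩ h

theorem IsWeakGradient.mono (h : IsWeakGradient Ω u G) {Ω' : Set (Euc m)} (hs : Ω' ⊆ Ω) :
    IsWeakGradient Ω' u G := by
  refine ⟨h.1.mono_set hs, h.2.1.mono_set hs, fun φ hφ hc ht e => ?_⟩
  have := h.2.2 φ hφ hc (ht.trans hs) e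
  rwa [setIntegral_smul_of_tsupport (ht.trans hs),
    setIntegral_fderiv_smul_of_tsupport (ht.trans hs), ← setIntegral_smul_of_tsupport ht,
    ← setIntegral_fderiv_smul_of_tsupport ht] at this

theorem LocallyIntegrableOn.congr_ae_restrict {F : Type*} [NormedAddCommGroup F]
    {f f' : Euc m → F} (hf : LocallyIntegrableOn f Ω)
    (h : ∀ᵐ z ∂(volume.restrict Ω), f z = f' z) : LocallyIntegrableOn f' Ω := by
  intro z hz
  obtain ⟨s, hs, hfs⟩ := hf z hz
  refine ⟨s ∩ Ω, inter_mem hs self_mem_nhdsWithin, ?_⟩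
  exact (hfs.mono_set inter_subset_left).congr
    (ae_mono (Measure.restrict_mono inter_subset_right le_rfl) h)

theorem IsWeakGradient.congr (h : IsWeakGradient Ω u G) {u' : Euc m → Euc L}
    {G' : Euc m → Euc m →L[ℝ] Euc L} (hu : ∀ᵐ z ∂(volume.restrict Ω), u z = u' z)
    (hG : ∀ᵐ z ∂(volume.restrict Ω), G z = G' z) : IsWeakGradient Ω u' G' := by
  refine ⟨LocallyIntegrableOn.congr_ae_restrict h.1 hu,
    LocallyIntegrableOn.congr_ae_restrict h.2.1 hG, fun φ hφ hc ht e => ?_⟩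
  have := h.2.2 φ hφ hc ht e
  rw [← integral_congr_ae (hu.mono fun z hz => by simp only [hz] :
    (fun z => fderiv ℝ φ z e • u z) =ᵐ[volume.restrict Ω] fun z => fderiv ℝ φ z e • u' z), this]
  congr 1
  exact integral_congr_ae (hG.mono fun z hz => by simp only [hz])

theorem locallyIntegrableOn_fun_add {F : Type*} [NormedAddCommGroup F] {f g : Euc m → F}
    (hf : LocallyIntegrableOn f Ω) (hg : LocallyIntegrableOn g Ω) :
    LocallyIntegrableOn (fun z => f z + g z) Ω :=
  hf.add hg

theorem IsWeakGradient.add (h : IsWeakGradient Ω u G) {w : Euc m → Euc L}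
    {H : Euc m → Euc m →L[ℝ] Euc L} (hw : IsWeakGradient Ω w H) :
    IsWeakGradient Ω (fun z => u z + w z) (fun z => G z + H z) := by
  refine ⟨LocallyIntegrableOn.add h.1 hw.1,
    locallyIntegrableOn_fun_add h.2.1 hw.2.1, fun φ hφ hc ht e => ?_⟩
  have e1 := h.2.2 φ hφ hc ht e
  have e2 := hw.2.2 φ hφ hc ht e
  simp only [setIntegral_smul_of_tsupport ht, setIntegral_fderiv_smul_of_tsupport ht] at e1 e2 ⊢
  simp only [smul_add, _root_.add_apply]
  rw [integral_add (integrable_fderiv_smul_of_locallyIntegrableOn hφ hc ht h.1 e)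
      (integrable_fderiv_smul_of_locallyIntegrableOn hφ hc ht hw.1 e),
    integral_add (integrable_smul_clm_apply hφ.continuous hc ht h.2.1 e)
      (integrable_smul_clm_apply hφ.continuous hc ht hw.2.1 e), e1, e2, neg_add]

/-- A `C¹` map is weakly differentiable and its weak gradient is its derivative. -/
theorem isWeakGradient_of_contDiff {U : Euc m → Euc L} (hU : ContDiff ℝ 1 U) :
    IsWeakGradient Ω U (fderiv ℝ U) := by
  have hc' : Continuous (fderiv ℝ U) := hU.continuous_fderiv (by simp)
  refine ⟨hU.continuous.locallyIntegrable.locallyIntegrableOn _,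
    hc'.locallyIntegrable.locallyIntegrableOn _, fun φ hφ hc ht e => ?_⟩
  rw [setIntegral_smul_of_tsupport ht, setIntegral_fderiv_smul_of_tsupport ht]
  have l1 : LocallyIntegrableOn U univ := hU.continuous.locallyIntegrable.locallyIntegrableOn _
  have l2 : LocallyIntegrableOn (fderiv ℝ U) univ := hc'.locallyIntegrable.locallyIntegrableOn _
  have := integral_smul_fderiv_eq_neg_fderiv_smul_of_integrable (μ := volume) (v := e)
    (integrable_fderiv_smul_of_locallyIntegrableOn hφ hc (subset_univ _) l1 e)
    (integrable_smul_clm_apply hφ.continuous hc (subset_univ _) l2 e)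
    (integrable_smul_of_locallyIntegrableOn hφ.continuous hc (subset_univ _) l1)
    (fun z _ => hφ.differentiable (by simp) z)
    (fun z _ => hU.differentiable (by simp) z)
  rw [this, neg_neg]

theorem isWeakGradient_const (c : Euc L) : IsWeakGradient Ω (fun _ => c) 0 := by
  have := isWeakGradient_of_contDiff (Ω := Ω) (contDiff_const (c := c) (𝕜 := ℝ) (E := Euc m) (n := 1))
  simpa using! this

end WeakGradientBasics


/-! ### Weak differentiability from a pointwise control of increments. -/

section Increment
open Filter Topology

variable {m L : ℕ} {Ω : Set (Euc m)} {u : Euc m → Euc L} {G : Euc m → Euc m →L[ℝ] Euc L}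

theorem integrable_sum_clm {E F : Type*} [NormedAddCommGroup E] [NormedSpace ℝ E]
    [NormedAddCommGroup F] [NormedSpace ℝ F] {ι : Type*} [Fintype ι] (A : ι → E →L[ℝ] F)
    {H : ι → Euc m → E} (hH : ∀ j, Integrable (H j)) : Integrable fun z => ∑ j, A j (H j z) :=
  integrable_finsetSum _ fun j _ => (A j).integrable_comp (hH j)

/-- Assembling a weak gradient from weak partial derivatives. -/
theorem isWeakGradient_of_partials {w : Euc m → Euc L} (hw : Integrable w)
    {H : Fin m → Euc m → Euc L} (hH : ∀ j, Integrable (H j))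
    (h : ∀ j, ∀ φ ∈ testFunctions m, ∫ z, fderiv ℝ φ z (EuclideanSpace.single j 1) • w z =
      - ∫ z, φ z • H j z) :
    IsWeakGradient univ w fun z => ∑ j, (EuclideanSpace.proj j : Euc m →L[ℝ] ℝ).smulRight (H j z) := by
  refine ⟨hw.locallyIntegrable.locallyIntegrableOn _,
    (integrable_sum_clm (fun j => ContinuousLinearMap.smulRightL ℝ (Euc m) (Euc L)
      (EuclideanSpace.proj j)) hH).locallyIntegrable.locallyIntegrableOn _,
    fun φ hφ hc _ e => ?_⟩
  rw [Measure.restrict_univ]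
  have he : e = ∑ j, e j • EuclideanSpace.single j (1 : ℝ) := by
    ext i; simp [Pi.single_apply]
  have hsm : ∀ j, Integrable fun z => fderiv ℝ φ z (EuclideanSpace.single j 1) • w z := fun j =>
    integrable_fderiv_smul_of_locallyIntegrableOn hφ hc (subset_univ _)
      (hw.locallyIntegrable.locallyIntegrableOn _) _
  have hsH : ∀ j, Integrable fun z => φ z • H j z := fun j =>
    integrable_smul_of_locallyIntegrableOn hφ.continuous hc (subset_univ _)
      ((hH j).locallyIntegrable.locallyIntegrableOn _)
  have e1 : ∀ z, fderiv ℝ φ z e • w z =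
      ∑ j, e j • (fderiv ℝ φ z (EuclideanSpace.single j 1) • w z) := by
    intro z
    conv_lhs => rw [he]
    rw [map_sum, Finset.sum_smul]
    simp [smul_smul]
  have e2 : ∀ z, φ z • (∑ j, (EuclideanSpace.proj j : Euc m →L[ℝ] ℝ).smulRight (H j z)) e =
      ∑ j, e j • (φ z • H j z) := by
    intro z
    rw [_root_.sum_apply, Finset.smul_sum]
    refine Finset.sum_congr rfl fun j _ => ?_
    simp [smul_smul, mul_comm]
  simp_rw [e1, e2]
  have hsm' : ∀ j, Integrable fun z =>
      e j • fderiv ℝ φ z (EuclideanSpace.single j 1) • w z := fun j => (hsm j).smul (e j)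
  have hsH' : ∀ j, Integrable fun z => e j • φ z • H j z := fun j => (hsH j).smul (e j)
  rw [integral_finsetSum _ fun j _ => hsm' j, integral_finsetSum _ fun j _ => hsH' j, ← Finset.sum_neg_distrib]
  refine Finset.sum_congr rfl fun j _ => ?_
  rw [integral_smul, integral_smul, h j φ ⟨hφ, hc⟩, smul_neg]

/-- Dominated convergence: a test function is Lipschitz, so its quotients are uniformly bounded.
This is the starting point for discrete integration by parts. -/
theorem tendsto_integral_test_quotient {w : Euc m → Euc L} (hw : Integrable w) {φ : Euc m → ℝ}
    (hφ : φ ∈ testFunctions m) (e : Euc m) {t : ℕ → ℝ} (ht : ∀ n, 0 < t n)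
    (ht0 : Tendsto t atTop (𝓝 0)) :
    Tendsto (fun n => ∫ z, ((t n)⁻¹ * (φ z - φ (z - t n • e))) • w z) atTop
      (𝓝 (∫ z, fderiv ℝ φ z e • w z)) := by
  obtain ⟨B, hB⟩ := (hφ.2.fderiv (𝕜 := ℝ)).exists_bound_of_continuous
    (hφ.1.continuous_fderiv (by simp))
  have hLip : ∀ x y, ‖φ x - φ y‖ ≤ B * ‖x - y‖ := fun x y =>
    convex_univ.norm_image_sub_le_of_norm_fderiv_le (𝕜 := ℝ)
      (fun z _ => hφ.1.differentiable (by simp) z) (fun z _ => hB z) (mem_univ y) (mem_univ x)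
  refine tendsto_integral_of_dominated_convergence (fun z => (B * ‖e‖) * ‖w z‖) ?_
    (hw.norm.const_mul _) ?_ ?_
  · intro n
    have h1 : Continuous φ := hφ.1.continuous
    have h2 : Continuous fun z => (t n)⁻¹ * (φ z - φ (z - t n • e)) := by fun_prop
    exact h2.aestronglyMeasurable.smul hw.1
  · intro n
    refine Eventually.of_forall fun z => ?_
    rw [norm_smul]
    gcongr
    rw [norm_mul, norm_inv, Real.norm_eq_abs (t n), abs_of_pos (ht n), inv_mul_le_iff₀ (ht n)]
    refine (hLip _ _).trans (le_of_eq ?_)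
    rw [sub_sub_cancel, norm_smul, Real.norm_eq_abs (t n), abs_of_pos (ht n)]
    ring
  · refine Eventually.of_forall fun z => ?_
    refine Tendsto.smul_const ?_ _
    have h1 : HasDerivAt (fun s : ℝ => φ (z - s • e)) (- fderiv ℝ φ z e) 0 := by
      have h2 : HasDerivAt (fun s : ℝ => z - s • e) (-e) 0 := by
        simpa using ((hasDerivAt_id (0 : ℝ)).smul_const e).const_sub z
      have h3 : HasFDerivAt φ (fderiv ℝ φ z) (z - (0 : ℝ) • e) := by
        rw [zero_smul, sub_zero]; exact (hφ.1.differentiable (by simp) z).hasFDerivAt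
      simpa using! h3.comp_hasDerivAt (0 : ℝ) h2
    have h4 := h1.tendsto_slope_zero
    have ht1 : Tendsto t atTop (𝓝[≠] 0) := tendsto_nhdsWithin_iff.2
      ⟨ht0, Eventually.of_forall fun n => (ht n).ne'⟩
    have h5 := (h4.comp ht1).neg
    rw [neg_neg] at h5
    refine h5.congr fun n => ?_
    simp only [Function.comp_apply, zero_add, zero_smul, sub_zero, smul_eq_mul]
    ring

/-- A compactly supported map whose increments are controlled by those of a weakly differentiable
map, with a variable factor `κ`, is weakly differentiable, with the corresponding control. -/
theorem exists_weakGradient_of_increment_le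
    {w : Euc m → Euc L} {K S : Set (Euc m)} (hS : IsCompact S)
    {δ : ℝ} (hδ : 0 < δ) (hKS : cthickening δ K ⊆ S) (hw0 : ∀ z, z ∉ K → w z = 0)
    (hwi : Integrable w) {κ : Euc m → ℝ} (hκ0 : ∀ z, 0 ≤ κ z)
    {b : ℝ} (hb : 0 ≤ b)
    (hκ : ∀ᵐ z ∂(volume.restrict S), ∀ z', ‖w z' - w z‖ ≤ κ z * (‖u z' - u z‖ + b * ‖z' - z‖))
    (hGi : IntegrableOn (fun z => κ z * (‖G z‖ + b)) S)
    (hlim : ∀ j : Fin m, ∃ t : ℕ → ℝ, (∀ n, 0 < t n) ∧ Tendsto t atTop (𝓝 0) ∧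
      Tendsto (fun n => ENNReal.ofReal (t n)⁻¹ * ∫⁻ z in S, ENNReal.ofReal (κ z) *
        ‖u (z + t n • EuclideanSpace.single j (1 : ℝ)) - u z -
          t n • G z (EuclideanSpace.single j (1 : ℝ))‖ₑ) atTop (𝓝 0)) :
    ∃ H, IsWeakGradient univ w H ∧
      ∀ᵐ z, ‖H z‖ ≤ m * L * S.indicator (fun z => κ z * (‖G z‖ + b)) z := by
  set g : Euc m → ℝ := S.indicator (fun z => κ z * (‖G z‖ + b)) with hg
  have hgi : Integrable g := (integrable_indicator_iff hS.measurableSet).2 hGi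
  have hg0 : ∀ z, 0 ≤ g z := fun z => indicator_nonneg (fun z _ => by
    have := hκ0 z; positivity) z
  have main : ∀ j : Fin m, ∃ H : Euc m → Euc L, Integrable H ∧ (∀ᵐ z, ‖H z‖ ≤ L * g z) ∧
      ∀ φ ∈ testFunctions m, ∫ z, fderiv ℝ φ z (EuclideanSpace.single j 1) • w z
        = - ∫ z, φ z • H z := by
    intro j
    refine exists_weak_partial_of_dominated hwi hgi hg0 _ fun φ hφ => ?_
    obtain ⟨t, ht, ht0, hlim⟩ := hlim j
    set e : Euc m := EuclideanSpace.single j (1 : ℝ) with he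
    have he1 : ‖e‖ = 1 := by simp [he]
    obtain ⟨B, hB⟩ := hφ.2.exists_bound_of_continuous hφ.1.continuous
    have hB0 : 0 ≤ B := (norm_nonneg _).trans (hB 0)
    have hgφ : Integrable (fun z => |φ z| * g z) :=
      hgi.bdd_mul hφ.1.continuous.abs.aestronglyMeasurable
        (Eventually.of_forall fun z => by simpa using hB z)
    set I := ∫ z, |φ z| * g z with hI
    set ρ := fun n => ENNReal.ofReal (t n)⁻¹ * ∫⁻ z in S, ENNReal.ofReal (κ z) *
        ‖u (z + t n • e) - u z - t n • G z e‖ₑ with hρ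
    -- The difference quotient of `φ` is moved to `w` by a translation. An increment of `w` is at
    -- most `κ` times the corresponding increment of `u` plus a term linear in `t n`; splitting off
    -- the linear part `t n • G z e` of the former leaves `I` as main term and the weighted Taylor
    -- remainder `ρ n`, which tends to zero by assumption.
    have hbound : ∀ᶠ n in atTop, ‖∫ z, ((t n)⁻¹ * (φ z - φ (z - t n • e))) • w z‖ₑ ≤
        ENNReal.ofReal I + ENNReal.ofReal B * ρ n := by
      filter_upwards [ht0.eventually (gt_mem_nhds hδ)] with n hn
      have htn := ht n
      have hi1 : Integrable (fun z => φ z • w z) :=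
        hwi.bdd_smul _ hφ.1.continuous.aestronglyMeasurable (Eventually.of_forall hB)
      have hi2 : Integrable (fun z => φ (z - t n • e) • w z) :=
        hwi.bdd_smul _ (hφ.1.continuous.comp (by fun_prop)).aestronglyMeasurable
          (Eventually.of_forall fun z => hB _)
      have hi3 : Integrable (fun z => φ z • w (z + t n • e)) :=
        (hwi.comp_add_right _).bdd_smul _ hφ.1.continuous.aestronglyMeasurable
          (Eventually.of_forall hB)
      have e1 : ∫ z, ((t n)⁻¹ * (φ z - φ (z - t n • e))) • w z =
          (t n)⁻¹ • ∫ z, φ z • (w z - w (z + t n • e)) := by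
        simp_rw [mul_smul, sub_smul, smul_sub]
        have hi1' : Integrable (fun z => (t n)⁻¹ • φ z • w z) := hi1.smul (t n)⁻¹
        have hi2' : Integrable (fun z => (t n)⁻¹ • φ (z - t n • e) • w z) := hi2.smul (t n)⁻¹
        rw [integral_sub hi1' hi2', integral_smul, integral_smul,
          integral_sub hi1 hi3, smul_sub]
        congr 2
        rw [← integral_add_right_eq_self _ (t n • e)]
        simp
      have hw1 : ∀ z, z ∉ S → w z - w (z + t n • e) = 0 := by
        intro z hz
        have h1 : z ∉ K := fun h => hz (hKS (self_subset_cthickening K h))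
        have h2 : z + t n • e ∉ K := fun h => hz (hKS (mem_cthickening_of_dist_le z _ δ K h (by
          rw [dist_comm, dist_eq_norm, add_sub_cancel_left, norm_smul, he1, Real.norm_eq_abs,
            abs_of_pos htn, mul_one]
          exact hn.le)))
        rw [hw0 _ h1, hw0 _ h2, sub_zero]
      have e2 : ∫ z, φ z • (w z - w (z + t n • e)) = ∫ z in S, φ z • (w z - w (z + t n • e)) :=
        (setIntegral_eq_integral_of_forall_compl_eq_zero fun z hz => by
          rw [hw1 z hz, smul_zero]).symm
      rw [e1, e2, enorm_smul]
      have e3 : ‖(t n)⁻¹‖ₑ = ENNReal.ofReal (t n)⁻¹ := by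
        rw [Real.enorm_eq_ofReal (by positivity)]
      rw [e3]
      have pt : ∀ᵐ z ∂(volume.restrict S), ‖φ z • (w z - w (z + t n • e))‖ₑ ≤
          ENNReal.ofReal (t n) * ENNReal.ofReal (|φ z| * (κ z * (‖G z‖ + b))) +
          ENNReal.ofReal B * (ENNReal.ofReal (κ z) * ‖u (z + t n • e) - u z - t n • G z e‖ₑ) := by
        filter_upwards [hκ] with z hκz
        have hk := hκ0 z
        rw [← ofReal_norm, ← ofReal_norm (u (z + t n • e) - u z - t n • G z e),
          ← ENNReal.ofReal_mul htn.le,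
          ← ENNReal.ofReal_mul hk, ← ENNReal.ofReal_mul hB0, ← ENNReal.ofReal_add
            (by positivity) (by positivity)]
        refine ENNReal.ofReal_le_ofReal ?_
        rw [norm_smul, norm_sub_rev]
        set R := u (z + t n • e) - u z - t n • G z e with hR
        have h1 := hκz (z + t n • e)
        rw [add_sub_cancel_left, norm_smul, he1, mul_one, Real.norm_eq_abs, abs_of_pos htn] at h1
        have h2 : ‖u (z + t n • e) - u z‖ ≤ ‖R‖ + t n * ‖G z‖ := by
          have : u (z + t n • e) - u z = R + t n • G z e := by rw [hR]; abel
          rw [this]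
          refine (norm_add_le _ _).trans ?_
          gcongr
          rw [norm_smul, Real.norm_eq_abs, abs_of_pos htn]
          gcongr
          exact (ContinuousLinearMap.le_opNorm _ _).trans (by rw [he1, mul_one])
        have h3 : ‖w (z + t n • e) - w z‖ ≤ κ z * (‖R‖ + t n * ‖G z‖ + b * t n) :=
          h1.trans (by gcongr)
        have hBz : |φ z| ≤ B := by simpa using hB z
        calc ‖φ z‖ * ‖w (z + t n • e) - w z‖
            ≤ |φ z| * (κ z * (‖R‖ + t n * ‖G z‖ + b * t n)) := by
              rw [Real.norm_eq_abs]; gcongr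
          _ = t n * (|φ z| * (κ z * (‖G z‖ + b))) + |φ z| * (κ z * ‖R‖) := by ring
          _ ≤ _ := by gcongr
      have hm1 : AEMeasurable (fun z => ENNReal.ofReal (t n) *
          ENNReal.ofReal (|φ z| * (κ z * (‖G z‖ + b)))) (volume.restrict S) :=
        ((hφ.1.continuous.abs.measurable.aemeasurable.mul
          hGi.1.aemeasurable).ennreal_ofReal).const_mul _
      have hm2 : ∫⁻ z in S, ENNReal.ofReal (|φ z| * (κ z * (‖G z‖ + b))) = ENNReal.ofReal I := by
        rw [hI, ofReal_integral_eq_lintegral_ofReal hgφ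
          (Eventually.of_forall fun z => mul_nonneg (abs_nonneg _) (hg0 z)),
          ← lintegral_indicator hS.measurableSet]
        refine lintegral_congr fun z => ?_
        by_cases hz : z ∈ S
        · rw [indicator_of_mem hz, hg, indicator_of_mem hz]
        · rw [indicator_of_notMem hz, hg, indicator_of_notMem hz]; simp
      calc ENNReal.ofReal (t n)⁻¹ * ‖∫ z in S, φ z • (w z - w (z + t n • e))‖ₑ
          ≤ ENNReal.ofReal (t n)⁻¹ * ∫⁻ z in S, (ENNReal.ofReal (t n) *
              ENNReal.ofReal (|φ z| * (κ z * (‖G z‖ + b))) +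
            ENNReal.ofReal B *
              (ENNReal.ofReal (κ z) * ‖u (z + t n • e) - u z - t n • G z e‖ₑ)) := by
            gcongr
            exact (enorm_integral_le_lintegral_enorm _).trans (lintegral_mono_ae pt)
        _ = ENNReal.ofReal (t n)⁻¹ * (ENNReal.ofReal (t n) * ENNReal.ofReal I) +
            ENNReal.ofReal B * ρ n := by
            rw [lintegral_add_left' hm1, lintegral_const_mul' _ _ ENNReal.ofReal_ne_top, hm2,
              lintegral_const_mul' _ _ ENNReal.ofReal_ne_top, mul_add, hρ]
            ring
        _ = _ := by
            rw [← mul_assoc, ← ENNReal.ofReal_mul (by positivity), inv_mul_cancel₀ htn.ne',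
              ENNReal.ofReal_one, one_mul]
    have h1 := (tendsto_integral_test_quotient hwi hφ e ht ht0).enorm
    have h2 : Tendsto (fun n => ENNReal.ofReal I + ENNReal.ofReal B * ρ n) atTop
        (𝓝 (ENNReal.ofReal I + ENNReal.ofReal B * 0)) :=
      tendsto_const_nhds.add (ENNReal.Tendsto.const_mul hlim (Or.inr ENNReal.ofReal_ne_top))
    rw [mul_zero, add_zero] at h2
    have h3 := le_of_tendsto_of_tendsto h1 h2 hbound
    rw [← ofReal_norm] at h3
    exact (ENNReal.ofReal_le_ofReal_iff
      (integral_nonneg fun z => mul_nonneg (abs_nonneg _) (hg0 z))).1 h3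
  choose H hHi hHb hHe using main
  refine ⟨_, isWeakGradient_of_partials hwi hHi hHe, ?_⟩
  filter_upwards [ae_all_iff.2 hHb] with z hz
  refine (norm_sum_le _ _).trans ?_
  calc ∑ j, ‖(EuclideanSpace.proj j : Euc m →L[ℝ] ℝ).smulRight (H j z)‖
      ≤ ∑ _j : Fin m, L * g z := by
        refine Finset.sum_le_sum fun j _ => ?_
        refine le_trans ?_ (hz j)
        refine ContinuousLinearMap.opNorm_le_bound _ (norm_nonneg _) fun y => ?_
        rw [ContinuousLinearMap.smulRight_apply, norm_smul, mul_comm]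
        gcongr
        exact PiLp.norm_apply_le _ j
    _ = m * L * g z := by simp; ring

end Increment


/-! ### Weak gradients under `C¹` diffeomorphisms. -/

section ChangeOfVariables
open Filter Topology

variable {m L : ℕ} {Ω : Set (Euc m)} {u : Euc m → Euc L} {G : Euc m → Euc m →L[ℝ] Euc L}

theorem tendsto_integral_smul_of_L1 {F : Type*} [NormedAddCommGroup F] [NormedSpace ℝ F]
    {K : Set (Euc m)} {a : Euc m → ℝ} {B : ℝ} (hB : ∀ z, ‖a z‖ ≤ B)
    (haK : ∀ z, z ∉ K → a z = 0) {f : Euc m → F} {U : ℕ → Euc m → F}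
    (hK : MeasurableSet K)
    (hf : Integrable fun z => a z • f z) (hU : ∀ n, Integrable fun z => a z • U n z)
    (h : Tendsto (fun n => ∫⁻ z in K, ‖U n z - f z‖ₑ) atTop (𝓝 0)) :
    Tendsto (fun n => ∫ z, a z • U n z) atTop (𝓝 (∫ z, a z • f z)) := by
  refine tendsto_integral_of_L1 _ hf.1 (Eventually.of_forall hU) ?_
  have hB0 : 0 ≤ B := (norm_nonneg _).trans (hB 0)
  have h2 : Tendsto (fun n => ENNReal.ofReal B * ∫⁻ z in K, ‖U n z - f z‖ₑ) atTop (𝓝 0) := by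
    have := ENNReal.Tendsto.const_mul h (Or.inr ENNReal.ofReal_ne_top) (a := ENNReal.ofReal B)
    rwa [mul_zero] at this
  refine tendsto_of_tendsto_of_tendsto_of_le_of_le tendsto_const_nhds h2 (fun _ => zero_le)
    fun n => ?_
  rw [← lintegral_const_mul' _ _ ENNReal.ofReal_ne_top, ← lintegral_indicator hK]
  refine lintegral_mono fun z => ?_
  by_cases hz : z ∈ K
  · rw [indicator_of_mem hz, ← smul_sub, enorm_smul]
    gcongr
    rw [← ofReal_norm]
    exact ENNReal.ofReal_le_ofReal (hB z)
  · simp [haK z hz]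

/-- Weak gradients are stable under local `L¹` convergence. -/
theorem isWeakGradient_of_approx (hu : LocallyIntegrableOn u Ω) (hG : LocallyIntegrableOn G Ω)
    (h : ∀ K, IsCompact K → K ⊆ Ω → ∃ (U : ℕ → Euc m → Euc L) (D : ℕ → Euc m → Euc m →L[ℝ] Euc L),
      (∀ n, IsWeakGradient Ω (U n) (D n)) ∧
      Tendsto (fun n => ∫⁻ z in K, ‖U n z - u z‖ₑ) atTop (𝓝 0) ∧
      Tendsto (fun n => ∫⁻ z in K, ‖D n z - G z‖ₑ) atTop (𝓝 0)) : IsWeakGradient Ω u G := by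
  refine ⟨hu, hG, fun φ hφ hc ht e => ?_⟩
  obtain ⟨U, D, hUD, h1, h2⟩ := h _ hc ht
  rw [setIntegral_smul_of_tsupport ht, setIntegral_fderiv_smul_of_tsupport ht]
  have hc' : Continuous fun z => fderiv ℝ φ z e :=
    (hφ.continuous_fderiv (by simp)).clm_apply continuous_const
  obtain ⟨B, hB⟩ := hc.exists_bound_of_continuous hφ.continuous
  obtain ⟨B', hB'⟩ := (hc.fderiv_apply (𝕜 := ℝ) e).exists_bound_of_continuous hc'
  have hc0 : ∀ z, z ∉ tsupport φ → fderiv ℝ φ z e = 0 := fun z hz =>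
    image_eq_zero_of_notMem_tsupport (f := fun z => fderiv ℝ φ z e)
      fun h => hz (tsupport_fderiv_apply_subset ℝ e h)
  have l1 := tendsto_integral_smul_of_L1 hB' hc0 (isClosed_tsupport φ).measurableSet
    (integrable_fderiv_smul_of_locallyIntegrableOn hφ hc ht hu e)
    (fun n => integrable_fderiv_smul_of_locallyIntegrableOn hφ hc ht (hUD n).1 e) h1
  have h2' : Tendsto (fun n => ∫⁻ z in tsupport φ, ‖D n z e - G z e‖ₑ) atTop (𝓝 0) := by
    have h3 : Tendsto (fun n => (∫⁻ z in tsupport φ, ‖D n z - G z‖ₑ) * ‖e‖ₑ) atTop (𝓝 0) := by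
      have := ENNReal.Tendsto.mul_const h2 (Or.inr (by simp : ‖e‖ₑ ≠ ⊤))
      rwa [zero_mul] at this
    refine tendsto_of_tendsto_of_tendsto_of_le_of_le tendsto_const_nhds h3 (fun _ => zero_le)
      fun n => ?_
    rw [← lintegral_mul_const' _ _ (by simp)]
    exact lintegral_mono fun z => ContinuousLinearMap.le_opENorm (D n z - G z) e
  have l2 := tendsto_integral_smul_of_L1 hB (fun z hz =>
      image_eq_zero_of_notMem_tsupport hz) (K := tsupport φ) (isClosed_tsupport φ).measurableSet
    (integrable_smul_clm_apply hφ.continuous hc ht hG e)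
    (fun n => integrable_smul_clm_apply hφ.continuous hc ht (hUD n).2.1 e) h2'
  refine tendsto_nhds_unique l1 (l2.neg.congr fun n => ?_)
  have := (hUD n).2.2 φ hφ hc ht e
  rw [setIntegral_smul_of_tsupport ht, setIntegral_fderiv_smul_of_tsupport ht] at this
  rw [this]

/-- A `C¹` diffeomorphism of `ℝᵐ`. -/
structure IsC1Diffeo (Ψ : Euc m ≃ₜ Euc m) : Prop where
  contDiff : ContDiff ℝ 1 Ψ
  contDiff_symm : ContDiff ℝ 1 Ψ.symm

namespace IsC1Diffeo

variable {Ψ : Euc m ≃ₜ Euc m}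

theorem symm (h : IsC1Diffeo Ψ) : IsC1Diffeo Ψ.symm := ⟨h.contDiff_symm, h.contDiff⟩

theorem quasiMeasurePreserving (h : IsC1Diffeo Ψ) :
    Measure.QuasiMeasurePreserving Ψ (volume : Measure (Euc m)) volume := by
  refine ⟨Ψ.continuous.measurable, Measure.AbsolutelyContinuous.mk fun A hA hA0 => ?_⟩
  rw [Measure.map_apply Ψ.continuous.measurable hA, ← Ψ.image_symm]
  exact addHaar_image_eq_zero_of_differentiableOn_of_addHaar_eq_zero _
    (h.contDiff_symm.differentiable (by simp)).differentiableOn hA0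

theorem setLIntegral_comp (h : IsC1Diffeo Ψ) {K : Set (Euc m)} (hK : MeasurableSet K)
    (g : Euc m → ENNReal) :
    ∫⁻ z in K, g (Ψ z) = ∫⁻ y in Ψ '' K, ENNReal.ofReal |(fderiv ℝ Ψ.symm y).det| * g y := by
  have h1 := lintegral_image_eq_lintegral_abs_det_fderiv_mul volume
    (s := Ψ '' K) (Ψ.measurableEmbedding.measurableSet_image.2 hK)
    (fun y _ => ((h.contDiff_symm.differentiable (by simp)) y).hasFDerivAt.hasFDerivWithinAt)
    Ψ.symm.injective.injOn (fun z => g (Ψ z))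
  simpa [image_image] using h1

theorem exists_setLIntegral_comp_le (h : IsC1Diffeo Ψ) {K : Set (Euc m)} (hK : IsCompact K) :
    ∃ C : ℝ, ∀ g : Euc m → ENNReal,
      ∫⁻ z in K, g (Ψ z) ≤ ENNReal.ofReal C * ∫⁻ y in Ψ '' K, g y := by
  have hc : Continuous fun y => |(fderiv ℝ Ψ.symm y).det| :=
    (ContinuousLinearMap.continuous_det.comp (h.contDiff_symm.continuous_fderiv (by simp))).abs
  obtain ⟨C, hC⟩ := ((hK.image Ψ.continuous).image hc).bddAbove
  refine ⟨C, fun g => ?_⟩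
  rw [h.setLIntegral_comp hK.measurableSet, ← lintegral_const_mul' _ _ ENNReal.ofReal_ne_top]
  refine setLIntegral_mono' (hK.image Ψ.continuous).measurableSet fun y hy => ?_
  gcongr
  exact hC (mem_image_of_mem _ hy)

theorem integrableOn_comp (h : IsC1Diffeo Ψ) {F : Type*} [NormedAddCommGroup F] {f : Euc m → F}
    {K : Set (Euc m)} (hK : IsCompact K) (hf : IntegrableOn f (Ψ '' K)) :
    IntegrableOn (fun z => f (Ψ z)) K := by
  have hm : MeasurableSet (Ψ '' K) := (hK.image Ψ.continuous).measurableSet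
  have h1 : AEStronglyMeasurable (fun z => f (Ψ z)) (volume.restrict K) := by
    have h2 : AEStronglyMeasurable ((Ψ '' K).indicator f) volume :=
      (aestronglyMeasurable_indicator_iff hm).2 hf.1
    have h3 := (h2.comp_quasiMeasurePreserving h.quasiMeasurePreserving).mono_measure
      (Measure.restrict_le_self (s := K))
    refine h3.congr ?_
    filter_upwards [ae_restrict_mem hK.measurableSet] with z hz
    simp only [Function.comp_apply]
    rw [indicator_of_mem (mem_image_of_mem _ hz)]
  refine ⟨h1, ?_⟩
  obtain ⟨C, hC⟩ := h.exists_setLIntegral_comp_le hK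
  refine (hC fun y => ‖f y‖ₑ).trans_lt ?_
  exact ENNReal.mul_lt_top ENNReal.ofReal_lt_top hf.2

theorem locallyIntegrableOn_comp (h : IsC1Diffeo Ψ) (hΩ : IsOpen Ω)
    (hΨ : ∀ z, Ψ z ∈ Ω ↔ z ∈ Ω) {F : Type*} [NormedAddCommGroup F] {f : Euc m → F}
    (hf : LocallyIntegrableOn f Ω) : LocallyIntegrableOn (fun z => f (Ψ z)) Ω := by
  rw [locallyIntegrableOn_iff hΩ.isLocallyClosed] at hf ⊢
  intro K hKΩ hK
  refine h.integrableOn_comp hK (hf _ ?_ (hK.image Ψ.continuous))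
  rintro _ ⟨z, hz, rfl⟩
  exact (hΨ z).2 (hKΩ hz)

end IsC1Diffeo

theorem locallyIntegrableOn_clm_comp (hΩ : IsOpen Ω) (hG : LocallyIntegrableOn G Ω)
    {D : Euc m → Euc m →L[ℝ] Euc m} (hD : Continuous D) :
    LocallyIntegrableOn (fun z => (G z).comp (D z)) Ω := by
  rw [locallyIntegrableOn_iff hΩ.isLocallyClosed] at hG ⊢
  intro K hKΩ hK
  have hGK := hG K hKΩ hK
  obtain ⟨B, hB⟩ := (hK.image hD.norm).bddAbove
  have hc : Continuous fun q : (Euc m →L[ℝ] Euc L) × (Euc m →L[ℝ] Euc m) => q.1.comp q.2 :=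
    continuous_fst.clm_comp continuous_snd
  refine Integrable.mono' (hGK.norm.const_mul B)
    (hc.comp_aestronglyMeasurable₂ hGK.1 hD.aestronglyMeasurable) ?_
  filter_upwards [ae_restrict_mem hK.measurableSet] with z hz
  refine (ContinuousLinearMap.opNorm_comp_le _ _).trans ?_
  rw [mul_comm]
  gcongr
  exact hB (mem_image_of_mem _ hz)

/-- The chain rule for smooth approximations passes to the limit: on a compact set the change of
variables multiplies `L¹` norms by a bounded factor, and the derivative of `Ψ` is bounded there. -/
theorem IsWeakGradient.comp_diffeo (hΩ : IsOpen Ω) (h : IsWeakGradient Ω u G)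
    {Ψ : Euc m ≃ₜ Euc m} (hΨ : IsC1Diffeo Ψ) (hΨΩ : ∀ z, Ψ z ∈ Ω ↔ z ∈ Ω) :
    IsWeakGradient Ω (fun z => u (Ψ z)) (fun z => (G (Ψ z)).comp (fderiv ℝ Ψ z)) := by
  have hDc : Continuous (fderiv ℝ Ψ) := hΨ.contDiff.continuous_fderiv (by simp)
  have hGl := hΨ.locallyIntegrableOn_comp hΩ hΨΩ h.2.1
  refine isWeakGradient_of_approx (hΨ.locallyIntegrableOn_comp hΩ hΨΩ h.1)
    (locallyIntegrableOn_clm_comp hΩ hGl hDc) fun K hK hKΩ => ?_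
  have hK' : IsCompact (Ψ '' K) := hK.image Ψ.continuous
  have hKΩ' : Ψ '' K ⊆ Ω := by
    rintro _ ⟨z, hz, rfl⟩
    exact (hΨΩ z).2 (hKΩ hz)
  obtain ⟨U, hU, hU0, hU1, -⟩ := exists_smooth_approx hΩ h hK' hKΩ'
  obtain ⟨C, hC⟩ := hΨ.exists_setLIntegral_comp_le hK
  obtain ⟨B, hB⟩ := (hK.image hDc.norm).bddAbove
  have hfd : ∀ n z, fderiv ℝ (fun z => U n (Ψ z)) z =
      (fderiv ℝ (U n) (Ψ z)).comp (fderiv ℝ Ψ z) := fun n z =>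
    fderiv_comp z ((hU n).differentiable (by simp) _) (hΨ.contDiff.differentiable (by simp) z)
  refine ⟨fun n z => U n (Ψ z), fun n => fderiv ℝ fun z => U n (Ψ z),
    fun n => isWeakGradient_of_contDiff (((hU n).of_le (by simp)).comp hΨ.contDiff), ?_, ?_⟩
  · have h2 := ENNReal.Tendsto.const_mul hU0 (Or.inr ENNReal.ofReal_ne_top) (a := ENNReal.ofReal C)
    rw [mul_zero] at h2
    exact tendsto_of_tendsto_of_tendsto_of_le_of_le tendsto_const_nhds h2 (fun _ => zero_le)
      fun n => hC fun y => ‖U n y - u y‖ₑ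
  · have h2 := ENNReal.Tendsto.const_mul (ENNReal.Tendsto.const_mul hU1
      (Or.inr ENNReal.ofReal_ne_top) (a := ENNReal.ofReal C))
      (Or.inr ENNReal.ofReal_ne_top) (a := ENNReal.ofReal B)
    rw [mul_zero, mul_zero] at h2
    refine tendsto_of_tendsto_of_tendsto_of_le_of_le tendsto_const_nhds h2 (fun _ => zero_le)
      fun n => ?_
    refine le_trans ?_ (mul_le_mul_right (hC fun y => ‖fderiv ℝ (U n) y - G y‖ₑ) _)
    rw [← lintegral_const_mul' _ _ ENNReal.ofReal_ne_top]
    refine setLIntegral_mono' hK.measurableSet fun z hz => ?_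
    change ‖fderiv ℝ (fun z => U n (Ψ z)) z - _‖ₑ ≤ _
    rw [hfd, ← ofReal_norm, ← ofReal_norm,
      ← ENNReal.ofReal_mul ((norm_nonneg _).trans (hB (mem_image_of_mem _ hz)))]
    refine ENNReal.ofReal_le_ofReal ?_
    have : (fderiv ℝ (U n) (Ψ z)).comp (fderiv ℝ Ψ z) - (G (Ψ z)).comp (fderiv ℝ Ψ z) =
      (fderiv ℝ (U n) (Ψ z) - G (Ψ z)).comp (fderiv ℝ Ψ z) := by ext1; simp
    rw [this]
    refine (ContinuousLinearMap.opNorm_comp_le _ _).trans ?_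
    rw [mul_comm]
    gcongr
    exact hB (mem_image_of_mem _ hz)

end ChangeOfVariables


/-! ### The Hilbert–Schmidt norm and the energy density of an inner variation. -/

section HilbertSchmidt
open Filter Topology

variable {m L : ℕ}

/-- The Hilbert-Schmidt norm. -/
noncomputable def hsNorm (A : Euc m →L[ℝ] Euc L) : ℝ :=
  Real.sqrt (∑ i, ‖A (EuclideanSpace.single i (1 : ℝ))‖ ^ 2)

theorem gradNorm_eq_hsNorm (Ω : Set (Euc m)) (u : Euc m → Euc L) (z : Euc m) :
    gradNorm Ω u z = hsNorm (weakGrad Ω u z) := gradNorm_eq Ω u z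

theorem hsNorm_nonneg (A : Euc m →L[ℝ] Euc L) : 0 ≤ hsNorm A := Real.sqrt_nonneg _

theorem continuous_hsNorm : Continuous (hsNorm : (Euc m →L[ℝ] Euc L) → ℝ) := by
  unfold hsNorm; fun_prop

theorem hsNorm_sq (A : Euc m →L[ℝ] Euc L) :
    hsNorm A ^ 2 = ∑ i, ‖A (EuclideanSpace.single i (1 : ℝ))‖ ^ 2 :=
  Real.sq_sqrt (Finset.sum_nonneg fun _ _ => sq_nonneg _)

theorem hsNorm_eq_norm (A : Euc m →L[ℝ] Euc L) :
    hsNorm A = ‖(WithLp.toLp 2 fun i => A (EuclideanSpace.single i (1 : ℝ)) :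
      PiLp 2 fun _ : Fin m => Euc L)‖ := by
  rw [PiLp.norm_eq_of_L2]; rfl

theorem abs_hsNorm_sub_le (A B : Euc m →L[ℝ] Euc L) : |hsNorm A - hsNorm B| ≤ hsNorm (A - B) := by
  rw [hsNorm_eq_norm, hsNorm_eq_norm, hsNorm_eq_norm]
  exact abs_norm_sub_norm_le _ _

theorem norm_apply_le_hsNorm (A : Euc m →L[ℝ] Euc L) (y : Euc m) : ‖A y‖ ≤ hsNorm A * ‖y‖ := by
  have he : y = ∑ j, y j • EuclideanSpace.single j (1 : ℝ) := by
    ext i; simp [Pi.single_apply]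
  have h1 : ‖A y‖ ≤ ∑ j, |y j| * ‖A (EuclideanSpace.single j (1 : ℝ))‖ := by
    conv_lhs => rw [he]
    rw [map_sum]
    refine (norm_sum_le _ _).trans (le_of_eq ?_)
    refine Finset.sum_congr rfl fun j _ => ?_
    rw [map_smul, norm_smul, Real.norm_eq_abs]
  refine h1.trans ?_
  refine (Real.sum_mul_le_sqrt_mul_sqrt _ _ _).trans (le_of_eq ?_)
  rw [mul_comm, EuclideanSpace.norm_eq]
  simp only [Real.norm_eq_abs]
  rfl

theorem opNorm_le_hsNorm (A : Euc m →L[ℝ] Euc L) : ‖A‖ ≤ hsNorm A :=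
  ContinuousLinearMap.opNorm_le_bound _ (hsNorm_nonneg A) (norm_apply_le_hsNorm A)

theorem hsNorm_le_opNorm (A : Euc m →L[ℝ] Euc L) : hsNorm A ≤ Real.sqrt m * ‖A‖ := by
  rw [hsNorm]
  refine Real.sqrt_le_iff.2 ⟨by positivity, ?_⟩
  rw [mul_pow, Real.sq_sqrt (Nat.cast_nonneg m)]
  calc ∑ i, ‖A (EuclideanSpace.single i (1 : ℝ))‖ ^ 2 ≤ ∑ _i : Fin m, ‖A‖ ^ 2 := by
        refine Finset.sum_le_sum fun i _ => ?_
        gcongr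
        exact (A.le_opNorm _).trans (by simp)
    _ = m * ‖A‖ ^ 2 := by simp

theorem abs_rpow_sub_rpow_le {p R x y : ℝ} (hp : 1 ≤ p) (hx : 0 ≤ x) (hxR : x ≤ R) (hy : 0 ≤ y)
    (hyR : y ≤ R) : |x ^ p - y ^ p| ≤ p * R ^ (p - 1) * |x - y| := by
  have := (convex_Icc (0 : ℝ) R).norm_image_sub_le_of_norm_hasDerivWithin_le
    (f := fun t => t ^ p) (f' := fun t => p * t ^ (p - 1)) (C := p * R ^ (p - 1))
    (fun t ht => (Real.hasDerivAt_rpow_const (Or.inr hp)).hasDerivWithinAt)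
    (fun t ht => by
      rw [Real.norm_eq_abs, abs_of_nonneg (mul_nonneg (by linarith) (Real.rpow_nonneg ht.1 _))]
      exact mul_le_mul_of_nonneg_left (Real.rpow_le_rpow ht.1 ht.2 (by linarith)) (by linarith)) ⟨hy, hyR⟩ ⟨hx, hxR⟩
  simpa [Real.norm_eq_abs] using this

theorem one_add_zero_smul (M : Euc m →L[ℝ] Euc m) : (1 + (0 : ℝ) • M : Euc m →L[ℝ] Euc m) = 1 :=
  (congrArg (1 + ·) (zero_smul ℝ M)).trans (add_zero _)

theorem hasDerivAt_det_one_add_smul (M : Euc m →L[ℝ] Euc m) :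
    HasDerivAt (fun t : ℝ => (1 + t • M : Euc m →L[ℝ] Euc m).det)
      (LinearMap.trace ℝ (Euc m) M.toLinearMap) 0 := by
  set b := (EuclideanSpace.basisFun (Fin m) ℝ).toBasis
  set A := LinearMap.toMatrix b b M.toLinearMap with hA
  have h1 : ∀ t : ℝ, (1 + t • M : Euc m →L[ℝ] Euc m).det = (1 + t • A).det := by
    intro t
    rw [ContinuousLinearMap.det, ← LinearMap.det_toMatrix b]
    congr 1
    have : ((1 + t • M : Euc m →L[ℝ] Euc m) : Euc m →ₗ[ℝ] Euc m) =
      LinearMap.id + t • M.toLinearMap := rfl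
    rw [this, map_add, map_smul, LinearMap.toMatrix_id]
  have h1' : ∀ t : ℝ, (1 + t • M : Euc m →L[ℝ] Euc m).det = 1 + Matrix.trace A * t +
      (Matrix.det (1 + (Polynomial.X : Polynomial ℝ) • A.map Polynomial.C)).divX.divX.eval t *
        t ^ 2 := fun t => (h1 t).trans (Matrix.det_one_add_smul t A)
  simp_rw [h1']
  rw [LinearMap.trace_eq_matrix_trace ℝ b]
  set q := (Matrix.det (1 + (Polynomial.X : Polynomial ℝ) • A.map Polynomial.C)).divX.divX
  have h2 : HasDerivAt (fun t : ℝ => Polynomial.eval t q * t ^ 2) 0 0 := by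
    have := (q.hasDerivAt 0).mul (hasDerivAt_pow 2 (0 : ℝ))
    simpa using! this
  have h3 : HasDerivAt (fun t : ℝ => 1 + Matrix.trace A * t) (Matrix.trace A) 0 := by
    simpa using ((hasDerivAt_id (0 : ℝ)).const_mul (Matrix.trace A)).const_add 1
  simpa using! h3.add h2

theorem hasDerivAt_inverse_one_add_smul (M : Euc m →L[ℝ] Euc m) :
    HasDerivAt (fun t : ℝ => Ring.inverse (1 + t • M : Euc m →L[ℝ] Euc m)) (-M) 0 := by
  have h1 : HasDerivAt (fun t : ℝ => (1 + t • M : Euc m →L[ℝ] Euc m)) M 0 := by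
    simpa using ((hasDerivAt_id (0 : ℝ)).smul_const M).const_add (1 : Euc m →L[ℝ] Euc m)
  have h2 := hasFDerivAt_ringInverse (𝕜 := ℝ) (1 : (Euc m →L[ℝ] Euc m)ˣ)
  have h3 : (1 + (0 : ℝ) • M : Euc m →L[ℝ] Euc m) = ((1 : (Euc m →L[ℝ] Euc m)ˣ) : _) := 
    one_add_zero_smul M
  rw [← h3] at h2
  simpa using! h2.comp_hasDerivAt (0 : ℝ) h1

/-- The integrand of the energy of an inner variation. -/
noncomputable def variationDensity (p : ℝ) (A : Euc m →L[ℝ] Euc L) (M : Euc m →L[ℝ] Euc m)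
    (t : ℝ) : ℝ :=
  |(1 + t • M : Euc m →L[ℝ] Euc m).det| * hsNorm (A.comp (Ring.inverse (1 + t • M))) ^ p

/-- The derivative of `variationDensity p A M` at `t = 0`. The trace comes from the determinant, the
inner products from the derivative `-M` of the inverse of `1 + t • M`. -/
noncomputable def variationDeriv (p : ℝ) (A : Euc m →L[ℝ] Euc L) (M : Euc m →L[ℝ] Euc m) : ℝ :=
  LinearMap.trace ℝ (Euc m) M.toLinearMap * hsNorm A ^ p -
    p * hsNorm A ^ (p - 2) * ∑ i, inner ℝ (A (EuclideanSpace.single i (1 : ℝ)))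
      (A (M (EuclideanSpace.single i (1 : ℝ))))

theorem variationDensity_zero (p : ℝ) (A : Euc m →L[ℝ] Euc L) (M : Euc m →L[ℝ] Euc m) :
    variationDensity p A M 0 = hsNorm A ^ p := by
  have : A.comp (1 : Euc m →L[ℝ] Euc m) = A := rfl
  have h2 : (1 : Euc m →L[ℝ] Euc m).det = 1 := LinearMap.det_id
  rw [variationDensity, one_add_zero_smul, h2, Ring.inverse_one, this, abs_one, one_mul]

theorem hasDerivAt_variationDensity {p : ℝ} (hp : 1 < p) (A : Euc m →L[ℝ] Euc L)
    (M : Euc m →L[ℝ] Euc m) :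
    HasDerivAt (variationDensity p A M) (variationDeriv p A M) 0 := by
  have e0 : (1 + (0 : ℝ) • M : Euc m →L[ℝ] Euc m) = 1 := one_add_zero_smul M
  have hdet1 : (1 : Euc m →L[ℝ] Euc m).det = 1 := LinearMap.det_id
  have hd : HasDerivAt (fun t : ℝ => |(1 + t • M : Euc m →L[ℝ] Euc m).det|)
      (LinearMap.trace ℝ (Euc m) M.toLinearMap) 0 := by
    have h1 := hasDerivAt_det_one_add_smul M
    have h2 : HasDerivAt (fun x : ℝ => |x|) 1 ((1 + (0 : ℝ) • M : Euc m →L[ℝ] Euc m).det) := by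
      rw [e0, hdet1]; simpa using hasDerivAt_abs (one_ne_zero (α := ℝ))
    simpa using! h2.comp (0 : ℝ) h1
  have hq : HasDerivAt (fun t : ℝ => hsNorm (A.comp (Ring.inverse (1 + t • M))) ^ p)
      (- (p * hsNorm A ^ (p - 2) * ∑ i, inner ℝ (A (EuclideanSpace.single i (1 : ℝ)))
      (A (M (EuclideanSpace.single i (1 : ℝ)))))) 0 := by
    -- The `p`-th power of the norm is treated as the power `p/2` of a sum of squares. For `p < 2`
    -- this power is not differentiable at zero, but for `A = 0` the function is identically zero;
    -- otherwise the sum is positive.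
    by_cases hA : A = 0
    · subst hA
      have h0 : hsNorm (0 : Euc m →L[ℝ] Euc L) = 0 := by simp [hsNorm]
      have hpp : (0 : ℝ) ^ p = 0 := Real.zero_rpow (by linarith)
      simp only [ContinuousLinearMap.zero_comp, h0, hpp]
      simpa using hasDerivAt_const (0 : ℝ) (0 : ℝ)
    have hpos : 0 < hsNorm A := (norm_pos_iff.2 hA).trans_le (opNorm_le_hsNorm A)
    have hi : ∀ i : Fin m, HasDerivAt (fun t : ℝ =>
        ‖A (Ring.inverse (1 + t • M) (EuclideanSpace.single i (1 : ℝ)))‖ ^ 2)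
        (2 * inner ℝ (A (EuclideanSpace.single i (1 : ℝ)))
          (- A (M (EuclideanSpace.single i (1 : ℝ))))) 0 := by
      intro i
      have h1 := (hasDerivAt_inverse_one_add_smul M).clm_apply
        (hasDerivAt_const (0 : ℝ) (EuclideanSpace.single i (1 : ℝ) : Euc m))
      have h2 := A.hasFDerivAt.comp_hasDerivAt (0 : ℝ) h1
      have h3 := h2.norm_sq
      refine h3.congr_deriv ?_
      dsimp only [Function.comp_apply]
      rw [e0, Ring.inverse_one]
      simp
    have hs := HasDerivAt.fun_sum (fun i (_ : i ∈ Finset.univ) => hi i)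
    have hval : ∑ i : Fin m, ‖A (Ring.inverse (1 + (0 : ℝ) • M) (EuclideanSpace.single i (1 : ℝ)))‖ ^ 2
        = hsNorm A ^ 2 := by
      rw [hsNorm_sq, e0]; simp
    have hr := hs.rpow_const (p := p / 2) (Or.inl (by rw [hval]; positivity))
    have heq : ∀ t : ℝ, hsNorm (A.comp (Ring.inverse (1 + t • M))) ^ p =
        (∑ i : Fin m, ‖A (Ring.inverse (1 + t • M) (EuclideanSpace.single i (1 : ℝ)))‖ ^ 2) ^ (p / 2) := by
      intro t
      have := hsNorm_sq (A.comp (Ring.inverse (1 + t • M)))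
      simp only [ContinuousLinearMap.comp_apply] at this
      rw [← this, ← Real.rpow_natCast, ← Real.rpow_mul (hsNorm_nonneg _)]
      congr 1; push_cast; ring
    simp_rw [heq]
    refine hr.congr_deriv ?_
    rw [hval, ← Real.rpow_natCast, ← Real.rpow_mul (hsNorm_nonneg _)]
    have : ((2 : ℕ) : ℝ) * (p / 2 - 1) = p - 2 := by push_cast; ring
    rw [this, ← Finset.mul_sum]
    simp only [inner_neg_right, Finset.sum_neg_distrib]
    ring
  have := hd.mul hq
  have e1 : A.comp (1 : Euc m →L[ℝ] Euc m) = A := rfl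
  simp only [e0, hdet1, Ring.inverse_one, e1, abs_one, one_mul] at this
  refine this.congr_deriv ?_
  rw [variationDeriv]; ring

/-- Inversion and determinant are `C¹` near the identity, hence Lipschitz there, and both send the
identity to an identity. -/
theorem exists_near_one_bounds (m : ℕ) : ∃ r > 0, ∃ K ≥ 0, ∀ M : Euc m →L[ℝ] Euc m, ‖M‖ ≤ r →
    IsUnit (1 + M) ∧ ‖Ring.inverse (1 + M) - 1‖ ≤ K * ‖M‖ ∧ |(1 + M).det - 1| ≤ K * ‖M‖ := by
  have h1 := (contDiffAt_ringInverse ℝ (n := 1) (1 : (Euc m →L[ℝ] Euc m)ˣ)).exists_lipschitzOnWith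
  have hdet : ContDiff ℝ 1 (fun A : Euc m →L[ℝ] Euc m => A.det) := by
    set b := (EuclideanSpace.basisFun (Fin m) ℝ).toBasis
    have : ∀ A : Euc m →L[ℝ] Euc m, A.det = ∑ σ : Equiv.Perm (Fin m),
        ((Equiv.Perm.sign σ : ℤ) : ℝ) * ∏ i, (A (b i)) (σ i) := by
      intro A
      rw [ContinuousLinearMap.det, ← LinearMap.det_toMatrix b, Matrix.det_apply']
      simp only [LinearMap.toMatrix_apply]
      rfl
    simp_rw [this]
    fun_prop
  obtain ⟨K₁, s₁, hs₁, hK₁⟩ := h1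
  obtain ⟨K₂, s₂, hs₂, hK₂⟩ := (hdet.contDiffAt (x := 1)).exists_lipschitzOnWith
  obtain ⟨r₁, hr₁, hr₁'⟩ := Metric.mem_nhds_iff.1 hs₁
  obtain ⟨r₂, hr₂, hr₂'⟩ := Metric.mem_nhds_iff.1 hs₂
  obtain ⟨r₃, hr₃, hr₃'⟩ := Metric.mem_nhds_iff.1 (Units.nhds (1 : (Euc m →L[ℝ] Euc m)ˣ))
  refine ⟨min r₁ (min r₂ r₃) / 2, by positivity, max K₁ K₂, by positivity, fun M hM => ?_⟩
  have hlt : ‖M‖ < min r₁ (min r₂ r₃) :=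
    hM.trans_lt (half_lt_self (by positivity))
  have hdist : dist (1 + M) 1 = ‖M‖ := by rw [dist_eq_norm, add_sub_cancel_left]
  refine ⟨hr₃' ?_, ?_, ?_⟩
  · rw [Units.val_one, mem_ball, hdist]
    exact hlt.trans_le ((min_le_right _ _).trans (min_le_right _ _))
  · have := hK₁.dist_le_mul (1 + M) (hr₁' (by
      rw [Units.val_one, mem_ball, hdist]; exact hlt.trans_le (min_le_left _ _)))
      1 (hr₁' (by rw [Units.val_one]; exact mem_ball_self hr₁))
    rw [hdist, dist_eq_norm, Ring.inverse_one] at this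
    exact this.trans (by gcongr; exact le_max_left _ _)
  · have := hK₂.dist_le_mul (1 + M) (hr₂' (by
      rw [mem_ball, hdist]
      exact hlt.trans_le ((min_le_right _ _).trans (min_le_left _ _))))
      1 (hr₂' (mem_ball_self hr₂))
    have h1 : (1 : Euc m →L[ℝ] Euc m).det = 1 := LinearMap.det_id
    rw [hdist, dist_eq_norm, h1, Real.norm_eq_abs] at this
    exact this.trans (by gcongr; exact le_max_right _ _)

/-- The constant does not depend on `A`, so `C |∇u|^p` dominates the difference quotients of the
energy and allows differentiation under the integral. The condition `t₀ * B ≤ 1 / 2` is the one that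
makes `id + tX` a diffeomorphism. -/
theorem exists_variationDensity_bound (m : ℕ) {p : ℝ} (hp : 1 < p) {B : ℝ} (hB : 0 ≤ B) :
    ∃ t₀ > 0, ∃ C ≥ 0, t₀ * B ≤ 1 / 2 ∧
      (∀ M : Euc m →L[ℝ] Euc m, ‖M‖ ≤ B → ∀ t : ℝ, |t| ≤ t₀ →
        IsUnit (1 + t • M) ∧ ‖Ring.inverse (1 + t • M)‖ ≤ C ∧ |(1 + t • M).det| ≤ C) ∧
      ∀ (L : ℕ) (A : Euc m →L[ℝ] Euc L) (M : Euc m →L[ℝ] Euc m), ‖M‖ ≤ B → ∀ t : ℝ, |t| ≤ t₀ →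
        |variationDensity p A M t - hsNorm A ^ p| ≤ C * hsNorm A ^ p * |t| := by
  obtain ⟨r, hr, K, hK, hb⟩ := exists_near_one_bounds m
  set c := Real.sqrt m * (K * B) with hc
  have hc0 : 0 ≤ c := by positivity
  set t₀ := min 1 (min (r / (B + 1)) (1 / (2 * (B + 1)))) with ht₀
  have ht₀0 : 0 < t₀ := by positivity
  have hsmall : ∀ M : Euc m →L[ℝ] Euc m, ‖M‖ ≤ B → ∀ t : ℝ, |t| ≤ t₀ →
      ‖t • M‖ ≤ r ∧ ‖t • M‖ ≤ |t| * B ∧ |t| ≤ 1 := by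
    intro M hM t ht
    have h1 : ‖t • M‖ ≤ |t| * B := by rw [norm_smul, Real.norm_eq_abs]; gcongr
    refine ⟨h1.trans ?_, h1, ht.trans (min_le_left _ _)⟩
    calc |t| * B ≤ (r / (B + 1)) * (B + 1) := by
          gcongr
          · exact ht.trans ((min_le_right _ _).trans (min_le_left _ _))
          · linarith
      _ = r := by field_simp
  set C := 1 + K * B + (K * B * (1 + c) ^ p + p * (1 + c) ^ (p - 1) * c) +
    ‖(1 : Euc m →L[ℝ] Euc m)‖ with hC
  have hC1 : 1 + K * B ≤ C := by
    have : 0 ≤ ‖(1 : Euc m →L[ℝ] Euc m)‖ := norm_nonneg _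
    have h2 : 0 ≤ K * B * (1 + c) ^ p + p * (1 + c) ^ (p - 1) * c := by positivity
    rw [hC]; linarith
  have hC2 : ‖(1 : Euc m →L[ℝ] Euc m)‖ + K * B ≤ C := by
    have h2 : 0 ≤ K * B * (1 + c) ^ p + p * (1 + c) ^ (p - 1) * c := by positivity
    rw [hC]; linarith
  have hC3 : K * B * (1 + c) ^ p + p * (1 + c) ^ (p - 1) * c ≤ C := by
    have : 0 ≤ ‖(1 : Euc m →L[ℝ] Euc m)‖ := norm_nonneg _
    have h2 : 0 ≤ K * B := by positivity
    rw [hC]; linarith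
  refine ⟨t₀, ht₀0, C, by positivity, ?_, ?_, ?_⟩
  · calc t₀ * B ≤ (1 / (2 * (B + 1))) * (B + 1) := by
          gcongr
          · exact (min_le_right _ _).trans (min_le_right _ _)
          · linarith
      _ = 1 / 2 := by field_simp
  · intro M hM t ht
    obtain ⟨h1, h2, h3⟩ := hsmall M hM t ht
    obtain ⟨hu, hi, hd⟩ := hb _ h1
    have h4 : K * ‖t • M‖ ≤ K * B := by
      gcongr
      exact h2.trans (mul_le_of_le_one_left hB h3)
    refine ⟨hu, ?_, ?_⟩
    · have := norm_le_norm_add_norm_sub' (Ring.inverse (1 + t • M)) (1 : Euc m →L[ℝ] Euc m)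
      linarith
    · have := abs_sub_abs_le_abs_sub (1 + t • M).det 1
      rw [abs_one] at this
      linarith
  · intro L A M hM t ht
    obtain ⟨h1, h2, h3⟩ := hsmall M hM t ht
    obtain ⟨hu, hi, hd⟩ := hb _ h1
    set N := Ring.inverse (1 + t • M) with hN
    set b := hsNorm A with hbdef
    have hb0 : 0 ≤ b := hsNorm_nonneg A
    set a := hsNorm (A.comp N) with ha
    have ha0 : 0 ≤ a := hsNorm_nonneg _
    have hKt : K * ‖t • M‖ ≤ K * B * |t| := by
      calc K * ‖t • M‖ ≤ K * (|t| * B) := by gcongr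
        _ = _ := by ring
    have hab : |a - b| ≤ c * b * |t| := by
      refine (abs_hsNorm_sub_le _ _).trans ((hsNorm_le_opNorm _).trans ?_)
      have e : A.comp N - A = A.comp (N - 1) := by ext1; simp
      rw [e]
      calc Real.sqrt m * ‖A.comp (N - 1)‖ ≤ Real.sqrt m * (‖A‖ * ‖N - 1‖) := by
            gcongr; exact ContinuousLinearMap.opNorm_comp_le _ _
        _ ≤ Real.sqrt m * (b * (K * B * |t|)) := by
            gcongr
            · exact opNorm_le_hsNorm A
            · exact hi.trans hKt
        _ = c * b * |t| := by rw [hc]; ring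
    have hale : a ≤ (1 + c) * b := by
      have := (abs_le.1 hab).2
      have : c * b * |t| ≤ c * b := mul_le_of_le_one_right (by positivity) h3
      linarith
    have hble : b ≤ (1 + c) * b := by nlinarith
    have hpow := abs_rpow_sub_rpow_le hp.le ha0 hale hb0 hble
    have hap : a ^ p ≤ (1 + c) ^ p * b ^ p := by
      rw [← Real.mul_rpow (by positivity) hb0]
      exact Real.rpow_le_rpow ha0 hale (by linarith)
    have hbp : b ^ (p - 1) * b = b ^ p := by
      rcases hb0.eq_or_lt with h | h
      · rw [← h, mul_zero, Real.zero_rpow (by linarith)]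
      · rw [← Real.rpow_add_one h.ne']; congr 1; ring
    set d := (1 + t • M : Euc m →L[ℝ] Euc m).det with hdd
    have hd1 : |(|d| - 1)| ≤ K * B * |t| := by
      have := abs_abs_sub_abs_le_abs_sub d 1
      rw [abs_one] at this
      exact this.trans (hd.trans hKt)
    calc |variationDensity p A M t - b ^ p| = |(|d| - 1) * a ^ p + (a ^ p - b ^ p)| := by
          rw [variationDensity]; congr 1; ring
      _ ≤ |(|d| - 1)| * a ^ p + |a ^ p - b ^ p| := by
          refine (abs_add_le _ _).trans ?_
          rw [abs_mul, abs_of_nonneg (Real.rpow_nonneg ha0 p)]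
      _ ≤ K * B * |t| * ((1 + c) ^ p * b ^ p) +
          p * ((1 + c) * b) ^ (p - 1) * (c * b * |t|) := by
          gcongr
          exact hpow.trans (by gcongr)
      _ = (K * B * (1 + c) ^ p + p * (1 + c) ^ (p - 1) * c) * b ^ p * |t| := by
          rw [Real.mul_rpow (by positivity) hb0, ← hbp]; ring
      _ ≤ C * b ^ p * |t| := by gcongr

end HilbertSchmidt


/-! ### Inner variations and the vanishing of the first variation. -/

section FirstVariation
open Filter Topology

variable {m L : ℕ}

/-- The perturbation `t • X` is Lipschitz with constant at most `1 / 2`, so its sum with the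
identity is a homeomorphism of the whole space. Invertibility of the derivative makes the inverse
`C¹`. -/
theorem exists_diffeo_id_add {X : Euc m → Euc m} (hX : ContDiff ℝ 1 X) {B : ℝ}
    (hB : ∀ z, ‖fderiv ℝ X z‖ ≤ B) {t : ℝ} (ht : |t| * B ≤ 1 / 2)
    (hu : ∀ z, IsUnit (1 + t • fderiv ℝ X z)) :
    ∃ Φ : Euc m ≃ₜ Euc m, (∀ z, Φ z = z + t • X z) ∧ IsC1Diffeo Φ ∧
      (∀ z, HasFDerivAt Φ (1 + t • fderiv ℝ X z) z) ∧
      ∀ z, fderiv ℝ Φ.symm (Φ z) = Ring.inverse (1 + t • fderiv ℝ X z) := by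
  set f : Euc m → Euc m := fun z => z + t • X z with hf
  have hLip : ∀ x y, ‖X x - X y‖ ≤ B * ‖x - y‖ := fun x y =>
    convex_univ.norm_image_sub_le_of_norm_fderiv_le (𝕜 := ℝ)
      (fun z _ => hX.differentiable (by simp) z) (fun z _ => hB z) (mem_univ y) (mem_univ x)
  have happ : ApproximatesLinearOn f
      ((ContinuousLinearEquiv.refl ℝ (Euc m) : Euc m ≃L[ℝ] Euc m) : Euc m →L[ℝ] Euc m) univ
      (1 / 2 : NNReal) := by
    intro x _ y _
    have : f x - f y - ((ContinuousLinearEquiv.refl ℝ (Euc m) : Euc m ≃L[ℝ] Euc m) :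
        Euc m →L[ℝ] Euc m) (x - y) = t • (X x - X y) := by
      simp only [hf, ContinuousLinearEquiv.coe_refl, ContinuousLinearMap.coe_id', id_eq, smul_sub]
      abel
    rw [this, norm_smul, Real.norm_eq_abs]
    calc |t| * ‖X x - X y‖ ≤ |t| * (B * ‖x - y‖) := by gcongr; exact hLip x y
      _ = |t| * B * ‖x - y‖ := by ring
      _ ≤ 1 / 2 * ‖x - y‖ := by gcongr
      _ = _ := by simp
  have hc : Subsingleton (Euc m) ∨ (1 / 2 : NNReal) <
      ‖(((ContinuousLinearEquiv.refl ℝ (Euc m)).symm : Euc m ≃L[ℝ] Euc m) :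
        Euc m →L[ℝ] Euc m)‖₊⁻¹ := by
    rcases subsingleton_or_nontrivial (Euc m) with h | h
    · exact Or.inl h
    · right
      rw [ContinuousLinearEquiv.refl_symm, ContinuousLinearEquiv.coe_refl,
        ContinuousLinearMap.nnnorm_id, inv_one]
      exact NNReal.half_lt_self one_ne_zero
  set Φ : Euc m ≃ₜ Euc m := happ.toHomeomorph f hc with hΦ
  have hΦf : ∀ z, Φ z = z + t • X z := fun z => rfl
  have hderiv : ∀ z, HasFDerivAt Φ (1 + t • fderiv ℝ X z) z := fun z =>
    (hasFDerivAt_id z).add (((hX.differentiable (by simp)) z).hasFDerivAt.const_smul t)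
  have hΦc : ContDiff ℝ 1 Φ := contDiff_id.add (hX.const_smul t)
  have hΦs : ContDiff ℝ 1 Φ.symm := by
    refine Φ.contDiff_symm (f₀' := fun z => ContinuousLinearEquiv.unitsEquiv ℝ (Euc m) (hu z).unit)
      (fun z => ?_) hΦc
    exact hderiv z
  refine ⟨Φ, hΦf, ⟨hΦc, hΦs⟩, hderiv, fun z => ?_⟩
  have h1 := ((hΦs.differentiable (by simp)) (Φ z)).hasFDerivAt.comp z (hderiv z)
  have h2 : (Φ.symm ∘ Φ) = id := by ext1 y; simp
  rw [h2] at h1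
  have h3 : fderiv ℝ Φ.symm (Φ z) * (1 + t • fderiv ℝ X z) = 1 :=
    h1.unique (hasFDerivAt_id z)
  calc fderiv ℝ Φ.symm (Φ z)
      = fderiv ℝ Φ.symm (Φ z) * ((1 + t • fderiv ℝ X z) * Ring.inverse (1 + t • fderiv ℝ X z)) := by
        rw [Ring.mul_inverse_cancel _ (hu z), mul_one]
    _ = _ := by rw [← mul_assoc, h3, one_mul]

theorem memLp_comp_diffeo {F : Type*} [NormedAddCommGroup F] {Ω : Set (Euc m)} (hΩ : IsOpen Ω)
    {Ψ : Euc m ≃ₜ Euc m} (hΨ : IsC1Diffeo Ψ) (hΨΩ : ∀ z, Ψ z ∈ Ω ↔ z ∈ Ω) {C : ℝ}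
    (hC : ∀ y, |(fderiv ℝ Ψ.symm y).det| ≤ C) {q : ENNReal} {f : Euc m → F}
    (hf : MemLp f q (volume.restrict Ω)) : MemLp (fun z => f (Ψ z)) q (volume.restrict Ω) := by
  have hle : Measure.map Ψ (volume.restrict Ω) ≤ ENNReal.ofReal C • volume.restrict Ω := by
    refine Measure.le_iff.2 fun A hA => ?_
    have hpre : MeasurableSet (Ψ ⁻¹' A) := Ψ.continuous.measurable hA
    rw [Measure.map_apply Ψ.continuous.measurable hA, Measure.restrict_apply hpre,
      Measure.smul_apply, Measure.restrict_apply hA, smul_eq_mul]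
    have h1 := hΨ.setLIntegral_comp (hpre.inter hΩ.measurableSet) (fun _ => 1)
    have himg : Ψ '' (Ψ ⁻¹' A ∩ Ω) = A ∩ Ω := by
      ext y
      constructor
      · rintro ⟨z, ⟨h1, h2⟩, rfl⟩; exact ⟨h1, (hΨΩ z).2 h2⟩
      · rintro ⟨h1, h2⟩
        refine ⟨Ψ.symm y, ⟨by simpa using h1, (hΨΩ _).1 (by simpa using h2)⟩, by simp⟩
    rw [himg] at h1
    simp only [lintegral_const, one_mul, Measure.restrict_apply_univ, mul_one] at h1
    rw [h1]
    calc ∫⁻ y in A ∩ Ω, ENNReal.ofReal |(fderiv ℝ Ψ.symm y).det|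
        ≤ ∫⁻ _ in A ∩ Ω, ENNReal.ofReal C :=
          lintegral_mono fun y => ENNReal.ofReal_le_ofReal (hC y)
      _ = _ := by simp
  exact (hf.of_measure_le_smul ENNReal.ofReal_ne_top hle).comp_of_map
    Ψ.continuous.measurable.aemeasurable

/-- Energy comparison of a minimizing map with its inner variations. -/
theorem IsPMinimizing.energy_le_variation {p : ℝ} {Ω : Set (Euc m)} (hΩ : IsOpen Ω)
    {N : Set (Euc L)} {u : Euc m → Euc L} (hu : IsPMinimizing p Ω N u)
    {X : Euc m → Euc m} (hX : ContDiff ℝ 1 X) (hXc : HasCompactSupport X) (hXΩ : tsupport X ⊆ Ω)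
    {B C : ℝ} (hB : ∀ z, ‖fderiv ℝ X z‖ ≤ B) {t : ℝ} (ht : |t| * B ≤ 1 / 2)
    (hb : ∀ z, IsUnit (1 + t • fderiv ℝ X z) ∧ ‖Ring.inverse (1 + t • fderiv ℝ X z)‖ ≤ C ∧
      |(1 + t • fderiv ℝ X z).det| ≤ C) :
    pEnergy p Ω u ≤ ∫ z in Ω, variationDensity p (weakGrad Ω u z) (fderiv ℝ X z) t := by
  obtain ⟨Φ, hΦ, hΦd, hΦf, hΨf⟩ := exists_diffeo_id_add hX hB ht fun z => (hb z).1
  set Ψ := Φ.symm with hΨ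
  have hΨd : IsC1Diffeo Ψ := hΦd.symm
  have hout : ∀ z, z ∉ tsupport X → Φ z = z := fun z hz => by
    rw [hΦ, image_eq_zero_of_notMem_tsupport hz, smul_zero, add_zero]
  have hout' : ∀ z, z ∉ tsupport X → Ψ z = z := fun z hz => by
    conv_lhs => rw [← hout z hz]
    simp [hΨ]
  have hin' : ∀ z, z ∈ tsupport X → Ψ z ∈ tsupport X := fun z hz => by
    by_contra h
    have h1 := hout _ h
    rw [hΨ, Φ.apply_symm_apply] at h1
    rw [hΨ, ← h1] at h
    exact h hz
  have hΨΩ : ∀ z, Ψ z ∈ Ω ↔ z ∈ Ω := fun z => by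
    by_cases hz : z ∈ tsupport X
    · exact ⟨fun _ => hXΩ hz, fun _ => hXΩ (hin' z hz)⟩
    · rw [hout' z hz]
  have hΦΩ : ∀ z, Φ z ∈ Ω ↔ z ∈ Ω := fun z => by
    rw [← hΨΩ (Φ z), hΨ, Φ.symm_apply_apply]
  obtain ⟨G₀, hG₀⟩ := hu.1.exists_weakGradient
  have hG := hG₀.weakGrad
  set G := weakGrad Ω u with hGdef
  have hv := hG.comp_diffeo hΩ hΨd hΨΩ
  -- Moving points of the domain keeps the values in `N`, so this competitor is admissible with no
  -- projection to the target. It agrees with `u` off the support of `X`.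
  set v : Euc m → Euc L := fun z => u (Ψ z) with hvdef
  have hvae := hv.weakGrad_ae_eq hΩ
  have hdetb : ∀ y, |(fderiv ℝ Ψ.symm y).det| ≤ C := fun y => by
    have : fderiv ℝ Ψ.symm y = 1 + t • fderiv ℝ X y := (hΦf y).fderiv
    rw [this]; exact (hb y).2.2
  have hinvb : ∀ z, ‖fderiv ℝ Ψ z‖ ≤ C := fun z => by
    have := hΨf (Ψ z)
    rw [hΨ, Φ.apply_symm_apply] at this
    rw [hΨ, this]
    exact (hb _).2.1
  have hvW : MemW1p p Ω N v := by
    refine ⟨memLp_comp_diffeo hΩ hΨd hΨΩ hdetb hu.1.memLp, ⟨_, hv⟩, ?_, ?_⟩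
    · refine MemLp.ae_eq (f := fun z => (G (Ψ z)).comp (fderiv ℝ Ψ z)) (hvae.mono fun z hz => hz.symm)
        ?_
      have h1 := memLp_comp_diffeo hΩ hΨd hΨΩ hdetb hu.1.memLp_weakGrad
      refine MemLp.of_le_mul (c := C) h1 ?_ (Eventually.of_forall fun z => ?_)
      · have hc : Continuous fun q : (Euc m →L[ℝ] Euc L) × (Euc m →L[ℝ] Euc m) => q.1.comp q.2 :=
          continuous_fst.clm_comp continuous_snd
        exact hc.comp_aestronglyMeasurable₂ h1.1
          (hΨd.contDiff.continuous_fderiv (by simp)).aestronglyMeasurable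
      · refine (ContinuousLinearMap.opNorm_comp_le _ _).trans ?_
        rw [mul_comm]
        gcongr
        exact hinvb z
    · have h1 := (ae_restrict_iff' hΩ.measurableSet).1 hu.1.mem_target
      rw [ae_restrict_iff' hΩ.measurableSet]
      filter_upwards [hΨd.quasiMeasurePreserving.ae h1] with z hz hzΩ
      exact hz ((hΨΩ z).2 hzΩ)
  have hmin := hu.2 (tsupport X) v hXc hXΩ hvW (by
    filter_upwards [ae_restrict_mem (hΩ.measurableSet.diff (isClosed_tsupport X).measurableSet)]
      with z hz
    rw [hvdef]; simp only [hout' z hz.2])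
  refine hmin.trans (le_of_eq ?_)
  have e1 : pEnergy p Ω v = ∫ z in Ω, hsNorm ((G (Ψ z)).comp (fderiv ℝ Ψ z)) ^ p := by
    refine integral_congr_ae (hvae.mono fun z hz => ?_)
    simp only [gradNorm_eq_hsNorm, hz]
  have himg : Φ '' Ω = Ω := by
    ext y
    constructor
    · rintro ⟨z, hz, rfl⟩; exact (hΦΩ z).2 hz
    · intro hy
      exact ⟨Φ.symm y, (hΨΩ y).2 hy, Φ.apply_symm_apply y⟩
  rw [e1]
  conv_lhs => rw [← himg]
  rw [integral_image_eq_integral_abs_det_fderiv_smul volume hΩ.measurableSet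
    (fun z _ => (hΦf z).hasFDerivWithinAt) Φ.injective.injOn]
  refine setIntegral_congr_fun hΩ.measurableSet fun z _ => ?_
  simp only [smul_eq_mul, hΨ, Φ.symm_apply_apply, variationDensity]
  rw [hΨf z]

/-- The inner first variation of a `p`-minimizing map vanishes. -/
theorem IsPMinimizing.first_variation {p : ℝ} (hp : 1 < p) {Ω : Set (Euc m)} (hΩ : IsOpen Ω)
    {N : Set (Euc L)} {u : Euc m → Euc L} (hu : IsPMinimizing p Ω N u)
    (hint : IntegrableOn (fun z => gradNorm Ω u z ^ p) Ω)
    {X : Euc m → Euc m} (hX : ContDiff ℝ 1 X) (hXc : HasCompactSupport X) (hXΩ : tsupport X ⊆ Ω) :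
    ∫ z in Ω, variationDeriv p (weakGrad Ω u z) (fderiv ℝ X z) = 0 := by
  have hXd : Continuous (fderiv ℝ X) := hX.continuous_fderiv (by simp)
  obtain ⟨B, hB⟩ := (hXc.fderiv (𝕜 := ℝ)).exists_bound_of_continuous hXd
  have hB0 : 0 ≤ B := (norm_nonneg _).trans (hB 0)
  obtain ⟨t₀, ht₀, C, hC, htB, hb1, hb2⟩ := exists_variationDensity_bound m hp hB0
  set G := weakGrad Ω u with hG
  have hGm : AEStronglyMeasurable G (volume.restrict Ω) := hu.1.memLp_weakGrad.1
  set E : ℝ → ℝ := fun t => ∫ z in Ω, variationDensity p (G z) (fderiv ℝ X z) t with hE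
  have hE0 : E 0 = pEnergy p Ω u := by
    simp only [hE, variationDensity_zero, pEnergy, gradNorm_eq_hsNorm]; rfl
  have hint' : IntegrableOn (fun z => hsNorm (G z) ^ p) Ω := by
    simpa only [gradNorm_eq_hsNorm] using hint
  have hmeas : ∀ t : ℝ, |t| ≤ t₀ → AEStronglyMeasurable
      (fun z => variationDensity p (G z) (fderiv ℝ X z) t) (volume.restrict Ω) := by
    intro t ht
    have h1 : Continuous fun z => (1 + t • fderiv ℝ X z : Euc m →L[ℝ] Euc m) :=
      continuous_const.add (hXd.const_smul t)
    have h2 : Continuous fun z => Ring.inverse (1 + t • fderiv ℝ X z : Euc m →L[ℝ] Euc m) := by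
      refine continuous_iff_continuousAt.2 fun z => ?_
      obtain ⟨U, hU⟩ := (hb1 _ (hB z) t ht).1
      have := NormedRing.inverse_continuousAt U
      rw [hU] at this
      exact ContinuousAt.comp (f := fun z => (1 + t • fderiv ℝ X z : Euc m →L[ℝ] Euc m))
        this h1.continuousAt
    have hc : Continuous fun q : (Euc m →L[ℝ] Euc L) × (Euc m →L[ℝ] Euc m) => q.1.comp q.2 :=
      continuous_fst.clm_comp continuous_snd
    have hr : Continuous fun x : Euc m →L[ℝ] Euc L => hsNorm x ^ p :=
      continuous_hsNorm.rpow_const fun _ => Or.inr (by linarith)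
    have h4 : AEStronglyMeasurable (fun z => (G z).comp (Ring.inverse (1 + t • fderiv ℝ X z)))
        (volume.restrict Ω) := hc.comp_aestronglyMeasurable₂ hGm h2.aestronglyMeasurable
    have h3 := hr.comp_aestronglyMeasurable h4
    exact ((ContinuousLinearMap.continuous_det.comp h1).abs.aestronglyMeasurable).mul h3
  have hintt : ∀ t : ℝ, |t| ≤ t₀ → IntegrableOn
      (fun z => variationDensity p (G z) (fderiv ℝ X z) t) Ω := by
    intro t ht
    refine Integrable.mono' (hint'.const_mul (C * |t| + 1)) (hmeas t ht)
      (Eventually.of_forall fun z => ?_)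
    have h1 := hb2 L (G z) _ (hB z) t ht
    have h2 := abs_sub_abs_le_abs_sub (variationDensity p (G z) (fderiv ℝ X z) t) (hsNorm (G z) ^ p)
    rw [abs_of_nonneg (Real.rpow_nonneg (hsNorm_nonneg (G z)) p)] at h2
    rw [Real.norm_eq_abs]
    linarith
  have hnear : ∀ᶠ t : ℝ in 𝓝[≠] 0, |t| ≤ t₀ := by
    refine mem_nhdsWithin_of_mem_nhds ?_
    filter_upwards [Metric.ball_mem_nhds (0 : ℝ) ht₀] with t ht
    rw [mem_ball, dist_zero_right, Real.norm_eq_abs] at ht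
    exact ht.le
  have hderiv : HasDerivAt E (∫ z in Ω, variationDeriv p (G z) (fderiv ℝ X z)) 0 := by
    rw [hasDerivAt_iff_tendsto_slope_zero]
    have key : Tendsto (fun t : ℝ => ∫ z in Ω, t⁻¹ • (variationDensity p (G z) (fderiv ℝ X z) t -
        variationDensity p (G z) (fderiv ℝ X z) 0)) (𝓝[≠] 0)
        (𝓝 (∫ z in Ω, variationDeriv p (G z) (fderiv ℝ X z))) := by
      refine tendsto_integral_filter_of_dominated_convergence (fun z => C * hsNorm (G z) ^ p)
        ?_ ?_ (hint'.const_mul C) ?_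
      · filter_upwards [hnear] with t ht
        exact ((hmeas t ht).sub (hmeas 0 (by simpa using ht₀.le))).fun_const_smul t⁻¹
      · filter_upwards [hnear, self_mem_nhdsWithin] with t ht ht0
        refine Eventually.of_forall fun z => ?_
        rw [norm_smul, variationDensity_zero, Real.norm_eq_abs, Real.norm_eq_abs, abs_inv,
          inv_mul_le_iff₀ (abs_pos.2 ht0)]
        exact (hb2 L (G z) _ (hB z) t ht).trans (le_of_eq (by ring))
      · refine Eventually.of_forall fun z => ?_
        have := (hasDerivAt_variationDensity hp (G z) (fderiv ℝ X z)).tendsto_slope_zero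
        simpa only [zero_add] using this
    refine key.congr' ?_
    filter_upwards [hnear] with t ht
    rw [integral_smul, integral_sub (hintt t ht) (hintt 0 (by simpa using ht₀.le)), zero_add]
  -- Both signs of `t` are admissible, so minimality makes `t = 0` a two-sided minimum of `E`.
  refine IsLocalMin.hasDerivAt_eq_zero ?_ hderiv
  filter_upwards [Metric.ball_mem_nhds (0 : ℝ) ht₀] with t ht
  rw [mem_ball, dist_zero_right, Real.norm_eq_abs] at ht
  rw [hE0]
  refine hu.energy_le_variation hΩ hX hXc hXΩ hB (C := C) ?_ fun z => hb1 _ (hB z) t ht.le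
  exact (mul_le_mul_of_nonneg_right ht.le hB0).trans htB

theorem MemW1p.integrableOn_gradNorm_rpow {p : ℝ} (hp : 0 < p) {Ω : Set (Euc m)}
    {N : Set (Euc L)} {u : Euc m → Euc L} (hu : MemW1p p Ω N u) :
    IntegrableOn (fun z => gradNorm Ω u z ^ p) Ω := by
  have h1 : MemLp (fun z => gradNorm Ω u z) (ENNReal.ofReal p) (volume.restrict Ω) := by
    refine MemLp.of_le_mul (c := Real.sqrt m) hu.memLp_weakGrad ?_ (Eventually.of_forall fun z => ?_)
    · simp only [gradNorm_eq_hsNorm]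
      exact continuous_hsNorm.comp_aestronglyMeasurable hu.memLp_weakGrad.1
    · rw [gradNorm_eq_hsNorm, Real.norm_eq_abs, abs_of_nonneg (hsNorm_nonneg _)]
      exact hsNorm_le_opNorm _
  have h2 := h1.integrable_norm_rpow (by simpa using hp) (by simp)
  rw [ENNReal.toReal_ofReal hp.le] at h2
  refine h2.congr (Eventually.of_forall fun z => ?_)
  simp only [Real.norm_eq_abs]
  rw [abs_of_nonneg]
  rw [gradNorm_eq_hsNorm]; exact hsNorm_nonneg _

end FirstVariation


/-! ### The radial vector field and the stationarity identity. -/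

section Monotonicity
open Filter Topology

variable {m L : ℕ}

theorem IsProfile.tb_pos {ψ : ℝ → ℝ} {ta tb ξ : ℝ} (h : IsProfile ψ ta tb ξ) : 0 < tb := by
  linarith [h.two_lt_ta, h.ta_lt_tb]

theorem IsProfile.eq_zero {ψ : ℝ → ℝ} {ta tb ξ : ℝ} (h : IsProfile ψ ta tb ξ) {t : ℝ}
    (ht : tb < t) : ψ t = 0 := by
  by_contra hne
  have : t ∈ closure {t | 0 ≤ t ∧ ψ t ≠ 0} := subset_closure ⟨by linarith [h.tb_pos], hne⟩
  rw [h.support_eq] at this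
  exact absurd this.2 (not_le.2 ht)

theorem IsProfile.hasDerivAt {ψ : ℝ → ℝ} {ta tb ξ : ℝ} (h : IsProfile ψ ta tb ξ) {t : ℝ}
    (ht : 0 < t) : HasDerivAt ψ (derivWithin ψ (Ici 0) t) t :=
  ((h.smooth.differentiableOn (by simp) t ht.le).hasDerivWithinAt).hasDerivAt (Ici_mem_nhds ht)

theorem IsProfile.continuousOn_derivWithin {ψ : ℝ → ℝ} {ta tb ξ : ℝ} (h : IsProfile ψ ta tb ξ) :
    ContinuousOn (derivWithin ψ (Ici 0)) (Ici 0) :=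
  h.smooth.continuousOn_derivWithin (uniqueDiffOn_Ici 0) (by simp)

theorem IsProfile.derivWithin_eq_zero {ψ : ℝ → ℝ} {ta tb ξ : ℝ} (h : IsProfile ψ ta tb ξ) {t : ℝ}
    (ht : tb ≤ t) : derivWithin ψ (Ici 0) t = 0 := by
  have h1 : ∀ t, tb < t → derivWithin ψ (Ici 0) t = 0 := by
    intro t ht
    have h2 : ψ =ᶠ[𝓝 t] fun _ => 0 := by
      filter_upwards [Ioi_mem_nhds ht] with s hs using h.eq_zero hs
    exact (h.hasDerivAt (h.tb_pos.trans ht)).unique ((hasDerivAt_const t (0:ℝ)).congr_of_eventuallyEq h2)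
  rcases ht.lt_or_eq with ht | rfl
  · exact h1 t ht
  · have h2 : Tendsto (derivWithin ψ (Ici 0)) (𝓝[>] tb) (𝓝 (derivWithin ψ (Ici 0) tb)) :=
      (h.continuousOn_derivWithin tb h.tb_pos.le).mono_left
        (nhdsWithin_mono _ fun s hs => h.tb_pos.le.trans (le_of_lt hs))
    refine tendsto_nhds_unique h2 (tendsto_const_nhds.congr' ?_)
    filter_upwards [self_mem_nhdsWithin] with s hs using (h1 s hs).symm

theorem IsProfile.derivWithin_nonpos {ψ : ℝ → ℝ} {ta tb ξ : ℝ} (h : IsProfile ψ ta tb ξ) {t : ℝ}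
    (ht : 0 ≤ t) : derivWithin ψ (Ici 0) t ≤ 0 := by
  rcases lt_or_ge t tb with h1 | h1
  · exact (h.deriv_neg t ⟨ht, h1⟩).le
  · exact (h.derivWithin_eq_zero h1).le

/-- The weight `1 + t` lets one constant bound both `ψ'(t)` and `t ψ'(t)`; both occur as multipliers
later. -/
theorem IsProfile.exists_bound {ψ : ℝ → ℝ} {ta tb ξ : ℝ} (h : IsProfile ψ ta tb ξ) :
    ∃ B : ℝ, 0 ≤ B ∧ (∀ t, 0 ≤ t → |ψ t| ≤ B) ∧
      ∀ t, 0 ≤ t → |derivWithin ψ (Ici 0) t| * (1 + t) ≤ B := by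
  obtain ⟨B₁, hB₁⟩ := isCompact_Icc.exists_bound_of_continuousOn
    (h.smooth.continuousOn.mono (Icc_subset_Ici_self : Icc 0 tb ⊆ Ici 0))
  obtain ⟨B₂, hB₂⟩ := isCompact_Icc.exists_bound_of_continuousOn
    ((h.continuousOn_derivWithin.mul (by fun_prop : ContinuousOn (fun t : ℝ => 1 + t) (Ici 0))).mono
      (Icc_subset_Ici_self : Icc 0 tb ⊆ Ici 0))
  have h1 : 0 ≤ B₁ := (norm_nonneg _).trans (hB₁ 0 ⟨le_rfl, h.tb_pos.le⟩)
  have h2 : 0 ≤ B₂ := (norm_nonneg _).trans (hB₂ 0 ⟨le_rfl, h.tb_pos.le⟩)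
  refine ⟨B₁ + B₂, by positivity, fun t ht => ?_, fun t ht => ?_⟩
  · rcases le_or_gt t tb with hb | hb
    · exact (hB₁ t ⟨ht, hb⟩).trans (by linarith)
    · rw [h.eq_zero hb]; simp; positivity
  · rcases le_or_gt t tb with hb | hb
    · have := hB₂ t ⟨ht, hb⟩
      rw [Pi.mul_apply, norm_mul, Real.norm_eq_abs, Real.norm_eq_abs,
        abs_of_nonneg (by positivity : 0 ≤ 1 + t)] at this
      linarith
    · rw [h.derivWithin_eq_zero hb.le]; simp; positivity

theorem IsProfile.continuous_comp_norm {ψ : ℝ → ℝ} {ta tb ξ : ℝ} (h : IsProfile ψ ta tb ξ)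
    {E : Type*} [TopologicalSpace E] {ρ : E → ℝ} (hρ : Continuous ρ) (hρ0 : ∀ z, 0 ≤ ρ z) :
    Continuous fun z => ψ (ρ z) :=
  h.smooth.continuousOn.comp_continuous hρ hρ0

/-- The derivative of the radial field `z ↦ ψ(|z - y| / s) (z - y)`. -/
noncomputable def radialFieldDeriv (ψ : ℝ → ℝ) (y : Euc m) (s : ℝ) (z : Euc m) :
    Euc m →L[ℝ] Euc m :=
  ψ (‖z - y‖ / s) • (1 : Euc m →L[ℝ] Euc m) +
    (derivWithin ψ (Ici 0) (‖z - y‖ / s) * (s * ‖z - y‖)⁻¹) •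
      (innerSL ℝ (z - y)).smulRight (z - y)

theorem IsProfile.hasFDerivAt_radialField {ψ : ℝ → ℝ} {ta tb ξ : ℝ} (h : IsProfile ψ ta tb ξ)
    (y : Euc m) {s : ℝ} (hs : 0 < s) (z : Euc m) :
    HasFDerivAt (fun z => ψ (‖z - y‖ / s) • (z - y)) (radialFieldDeriv ψ y s z) z := by
  by_cases hz : z = y
  -- At the centre the norm is not differentiable, but `ψ(|w|/s) w = ψ(0) w + o(|w|)` follows from
  -- continuity of `ψ` alone, and the second term of `radialFieldDeriv` vanishes there.
  · subst hz
    rw [hasFDerivAt_iff_isLittleO_nhds_zero, Asymptotics.isLittleO_iff]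
    intro c hc
    have hcont := (h.continuous_comp_norm (by fun_prop : Continuous fun w : Euc m => ‖w‖ / s)
      fun w => by positivity).tendsto 0
    have := (Metric.tendsto_nhds.1 hcont c hc)
    filter_upwards [this] with w hw
    have e : ψ (‖z + w - z‖ / s) • (z + w - z) - ψ (‖z - z‖ / s) • (z - z) -
        (radialFieldDeriv ψ z s z) w = (ψ (‖w‖ / s) - ψ (‖(0:Euc m)‖ / s)) • w := by
      simp [radialFieldDeriv, sub_smul]
    rw [e, norm_smul]
    rw [Real.dist_eq] at hw
    exact mul_le_mul_of_nonneg_right hw.le (norm_nonneg _)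
  · have hne : z - y ≠ 0 := sub_ne_zero.2 hz
    have hpos : 0 < ‖z - y‖ := norm_pos_iff.2 hne
    have h0 : HasFDerivAt (fun z : Euc m => z - y) (ContinuousLinearMap.id ℝ (Euc m)) z :=
      (hasFDerivAt_id z).sub_const y
    have h1 : HasFDerivAt (fun z : Euc m => ‖z - y‖ ^ 2) (2 • (innerSL ℝ (z - y)).comp
        (ContinuousLinearMap.id ℝ (Euc m))) z := h0.norm_sq
    have h2 : HasFDerivAt (fun z : Euc m => Real.sqrt (‖z - y‖ ^ 2))
      ((1 / (2 * Real.sqrt (‖z - y‖ ^ 2))) • (2 • (innerSL ℝ (z - y)).comp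
        (ContinuousLinearMap.id ℝ (Euc m)))) z := h1.sqrt (by positivity)
    have h3 : HasFDerivAt (fun z : Euc m => ‖z - y‖ / s)
        ((s * ‖z - y‖)⁻¹ • innerSL ℝ (z - y)) z := by
      have h4 := h2.const_mul s⁻¹
      have e1 : (fun z : Euc m => ‖z - y‖ / s) = fun z => s⁻¹ * Real.sqrt (‖z - y‖ ^ 2) := by
        ext w; rw [Real.sqrt_sq (norm_nonneg _)]; ring
      rw [e1]
      refine h4.congr_fderiv ?_
      ext w
      rw [Real.sqrt_sq (norm_nonneg _)]
      simp only [_root_.smul_apply, ContinuousLinearMap.comp_apply,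
        ContinuousLinearMap.id_apply, smul_eq_mul, nsmul_eq_mul, Nat.cast_ofNat]
      field_simp
    have h5 := (h.hasDerivAt (div_pos hpos hs)).comp_hasFDerivAt z h3
    have h6 := HasFDerivAt.fun_smul h5 h0
    refine h6.congr_fderiv ?_
    ext1 w
    simp only [radialFieldDeriv, _root_.add_apply, _root_.smul_apply,
      ContinuousLinearMap.smulRight_apply, ContinuousLinearMap.id_apply,
      one_apply_eq_self, smul_smul, smul_eq_mul, mul_assoc, Function.comp]

theorem IsProfile.continuous_radialFieldDeriv {ψ : ℝ → ℝ} {ta tb ξ : ℝ} (h : IsProfile ψ ta tb ξ)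
    (y : Euc m) {s : ℝ} (hs : 0 < s) : Continuous (radialFieldDeriv ψ y s) := by
  have hρ : Continuous fun w : Euc m => ‖w - y‖ / s := by fun_prop
  have h1 : Continuous fun z : Euc m => ψ (‖z - y‖ / s) :=
    h.continuous_comp_norm hρ fun w => by positivity
  have h2 : Continuous fun z : Euc m => derivWithin ψ (Ici 0) (‖z - y‖ / s) :=
    h.continuousOn_derivWithin.comp_continuous hρ fun w => by
      have : 0 ≤ ‖w - y‖ / s := by positivity
      exact this
  have h3 : Continuous fun z : Euc m => (innerSL ℝ (z - y)).smulRight (z - y) := by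
    have : Continuous fun z : Euc m => ContinuousLinearMap.smulRightL ℝ (Euc m) (Euc m)
      (innerSL ℝ (z - y)) (z - y) := by fun_prop
    exact this
  refine Continuous.add (h1.smul continuous_const) ?_
  obtain ⟨B, hB0, -, hB⟩ := h.exists_bound
  refine continuous_iff_continuousAt.2 fun z => ?_
  by_cases hz : z = y
  · subst hz
    rw [ContinuousAt]
    have e : (derivWithin ψ (Ici 0) (‖z - z‖ / s) * (s * ‖z - z‖)⁻¹) •
      (innerSL ℝ (z - z)).smulRight (z - z) = 0 := by
      rw [sub_self]; ext; simp
    rw [e]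
    refine squeeze_zero_norm (a := fun w => B * (‖w - z‖ / s)) (fun w => ?_) ?_
    · rw [norm_smul, ContinuousLinearMap.norm_smulRight_apply, innerSL_apply_norm, norm_mul,
        Real.norm_eq_abs, Real.norm_eq_abs]
      have := hB (‖w - z‖ / s) (by positivity)
      have h4 : |derivWithin ψ (Ici 0) (‖w - z‖ / s)| ≤ B := by
        refine le_trans ?_ this
        refine le_mul_of_one_le_right (abs_nonneg _) ?_
        have : 0 ≤ ‖w - z‖ / s := by positivity
        linarith
      rcases eq_or_ne ‖w - z‖ 0 with h0 | h0
      · rw [h0]; simp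
      · rw [mul_assoc]
        refine mul_le_mul h4 (le_of_eq ?_) (by positivity) hB0
        rw [abs_of_nonneg (by positivity)]
        field_simp
    · have : Continuous fun w : Euc m => B * (‖w - z‖ / s) := by fun_prop
      simpa using this.tendsto z
  · have hne : s * ‖z - y‖ ≠ 0 := mul_ne_zero hs.ne' (norm_ne_zero_iff.2 (sub_ne_zero.2 hz))
    have h4 : ContinuousAt (fun z : Euc m => (s * ‖z - y‖)⁻¹) z := by
      refine ContinuousAt.inv₀ ?_ hne
      fun_prop
    exact ((h2.continuousAt).mul h4).smul h3.continuousAt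

theorem IsProfile.contDiff_radialField {ψ : ℝ → ℝ} {ta tb ξ : ℝ} (h : IsProfile ψ ta tb ξ)
    (y : Euc m) {s : ℝ} (hs : 0 < s) : ContDiff ℝ 1 fun z => ψ (‖z - y‖ / s) • (z - y) := by
  rw [contDiff_one_iff_hasFDerivAt]
  exact ⟨_, h.continuous_radialFieldDeriv y hs, h.hasFDerivAt_radialField y hs⟩

theorem IsProfile.tsupport_radialField {ψ : ℝ → ℝ} {ta tb ξ : ℝ} (h : IsProfile ψ ta tb ξ)
    (y : Euc m) {s : ℝ} (hs : 0 < s) :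
    tsupport (fun z => ψ (‖z - y‖ / s) • (z - y)) ⊆ closedBall y (s * tb) := by
  refine closure_minimal (fun z hz => ?_) isClosed_closedBall
  rw [mem_closedBall, dist_eq_norm]
  by_contra hlt
  refine hz ?_
  have : tb < ‖z - y‖ / s := by rw [lt_div_iff₀ hs]; linarith
  simp only [h.eq_zero this, zero_smul]

/-- The endomorphism `a + b v ⊗ v` has trace `m a + b|v|²`, and its pairing with `A` is `a|A|² + b|A
v|²`. This is where the radial derivative `A v` appears. -/
theorem variationDeriv_radial (p : ℝ) (hp : 1 < p) (A : Euc m →L[ℝ] Euc L) (a b : ℝ) (v : Euc m) :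
    variationDeriv p A (a • (1 : Euc m →L[ℝ] Euc m) + b • (innerSL ℝ v).smulRight v) =
      ((m - p) * a + b * ‖v‖ ^ 2) * hsNorm A ^ p - p * b * (hsNorm A ^ (p - 2) * ‖A v‖ ^ 2) := by
  have htr : LinearMap.trace ℝ (Euc m) ((a • (1 : Euc m →L[ℝ] Euc m) +
      b • (innerSL ℝ v).smulRight v : Euc m →L[ℝ] Euc m)).toLinearMap = m * a + b * ‖v‖ ^ 2 := by
    have : ((a • (1 : Euc m →L[ℝ] Euc m) +
      b • (innerSL ℝ v).smulRight v : Euc m →L[ℝ] Euc m)).toLinearMap =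
      a • (LinearMap.id : Euc m →ₗ[ℝ] Euc m) + b • ((innerₛₗ ℝ v).smulRight v) := by
      ext; rfl
    rw [this, map_add, map_smul, map_smul, LinearMap.trace_id, LinearMap.trace_smulRight]
    simp [mul_comm]
  have hsum : ∑ i, inner ℝ (A (EuclideanSpace.single i (1 : ℝ)))
      (A ((a • (1 : Euc m →L[ℝ] Euc m) + b • (innerSL ℝ v).smulRight v)
        (EuclideanSpace.single i (1 : ℝ)))) = a * hsNorm A ^ 2 + b * ‖A v‖ ^ 2 := by
    have h1 : A v = ∑ i, v i • A (EuclideanSpace.single i (1 : ℝ)) := by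
      conv_lhs => rw [show v = ∑ j, v j • EuclideanSpace.single j (1 : ℝ) by
        ext i; simp [Pi.single_apply]]
      rw [map_sum]; simp only [map_smul]
    have h2 : ‖A v‖ ^ 2 = ∑ i, v i * inner ℝ (A (EuclideanSpace.single i (1 : ℝ))) (A v) := by
      rw [← real_inner_self_eq_norm_sq]
      conv_lhs => rw [h1, sum_inner]
      simp only [← h1, real_inner_smul_left]
    rw [hsNorm_sq, h2, Finset.mul_sum, Finset.mul_sum, ← Finset.sum_add_distrib]
    refine Finset.sum_congr rfl fun i _ => ?_
    simp only [_root_.add_apply, _root_.smul_apply,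
      ContinuousLinearMap.smulRight_apply, one_apply_eq_self, map_add, map_smul,
      inner_add_right, real_inner_smul_right, real_inner_self_eq_norm_sq, innerSL_apply_apply]
    simp [EuclideanSpace.inner_single_right]
  rw [variationDeriv, htr, hsum]
  have hpow : hsNorm A ^ (p - 2) * hsNorm A ^ 2 = hsNorm A ^ p := by
    rcases (hsNorm_nonneg A).eq_or_lt with h0 | h0
    · rw [← h0, Real.zero_rpow (by linarith : p ≠ 0)]; simp
    · rw [← Real.rpow_natCast, ← Real.rpow_add h0]; congr 1; push_cast; ring
  rw [← hpow]; ring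

/-- The stationarity identity behind the monotonicity formula. -/
theorem IsPMinimizing.radial_identity {p : ℝ} (hp : 1 < p) {Ω : Set (Euc m)} (hΩ : IsOpen Ω)
    {N : Set (Euc L)} {u : Euc m → Euc L} (hu : IsPMinimizing p Ω N u)
    {ψ : ℝ → ℝ} {ta tb ξ : ℝ} (h : IsProfile ψ ta tb ξ) (y : Euc m) {s : ℝ} (hs : 0 < s)
    (hy : closedBall y (s * tb) ⊆ Ω) :
    ∫ z in Ω, (((m - p) * ψ (‖z - y‖ / s) +
        derivWithin ψ (Ici 0) (‖z - y‖ / s) * (‖z - y‖ / s)) * gradNorm Ω u z ^ p -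
      p * (derivWithin ψ (Ici 0) (‖z - y‖ / s) * (s * ‖z - y‖)⁻¹ *
        (gradNorm Ω u z ^ (p - 2) * ‖weakGrad Ω u z (z - y)‖ ^ 2))) = 0 := by
  have hsup := h.tsupport_radialField y hs
  have := hu.first_variation hp hΩ (hu.1.integrableOn_gradNorm_rpow (by linarith))
    (h.contDiff_radialField y hs)
    (HasCompactSupport.of_support_subset_isCompact (isCompact_closedBall y (s * tb))
      (subset_closure.trans hsup)) (hsup.trans hy)
  refine Eq.trans ?_ this
  congr 1
  ext z
  rw [(h.hasFDerivAt_radialField y hs z).fderiv, radialFieldDeriv, variationDeriv_radial p hp,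
    gradNorm_eq_hsNorm]
  rcases eq_or_ne ‖z - y‖ 0 with h0 | h0
  · rw [h0]; simp
  · field_simp
    try ring

end Monotonicity


/-! ### The monotonicity formula and the lower bound for the energy drop. -/

section EnergyDrop
open Filter Topology

variable {m L : ℕ}

theorem IsProfile.integrable_radial_mul {ψ : ℝ → ℝ} {ta tb ξ : ℝ} (h : IsProfile ψ ta tb ξ)
    {Ω : Set (Euc m)} {f : Euc m → ℝ} (hf : IntegrableOn f Ω) (y : Euc m) {s : ℝ} (hs : 0 < s) :
    IntegrableOn (fun z => ψ (‖z - y‖ / s) * f z) Ω := by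
  obtain ⟨B, hB0, hB, -⟩ := h.exists_bound
  refine Integrable.bdd_mul (c := B) hf ?_ (Eventually.of_forall fun z => hB _ (by positivity))
  exact (h.continuous_comp_norm (by fun_prop : Continuous fun z : Euc m => ‖z - y‖ / s)
    fun z => by positivity).aestronglyMeasurable

theorem IsProfile.integrable_radial_deriv_mul {ψ : ℝ → ℝ} {ta tb ξ : ℝ} (h : IsProfile ψ ta tb ξ)
    {Ω : Set (Euc m)} {f : Euc m → ℝ} (hf : IntegrableOn f Ω) (y : Euc m) {s : ℝ} (hs : 0 < s) :
    IntegrableOn (fun z => derivWithin ψ (Ici 0) (‖z - y‖ / s) * (‖z - y‖ / s) * f z) Ω := by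
  obtain ⟨B, hB0, -, hB⟩ := h.exists_bound
  refine Integrable.bdd_mul (c := B) hf ?_ (Eventually.of_forall fun z => ?_)
  · have hρ : Continuous fun z : Euc m => ‖z - y‖ / s := by fun_prop
    have h1 : Continuous fun z : Euc m => derivWithin ψ (Ici 0) (‖z - y‖ / s) :=
      h.continuousOn_derivWithin.comp_continuous hρ fun w => by
        have : 0 ≤ ‖w - y‖ / s := by positivity
        exact this
    exact (h1.mul hρ).aestronglyMeasurable
  · have h0 : 0 ≤ ‖z - y‖ / s := by positivity
    rw [norm_mul, Real.norm_eq_abs, Real.norm_eq_abs, abs_of_nonneg h0]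
    refine le_trans ?_ (hB _ h0)
    gcongr; linarith

/-- Differentiation under the integral: on the ball of radius `s/2` about `s` the derivative of the
integrand is dominated through the bound on `t ψ'(t)`. -/
theorem IsProfile.hasDerivAt_integral_radial {ψ : ℝ → ℝ} {ta tb ξ : ℝ} (h : IsProfile ψ ta tb ξ)
    {Ω : Set (Euc m)} {f : Euc m → ℝ} (hf : IntegrableOn f Ω) (y : Euc m) {s : ℝ} (hs : 0 < s) :
    HasDerivAt (fun s => ∫ z in Ω, ψ (‖z - y‖ / s) * f z)
      (- s⁻¹ * ∫ z in Ω, derivWithin ψ (Ici 0) (‖z - y‖ / s) * (‖z - y‖ / s) * f z) s := by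
  obtain ⟨B, hB0, -, hB⟩ := h.exists_bound
  have hball : ball s (s / 2) ∈ 𝓝 s := Metric.ball_mem_nhds s (by positivity)
  have hpos : ∀ t ∈ ball s (s / 2), s / 2 < t := by
    intro t ht
    rw [mem_ball, Real.dist_eq, abs_lt] at ht
    linarith
  have key := (hasDerivAt_integral_of_dominated_loc_of_deriv_le (μ := volume.restrict Ω)
    (F := fun s z => ψ (‖z - y‖ / s) * f z)
    (F' := fun s z => (- s⁻¹) * (derivWithin ψ (Ici 0) (‖z - y‖ / s) * (‖z - y‖ / s) * f z))
    (x₀ := s) (bound := fun z => (2 / s) * (B * |f z|)) hball ?_ ?_ ?_ ?_ ?_ ?_).2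
  · rw [integral_const_mul] at key
    exact key
  · filter_upwards [hball] with t ht
    exact (h.integrable_radial_mul hf y ((by positivity : 0 < s / 2).trans (hpos t ht))).1
  · exact h.integrable_radial_mul hf y hs
  · exact ((h.integrable_radial_deriv_mul hf y hs).const_mul _).1
  · refine Eventually.of_forall fun z t ht => ?_
    have ht' := hpos t ht
    have ht0 : 0 < t := (by positivity : 0 < s / 2).trans ht'
    have h0 : 0 ≤ ‖z - y‖ / t := by positivity
    rw [norm_mul, norm_mul, norm_mul, Real.norm_eq_abs, Real.norm_eq_abs, Real.norm_eq_abs,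
      Real.norm_eq_abs, abs_neg, abs_of_pos (inv_pos.2 ht0), abs_of_nonneg h0]
    have h1 : t⁻¹ ≤ 2 / s := by
      rw [inv_le_comm₀ ht0 (by positivity), inv_div]; exact ht'.le
    have h2 : |derivWithin ψ (Ici 0) (‖z - y‖ / t)| * (‖z - y‖ / t) ≤ B := by
      refine le_trans ?_ (hB _ h0)
      gcongr; linarith
    gcongr
  · exact (hf.norm.const_mul B).const_mul _
  · refine Eventually.of_forall fun z t ht => ?_
    have ht0 : 0 < t := (by positivity : 0 < s / 2).trans (hpos t ht)
    have hd : HasDerivAt (fun t => ψ (‖z - y‖ / t))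
        (- t⁻¹ * (derivWithin ψ (Ici 0) (‖z - y‖ / t) * (‖z - y‖ / t))) t := by
      rcases (norm_nonneg (z - y)).eq_or_lt with h0 | h0
      · rw [← h0]; simpa using hasDerivAt_const t (ψ 0)
      · have h1 : HasDerivAt (fun t : ℝ => ‖z - y‖ / t) (‖z - y‖ * (-(t ^ 2)⁻¹)) t := by
          simpa [div_eq_mul_inv] using (hasDerivAt_inv ht0.ne').const_mul ‖z - y‖
        refine ((h.hasDerivAt (div_pos h0 ht0)).comp t h1).congr_deriv ?_
        field_simp
    exact (hd.mul_const (f z)).congr_deriv (by ring)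

/-- At `A = 0` both sides vanish whatever value `0 ^ (p - 2)` takes, thanks to the square; so the
weight `|∇u|^{p-2}` needs no special care where the gradient is zero. -/
theorem hsNorm_rpow_sub_two_mul (p : ℝ) (hp : 1 < p) (A : Euc m →L[ℝ] Euc L) :
    hsNorm A ^ (p - 2) * hsNorm A ^ 2 = hsNorm A ^ p := by
  rcases (hsNorm_nonneg A).eq_or_lt with h0 | h0
  · rw [← h0, Real.zero_rpow (by linarith : p ≠ 0)]; simp
  · rw [← Real.rpow_natCast, ← Real.rpow_add h0]; congr 1; push_cast; ring

theorem hsNorm_rpow_mul_apply_sq_le {p : ℝ} (hp : 1 < p) (A : Euc m →L[ℝ] Euc L) (v : Euc m) :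
    hsNorm A ^ (p - 2) * ‖A v‖ ^ 2 ≤ hsNorm A ^ p * ‖v‖ ^ 2 := by
  rw [← hsNorm_rpow_sub_two_mul p hp, mul_assoc, ← mul_pow]
  exact mul_le_mul_of_nonneg_left (pow_le_pow_left₀ (norm_nonneg _) (norm_apply_le_hsNorm A v) 2)
    (Real.rpow_nonneg (hsNorm_nonneg A) _)

theorem MemW1p.aestronglyMeasurable_weight {p : ℝ} {Ω : Set (Euc m)}
    {N : Set (Euc L)} {u : Euc m → Euc L} (hu : MemW1p p Ω N u) (y : Euc m) :
    AEStronglyMeasurable (fun z => gradNorm Ω u z ^ (p - 2) * ‖weakGrad Ω u z (z - y)‖ ^ 2)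
      (volume.restrict Ω) := by
  have hG := hu.memLp_weakGrad.1
  have h1 : AEStronglyMeasurable (fun z => gradNorm Ω u z) (volume.restrict Ω) := by
    simp only [gradNorm_eq_hsNorm]
    exact continuous_hsNorm.comp_aestronglyMeasurable hG
  have h2 : AEStronglyMeasurable (fun z => gradNorm Ω u z ^ (p - 2)) (volume.restrict Ω) :=
    (h1.aemeasurable.pow_const _).aestronglyMeasurable
  have hc : Continuous fun q : (Euc m →L[ℝ] Euc L) × Euc m => ‖q.1 q.2‖ ^ 2 := by fun_prop
  have h3 : AEStronglyMeasurable (fun z : Euc m => z - y) (volume.restrict Ω) :=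
    (by fun_prop : Continuous fun z : Euc m => z - y).aestronglyMeasurable
  have h4 : AEStronglyMeasurable (fun z => ‖weakGrad Ω u z (z - y)‖ ^ 2) (volume.restrict Ω) :=
    Continuous.comp_aestronglyMeasurable₂ (g := fun (A : Euc m →L[ℝ] Euc L) v => ‖A v‖ ^ 2) hc hG h3
  exact h2.mul h4

theorem MemW1p.integrableOn_weight {p : ℝ} (hp : 1 < p) {Ω : Set (Euc m)}
    {N : Set (Euc L)} {u : Euc m → Euc L} (hu : MemW1p p Ω N u) (y : Euc m) {S : Set (Euc m)}
    (hS : MeasurableSet S) (hSΩ : S ⊆ Ω) {R : ℝ} (hR : ∀ z ∈ S, ‖z - y‖ ≤ R) :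
    IntegrableOn (fun z => gradNorm Ω u z ^ (p - 2) * ‖weakGrad Ω u z (z - y)‖ ^ 2) S := by
  refine Integrable.mono' (((hu.integrableOn_gradNorm_rpow (by linarith)).mono_set hSΩ).mul_const
    (R ^ 2)) ((hu.aestronglyMeasurable_weight y).mono_measure (Measure.restrict_mono hSΩ le_rfl)) ?_
  rw [ae_restrict_iff' hS]
  refine Eventually.of_forall fun z hz => ?_
  rw [gradNorm_eq_hsNorm, Real.norm_eq_abs, abs_of_nonneg (mul_nonneg
    (Real.rpow_nonneg (hsNorm_nonneg _) _) (sq_nonneg _))]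
  refine (hsNorm_rpow_mul_apply_sq_le hp _ _).trans ?_
  exact mul_le_mul_of_nonneg_left (pow_le_pow_left₀ (norm_nonneg _) (hR z hz) 2)
    (Real.rpow_nonneg (hsNorm_nonneg _) _)

theorem MemW1p.integrableOn_radial_weight {p : ℝ} (hp : 1 < p) {Ω : Set (Euc m)}
    {N : Set (Euc L)} {u : Euc m → Euc L} (hu : MemW1p p Ω N u)
    {ψ : ℝ → ℝ} {ta tb ξ : ℝ} (h : IsProfile ψ ta tb ξ) (y : Euc m) {s : ℝ} (hs : 0 < s) :
    IntegrableOn (fun z => derivWithin ψ (Ici 0) (‖z - y‖ / s) * (s * ‖z - y‖)⁻¹ *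
        (gradNorm Ω u z ^ (p - 2) * ‖weakGrad Ω u z (z - y)‖ ^ 2)) Ω := by
  have hf := h.integrable_radial_deriv_mul (hu.integrableOn_gradNorm_rpow (by linarith)) y hs
  refine Integrable.mono hf ?_ (Eventually.of_forall fun z => ?_)
  · have hρ : Continuous fun z : Euc m => ‖z - y‖ / s := by fun_prop
    have h1 : Continuous fun z : Euc m => derivWithin ψ (Ici 0) (‖z - y‖ / s) :=
      h.continuousOn_derivWithin.comp_continuous hρ fun w => by
        have : 0 ≤ ‖w - y‖ / s := by positivity
        exact this
    have h2 : Measurable fun z : Euc m => (s * ‖z - y‖)⁻¹ := by fun_prop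
    exact (h1.aestronglyMeasurable.mul h2.aestronglyMeasurable).mul (hu.aestronglyMeasurable_weight y)
  · rw [norm_mul, norm_mul (derivWithin ψ (Ici 0) _), norm_mul _ (gradNorm Ω u z ^ p),
      norm_mul (derivWithin ψ (Ici 0) _), gradNorm_eq_hsNorm,
      mul_assoc, mul_assoc]
    refine mul_le_mul_of_nonneg_left ?_ (norm_nonneg _)
    rw [Real.norm_of_nonneg (by positivity : 0 ≤ (s * ‖z - y‖)⁻¹),
      Real.norm_of_nonneg (by positivity : 0 ≤ ‖z - y‖ / s),
      Real.norm_of_nonneg (mul_nonneg (Real.rpow_nonneg (hsNorm_nonneg _) _) (sq_nonneg _)),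
      Real.norm_of_nonneg (Real.rpow_nonneg (hsNorm_nonneg _) _)]
    refine (mul_le_mul_of_nonneg_left (hsNorm_rpow_mul_apply_sq_le hp _ _)
      (by positivity)).trans (le_of_eq ?_)
    rcases eq_or_ne ‖z - y‖ 0 with h0 | h0
    · rw [h0]; simp
    · field_simp

/-- The product rule gives `-s^{p-m-1}` times `(m - p) I₁ + I₂`, which `radial_identity` equates
with `p I₃`: only the radial part of the energy remains. -/
theorem IsPMinimizing.hasDerivAt_normalizedEnergy {p : ℝ} (hp : 1 < p) {Ω : Set (Euc m)}
    (hΩ : IsOpen Ω) {N : Set (Euc L)} {u : Euc m → Euc L} (hu : IsPMinimizing p Ω N u)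
    {ψ : ℝ → ℝ} {ta tb ξ : ℝ} (h : IsProfile ψ ta tb ξ) (y : Euc m) {s : ℝ} (hs : 0 < s)
    (hy : closedBall y (s * tb) ⊆ Ω) :
    HasDerivAt (normalizedEnergy p ψ Ω u y) (-(p * s ^ (p - m - 1) *
      ∫ z in Ω, derivWithin ψ (Ici 0) (‖z - y‖ / s) * (s * ‖z - y‖)⁻¹ *
        (gradNorm Ω u z ^ (p - 2) * ‖weakGrad Ω u z (z - y)‖ ^ 2))) s := by
  have hf := hu.1.integrableOn_gradNorm_rpow (p := p) (by linarith)
  have hid := hu.radial_identity hp hΩ h y hs hy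
  have i1 := h.integrable_radial_mul hf y hs
  have i2 := h.integrable_radial_deriv_mul hf y hs
  have i3 := hu.1.integrableOn_radial_weight hp h y hs
  have e1 : ∫ z in Ω, (((m - p) * ψ (‖z - y‖ / s) +
        derivWithin ψ (Ici 0) (‖z - y‖ / s) * (‖z - y‖ / s)) * gradNorm Ω u z ^ p -
      p * (derivWithin ψ (Ici 0) (‖z - y‖ / s) * (s * ‖z - y‖)⁻¹ *
        (gradNorm Ω u z ^ (p - 2) * ‖weakGrad Ω u z (z - y)‖ ^ 2))) =
      ((m - p) * ∫ z in Ω, ψ (‖z - y‖ / s) * gradNorm Ω u z ^ p) +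
        (∫ z in Ω, derivWithin ψ (Ici 0) (‖z - y‖ / s) * (‖z - y‖ / s) * gradNorm Ω u z ^ p) -
      p * ∫ z in Ω, (derivWithin ψ (Ici 0) (‖z - y‖ / s) * (s * ‖z - y‖)⁻¹ *
        (gradNorm Ω u z ^ (p - 2) * ‖weakGrad Ω u z (z - y)‖ ^ 2)) := by
    have i4 : Integrable (fun z => (m - p) * (ψ (‖z - y‖ / s) * gradNorm Ω u z ^ p) +
        derivWithin ψ (Ici 0) (‖z - y‖ / s) * (‖z - y‖ / s) * gradNorm Ω u z ^ p)
        (volume.restrict Ω) := (i1.const_mul _).add i2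
    rw [← integral_const_mul, ← integral_const_mul, ← integral_add (i1.const_mul _) i2,
      ← integral_sub i4 (i3.const_mul _)]
    congr 1; ext z; ring
  rw [e1] at hid
  have hd := (Real.hasDerivAt_rpow_const (x := s) (p := p - m) (Or.inl hs.ne')).mul
    (h.hasDerivAt_integral_radial hf y hs)
  refine hd.congr_deriv ?_
  have e2 : s ^ (p - m) = s ^ (p - m - 1) * s := by
    rw [← Real.rpow_add_one hs.ne']; congr 1; ring
  rw [e2]
  generalize (∫ z in Ω, ψ (‖z - y‖ / s) * gradNorm Ω u z ^ p) = I₁ at hid ⊢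
  generalize (∫ z in Ω, derivWithin ψ (Ici 0) (‖z - y‖ / s) * (‖z - y‖ / s) * gradNorm Ω u z ^ p) =
    I₂ at hid ⊢
  generalize (∫ z in Ω, derivWithin ψ (Ici 0) (‖z - y‖ / s) * (s * ‖z - y‖)⁻¹ *
    (gradNorm Ω u z ^ (p - 2) * ‖weakGrad Ω u z (z - y)‖ ^ 2)) = I₃ at hid ⊢
  field_simp
  linear_combination -hid

/-- The drop of the normalized energy controls the radial energy. -/
theorem IsPMinimizing.energy_drop {p : ℝ} (hp : 1 < p) (hpm : p < m) {Ω : Set (Euc m)}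
    (hΩ : IsOpen Ω) {N : Set (Euc L)} {u : Euc m → Euc L} (hu : IsPMinimizing p Ω N u)
    {ψ : ℝ → ℝ} {ta tb ξ : ℝ} (h : IsProfile ψ ta tb ξ) {σ : ℝ} (hσ : 1 < σ) {x y : Euc m} {r : ℝ}
    (hr : 0 < r) (hx : ball x ((1 + σ * tb) * r) ⊆ Ω) (hy : y ∈ ball x r) :
    (σ - 1) * (p * σ ^ (p - m - 1) * ξ / (2 * σ)) * r ^ (p - m - 2) *
      (∫ z in ball x r, gradNorm Ω u z ^ (p - 2) * ‖weakGrad Ω u z (z - y)‖ ^ 2) ≤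
    normalizedEnergy p ψ Ω u y (σ * r) - normalizedEnergy p ψ Ω u y r := by
  have htb := h.tb_pos
  have hσ0 : 0 < σ := by linarith
  have hrσ : r < σ * r := by nlinarith
  rw [mem_ball] at hy
  have hsub : ∀ s ∈ Icc r (σ * r), closedBall y (s * tb) ⊆ Ω := by
    intro s hs z hz
    refine hx ?_
    rw [mem_closedBall] at hz
    rw [mem_ball]
    have h1 := dist_triangle z y x
    have h2 : s * tb ≤ σ * r * tb := by gcongr; exact hs.2
    nlinarith
  have hbΩ : ball x r ⊆ Ω := (ball_subset_ball (by nlinarith [mul_pos hσ0 htb])).trans hx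
  set D := ∫ z in ball x r, gradNorm Ω u z ^ (p - 2) * ‖weakGrad Ω u z (z - y)‖ ^ 2 with hD
  have hw0 : ∀ z, 0 ≤ gradNorm Ω u z ^ (p - 2) * ‖weakGrad Ω u z (z - y)‖ ^ 2 := fun z => by
    rw [gradNorm_eq_hsNorm]
    exact mul_nonneg (Real.rpow_nonneg (hsNorm_nonneg _) _) (sq_nonneg _)
  have hD0 : 0 ≤ D := integral_nonneg hw0
  have hder : ∀ s ∈ Icc r (σ * r), _ := fun s hs =>
    hu.hasDerivAt_normalizedEnergy hp hΩ h y (hr.trans_le hs.1) (hsub s hs)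
  -- Mean value inequality on `[r, σr]`. The lower bound `C` for the derivative combines `s^{p-m-1}
  -- ≥ (σr)^{p-m-1}` (the exponent is negative), `-ψ' ≥ ξ`, and `s|z - y| ≤ σr · 2r`.
  have key := (convex_Icc r (σ * r)).mul_sub_le_image_sub_of_le_deriv
    (f := normalizedEnergy p ψ Ω u y)
    (C := p * (σ * r) ^ (p - m - 1) * (ξ * (2 * σ * r ^ 2)⁻¹ * D))
    (fun s hs => (hder s hs).continuousAt.continuousWithinAt)
    (fun s hs => (hder s (interior_subset hs)).differentiableAt.differentiableWithinAt) ?_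
    r ⟨le_rfl, hrσ.le⟩ (σ * r) ⟨hrσ.le, le_rfl⟩ hrσ.le
  · refine le_trans (le_of_eq ?_) key
    rw [Real.mul_rpow hσ0.le hr.le]
    have e2 : r ^ (p - m - 2) = r ^ (p - m - 1) * r⁻¹ := by
      rw [← div_eq_mul_inv, ← Real.rpow_sub_one hr.ne']; congr 1; ring
    rw [e2]
    field_simp
  · intro s hs
    have hs' := interior_subset hs
    have hs0 : 0 < s := hr.trans_le hs'.1
    rw [(hder s hs').deriv, ← mul_neg]
    have h1 : (σ * r) ^ (p - m - 1) ≤ s ^ (p - m - 1) :=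
      Real.rpow_le_rpow_of_nonpos hs0 hs'.2 (by linarith)
    have i3 := hu.1.integrableOn_radial_weight hp h y hs0
    have h2 : ξ * (2 * σ * r ^ 2)⁻¹ * D ≤ -∫ z in Ω, derivWithin ψ (Ici 0) (‖z - y‖ / s) *
        (s * ‖z - y‖)⁻¹ * (gradNorm Ω u z ^ (p - 2) * ‖weakGrad Ω u z (z - y)‖ ^ 2) := by
      rw [← integral_neg]
      refine le_trans ?_ (setIntegral_mono_set i3.neg (Eventually.of_forall fun z => ?_)
        (LE.le.eventuallyLE hbΩ))
      · rw [hD, ← integral_const_mul]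
        refine setIntegral_mono_on ?_ (i3.neg.mono_set hbΩ) measurableSet_ball fun z hz => ?_
        · refine (hu.1.integrableOn_weight hp y (R := 2 * r) measurableSet_ball hbΩ fun z hz => ?_).const_mul _
          rw [mem_ball] at hz
          rw [← dist_eq_norm]
          linarith [dist_triangle_right z y x]
        · rw [← neg_mul]
          rcases (norm_nonneg (z - y)).eq_or_lt with h0 | h0
          · have : z - y = 0 := norm_eq_zero.1 h0.symm
            rw [this]; simp
          · refine mul_le_mul_of_nonneg_right ?_ (hw0 z)
            rw [mem_ball] at hz
            have h3 : ‖z - y‖ < 2 * r := by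
              rw [← dist_eq_norm]; linarith [dist_triangle_right z y x]
            -- Both points lie in `B_r(x)` and `s ≥ r`, so the argument is below `2`; this is the
            -- role of `2 < ta`.
            have h4 := h.deriv_le (‖z - y‖ / s) ⟨by positivity, by
              rw [div_lt_iff₀ hs0]
              nlinarith [h.two_lt_ta, hs'.1]⟩
            rw [← neg_mul]
            refine mul_le_mul (by linarith) ?_ (by positivity) (by linarith [h.xi_pos])
            refine inv_anti₀ (by positivity) ?_
            calc s * ‖z - y‖ ≤ (σ * r) * (2 * r) := by gcongr; exact hs'.2
              _ = 2 * σ * r ^ 2 := by ring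
      · change 0 ≤ -(_)
        rw [neg_nonneg]
        refine mul_nonpos_of_nonpos_of_nonneg ?_ (hw0 z)
        exact mul_nonpos_of_nonpos_of_nonneg (h.derivWithin_nonpos (by positivity)) (by positivity)
    have hξ := h.xi_pos
    have h3 : 0 ≤ ξ * (2 * σ * r ^ 2)⁻¹ * D := by positivity
    gcongr

/-- By dominated convergence the normalized energy is continuous in its centre, and it is bounded by
a multiple of the total energy; this suffices on a set of finite measure. -/
theorem IsProfile.integrableOn_normalizedEnergy {p : ℝ} {Ω : Set (Euc m)} {u : Euc m → Euc L}
    (hf : IntegrableOn (fun z => gradNorm Ω u z ^ p) Ω)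
    {ψ : ℝ → ℝ} {ta tb ξ : ℝ} (h : IsProfile ψ ta tb ξ) {s : ℝ} (hs : 0 < s)
    {S : Set (Euc m)} {μ : Measure (Euc m)} (hμ : μ S < ⊤) :
    IntegrableOn (fun y => normalizedEnergy p ψ Ω u y s) S μ := by
  obtain ⟨B, hB0, hB, -⟩ := h.exists_bound
  have hbd : ∀ y z : Euc m, ‖ψ (‖z - y‖ / s) * gradNorm Ω u z ^ p‖ ≤ B * ‖gradNorm Ω u z ^ p‖ := by
    intro y z
    rw [norm_mul]
    exact mul_le_mul_of_nonneg_right (hB _ (by positivity)) (norm_nonneg _)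
  have hcont : Continuous fun y => ∫ z in Ω, ψ (‖z - y‖ / s) * gradNorm Ω u z ^ p := by
    refine continuous_of_dominated (bound := fun z => B * ‖gradNorm Ω u z ^ p‖)
      (fun y => (h.integrable_radial_mul hf y hs).1) (fun y => Eventually.of_forall (hbd y))
      (hf.norm.const_mul B) (Eventually.of_forall fun z => ?_)
    exact (h.continuous_comp_norm (by fun_prop : Continuous fun y : Euc m => ‖z - y‖ / s)
      fun y => by positivity).mul continuous_const
  refine Measure.integrableOn_of_bounded
    (M := ‖s ^ (p - m)‖ * ∫ z in Ω, B * ‖gradNorm Ω u z ^ p‖) hμ.ne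
    (continuous_const.mul hcont).aestronglyMeasurable (Eventually.of_forall fun y => ?_)
  rw [normalizedEnergy, norm_mul]
  refine mul_le_mul_of_nonneg_left ?_ (norm_nonneg _)
  exact norm_integral_le_of_norm_le (hf.norm.const_mul B) (Eventually.of_forall (hbd y))

end EnergyDrop


/-! ### Principal axes of a measure and the Jones number. -/

section Jones
open Filter Topology

variable {m L : ℕ}

theorem memLp_two_of_bounded {ν : Measure (Euc m)} [IsFiniteMeasure ν] {R : ℝ}
    (hR : ∀ᵐ y ∂ν, ‖y‖ ≤ R) : MemLp (id : Euc m → Euc m) 2 ν :=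
  MemLp.of_bound aestronglyMeasurable_id R hR

theorem integrable_of_bounded {F : Type*} [NormedAddCommGroup F] {ν : Measure (Euc m)}
    [IsFiniteMeasure ν] {R : ℝ} (hR : ∀ᵐ y ∂ν, ‖y‖ ≤ R) {f : Euc m → F} (hf : Continuous f) :
    Integrable f ν := by
  obtain ⟨B, hB⟩ := (isCompact_closedBall (0 : Euc m) R).exists_bound_of_continuousOn hf.continuousOn
  refine Integrable.of_bound hf.aestronglyMeasurable B ?_
  filter_upwards [hR] with y hy
  exact hB y (by simpa using hy)

/-- Principal axes of a centered measure with bounded support. -/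
theorem exists_principal_axes (ν : Measure (Euc m)) [IsFiniteMeasure ν] {R : ℝ}
    (hR : ∀ᵐ y ∂ν, ‖y‖ ≤ R) (hmean : ∫ y, y ∂ν = 0) :
    ∃ (b : OrthonormalBasis (Fin m) ℝ (Euc m)) (l : Fin m → ℝ), Antitone l ∧ (∀ i, 0 ≤ l i) ∧
      (∀ i, ∫ y, inner ℝ (b i) y ^ 2 ∂ν = l i) ∧
      ∀ (i : Fin m) (A : Euc m →L[ℝ] Euc L) (w : Euc m),
        l i * ‖A (b i)‖ ^ 2 ≤ ∫ y, ‖A (w - y)‖ ^ 2 ∂ν := by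
  have hν := memLp_two_of_bounded hR
  have hpos := ProbabilityTheory.isPositive_covarianceOperator (μ := ν)
  set T := ProbabilityTheory.covarianceOperator ν with hT
  have hsym : T.toLinearMap.IsSymmetric := hpos.1
  have hfin : Module.finrank ℝ (Euc m) = m := by simp
  set b := hsym.eigenvectorBasis hfin with hb
  set l := hsym.eigenvalues hfin with hl
  have hTb : ∀ i, T (b i) = l i • b i := fun i => hsym.apply_eigenvectorBasis hfin i
  have hlb : ∀ i, ∫ y, inner ℝ (b i) y ^ 2 ∂ν = l i := by
    intro i
    have := ProbabilityTheory.covarianceOperator_inner hν (b i) (b i)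
    rw [← hT, hTb, real_inner_smul_left, real_inner_self_eq_norm_sq, b.norm_eq_one] at this
    simp only [sq]
    rw [← this]; ring
  refine ⟨b, l, hsym.eigenvalues_antitone hfin, fun i => ?_, hlb, fun i A w => ?_⟩
  · rw [← hlb i]; exact integral_nonneg fun y => sq_nonneg _
  · have i1 : Integrable (fun y => ‖A (w - y)‖ ^ 2) ν := integrable_of_bounded hR (by fun_prop)
    have i2 : Integrable (fun y => inner ℝ (b i) y * inner ℝ (A (w - y)) (A (b i))) ν :=
      integrable_of_bounded hR (by fun_prop)
    have i3 : Integrable (fun y => inner ℝ (b i) y ^ 2) ν := integrable_of_bounded hR (by fun_prop)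
    have hmean' : ∫ y, inner ℝ (b i) y ∂ν = 0 := by
      have h1 : Integrable (fun y : Euc m => y) ν := integrable_of_bounded hR continuous_id
      rw [integral_inner h1, hmean, inner_zero_right]
    have e2 : ∫ y, inner ℝ (b i) y * inner ℝ (A (w - y)) (A (b i)) ∂ν = - (l i * ‖A (b i)‖ ^ 2) := by
      have e3 : ∀ y, inner ℝ (b i) y * inner ℝ (A (w - y)) (A (b i)) =
          inner ℝ (A w) (A (b i)) * inner ℝ (b i) y -
            inner ℝ (b i) y * inner ℝ (A.adjoint (A (b i))) y := by
        intro y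
        rw [map_sub, inner_sub_left, ContinuousLinearMap.adjoint_inner_left,
          real_inner_comm (A y)]
        ring
      simp_rw [e3]
      rw [integral_sub ((integrable_of_bounded hR (by fun_prop)).const_mul _)
        (integrable_of_bounded hR (by fun_prop)), integral_const_mul, hmean',
        ← ProbabilityTheory.covarianceOperator_inner hν, ← hT, hTb, real_inner_smul_left,
        ContinuousLinearMap.adjoint_inner_right, real_inner_self_eq_norm_sq]
      ring
    -- Expand the square. Since `b i` is an eigenvector of the second moment form and `ν` is
    -- centred, the cross term is `-2 l i ‖A (b i)‖²`, independently of `w`, and the last term is `l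
    -- i ‖A (b i)‖²`. Rearranging gives the claim.
    have h0 : 0 ≤ ∫ y, ‖A (w - y) + (inner ℝ (b i) y : ℝ) • A (b i)‖ ^ 2 ∂ν :=
      integral_nonneg fun y => sq_nonneg _
    have e4 : ∀ y, ‖A (w - y) + (inner ℝ (b i) y : ℝ) • A (b i)‖ ^ 2 =
        ‖A (w - y)‖ ^ 2 + 2 * (inner ℝ (b i) y * inner ℝ (A (w - y)) (A (b i))) +
          inner ℝ (b i) y ^ 2 * ‖A (b i)‖ ^ 2 := by
      intro y
      rw [norm_add_sq_real, real_inner_smul_right, norm_smul, mul_pow, Real.norm_eq_abs, sq_abs]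
    simp_rw [e4] at h0
    have i4 : Integrable (fun y => ‖A (w - y)‖ ^ 2 +
      2 * (inner ℝ (b i) y * inner ℝ (A (w - y)) (A (b i)))) ν := i1.add (i2.const_mul 2)
    rw [integral_add i4 (i3.mul_const _), integral_add i1 (i2.const_mul 2), integral_const_mul,
      integral_mul_const, hlb, e2] at h0
    linarith

theorem jonesNumber_sq_le_of_affine (k : ℕ) (μ : Measure (Euc m)) (x : Euc m) {r : ℝ} (hr : 0 < r) {I : ℝ}
    (A : AffineSubspace ℝ (Euc m)) (hA : (A : Set (Euc m)).Nonempty)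
    (hk : Module.finrank ℝ A.direction = k)
    (hI : ∫ y in ball x r, infDist y (A : Set (Euc m)) ^ 2 / r ^ 2 ∂μ ≤ I) :
    jonesNumber k μ x r ^ 2 ≤ (r ^ k)⁻¹ * I := by
  unfold jonesNumber
  have hnn : ∀ J ∈ {I : ℝ | ∃ A : AffineSubspace ℝ (Euc m), (A : Set (Euc m)).Nonempty ∧
      Module.finrank ℝ A.direction = k ∧
      I = ∫ y in ball x r, infDist y (A : Set (Euc m)) ^ 2 / r ^ 2 ∂μ}, 0 ≤ J := by
    rintro J ⟨A, -, -, rfl⟩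
    exact integral_nonneg fun y => by positivity
  rw [Real.sq_sqrt (mul_nonneg (by positivity) (Real.sInf_nonneg hnn))]
  refine mul_le_mul_of_nonneg_left ?_ (by positivity)
  exact (csInf_le ⟨0, hnn⟩ ⟨A, hA, hk, rfl⟩).trans hI

theorem finrank_span_orthonormalBasis (b : OrthonormalBasis (Fin m) ℝ (Euc m)) (s : Finset (Fin m)) :
    Module.finrank ℝ (Submodule.span ℝ (s.image b : Set (Euc m))) = s.card := by
  classical
  rw [Module.finrank_eq_card_basis (OrthonormalBasis.span b.orthonormal s).toBasis]
  simp

theorem normAlong_span_sq (b : OrthonormalBasis (Fin m) ℝ (Euc m)) (s : Finset (Fin m))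
    (A : Euc m →L[ℝ] Euc L) :
    normAlong (Submodule.span ℝ (s.image b : Set (Euc m))) A ^ 2 = ∑ i ∈ s, ‖A (b i)‖ ^ 2 := by
  classical
  have := normAlong_eq _ A (OrthonormalBasis.span b.orthonormal s)
  rw [this, Real.sq_sqrt (Finset.sum_nonneg fun _ _ => sq_nonneg _)]
  simp only [OrthonormalBasis.span_apply]
  exact Finset.sum_coe_sort s fun i => ‖A (b i)‖ ^ 2

theorem infDist_affine_sq_le (b : OrthonormalBasis (Fin m) ℝ (Euc m)) (s : Finset (Fin m))
    (c y : Euc m) :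
    infDist y (AffineSubspace.mk' c (Submodule.span ℝ (s.image b : Set (Euc m))) : Set (Euc m)) ^ 2 ≤
      ∑ i ∈ sᶜ, inner ℝ (b i) (y - c) ^ 2 := by
  have h1 : (∑ i ∈ s, (inner ℝ (b i) (y - c) : ℝ) • b i) + c ∈
      (AffineSubspace.mk' c (Submodule.span ℝ (s.image b : Set (Euc m))) : Set (Euc m)) := by
    rw [SetLike.mem_coe, AffineSubspace.mem_mk']
    simp only [vsub_eq_sub, add_sub_cancel_right]
    refine Submodule.sum_mem _ fun i hi => Submodule.smul_mem _ _ (Submodule.subset_span ?_)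
    exact Finset.mem_coe.2 (Finset.mem_image_of_mem _ hi)
  have h2 := infDist_le_dist_of_mem (x := y) h1
  refine (pow_le_pow_left₀ infDist_nonneg h2 2).trans (le_of_eq ?_)
  have h3 : y - ((∑ i ∈ s, (inner ℝ (b i) (y - c) : ℝ) • b i) + c) =
      ∑ i ∈ sᶜ, (inner ℝ (b i) (y - c) : ℝ) • b i := by
    have := b.sum_repr' (y - c)
    rw [← Finset.sum_add_sum_compl s] at this
    rw [add_comm, ← sub_sub]
    exact (eq_sub_of_add_eq' this).symm
  rw [dist_eq_norm, h3, ← real_inner_self_eq_norm_sq, b.orthonormal.inner_sum]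
  simp [sq]

/-- The Jones number is controlled by the `(k+1)`-st principal moment. -/
theorem exists_subspace_jonesNumber_sq_le (L : ℕ) {k : ℕ} (hk : k < m) (μ : Measure (Euc m)) (x : Euc m)
    {r : ℝ} (hr : 0 < r) (hμ : μ (ball x r) < ⊤) :
    ∃ (W : Submodule ℝ (Euc m)) (l : ℝ), Module.finrank ℝ W = k + 1 ∧ 0 ≤ l ∧
      jonesNumber k μ x r ^ 2 ≤ (r ^ k)⁻¹ * (m * l / r ^ 2) ∧
      ∀ (A : Euc m →L[ℝ] Euc L) (z : Euc m),
        l * normAlong W A ^ 2 ≤ (k + 1) * ∫ y in ball x r, ‖A (z - y)‖ ^ 2 ∂μ := by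
  classical
  have : IsFiniteMeasure (μ.restrict (ball x r)) := ⟨by simpa using hμ⟩
  -- Recentring at the centre of mass makes the first moments vanish, as `exists_principal_axes`
  -- requires.
  set c : Euc m := ⨍ y in ball x r, y ∂μ with hc
  set ν := (μ.restrict (ball x r)).map (fun y => y - c) with hν
  have hmeas : Measurable fun y : Euc m => y - c := by fun_prop
  have hR : ∀ᵐ y ∂ν, ‖y‖ ≤ r + ‖x - c‖ := by
    rw [hν, ae_map_iff hmeas.aemeasurable (measurableSet_le (by fun_prop) (by fun_prop)),
      ae_restrict_iff' measurableSet_ball]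
    refine Eventually.of_forall fun y hy => ?_
    rw [mem_ball, dist_eq_norm] at hy
    calc ‖y - c‖ = ‖(y - x) + (x - c)‖ := by rw [sub_add_sub_cancel]
      _ ≤ _ := (norm_add_le _ _).trans (by linarith)
  have hmap : ∀ {F : Type} [NormedAddCommGroup F] [NormedSpace ℝ F] {f : Euc m → F},
      Continuous f → ∫ y, f y ∂ν = ∫ y in ball x r, f (y - c) ∂μ := by
    intro F _ _ f hf
    rw [hν, integral_map hmeas.aemeasurable hf.aestronglyMeasurable]
  have hmean : ∫ y, y ∂ν = 0 := by
    rw [hmap (f := fun y : Euc m => y) continuous_id]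
    exact integral_sub_average (μ.restrict (ball x r)) fun y : Euc m => y
  obtain ⟨b, l, hl, hl0, hlb, hA⟩ := exists_principal_axes (L := L) ν hR hmean
  -- The indices start at `0` and the moments decrease. The plane spanned by `t` leaves the moments
  -- of index at least `k`, each at most `l k`; the space spanned by `s` has the moments of index at
  -- most `k`, each at least `l k`. So the single number `l k` serves both estimates.
  let s : Finset (Fin m) := Finset.univ.filter fun i => i.1 < k + 1
  let t : Finset (Fin m) := Finset.univ.filter fun i => i.1 < k
  have hs : s.card = k + 1 := by
    rw [Fin.card_filter_val_lt]; omega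
  have ht : t.card = k := by
    rw [Fin.card_filter_val_lt]; omega
  refine ⟨Submodule.span ℝ (s.image b : Set (Euc m)), l ⟨k, hk⟩,
    by rw [finrank_span_orthonormalBasis, hs], hl0 _, ?_, fun A z => ?_⟩
  · refine jonesNumber_sq_le_of_affine k μ x hr
      (AffineSubspace.mk' c (Submodule.span ℝ (t.image b : Set (Euc m))))
      (AffineSubspace.mk'_nonempty _ _)
      (by rw [AffineSubspace.direction_mk', finrank_span_orthonormalBasis, ht]) ?_
    have hi : ∀ i, Integrable (fun y => inner ℝ (b i) (y - c) ^ 2) (μ.restrict (ball x r)) := by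
      intro i
      have : Integrable (fun y => inner ℝ (b i) y ^ 2) ν := integrable_of_bounded hR (by fun_prop)
      rw [hν, integrable_map_measure (by fun_prop : Continuous fun y =>
        inner ℝ (b i) y ^ 2).aestronglyMeasurable hmeas.aemeasurable] at this
      exact this
    calc ∫ y in ball x r, infDist y (AffineSubspace.mk' c
          (Submodule.span ℝ (t.image b : Set (Euc m))) : Set (Euc m)) ^ 2 / r ^ 2 ∂μ
        ≤ ∫ y in ball x r, (∑ i ∈ tᶜ, inner ℝ (b i) (y - c) ^ 2) / r ^ 2 ∂μ := by
          refine integral_mono_of_nonneg (Eventually.of_forall fun y => by positivity)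
            ((integrable_finsetSum _ fun i _ => hi i).div_const _) (Eventually.of_forall fun y => ?_)
          exact div_le_div_of_nonneg_right (infDist_affine_sq_le b t c y) (by positivity)
      _ = (∑ i ∈ tᶜ, l i) / r ^ 2 := by
          rw [integral_div, integral_finsetSum _ fun i _ => hi i]
          congr 1
          refine Finset.sum_congr rfl fun i _ => ?_
          rw [← hlb i, hmap (f := fun y => inner ℝ (b i) y ^ 2) (by fun_prop)]
      _ ≤ m * l ⟨k, hk⟩ / r ^ 2 := by
          refine div_le_div_of_nonneg_right ?_ (by positivity)
          calc ∑ i ∈ tᶜ, l i ≤ ∑ i ∈ tᶜ, l ⟨k, hk⟩ := by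
                refine Finset.sum_le_sum fun i hi => hl ?_
                simp only [t, Finset.mem_compl, Finset.mem_filter, Finset.mem_univ, true_and,
                  not_lt] at hi
                exact hi
            _ = (tᶜ.card : ℝ) * l ⟨k, hk⟩ := by rw [Finset.sum_const, nsmul_eq_mul]
            _ ≤ m * l ⟨k, hk⟩ := by
                refine mul_le_mul_of_nonneg_right ?_ (hl0 _)
                exact_mod_cast (Finset.card_le_univ _).trans (by simp)
  · rw [normAlong_span_sq, Finset.mul_sum]
    have e : ∫ y, ‖A ((z - c) - y)‖ ^ 2 ∂ν = ∫ y in ball x r, ‖A (z - y)‖ ^ 2 ∂μ := by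
      rw [hmap (f := fun y => ‖A ((z - c) - y)‖ ^ 2) (by fun_prop)]
      simp
    calc ∑ i ∈ s, l ⟨k, hk⟩ * ‖A (b i)‖ ^ 2
        ≤ ∑ i ∈ s, ∫ y in ball x r, ‖A (z - y)‖ ^ 2 ∂μ := by
          refine Finset.sum_le_sum fun i hi => ?_
          rw [← e]
          refine le_trans (mul_le_mul_of_nonneg_right (hl ?_) (sq_nonneg _)) (hA i A (z - c))
          simp only [s, Finset.mem_filter, Finset.mem_univ, true_and] at hi
          exact Nat.lt_succ_iff.1 hi
      _ = _ := by rw [Finset.sum_const, hs, nsmul_eq_mul]; push_cast; ring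

theorem normAlong_nonneg (W : Submodule ℝ (Euc m)) (A : Euc m →L[ℝ] Euc L) : 0 ≤ normAlong W A :=
  Real.sqrt_nonneg _

theorem continuous_normAlong (W : Submodule ℝ (Euc m)) :
    Continuous (normAlong W : (Euc m →L[ℝ] Euc L) → ℝ) := by
  unfold normAlong; fun_prop

/-- By `sum_sq_norm_onb` both norms are computed from adjoints applied to a basis of the target. The
adjoint of the restriction to `W` pairs with vectors of `W` as the adjoint of `A` does, so
Cauchy–Schwarz shows that it is shorter. -/
theorem normAlong_le_hsNorm (W : Submodule ℝ (Euc m)) (A : Euc m →L[ℝ] Euc L) :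
    normAlong W A ≤ hsNorm A := by
  have h1 := normAlong_eq ⊤ A ((EuclideanSpace.basisFun (Fin m) ℝ).map
    (LinearIsometryEquiv.ofTop (Euc m) ⊤ rfl).symm)
  have h2 : hsNorm A = normAlong ⊤ A := by rw [h1, hsNorm]; simp
  rw [h2]
  unfold normAlong
  refine Real.sqrt_le_sqrt ?_
  rw [sum_sq_norm_onb W A, sum_sq_norm_onb ⊤ A]
  refine Finset.sum_le_sum fun j _ => ?_
  refine pow_le_pow_left₀ (norm_nonneg _) ?_ 2
  set v := stdOrthonormalBasis ℝ (Euc L) j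
  have e : ∀ (V : Submodule ℝ (Euc m)) (q : V),
      inner ℝ ((A.comp V.subtypeL).adjoint v) q = inner ℝ (A.adjoint v) (q : Euc m) := by
    intro V q
    rw [ContinuousLinearMap.adjoint_inner_left, ContinuousLinearMap.adjoint_inner_left]; rfl
  have e3 : ‖A.adjoint v‖ ≤ ‖(A.comp (⊤ : Submodule ℝ (Euc m)).subtypeL).adjoint v‖ := by
    have h5 := e ⊤ ⟨A.adjoint v, trivial⟩
    rw [real_inner_self_eq_norm_sq] at h5
    have h6 := real_inner_le_norm ((A.comp (⊤ : Submodule ℝ (Euc m)).subtypeL).adjoint v)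
      ⟨A.adjoint v, trivial⟩
    rw [h5, sq] at h6
    rcases (norm_nonneg (A.adjoint v)).eq_or_lt with h0 | h0
    · rw [← h0]; exact norm_nonneg _
    · exact le_of_mul_le_mul_right h6 h0
  refine le_trans ?_ e3
  have h5 := e W ((A.comp W.subtypeL).adjoint v)
  rw [real_inner_self_eq_norm_sq] at h5
  have h6 := real_inner_le_norm (A.adjoint v) (((A.comp W.subtypeL).adjoint v : W) : Euc m)
  rw [← h5, sq, Submodule.coe_norm] at h6
  rw [Submodule.coe_norm]
  rcases (norm_nonneg (((A.comp W.subtypeL).adjoint v : W) : Euc m)).eq_or_lt with h0 | h0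
  · rw [← h0]; exact norm_nonneg _
  · exact le_of_mul_le_mul_right h6 h0

end Jones


/-! ### Coercivity on subspaces, and the Jones number estimate it implies. -/

section JonesBound
open Filter Topology

variable {m L : ℕ}

theorem rpow_le_weight_of_two_le {p a b : ℝ} (hp : 2 ≤ p) (ha : 0 ≤ a) (hab : a ≤ b) :
    a ^ p ≤ b ^ (p - 2) * a ^ 2 := by
  have h1 : a ^ p = a ^ (p - 2) * a ^ 2 := by
    rcases ha.eq_or_lt with h0 | h0
    · rw [← h0, Real.zero_rpow (by linarith : p ≠ 0)]; simp
    · rw [← Real.rpow_natCast, ← Real.rpow_add h0]; congr 1; push_cast; ring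
  rw [h1]
  exact mul_le_mul_of_nonneg_right (Real.rpow_le_rpow ha hab (by linarith)) (sq_nonneg _)

/-- If `a ≤ δ^{1/p} b`, the first term alone suffices. Otherwise, since `p - 2` is negative,
`a^{p-2} ≤ δ^{(p-2)/p} b^{p-2}`, and the second term suffices. -/
theorem rpow_le_weight_of_lt_two {p a b δ : ℝ} (hp : 1 < p) (hp2 : p < 2) (hδ : 0 < δ) (ha : 0 ≤ a)
    (hab : a ≤ b) : a ^ p ≤ δ * b ^ p + δ ^ ((p - 2) / p) * (b ^ (p - 2) * a ^ 2) := by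
  have hb := ha.trans hab
  have hp0 : p ≠ 0 := by linarith
  rcases le_or_gt a (δ ^ (1 / p) * b) with h | h
  · have h1 : a ^ p ≤ δ * b ^ p := by
      refine (Real.rpow_le_rpow ha h (by linarith)).trans (le_of_eq ?_)
      rw [Real.mul_rpow (by positivity) hb, ← Real.rpow_mul hδ.le, one_div_mul_cancel hp0,
        Real.rpow_one]
    have h2 : 0 ≤ δ ^ ((p - 2) / p) * (b ^ (p - 2) * a ^ 2) := by positivity
    linarith
  · have ha' : 0 < a := lt_of_le_of_lt (by positivity) h
    have hb' : 0 < b := ha'.trans_le hab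
    have h1 : a ^ p = a ^ (p - 2) * a ^ 2 := by
      rw [← Real.rpow_natCast, ← Real.rpow_add ha']; congr 1; push_cast; ring
    have h2 : a ^ (p - 2) ≤ δ ^ ((p - 2) / p) * b ^ (p - 2) := by
      refine (Real.rpow_le_rpow_of_nonpos (by positivity) h.le (by linarith)).trans (le_of_eq ?_)
      rw [Real.mul_rpow (by positivity) hb, ← Real.rpow_mul hδ.le]
      congr 2; ring
    have h3 : 0 ≤ δ * b ^ p := by positivity
    rw [h1, ← mul_assoc]
    have := mul_le_mul_of_nonneg_right h2 (sq_nonneg a)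
    linarith

theorem MemW1p.integrableOn_normAlong_weight {p : ℝ} (hp : 1 < p) {Ω : Set (Euc m)}
    {N : Set (Euc L)} {u : Euc m → Euc L} (hu : MemW1p p Ω N u) (W : Submodule ℝ (Euc m)) :
    IntegrableOn (fun z => gradNorm Ω u z ^ (p - 2) * normAlong W (weakGrad Ω u z) ^ 2) Ω := by
  refine Integrable.mono' (hu.integrableOn_gradNorm_rpow (by linarith)) ?_
    (Eventually.of_forall fun z => ?_)
  · have h1 : AEStronglyMeasurable (fun z => gradNorm Ω u z) (volume.restrict Ω) := by
      simp only [gradNorm_eq_hsNorm]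
      exact continuous_hsNorm.comp_aestronglyMeasurable hu.memLp_weakGrad.1
    exact (h1.aemeasurable.pow_const _).aestronglyMeasurable.mul
      (((continuous_normAlong W).comp_aestronglyMeasurable hu.memLp_weakGrad.1).pow 2)
  · rw [gradNorm_eq_hsNorm, Real.norm_eq_abs, abs_of_nonneg (mul_nonneg
      (Real.rpow_nonneg (hsNorm_nonneg _) _) (sq_nonneg _)), ← hsNorm_rpow_sub_two_mul p hp]
    exact mul_le_mul_of_nonneg_left (pow_le_pow_left₀ (normAlong_nonneg _ _)
      (normAlong_le_hsNorm _ _) 2) (Real.rpow_nonneg (hsNorm_nonneg _) _)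

theorem MemW1p.integrableOn_normAlong {p : ℝ} (hp : 1 < p) {Ω : Set (Euc m)}
    {N : Set (Euc L)} {u : Euc m → Euc L} (hu : MemW1p p Ω N u) (W : Submodule ℝ (Euc m)) :
    IntegrableOn (fun z => normAlong W (weakGrad Ω u z) ^ p) Ω := by
  refine Integrable.mono' (hu.integrableOn_gradNorm_rpow (by linarith)) ?_
    (Eventually.of_forall fun z => ?_)
  · exact ((((continuous_normAlong W).comp_aestronglyMeasurable
      hu.memLp_weakGrad.1)).aemeasurable.pow_const _).aestronglyMeasurable
  · rw [gradNorm_eq_hsNorm, Real.norm_eq_abs, abs_of_nonneg (Real.rpow_nonneg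
      (normAlong_nonneg _ _) _)]
    exact Real.rpow_le_rpow (normAlong_nonneg _ _) (normAlong_le_hsNorm _ _) (by linarith)

/-- Failure of invariance bounds the energy along every `W` from below on the ball of radius `rbar *
r`; enlarging the ball to radius `r` only increases it. -/
theorem le_integral_normAlong_of_not_almostInvariant {p : ℝ} (hp : 1 < p) {Ω : Set (Euc m)}
    {N : Set (Euc L)} {u : Euc m → Euc L} (hu : MemW1p p Ω N u) {η rbar r : ℝ} (hr : 0 < r)
    (hrbar : 0 < rbar) (hrbar1 : rbar ≤ 1) {x : Euc m} (hx : ball x r ⊆ Ω) {k : ℕ}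
    (hinv : ¬ IsAlmostInvariant p Ω u η k x (rbar * r)) (W : Submodule ℝ (Euc m))
    (hW : Module.finrank ℝ W = k) :
    η * rbar ^ (m - p) * r ^ (m - p) ≤ ∫ z in ball x r, normAlong W (weakGrad Ω u z) ^ p := by
  have h1 : η ≤ (rbar * r) ^ (p - m) * ∫ z in ball x (rbar * r), normAlong W (weakGrad Ω u z) ^ p := by
    by_contra h
    exact hinv ⟨W, hW, not_le.1 h⟩
  have h2 : ∫ z in ball x (rbar * r), normAlong W (weakGrad Ω u z) ^ p ≤
      ∫ z in ball x r, normAlong W (weakGrad Ω u z) ^ p := by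
    refine setIntegral_mono_set ((hu.integrableOn_normAlong hp W).mono_set hx)
      (Eventually.of_forall fun z => Real.rpow_nonneg (normAlong_nonneg _ _) _)
      (LE.le.eventuallyLE (ball_subset_ball ?_))
    nlinarith
  refine le_trans ?_ h2
  have hpos : 0 < rbar * r := by positivity
  have h3 : (rbar * r) ^ (m - p) * (rbar * r) ^ (p - m) = 1 := by
    rw [← Real.rpow_add hpos]; simp
  rw [mul_assoc, ← Real.mul_rpow hrbar.le hr.le]
  have := mul_le_mul_of_nonneg_left h1 (Real.rpow_nonneg hpos.le (m - p))
  rw [← mul_assoc, h3, one_mul] at this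
  linarith

theorem coercive_of_two_le {p : ℝ} (hp : 2 ≤ p) {Ω : Set (Euc m)}
    {N : Set (Euc L)} {u : Euc m → Euc L} (hu : MemW1p p Ω N u) {η rbar r : ℝ} (hr : 0 < r)
    (hrbar : 0 < rbar) (hrbar1 : rbar ≤ 1) {x : Euc m} (hx : ball x r ⊆ Ω) {k : ℕ}
    (hinv : ¬ IsAlmostInvariant p Ω u η k x (rbar * r)) (W : Submodule ℝ (Euc m))
    (hW : Module.finrank ℝ W = k) :
    η * rbar ^ (m - p) * r ^ (m - p) ≤
      ∫ z in ball x r, gradNorm Ω u z ^ (p - 2) * normAlong W (weakGrad Ω u z) ^ 2 := by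
  refine (le_integral_normAlong_of_not_almostInvariant (by linarith) hu hr hrbar hrbar1 hx hinv W
    hW).trans ?_
  refine setIntegral_mono_on ((hu.integrableOn_normAlong (by linarith) W).mono_set hx)
    ((hu.integrableOn_normAlong_weight (by linarith) W).mono_set hx) measurableSet_ball fun z _ => ?_
  rw [gradNorm_eq_hsNorm]
  exact rpow_le_weight_of_two_le hp (normAlong_nonneg _ _) (normAlong_le_hsNorm _ _)

/-- After `rpow_le_weight_of_lt_two`, the term `δ ∫ |∇u|^p` is at most `δ E r^{m-p}`, and the choice
of `δ` makes this at most half of the lower bound coming from non-invariance. -/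
theorem coercive_of_lt_two {p : ℝ} (hp : 1 < p) (hp2 : p < 2) {Ω : Set (Euc m)}
    {N : Set (Euc L)} {u : Euc m → Euc L} (hu : MemW1p p Ω N u) {η rbar r δ E : ℝ} (hr : 0 < r)
    (hrbar : 0 < rbar) (hrbar1 : rbar ≤ 1) {x : Euc m} (hx : ball x r ⊆ Ω) {k : ℕ}
    (hinv : ¬ IsAlmostInvariant p Ω u η k x (rbar * r))
    (hE : ∫ z in ball x r, gradNorm Ω u z ^ p ≤ E * r ^ (m - p)) (hδ : 0 < δ)
    (hδE : δ * E ≤ η * rbar ^ (m - p) / 2) (W : Submodule ℝ (Euc m))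
    (hW : Module.finrank ℝ W = k) :
    (δ ^ ((p - 2) / p))⁻¹ * (η * rbar ^ (m - p) / 2) * r ^ (m - p) ≤
      ∫ z in ball x r, gradNorm Ω u z ^ (p - 2) * normAlong W (weakGrad Ω u z) ^ 2 := by
  have h1 := le_integral_normAlong_of_not_almostInvariant (by linarith) hu hr hrbar hrbar1 hx hinv W
    hW
  have i1 := (hu.integrableOn_gradNorm_rpow (p := p) (by linarith)).mono_set hx
  have i2 := (hu.integrableOn_normAlong_weight (by linarith) W).mono_set hx
  have h2 : ∫ z in ball x r, normAlong W (weakGrad Ω u z) ^ p ≤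
      ∫ z in ball x r, (δ * gradNorm Ω u z ^ p + δ ^ ((p - 2) / p) *
        (gradNorm Ω u z ^ (p - 2) * normAlong W (weakGrad Ω u z) ^ 2)) := by
    refine setIntegral_mono_on ((hu.integrableOn_normAlong (by linarith) W).mono_set hx)
      ((i1.const_mul _).add (i2.const_mul _)) measurableSet_ball fun z _ => ?_
    rw [gradNorm_eq_hsNorm]
    exact rpow_le_weight_of_lt_two hp hp2 hδ (normAlong_nonneg _ _) (normAlong_le_hsNorm _ _)
  rw [integral_add (i1.const_mul _) (i2.const_mul _), integral_const_mul, integral_const_mul] at h2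
  have hd : 0 < δ ^ ((p - 2) / p) := Real.rpow_pos_of_pos hδ _
  have hr' : 0 < r ^ (m - p) := Real.rpow_pos_of_pos hr _
  rw [mul_assoc, inv_mul_le_iff₀ hd]
  have h3 := mul_le_mul_of_nonneg_left hE hδ.le
  have h4 := mul_le_mul_of_nonneg_right hδE hr'.le
  nlinarith

/-- The moment `l` is estimated from above: coercivity bounds `l c₀ r^{m-p}` by `l` times the energy
along `W`, the moment inequality and Fubini bound that by `(k + 1) ∫ D dμ`, and `energy_drop` bounds
`D`. The factor `m` comes from the Jones number, `m + 1` from `k + 1`. -/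
theorem jonesNumber_sq_le_of_coercive {p : ℝ} (hp : 1 < p) (hpm : p < m) {Ω : Set (Euc m)}
    (hΩ : IsOpen Ω) {N : Set (Euc L)} {u : Euc m → Euc L} (hu : IsPMinimizing p Ω N u)
    {ψ : ℝ → ℝ} {ta tb ξ : ℝ} (h : IsProfile ψ ta tb ξ) {σ : ℝ} (hσ : 1 < σ) {x : Euc m} {r : ℝ}
    (hr : 0 < r) (hx : ball x ((1 + σ * tb) * r) ⊆ Ω) {k : ℕ} {c₀ : ℝ} (hc₀ : 0 < c₀)
    (hcoer : ∀ W : Submodule ℝ (Euc m), Module.finrank ℝ W = k + 1 → c₀ * r ^ (m - p) ≤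
      ∫ z in ball x r, gradNorm Ω u z ^ (p - 2) * normAlong W (weakGrad Ω u z) ^ 2)
    {μ : Measure (Euc m)} (hμ : IsRadonOn Ω μ) :
    IntegrableOn (fun y => normalizedEnergy p ψ Ω u y (σ * r) - normalizedEnergy p ψ Ω u y r)
      (ball x r) μ ∧
    jonesNumber k μ x r ^ 2 ≤
      m * (m + 1) / (c₀ * ((σ - 1) * (p * σ ^ (p - m - 1) * ξ / (2 * σ)))) * (r ^ k)⁻¹ *
      ∫ y in ball x r, (normalizedEnergy p ψ Ω u y (σ * r) - normalizedEnergy p ψ Ω u y r) ∂μ := by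
  have htb := h.tb_pos
  have hξ := h.xi_pos
  have hσ0 : 0 < σ := by linarith
  have hσ1 : 0 < σ - 1 := by linarith
  have hcb : closedBall x r ⊆ Ω := (closedBall_subset_ball (by nlinarith [mul_pos hσ0 htb])).trans hx
  have hbΩ : ball x r ⊆ Ω := ball_subset_closedBall.trans hcb
  have hμb : μ (ball x r) < ⊤ := (measure_mono ball_subset_closedBall).trans_lt
    (hμ _ (isCompact_closedBall x r) hcb)
  have hf := hu.1.integrableOn_gradNorm_rpow (p := p) (by linarith)
  have hdrop : IntegrableOn (fun y => normalizedEnergy p ψ Ω u y (σ * r) -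
      normalizedEnergy p ψ Ω u y r) (ball x r) μ :=
    (h.integrableOn_normalizedEnergy hf (by positivity) hμb).sub
      (h.integrableOn_normalizedEnergy hf hr hμb)
  refine ⟨hdrop, ?_⟩
  set c₁ := (σ - 1) * (p * σ ^ (p - m - 1) * ξ / (2 * σ)) with hc₁
  have hc₁0 : 0 < c₁ := by
    have : 0 < σ ^ (p - m - 1) := Real.rpow_pos_of_pos hσ0 _
    positivity
  set D : Euc m → ℝ := fun y => ∫ z in ball x r,
    gradNorm Ω u z ^ (p - 2) * ‖weakGrad Ω u z (z - y)‖ ^ 2 with hD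
  have hw0 : ∀ z, 0 ≤ gradNorm Ω u z ^ (p - 2) := fun z => by
    rw [gradNorm_eq_hsNorm]; exact Real.rpow_nonneg (hsNorm_nonneg _) _
  have hD0 : ∀ y, 0 ≤ D y := fun y => integral_nonneg fun z => mul_nonneg (hw0 z) (sq_nonneg _)
  have hdropD : ∀ y ∈ ball x r, c₁ * r ^ (p - m - 2) * D y ≤
      normalizedEnergy p ψ Ω u y (σ * r) - normalizedEnergy p ψ Ω u y r :=
    fun y hy => hu.energy_drop hp hpm hΩ h hσ hr hx hy
  have hr2 : 0 < r ^ (p - m - 2) := Real.rpow_pos_of_pos hr _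
  have hI0 : 0 ≤ ∫ y in ball x r,
      (normalizedEnergy p ψ Ω u y (σ * r) - normalizedEnergy p ψ Ω u y r) ∂μ :=
    setIntegral_nonneg measurableSet_ball fun y hy =>
      (mul_nonneg (by positivity) (hD0 y)).trans (hdropD y hy)
  set I := ∫ y in ball x r,
      (normalizedEnergy p ψ Ω u y (σ * r) - normalizedEnergy p ψ Ω u y r) ∂μ with hI
  -- Only `k < m` has content. For `k = m` the whole space is an admissible plane; for `k > m` there
  -- is none, and the infimum of the empty set is `0`.
  rcases lt_trichotomy k m with hk | hk | hk
  rotate_left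
  · subst hk
    have h1 := jonesNumber_sq_le_of_affine (I := 0) k μ x hr (⊤ : AffineSubspace ℝ (Euc k)) ⟨x, trivial⟩
      (by rw [AffineSubspace.direction_top, finrank_top]; simp) (by
        refine le_of_eq ?_
        simp [infDist_zero_of_mem])
    refine h1.trans ?_
    rw [mul_zero]
    positivity
  · have : {I : ℝ | ∃ A : AffineSubspace ℝ (Euc m), (A : Set (Euc m)).Nonempty ∧
      Module.finrank ℝ A.direction = k ∧
      I = ∫ y in ball x r, infDist y (A : Set (Euc m)) ^ 2 / r ^ 2 ∂μ} = ∅ := by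
      refine eq_empty_of_forall_notMem ?_
      rintro J ⟨A, -, hA, -⟩
      have := Submodule.finrank_le A.direction
      rw [hA] at this
      simp only [finrank_euclideanSpace, Fintype.card_fin] at this
      omega
    rw [jonesNumber, this, Real.sInf_empty]
    simp only [mul_zero, Real.sqrt_zero, ne_eq, OfNat.ofNat_ne_zero, not_false_eq_true, zero_pow]
    positivity
  have : IsFiniteMeasure (μ.restrict (ball x r)) := ⟨by simpa using hμb⟩
  obtain ⟨W, l, hW, hl0, hβ, hA⟩ := exists_subspace_jonesNumber_sq_le L hk μ x hr hμb
  -- Joint integrability for Fubini: the integrand is at most `|∇u(z)|^p (2r)²`, also when `p < 2`.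
  have hprod : Integrable (Function.uncurry fun z y =>
      gradNorm Ω u z ^ (p - 2) * ‖weakGrad Ω u z (z - y)‖ ^ 2)
      ((volume.restrict (ball x r)).prod (μ.restrict (ball x r))) := by
    have hG : AEStronglyMeasurable (weakGrad Ω u) (volume.restrict (ball x r)) :=
      hu.1.memLp_weakGrad.1.mono_measure (Measure.restrict_mono hbΩ le_rfl)
    have h1 : AEStronglyMeasurable (fun z => gradNorm Ω u z) (volume.restrict (ball x r)) := by
      simp only [gradNorm_eq_hsNorm]
      exact continuous_hsNorm.comp_aestronglyMeasurable hG
    have h2 : AEStronglyMeasurable (fun z => gradNorm Ω u z ^ (p - 2)) (volume.restrict (ball x r)) :=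
      (h1.aemeasurable.pow_const _).aestronglyMeasurable
    have h3 : AEStronglyMeasurable (fun q : Euc m × Euc m => q.1 - q.2)
        ((volume.restrict (ball x r)).prod (μ.restrict (ball x r))) :=
      (by fun_prop : Continuous fun q : Euc m × Euc m => q.1 - q.2).aestronglyMeasurable
    have hc : Continuous fun q : (Euc m →L[ℝ] Euc L) × Euc m => ‖q.1 q.2‖ ^ 2 := by fun_prop
    have h5 : AEStronglyMeasurable (fun q : Euc m × Euc m => weakGrad Ω u q.1)
        ((volume.restrict (ball x r)).prod (μ.restrict (ball x r))) := hG.comp_fst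
    have h4 : AEStronglyMeasurable (fun q : Euc m × Euc m => ‖weakGrad Ω u q.1 (q.1 - q.2)‖ ^ 2)
        ((volume.restrict (ball x r)).prod (μ.restrict (ball x r))) :=
      Continuous.comp_aestronglyMeasurable₂ (g := fun (A : Euc m →L[ℝ] Euc L) v => ‖A v‖ ^ 2) hc h5 h3
    have h6 : AEStronglyMeasurable (fun q : Euc m × Euc m => gradNorm Ω u q.1 ^ (p - 2))
        ((volume.restrict (ball x r)).prod (μ.restrict (ball x r))) := h2.comp_fst
    have h7 : Integrable (fun q : Euc m × Euc m => gradNorm Ω u q.1 ^ p * (2 * r) ^ 2)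
        ((volume.restrict (ball x r)).prod (μ.restrict (ball x r))) :=
      ((hf.mono_set hbΩ).mul_const ((2 * r) ^ 2)).comp_fst _
    refine Integrable.mono' h7 (h6.mul h4) ?_
    have hm1 : ∀ᵐ q ∂((volume.restrict (ball x r)).prod (μ.restrict (ball x r))), q.1 ∈ ball x r :=
      Measure.quasiMeasurePreserving_fst.ae (ae_restrict_mem measurableSet_ball)
    have hm2 : ∀ᵐ q ∂((volume.restrict (ball x r)).prod (μ.restrict (ball x r))), q.2 ∈ ball x r :=
      Measure.quasiMeasurePreserving_snd.ae (ae_restrict_mem measurableSet_ball)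
    filter_upwards [hm1, hm2] with q hq1 hq2
    rw [Function.uncurry, Real.norm_eq_abs, abs_of_nonneg (mul_nonneg (hw0 _) (sq_nonneg _)),
      gradNorm_eq_hsNorm]
    refine (hsNorm_rpow_mul_apply_sq_le hp _ _).trans ?_
    refine mul_le_mul_of_nonneg_left (pow_le_pow_left₀ (norm_nonneg _) ?_ 2)
      (Real.rpow_nonneg (hsNorm_nonneg _) _)
    rw [mem_ball] at hq1 hq2
    rw [← dist_eq_norm]
    linarith [dist_triangle_right q.1 q.2 x]
  have hswap := integral_integral_swap hprod
  have hDint : IntegrableOn D (ball x r) μ := hprod.integral_prod_right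
  have k1 : l * (c₀ * r ^ (m - p)) ≤ (k + 1) * ∫ y in ball x r, D y ∂μ := by
    refine (mul_le_mul_of_nonneg_left (hcoer W hW) hl0).trans ?_
    rw [← hswap, ← integral_const_mul, ← integral_const_mul]
    refine integral_mono (((hu.1.integrableOn_normAlong_weight hp W).mono_set hbΩ).const_mul l)
      (hprod.integral_prod_left.const_mul _) fun z => ?_
    have := mul_le_mul_of_nonneg_left (hA (weakGrad Ω u z) z) (hw0 z)
    simp only [integral_const_mul]
    linarith
  have k2 : c₁ * r ^ (p - m - 2) * ∫ y in ball x r, D y ∂μ ≤ I := by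
    rw [← integral_const_mul]
    exact setIntegral_mono_on (hDint.const_mul _) hdrop measurableSet_ball hdropD
  -- The powers of `r` from the energy drop, the coercivity and the Jones number cancel, so the
  -- constant is scale invariant.
  have hrr : r ^ (p - m - 2) * (r ^ (m - p) * r ^ 2) = 1 := by
    rw [← Real.rpow_natCast r 2, ← Real.rpow_add hr, ← Real.rpow_add hr]
    norm_num
  have hkm : (k : ℝ) + 1 ≤ m + 1 := by
    have : (k : ℝ) < m := by exact_mod_cast hk
    linarith
  have k3 : c₀ * c₁ * (l / r ^ 2) ≤ (m + 1) * I := by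
    have e1 : c₀ * c₁ * (l / r ^ 2) = (c₁ * r ^ (p - m - 2)) * (l * (c₀ * r ^ (m - p))) := by
      rw [mul_div_assoc', div_eq_iff (by positivity)]
      calc c₀ * c₁ * l = c₀ * c₁ * l * (r ^ (p - m - 2) * (r ^ (m - p) * r ^ 2)) := by rw [hrr, mul_one]
        _ = _ := by ring
    rw [e1]
    calc (c₁ * r ^ (p - m - 2)) * (l * (c₀ * r ^ (m - p)))
        ≤ (c₁ * r ^ (p - m - 2)) * ((k + 1) * ∫ y in ball x r, D y ∂μ) :=
          mul_le_mul_of_nonneg_left k1 (by positivity)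
      _ = (k + 1) * (c₁ * r ^ (p - m - 2) * ∫ y in ball x r, D y ∂μ) := by ring
      _ ≤ (k + 1) * I := mul_le_mul_of_nonneg_left k2 (by positivity)
      _ ≤ (m + 1) * I := mul_le_mul_of_nonneg_right hkm hI0
  refine hβ.trans ?_
  have e2 : (m : ℝ) * (m + 1) / (c₀ * c₁) * (r ^ k)⁻¹ * I =
      (r ^ k)⁻¹ * (m * (((m + 1) * I) / (c₀ * c₁))) := by ring
  rw [e2]
  refine mul_le_mul_of_nonneg_left ?_ (by positivity)
  rw [mul_div_assoc]
  refine mul_le_mul_of_nonneg_left ?_ (by positivity)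
  rw [le_div_iff₀ (by positivity)]
  linarith

end JonesBound


/-! ### Lipschitz neighbourhood retraction onto a closed submanifold. -/

section Retraction
open Filter Topology

variable {L : ℕ}

/-- In the straightening chart the orthogonal projection onto `V` is a retraction `R`. The map `y +
χ y • (R y - y)` with a cut-off `χ` is defined and Lipschitz everywhere, fixes all of `N`, and
equals `R` near `q`. -/
theorem exists_local_retraction {N : Set (Euc L)} (Φ : OpenPartialHomeomorph (Euc L) (Euc L))
    (V : Submodule ℝ (Euc L)) {q : Euc L} (hqN : q ∈ N) (hq : q ∈ Φ.source)
    (h1 : ContDiffOn ℝ ∞ Φ Φ.source) (h2 : ContDiffOn ℝ ∞ Φ.symm Φ.target)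
    (hV : ∀ z ∈ Φ.source, (z ∈ N ↔ Φ z ∈ V)) :
    ∃ (S : Euc L → Euc L) (K : NNReal) (δ : ℝ), LipschitzWith K S ∧ 0 < δ ∧ (∀ y ∈ N, S y = y) ∧
      ∀ y ∈ ball q δ, S y ∈ N := by
  have hPid : ∀ v ∈ V, V.starProjection v = v := fun v hv =>
    Submodule.starProjection_eq_self_iff.2 hv
  set O : Set (Euc L) := Φ.source ∩ (fun y => V.starProjection (Φ y)) ⁻¹' Φ.target with hO
  have hcont : ContinuousOn (fun y => V.starProjection (Φ y)) Φ.source :=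
    V.starProjection.continuous.comp_continuousOn h1.continuousOn
  have hOo : IsOpen O := hcont.isOpen_inter_preimage Φ.open_source Φ.open_target
  have hqO : q ∈ O := ⟨hq, by
    change V.starProjection (Φ q) ∈ Φ.target
    rw [hPid _ ((hV q hq).1 hqN)]; exact Φ.map_source hq⟩
  set R : Euc L → Euc L := fun y => Φ.symm (V.starProjection (Φ y)) with hR
  have hRs : ContDiffOn ℝ ∞ R O :=
    h2.comp ((V.starProjection.contDiff.comp_contDiffOn h1).mono inter_subset_left)
      fun y hy => hy.2
  have hRN : ∀ y ∈ O, R y ∈ N := by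
    intro y hy
    have hs : R y ∈ Φ.source := Φ.map_target hy.2
    rw [hV _ hs, hR]
    change Φ (Φ.symm _) ∈ V
    rw [Φ.right_inv hy.2]
    exact Submodule.starProjection_apply_mem _ _
  have hRid : ∀ y ∈ O, y ∈ N → R y = y := by
    intro y hy hyN
    change Φ.symm (V.starProjection (Φ y)) = y
    rw [hPid _ ((hV y hy.1).1 hyN), Φ.left_inv hy.1]
  obtain ⟨ε, hε, hεO⟩ := Metric.isOpen_iff.1 hOo q hqO
  let χ : ContDiffBump q := ⟨ε / 4, ε / 2, by positivity, by linarith⟩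
  have htsup : tsupport (χ : Euc L → ℝ) ⊆ O := by
    rw [χ.tsupport_eq]
    exact (closedBall_subset_ball (by change ε / 2 < ε; linarith)).trans hεO
  have hW : ContDiff ℝ 1 fun y => χ y • (R y - y) := by
    refine contDiff_iff_contDiffAt.2 fun y => ?_
    by_cases hy : y ∈ O
    · have hRy : ContDiffAt ℝ 1 R y := ((hRs y hy).contDiffAt (hOo.mem_nhds hy)).of_le (by simp)
      exact χ.contDiff.contDiffAt.smul (hRy.sub contDiffAt_id)
    · have h3 : (fun y => χ y • (R y - y)) =ᶠ[𝓝 y] fun _ => 0 := by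
        have := (isClosed_tsupport (χ : Euc L → ℝ)).isOpen_compl.mem_nhds fun h => hy (htsup h)
        filter_upwards [this] with z hz
        rw [image_eq_zero_of_notMem_tsupport hz, zero_smul]
      exact contDiffAt_const.congr_of_eventuallyEq h3
  have hWc : HasCompactSupport fun y => χ y • (R y - y) := χ.hasCompactSupport.smul_right
  obtain ⟨K, hK⟩ := hW.lipschitzWith_of_hasCompactSupport hWc (by simp)
  refine ⟨fun y => y + χ y • (R y - y), 1 + K, ε / 4, LipschitzWith.id.add hK, by positivity,
    fun y hy => ?_, fun y hy => ?_⟩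
  · by_cases hyO : y ∈ O
    · simp [hRid y hyO hy]
    · have : χ y = 0 := image_eq_zero_of_notMem_tsupport fun h => hyO (htsup h)
      simp [this]
  · have h1 : χ y = 1 := χ.one_of_mem_closedBall (ball_subset_closedBall hy)
    have h2 : y ∈ O := hεO (ball_subset_ball (by linarith) hy)
    simpa [h1] using hRN y h2

/-- A closed submanifold is a Lipschitz neighbourhood retract. -/
theorem IsClosedSubmanifold.exists_retraction {N : Set (Euc L)} (hN : IsClosedSubmanifold N) :
    ∃ (S : Euc L → Euc L) (K : NNReal) (δ : ℝ), LipschitzWith K S ∧ 0 < δ ∧ (∀ y ∈ N, S y = y) ∧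
      ∀ q ∈ N, ∀ y ∈ ball q δ, S y ∈ N := by
  obtain ⟨hc, n, hloc⟩ := hN
  have key : ∀ A : Set (Euc L), IsCompact A → A ⊆ N → ∃ (S : Euc L → Euc L) (K : NNReal) (δ : ℝ),
      LipschitzWith K S ∧ 0 < δ ∧ (∀ y ∈ N, S y = y) ∧ ∀ q ∈ A, ∀ y ∈ ball q δ, S y ∈ N := by
    intro A hA hAN
    refine hA.induction_on (p := fun A => ∃ (S : Euc L → Euc L) (K : NNReal) (δ : ℝ),
      LipschitzWith K S ∧ 0 < δ ∧ (∀ y ∈ N, S y = y) ∧ ∀ q ∈ A ∩ N, ∀ y ∈ ball q δ, S y ∈ N)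
      ?_ ?_ ?_ ?_ |>.imp fun S => ?_
    · exact ⟨id, 1, 1, LipschitzWith.id, one_pos, fun _ _ => rfl, by simp⟩
    · rintro s t hst ⟨S, K, δ, h1, h2, h3, h4⟩
      exact ⟨S, K, δ, h1, h2, h3, fun q hq => h4 q ⟨hst hq.1, hq.2⟩⟩
    -- Retractions for two pieces are composed. Near the first piece `S` already lands in `N`, which
    -- `S'` fixes; near the second, `S` moves points by a controlled amount and `S'` finishes. This
    -- works because each map fixes all of `N`.
    · rintro s t ⟨S, K, δ, h1, h2, h3, h4⟩ ⟨S', K', δ', h1', h2', h3', h4'⟩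
      refine ⟨S' ∘ S, K' * K, min δ (δ' / (K + 1)), h1'.comp h1, by positivity,
        fun y hy => by rw [Function.comp, h3 y hy, h3' y hy], ?_⟩
      rintro q ⟨hq, hqN⟩ y hy
      rw [mem_ball, lt_min_iff] at hy
      rcases hq with hq | hq
      · have := h4 q ⟨hq, hqN⟩ y hy.1
        rw [Function.comp, h3' _ this]; exact this
      · refine h4' q ⟨hq, hqN⟩ (S y) ?_
        have h5 := h1.dist_le_mul y q
        rw [h3 q hqN] at h5
        rw [mem_ball]
        have h6 := hy.2
        rw [lt_div_iff₀ (by positivity)] at h6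
        nlinarith [dist_nonneg (x := y) (y := q)]
    · intro q hq
      obtain ⟨Φ, V, hqs, c1, c2, -, hV⟩ := hloc q (hAN hq)
      obtain ⟨S, K, δ, h1, h2, h3, h4⟩ := exists_local_retraction Φ V (hAN hq) hqs c1 c2 hV
      refine ⟨ball q (δ / 2), mem_nhdsWithin_of_mem_nhds (ball_mem_nhds q (by positivity)), S, K,
        δ / 2, h1, by positivity, h3, ?_⟩
      rintro q' ⟨hq', -⟩ y hy
      refine h4 y ?_
      rw [mem_ball] at *
      linarith [dist_triangle y q' q]
    · rintro ⟨K, δ, h1, h2, h3, h4⟩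
      exact ⟨K, δ, h1, h2, h3, fun q hq => h4 q ⟨hq, hAN hq⟩⟩
  exact key N hc le_rfl

end Retraction


/-! ### A map through the edges of a grid, singular in codimension two. -/

section GridMap
open Filter Topology

variable {L : ℕ}

/-- The distance of `t` to `ℤ + 1/2`. -/
noncomputable def halfDist (t : ℝ) : ℝ := |t - ⌊t⌋ - 1 / 2|

theorem halfDist_nonneg (t : ℝ) : 0 ≤ halfDist t := abs_nonneg _

theorem halfDist_le_half (t : ℝ) : halfDist t ≤ 1 / 2 := by
  unfold halfDist
  rw [abs_le]
  constructor <;> linarith [Int.floor_le t, Int.lt_floor_add_one t]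

theorem halfDist_le (t : ℝ) (k : ℤ) : halfDist t ≤ |t - k - 1 / 2| := by
  rcases lt_trichotomy k ⌊t⌋ with h | h | h
  · have h1 : (k : ℝ) + 1 ≤ ⌊t⌋ := by exact_mod_cast h
    refine (halfDist_le_half t).trans (le_trans ?_ (le_abs_self _))
    linarith [Int.floor_le t]
  · rw [h]; rfl
  · have h1 : (⌊t⌋ : ℝ) + 1 ≤ k := by exact_mod_cast h
    refine (halfDist_le_half t).trans (le_trans ?_ (neg_le_abs _))
    linarith [Int.lt_floor_add_one t]

theorem halfDist_le_add (s t : ℝ) : halfDist s ≤ halfDist t + |s - t| := by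
  refine (halfDist_le s ⌊t⌋).trans ?_
  have : s - ⌊t⌋ - 1 / 2 = (t - ⌊t⌋ - 1 / 2) + (s - t) := by ring
  rw [this]
  exact abs_add_le _ _

/-- Rounding to the nearest integer jumps only at half-integers, and none is met within `halfDist t`
of `t`. -/
theorem round_eq_of_lt_halfDist {s t : ℝ} (h : |s - t| < halfDist t) :
    ⌊s + 1 / 2⌋ = ⌊t + 1 / 2⌋ := by
  have h1 := h.trans_le (halfDist_le t ⌊t + 1 / 2⌋)
  have h2 := h.trans_le (halfDist_le t (⌊t + 1 / 2⌋ - 1))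
  have h3 := Int.floor_le (t + 1 / 2)
  have h4 := Int.lt_floor_add_one (t + 1 / 2)
  push_cast at h2
  rw [abs_of_neg (by linarith : t - ⌊t + 1 / 2⌋ - 1 / 2 < 0)] at h1
  rw [abs_of_nonneg (by linarith : 0 ≤ t - (⌊t + 1 / 2⌋ - 1) - 1 / 2)] at h2
  rw [abs_lt] at h1 h2
  rw [Int.floor_eq_iff]
  constructor <;> linarith

/-- The smallest value of `max (halfDist (y l)) (halfDist (y l'))` over pairs `l ≠ l'`, cut off at
`1/2`. -/
noncomputable def gridGap (y : Fin L → ℝ) : ℝ :=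
  ⨅ q : Option {q : Fin L × Fin L // q.1 ≠ q.2},
    q.elim (1 / 2) fun q => max (halfDist (y q.1.1)) (halfDist (y q.1.2))

theorem exists_gridGap_eq (y : Fin L → ℝ) : gridGap y = 1 / 2 ∨
    ∃ l l' : Fin L, l ≠ l' ∧ gridGap y = max (halfDist (y l)) (halfDist (y l')) := by
  obtain ⟨q, hq⟩ := exists_eq_ciInf_of_finite (f := fun q : Option {q : Fin L × Fin L // q.1 ≠ q.2} =>
    q.elim (1 / 2 : ℝ) fun q => max (halfDist (y q.1.1)) (halfDist (y q.1.2)))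
  rcases q with _ | q
  · exact Or.inl hq.symm
  · exact Or.inr ⟨_, _, q.2, hq.symm⟩

theorem gridGap_nonneg (y : Fin L → ℝ) : 0 ≤ gridGap y := by
  rcases exists_gridGap_eq y with h | ⟨l, l', -, h⟩ <;> rw [h]
  · norm_num
  · exact le_max_of_le_left (halfDist_nonneg _)

theorem gridGap_le_half (y : Fin L → ℝ) : gridGap y ≤ 1 / 2 :=
  ciInf_le (Set.finite_range _).bddBelow (none : Option {q : Fin L × Fin L // q.1 ≠ q.2})

theorem gridGap_le_max (y : Fin L → ℝ) {l l' : Fin L} (h : l ≠ l') :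
    gridGap y ≤ max (halfDist (y l)) (halfDist (y l')) :=
  ciInf_le (Set.finite_range _).bddBelow
    (some ⟨(l, l'), h⟩ : Option {q : Fin L × Fin L // q.1 ≠ q.2})

theorem gridGap_le_add (y y' : Fin L → ℝ) : gridGap y ≤ gridGap y' + ‖y - y'‖ := by
  rcases exists_gridGap_eq y' with h | ⟨l, l', hne, h⟩ <;> rw [h]
  · linarith [gridGap_le_half y, norm_nonneg (y - y')]
  · refine (gridGap_le_max y hne).trans ?_
    have h1 : ∀ l, |y l - y' l| ≤ ‖y - y'‖ := fun l => norm_le_pi_norm (y - y') l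
    refine max_le ?_ ?_
    · linarith [halfDist_le_add (y l) (y' l), h1 l, le_max_left (halfDist (y' l)) (halfDist (y' l'))]
    · linarith [halfDist_le_add (y l') (y' l'), h1 l',
        le_max_right (halfDist (y' l)) (halfDist (y' l'))]

theorem continuous_gridGap : Continuous (gridGap : (Fin L → ℝ) → ℝ) := by
  refine (LipschitzWith.of_dist_le_mul (K := 1) fun y y' => ?_).continuous
  rw [NNReal.coe_one, one_mul, Real.dist_eq, dist_eq_norm, abs_le]
  have h1 := gridGap_le_add y y'
  have h2 := gridGap_le_add y' y
  rw [norm_sub_rev] at h2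
  constructor <;> linarith

/-- The clamping of a real number to `[0, 1]`. -/
noncomputable def clamp (t : ℝ) : ℝ := max 0 (min 1 t)

theorem clamp_mem (t : ℝ) : clamp t ∈ Icc (0 : ℝ) 1 :=
  ⟨le_max_left _ _, max_le zero_le_one (min_le_left _ _)⟩

theorem clamp_of_nonpos {t : ℝ} (h : t ≤ 0) : clamp t = 0 :=
  max_eq_left ((min_le_right _ _).trans h)

theorem clamp_of_one_le {t : ℝ} (h : 1 ≤ t) : clamp t = 1 := by
  rw [clamp, min_eq_left h, max_eq_right zero_le_one]

theorem abs_clamp_sub_le (s t : ℝ) : |clamp s - clamp t| ≤ |s - t| := by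
  unfold clamp
  refine (abs_max_sub_max_le_max _ _ _ _).trans ?_
  rw [sub_self, abs_zero, max_eq_right (abs_nonneg _)]
  refine (abs_min_sub_min_le_max _ _ _ _).trans ?_
  rw [sub_self, abs_zero, max_eq_right (abs_nonneg _)]

/-- The nearest grid point. -/
noncomputable def gridRound (y : Fin L → ℝ) : Fin L → ℤ := fun l => ⌊y l + 1 / 2⌋

/-- The map along the grid edge in direction `l` at the grid point `v`. -/
noncomputable def edgeMap {E : Type*} (P : (Fin L → ℤ) → (Fin L → ℤ) → ℝ → E) (v : Fin L → ℤ)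
    (l : Fin L) (k : ℤ) (t : ℝ) : E :=
  P (Function.update v l k) (Function.update v l (k + 1)) (clamp (1 / 2 + t))

open Classical in
/-- A map which is constant near the grid points, runs along paths between neighbouring grid
points, and is singular only where two coordinates are near `ℤ + 1/2`. -/
noncomputable def gridMap {E : Type*} (P : (Fin L → ℤ) → (Fin L → ℤ) → ℝ → E) (y : Fin L → ℝ) : E :=
  if h : ∃ l, halfDist (y l) < gridGap y / 2 then
    edgeMap P (gridRound y) h.choose ⌊y h.choose⌋ ((y h.choose - ⌊y h.choose⌋ - 1 / 2) / gridGap y)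
  else P (gridRound y) (gridRound y) 0

theorem gridMap_eq_of_forall {E : Type*} (P : (Fin L → ℤ) → (Fin L → ℤ) → ℝ → E) {y : Fin L → ℝ}
    (h : ∀ l, gridGap y / 2 ≤ halfDist (y l)) :
    gridMap P y = P (gridRound y) (gridRound y) 0 :=
  dif_neg fun ⟨l, hl⟩ => absurd hl (not_lt.2 (h l))

/-- Removes the choice of the coordinate. If `l` is not near a half-integer either, the clamp is
saturated at `0` or `1`, and the edge map takes the value at the rounded vertex, in agreement with
the other branch of `gridMap`. -/
theorem gridMap_eq_edgeMap {E : Type*} {P : (Fin L → ℤ) → (Fin L → ℤ) → ℝ → E}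
    (hP0 : ∀ v w, P v w 0 = P v v 0) (hP1 : ∀ v w, P v w 1 = P w w 0) {y : Fin L → ℝ}
    (hg : 0 < gridGap y) {l : Fin L} (h : ∀ l' ≠ l, gridGap y / 2 ≤ halfDist (y l')) :
    gridMap P y = edgeMap P (gridRound y) l ⌊y l⌋ ((y l - ⌊y l⌋ - 1 / 2) / gridGap y) := by
  by_cases hex : ∃ l, halfDist (y l) < gridGap y / 2
  · have hl : hex.choose = l := by
      by_contra hne
      exact absurd hex.choose_spec (not_lt.2 (h _ hne))
    rw [gridMap, dif_pos hex, hl]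
  · rw [gridMap, dif_neg hex]
    have h1 : gridGap y / 2 ≤ |y l - ⌊y l⌋ - 1 / 2| := by
      by_contra hlt
      exact hex ⟨l, not_le.1 hlt⟩
    rw [edgeMap]
    rcases le_abs.1 h1 with h2 | h2
    · rw [clamp_of_one_le, hP1]
      · have : Function.update (gridRound y) l (⌊y l⌋ + 1) = gridRound y := by
          rw [Function.update_eq_self_iff, gridRound, eq_comm, Int.floor_eq_iff]
          push_cast
          constructor <;> linarith [Int.lt_floor_add_one (y l)]
        rw [this]
      · have : 1 / 2 ≤ (y l - ⌊y l⌋ - 1 / 2) / gridGap y := by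
          rw [le_div_iff₀ hg]; linarith
        linarith
    · rw [clamp_of_nonpos]
      · have : Function.update (gridRound y) l ⌊y l⌋ = gridRound y := by
          rw [Function.update_eq_self_iff, gridRound, eq_comm, Int.floor_eq_iff]
          constructor <;> linarith [Int.floor_le (y l)]
        rw [this]; exact (hP0 _ _).symm
      · have : (y l - ⌊y l⌋ - 1 / 2) / gridGap y ≤ - (1 / 2) := by
          rw [div_le_iff₀ hg]; linarith
        linarith

theorem exists_gridMap_eq {E : Type*} (P : (Fin L → ℤ) → (Fin L → ℤ) → ℝ → E) (y : Fin L → ℝ) :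
    ∃ v w : Fin L → ℤ, ∃ t ∈ Icc (0 : ℝ) 1, gridMap P y = P v w t ∧
      (∀ l, |v l - y l| ≤ 1) ∧ ∀ l, |w l - y l| ≤ 1 := by
  have hr : ∀ l, |(gridRound y l : ℝ) - y l| ≤ 1 := by
    intro l
    rw [gridRound, abs_le]
    constructor <;> linarith [Int.floor_le (y l + 1 / 2), Int.lt_floor_add_one (y l + 1 / 2)]
  by_cases hex : ∃ l, halfDist (y l) < gridGap y / 2
  · refine ⟨_, _, _, clamp_mem _, by rw [gridMap, dif_pos hex, edgeMap], fun l => ?_, fun l => ?_⟩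
    · by_cases hl : l = hex.choose
      · rw [← hl, Function.update_self, abs_le]
        constructor <;> linarith [Int.floor_le (y l), Int.lt_floor_add_one (y l)]
      · rw [Function.update_of_ne hl]; exact hr l
    · by_cases hl : l = hex.choose
      · rw [← hl, Function.update_self, abs_le]
        push_cast
        constructor <;> linarith [Int.floor_le (y l), Int.lt_floor_add_one (y l)]
      · rw [Function.update_of_ne hl]; exact hr l
  · exact ⟨_, _, 0, ⟨le_rfl, zero_le_one⟩, by rw [gridMap, dif_neg hex], hr, hr⟩

/-- A displacement of at least an eighth of the gap is handled by the diameter bound, whence `8 *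
D`. For smaller ones, at most one coordinate of `y` is within `3/4` of the gap from a half-integer,
because of any two coordinates one is at distance at least the gap. If there is one, both points lie
on the same edge and the clamped parameter varies at rate `3 / gap`; if there is none, both go to
the same vertex. -/
theorem norm_gridMap_sub_le {E : Type*} [NormedAddCommGroup E]
    {P : (Fin L → ℤ) → (Fin L → ℤ) → ℝ → E}
    (hP0 : ∀ v w, P v w 0 = P v v 0) (hP1 : ∀ v w, P v w 1 = P w w 0) {K D : ℝ} (hK : 0 ≤ K)
    (hPK : ∀ v w s t, ‖P v w s - P v w t‖ ≤ K * |s - t|)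
    (hD : ∀ y y', ‖gridMap P y - gridMap P y'‖ ≤ D) {y : Fin L → ℝ}
    (hg : 0 < gridGap y) (y' : Fin L → ℝ) :
    ‖gridMap P y' - gridMap P y‖ ≤ (8 * D + 3 * K) * ‖y' - y‖ / gridGap y := by
  set g := gridGap y with hgdef
  set τ := ‖y' - y‖ with hτ
  have hD0 : 0 ≤ D := (norm_nonneg _).trans (hD y y)
  rcases le_or_gt (g / 8) τ with hbig | hsmall
  · refine (hD y' y).trans ?_
    rw [le_div_iff₀ hg]
    have h1 : 0 ≤ 3 * K * τ := by positivity
    nlinarith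
  have hτl : ∀ l, |y' l - y l| ≤ τ := fun l => norm_le_pi_norm (y' - y) l
  have hg1 : gridGap y' ≤ g + τ := gridGap_le_add y' y
  have hg2 : g ≤ gridGap y' + τ := by
    have := gridGap_le_add y y'
    rwa [norm_sub_rev] at this
  have hd : ∀ l, halfDist (y l) ≤ halfDist (y' l) + τ := fun l => by
    have := halfDist_le_add (y l) (y' l)
    rw [abs_sub_comm] at this
    linarith [hτl l]
  have hround : ∀ l, τ < halfDist (y l) → gridRound y' l = gridRound y l := fun l hl =>
    round_eq_of_lt_halfDist ((hτl l).trans_lt hl)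
  by_cases hA : ∃ l, halfDist (y l) < 3 / 4 * g
  · obtain ⟨l, hl⟩ := hA
    have hoth : ∀ l' ≠ l, g ≤ halfDist (y l') := by
      intro l' hne
      rcases le_max_iff.1 (gridGap_le_max y hne) with h | h
      · exact h
      · exact absurd (lt_of_le_of_lt h hl) (by linarith)
    have hghalf : g ≤ 1 / 2 := gridGap_le_half y
    have hfl : ⌊y' l⌋ = ⌊y l⌋ := by
      have h1 := hl
      unfold halfDist at h1
      rw [abs_lt] at h1
      have h2 := hτl l
      rw [abs_le] at h2
      rw [Int.floor_eq_iff]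
      constructor <;> linarith
    have e1 := gridMap_eq_edgeMap hP0 hP1 hg (l := l) fun l' hne => by linarith [hoth l' hne]
    have e2 := gridMap_eq_edgeMap hP0 hP1 (y := y') (by linarith) (l := l) fun l' hne => by
      linarith [hoth l' hne, hd l']
    have hup : ∀ k, Function.update (gridRound y') l k = Function.update (gridRound y) l k := by
      intro k
      ext l'
      by_cases hne : l' = l
      · rw [hne, Function.update_self, Function.update_self]
      · rw [Function.update_of_ne hne, Function.update_of_ne hne,
          hround l' (by linarith [hoth l' hne])]
    rw [e1, e2, edgeMap, edgeMap, hup, hup, hfl]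
    refine (hPK _ _ _ _).trans ?_
    set c := (⌊y l⌋ : ℝ)
    set g' := gridGap y'
    have hg'0 : 0 < g' := by linarith
    have h1 : |clamp (1 / 2 + (y' l - c - 1 / 2) / g') - clamp (1 / 2 + (y l - c - 1 / 2) / g)| ≤
        3 * (τ / g) := by
      refine (abs_clamp_sub_le _ _).trans ?_
      have e : 1 / 2 + (y' l - c - 1 / 2) / g' - (1 / 2 + (y l - c - 1 / 2) / g) =
          (y' l - y l) / g + (y' l - c - 1 / 2) * (g - g') / (g * g') := by
        field_simp; ring
      rw [e]
      refine (abs_add_le _ _).trans ?_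
      have h2 : |(y' l - y l) / g| ≤ τ / g := by
        rw [abs_div, abs_of_pos hg]
        exact div_le_div_of_nonneg_right (hτl l) hg.le
      have h3 : |y' l - c - 1 / 2| ≤ 2 * g' := by
        have : y' l - c - 1 / 2 = (y l - c - 1 / 2) + (y' l - y l) := by ring
        rw [this]
        refine (abs_add_le _ _).trans ?_
        have h4 : |y l - c - 1 / 2| < 3 / 4 * g := hl
        linarith [hτl l]
      have h5 : |g - g'| ≤ τ := by rw [abs_le]; constructor <;> linarith
      have h6 : |(y' l - c - 1 / 2) * (g - g') / (g * g')| ≤ 2 * (τ / g) := by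
        rw [abs_div, abs_mul, abs_of_pos (mul_pos hg hg'0), div_le_iff₀ (mul_pos hg hg'0)]
        calc |y' l - c - 1 / 2| * |g - g'| ≤ (2 * g') * τ := by gcongr
          _ = 2 * (τ / g) * (g * g') := by field_simp
      linarith
    have h7 : 0 ≤ 8 * D * τ / g := by positivity
    calc K * _ ≤ K * (3 * (τ / g)) := mul_le_mul_of_nonneg_left h1 hK
      _ ≤ _ := by
        rw [show (8 * D + 3 * K) * τ / g = 8 * D * τ / g + K * (3 * (τ / g)) by ring]
        linarith
  · push Not at hA
    have e1 := gridMap_eq_of_forall P (y := y) fun l => by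
      have := hA l
      linarith
    have e2 := gridMap_eq_of_forall P (y := y') fun l => by
      linarith [hA l, hd l]
    have e3 : gridRound y' = gridRound y := by
      ext l
      exact hround l (by linarith [hA l])
    rw [e1, e2, e3, sub_self, norm_zero]
    positivity

/-- The power is integrable near its singularity because `s < 1` and is at most `1` at distance one
or more, so the bound does not depend on the centre. -/
theorem exists_lintegral_abs_rpow_le {s : ℝ} (hs : 0 < s) (hs1 : s < 1) :
    ∃ J : ENNReal, J ≠ ⊤ ∧ ∀ c : ℝ,
      ∫⁻ a in Icc (0 : ℝ) 1, ENNReal.ofReal |a - c| ^ (-s) ≤ J := by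
  have hm : Measurable fun x : ℝ => ENNReal.ofReal |x| ^ (-s) := by fun_prop
  refine ⟨(∫⁻ x in ball (0 : ℝ) 1, ENNReal.ofReal |x| ^ (-s)) + 1, ?_, fun c => ?_⟩
  · have hi : IntegrableOn (fun x : ℝ => |x| ^ (-s)) (ball 0 1) := by
      refine integrableOn_ball_of_norm_le_rpow (C := 1) (α := s) (by simp) (by simpa using hs1)
        (Eventually.of_forall fun x => ?_) (by fun_prop : Measurable fun x : ℝ => |x| ^ (-s)).aestronglyMeasurable
      rw [one_mul, Real.norm_eq_abs, Real.norm_eq_abs, abs_of_nonneg (by positivity)]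
    have h2 := hi.2
    rw [hasFiniteIntegral_iff_enorm] at h2
    refine ENNReal.add_ne_top.2 ⟨(lt_of_le_of_lt (le_of_eq ?_) h2).ne, ENNReal.one_ne_top⟩
    refine lintegral_congr_ae ?_
    have h0 : ∀ᵐ x : ℝ ∂(volume.restrict (ball 0 1)), x ≠ 0 :=
      ae_restrict_of_ae (Measure.ae_ne volume 0)
    filter_upwards [h0] with x hx
    rw [Real.enorm_eq_ofReal (by positivity), ENNReal.ofReal_rpow_of_pos (abs_pos.2 hx)]
  · have h1 : ∀ a : ℝ, ENNReal.ofReal |a - c| ^ (-s) ≤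
        (ball (0 : ℝ) 1).indicator (fun x => ENNReal.ofReal |x| ^ (-s)) (a - c) + 1 := by
      intro a
      by_cases h : a - c ∈ ball (0 : ℝ) 1
      · rw [indicator_of_mem h]; exact le_self_add
      · rw [indicator_of_notMem h, zero_add]
        rw [mem_ball, dist_zero_right, Real.norm_eq_abs, not_lt] at h
        rw [ENNReal.rpow_neg]
        refine ENNReal.inv_le_one.2 (ENNReal.one_le_rpow ?_ hs)
        rwa [ENNReal.one_le_ofReal]
    calc ∫⁻ a in Icc (0 : ℝ) 1, ENNReal.ofReal |a - c| ^ (-s)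
        ≤ ∫⁻ a in Icc (0 : ℝ) 1,
          ((ball (0 : ℝ) 1).indicator (fun x => ENNReal.ofReal |x| ^ (-s)) (a - c) + 1) :=
          lintegral_mono h1
      _ = (∫⁻ a in Icc (0 : ℝ) 1,
          (ball (0 : ℝ) 1).indicator (fun x => ENNReal.ofReal |x| ^ (-s)) (a - c)) + 1 := by
          rw [lintegral_add_right _ measurable_const]; simp
      _ ≤ (∫⁻ a : ℝ, (ball (0 : ℝ) 1).indicator (fun x => ENNReal.ofReal |x| ^ (-s)) (a - c)) + 1 := by
          gcongr; exact Measure.restrict_le_self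
      _ = _ := by
          rw [lintegral_sub_right_eq_self (fun x => (ball (0 : ℝ) 1).indicator
            (fun x => ENNReal.ofReal |x| ^ (-s)) x) c, lintegral_indicator measurableSet_ball]

theorem exists_lintegral_halfDist_le {s : ℝ} (hs : 0 < s) (hs1 : s < 1) :
    ∃ J : ENNReal, J ≠ ⊤ ∧ ∀ c : ℝ,
      ∫⁻ a in Icc (0 : ℝ) 1, ENNReal.ofReal (halfDist (c + a)) ^ (-s) ≤ J := by
  obtain ⟨J, hJ, h⟩ := exists_lintegral_abs_rpow_le hs hs1
  refine ⟨J + J, ENNReal.add_ne_top.2 ⟨hJ, hJ⟩, fun c => ?_⟩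
  set c₁ : ℝ := ⌊c⌋ + 1 / 2 - c
  set c₂ : ℝ := ⌊c⌋ + 1 + 1 / 2 - c
  set c₃ : ℝ := ⌊c⌋ + 2 + 1 / 2 - c
  have hm : ∀ c' : ℝ, Measurable fun a : ℝ => ENNReal.ofReal |a - c'| ^ (-s) := by
    intro c'; fun_prop
  calc ∫⁻ a in Icc (0 : ℝ) 1, ENNReal.ofReal (halfDist (c + a)) ^ (-s)
      = ∫⁻ a in Ico (0 : ℝ) 1, ENNReal.ofReal (halfDist (c + a)) ^ (-s) :=
        setLIntegral_congr Ico_ae_eq_Icc.symm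
    -- For `a` in `[0, 1)` the floor of `c + a` is `⌊c⌋` or `⌊c⌋ + 1`, so only two half-integers
    -- matter.
    _ ≤ ∫⁻ a in Ico (0 : ℝ) 1, (ENNReal.ofReal |a - c₁| ^ (-s) + ENNReal.ofReal |a - c₂| ^ (-s)) := by
        refine setLIntegral_mono' measurableSet_Ico fun a ha => ?_
        have hf : ⌊c + a⌋ = ⌊c⌋ ∨ ⌊c + a⌋ = ⌊c⌋ + 1 := by
          rcases lt_or_ge (c + a) (⌊c⌋ + 1) with h | h
          · left; rw [Int.floor_eq_iff]; exact ⟨by linarith [Int.floor_le c, ha.1], h⟩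
          · right; rw [Int.floor_eq_iff]; push_cast
            exact ⟨h, by linarith [Int.lt_floor_add_one c, ha.2]⟩
        rcases hf with hf | hf
        · refine le_trans (le_of_eq ?_) le_self_add
          rw [halfDist, hf]; congr 3; simp only [c₁]; ring
        · refine le_trans (le_of_eq ?_) le_add_self
          rw [halfDist, hf]; congr 3; simp only [c₂]; push_cast; ring
    _ ≤ ∫⁻ a in Icc (0 : ℝ) 1, (ENNReal.ofReal |a - c₁| ^ (-s) + ENNReal.ofReal |a - c₂| ^ (-s)) :=
        lintegral_mono_set Ico_subset_Icc_self
    _ ≤ J + J := by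
        rw [lintegral_add_left (hm c₁)]
        exact add_le_add (h _) (h _)

/-- The uniform probability measure on the unit cube. -/
noncomputable def unitCube (L : ℕ) : Measure (Fin L → ℝ) :=
  Measure.pi fun _ => volume.restrict (Icc (0 : ℝ) 1)

instance isProbabilityMeasure_restrict_Icc : IsProbabilityMeasure (volume.restrict (Icc (0 : ℝ) 1)) :=
  ⟨by simp⟩

instance isProbabilityMeasure_unitCube : IsProbabilityMeasure (unitCube L) := by
  unfold unitCube; infer_instance

theorem measurable_halfDist : Measurable halfDist := by
  unfold halfDist
  exact (((measurable_id.sub (by fun_prop : Measurable fun t : ℝ => (⌊t⌋ : ℝ))).sub_const _)).abs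

/-- Codimension two made quantitative: the maximum of two distances to the power `-p` is at most the
product of their powers `-p/2`. The two coordinates of the random translation are independent, and
each factor has finite mean because `p/2 < 1`. -/
theorem exists_lintegral_gridGap_le (L : ℕ) {p : ℝ} (hp : 0 < p) (hp2 : p < 2) :
    ∃ J : ENNReal, J ≠ ⊤ ∧ ∀ y : Fin L → ℝ,
      ∫⁻ a, ENNReal.ofReal (gridGap (y + a)) ^ (-p) ∂(unitCube L) ≤ J := by
  obtain ⟨J, hJ, h⟩ := exists_lintegral_halfDist_le (s := p / 2) (by positivity) (by linarith)
  refine ⟨ENNReal.ofReal (1 / 2) ^ (-p) + ∑ q : Fin L × Fin L, J * J, ?_, fun y => ?_⟩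
  · refine ENNReal.add_ne_top.2 ⟨?_, ENNReal.sum_ne_top.2 fun _ _ => ENNReal.mul_ne_top hJ hJ⟩
    refine ENNReal.rpow_ne_top_of_ne_zero ?_ ENNReal.ofReal_ne_top
    simp
  set f : Fin L → (Fin L → ℝ) → ENNReal := fun l a =>
    ENNReal.ofReal (halfDist (y l + a l)) ^ (-(p / 2)) with hf
  have hf1 : ∀ l, Measurable fun t : ℝ => ENNReal.ofReal (halfDist (y l + t)) ^ (-(p / 2)) := by
    intro l
    exact ((measurable_halfDist.comp (by fun_prop : Measurable fun t : ℝ => y l + t)).ennreal_ofReal).pow_const _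
  have hfm : ∀ l, Measurable (f l) := fun l => (hf1 l).comp (measurable_pi_apply l)
  have hfi : ∀ l, ∫⁻ a, f l a ∂(unitCube L) ≤ J := by
    intro l
    have := (measurePreserving_eval (fun _ : Fin L => volume.restrict (Icc (0 : ℝ) 1)) l).lintegral_comp
      (hf1 l)
    exact (le_of_eq this).trans (h (y l))
  have hind : ProbabilityTheory.iIndepFun f (unitCube L) :=
    ProbabilityTheory.iIndepFun_pi (X := fun l (t : ℝ) =>
      ENNReal.ofReal (halfDist (y l + t)) ^ (-(p / 2))) fun l => (hf1 l).aemeasurable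
  have hpt : ∀ a, ENNReal.ofReal (gridGap (y + a)) ^ (-p) ≤
      ENNReal.ofReal (1 / 2) ^ (-p) + ∑ q : Fin L × Fin L,
        if q.1 ≠ q.2 then f q.1 a * f q.2 a else 0 := by
    intro a
    rcases exists_gridGap_eq (y + a) with h | ⟨l, l', hne, h⟩ <;> rw [h]
    · exact le_self_add
    · refine le_trans ?_ le_add_self
      refine le_trans ?_ (Finset.single_le_sum (f := fun q : Fin L × Fin L =>
        if q.1 ≠ q.2 then f q.1 a * f q.2 a else 0) (fun _ _ => zero_le) (Finset.mem_univ (l, l')))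
      simp only [ne_eq, hne, not_false_eq_true, if_true]
      have e : -p = -(p / 2) + -(p / 2) := by ring
      have hmax : ∀ d : ℝ, d ≤ max (halfDist ((y + a) l)) (halfDist ((y + a) l')) →
          ENNReal.ofReal (max (halfDist ((y + a) l)) (halfDist ((y + a) l'))) ^ (-(p / 2)) ≤
          ENNReal.ofReal d ^ (-(p / 2)) := fun d hd => by
        rw [ENNReal.rpow_neg, ENNReal.rpow_neg]
        refine ENNReal.inv_le_inv.2 (ENNReal.rpow_le_rpow (ENNReal.ofReal_le_ofReal hd) (by positivity))
      calc ENNReal.ofReal (max (halfDist ((y + a) l)) (halfDist ((y + a) l'))) ^ (-p)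
          = ENNReal.ofReal (max (halfDist ((y + a) l)) (halfDist ((y + a) l'))) ^ (-(p / 2)) *
            ENNReal.ofReal (max (halfDist ((y + a) l)) (halfDist ((y + a) l'))) ^ (-(p / 2)) := by
            rw [ENNReal.rpow_neg, ENNReal.rpow_neg, ← ENNReal.mul_inv
              (Or.inr (ENNReal.rpow_ne_top_of_nonneg (by positivity) ENNReal.ofReal_ne_top))
              (Or.inl (ENNReal.rpow_ne_top_of_nonneg (by positivity) ENNReal.ofReal_ne_top)),
              ← ENNReal.rpow_add_of_nonneg _ _ (by positivity) (by positivity), add_halves]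
        _ ≤ f l a * f l' a := mul_le_mul' (hmax _ (le_max_left _ _)) (hmax _ (le_max_right _ _))
  refine (lintegral_mono hpt).trans ?_
  rw [lintegral_add_left measurable_const, lintegral_finsetSum]
  · refine add_le_add (by simp) (Finset.sum_le_sum fun q _ => ?_)
    split_ifs with hne
    · rw [ProbabilityTheory.lintegral_mul_eq_lintegral_mul_lintegral_of_indepFun'' (hfm _).aemeasurable
        (hfm _).aemeasurable (hind.indepFun hne)]
      exact mul_le_mul' (hfi _) (hfi _)
    · simp
  · intro q _
    split_ifs
    · exact (hfm _).mul (hfm _)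
    · exact measurable_const

end GridMap


/-! ### Chain classes, Lipschitz paths, and singular maps into the target. -/

section SingularMaps
open Filter Topology

variable {L : ℕ}

/-- The points of `N` which can be reached from `c` by jumps in `N` of length less than `ε`. -/
def chainClass (N : Set (Euc L)) (ε : ℝ) (c : Euc L) : Set (Euc L) :=
  {q | Relation.ReflTransGen (fun q q' => q ∈ N ∧ q' ∈ N ∧ dist q q' < ε) c q}

theorem self_mem_chainClass (N : Set (Euc L)) (ε : ℝ) (c : Euc L) : c ∈ chainClass N ε c :=
  Relation.ReflTransGen.refl

theorem chainClass_subset {N : Set (Euc L)} {ε : ℝ} {c : Euc L} (hc : c ∈ N) :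
    chainClass N ε c ⊆ N := by
  intro q hq
  rcases Relation.ReflTransGen.cases_tail hq with h | ⟨q', -, h⟩
  · rw [h]; exact hc
  · exact h.2.1

theorem mem_chainClass_of_dist_lt {N : Set (Euc L)} {ε : ℝ} {c q q' : Euc L}
    (hc : c ∈ N) (hq : q ∈ chainClass N ε c) (hq' : q' ∈ N) (h : dist q q' < ε) :
    q' ∈ chainClass N ε c :=
  Relation.ReflTransGen.tail hq ⟨chainClass_subset hc hq, hq', h⟩

/-- `q` and `q'` are joined in `N` by a Lipschitz path. -/
def LipJoined (N : Set (Euc L)) (q q' : Euc L) : Prop :=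
  ∃ (γ : ℝ → Euc L) (k : NNReal), LipschitzWith k γ ∧ γ 0 = q ∧ γ 1 = q' ∧
    ∀ t ∈ Icc (0 : ℝ) 1, γ t ∈ N

theorem lipschitzWith_clamp : LipschitzWith 1 clamp :=
  LipschitzWith.of_dist_le_mul fun s t => by
    rw [NNReal.coe_one, one_mul, Real.dist_eq, Real.dist_eq]; exact abs_clamp_sub_le s t

theorem LipJoined.trans {N : Set (Euc L)} {q q' q'' : Euc L} (h : LipJoined N q q')
    (h' : LipJoined N q' q'') : LipJoined N q q'' := by
  obtain ⟨γ, k, hL, h0, h1, hN⟩ := h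
  obtain ⟨γ', k', hL', h0', h1', hN'⟩ := h'
  have l1 : LipschitzWith 2 fun t : ℝ => 2 * t :=
    LipschitzWith.of_dist_le_mul fun s t => by
      rw [Real.dist_eq, Real.dist_eq, ← mul_sub, abs_mul]; norm_num
  have l2 : LipschitzWith 2 fun t : ℝ => 2 * t - 1 :=
    LipschitzWith.of_dist_le_mul fun s t => by
      rw [Real.dist_eq, Real.dist_eq, show 2 * s - 1 - (2 * t - 1) = 2 * (s - t) by ring, abs_mul]
      norm_num
  -- Concatenation written as a sum: at every time one of the two paths rests at `q'`, so the
  -- formula is globally Lipschitz without gluing.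
  refine ⟨fun t => γ (clamp (2 * t)) + γ' (clamp (2 * t - 1)) - q', _,
    ((hL.comp (lipschitzWith_clamp.comp l1)).add (hL'.comp (lipschitzWith_clamp.comp l2))).sub
      (LipschitzWith.const q'), ?_, ?_, fun t ht => ?_⟩
  · simp only [mul_zero, zero_sub]
    rw [clamp_of_nonpos le_rfl, clamp_of_nonpos (by norm_num), h0, h0']
    abel
  · simp only [mul_one]
    rw [clamp_of_one_le (by norm_num), clamp_of_one_le (by norm_num), h1, h1']
    abel
  · simp only
    rcases le_total t (1 / 2) with h | h
    · rw [clamp_of_nonpos (by linarith : 2 * t - 1 ≤ 0), h0', add_sub_cancel_right]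
      exact hN _ (clamp_mem _)
    · rw [clamp_of_one_le (by linarith : 1 ≤ 2 * t), h1, add_sub_cancel_left]
      exact hN' _ (clamp_mem _)

theorem LipJoined.symm {N : Set (Euc L)} {q q' : Euc L} (h : LipJoined N q q') :
    LipJoined N q' q := by
  obtain ⟨γ, k, hL, h0, h1, hN⟩ := h
  have l1 : LipschitzWith 1 fun t : ℝ => 1 - t :=
    LipschitzWith.of_dist_le_mul fun s t => by
      rw [Real.dist_eq, Real.dist_eq, NNReal.coe_one, one_mul,
        show 1 - s - (1 - t) = t - s by ring, abs_sub_comm]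
  exact ⟨fun t => γ (1 - t), _, hL.comp l1, by simpa using h1, by simpa using h0,
    fun t ht => hN _ ⟨by linarith [ht.2], by linarith [ht.1]⟩⟩

theorem segment_path {S : Euc L → Euc L} {K : NNReal} (hS : LipschitzWith K S) (q q' : Euc L) :
    LipschitzWith (K * ‖q' - q‖₊) fun t : ℝ => S (q + t • (q' - q)) := by
  refine hS.comp (LipschitzWith.of_dist_le_mul fun s t => ?_)
  rw [dist_add_left, dist_eq_norm, ← sub_smul, norm_smul, coe_nnnorm, Real.dist_eq, mul_comm,
    Real.norm_eq_abs]

theorem segment_mem_ball {q q' : Euc L} {δ : ℝ} (h : dist q q' < δ) {t : ℝ}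
    (ht : t ∈ Icc (0 : ℝ) 1) : q + t • (q' - q) ∈ ball q δ := by
  rw [mem_ball, dist_eq_norm, add_sub_cancel_left, norm_smul, Real.norm_eq_abs, abs_of_nonneg ht.1]
  rw [dist_comm, dist_eq_norm] at h
  calc t * ‖q' - q‖ ≤ 1 * ‖q' - q‖ := mul_le_mul_of_nonneg_right ht.2 (norm_nonneg _)
    _ < δ := by rwa [one_mul]

theorem lipJoined_of_mem_chainClass {N : Set (Euc L)} {S : Euc L → Euc L} {K : NNReal} {δ : ℝ}
    (hS : LipschitzWith K S) (hid : ∀ y ∈ N, S y = y) (hSN : ∀ q ∈ N, ∀ y ∈ ball q δ, S y ∈ N)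
    {c q : Euc L} (hc : c ∈ N) (hq : q ∈ chainClass N δ c) : LipJoined N c q := by
  induction hq with
  | refl => exact ⟨fun _ => c, 0, LipschitzWith.const c, rfl, rfl, fun _ _ => hc⟩
  | tail _ h ih =>
    rename_i q₁ q₂ _
    refine ih.trans ⟨_, _, segment_path hS q₁ q₂, ?_, ?_, fun t ht => hSN q₁ h.1 _
      (segment_mem_ball h.2.2 ht)⟩
    · simp [hid _ h.1]
    · simp [hid _ h.2.1]

/-- Nearby points are joined by the retracted segment, which stays close to its endpoints; points
far apart are joined by any Lipschitz path, with no control on where it goes. -/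
theorem exists_path_family {N : Set (Euc L)} {S : Euc L → Euc L} {K : NNReal} {δ : ℝ}
    (hS : LipschitzWith K S) (hid : ∀ y ∈ N, S y = y) (hSN : ∀ q ∈ N, ∀ y ∈ ball q δ, S y ∈ N) :
    ∃ (γ : Euc L → Euc L → ℝ → Euc L) (k : Euc L → Euc L → NNReal), ∀ q ∈ N, ∀ q' ∈ N,
      LipJoined N q q' → LipschitzWith (k q q') (γ q q') ∧ γ q q' 0 = q ∧ γ q q' 1 = q' ∧
      (∀ t ∈ Icc (0 : ℝ) 1, γ q q' t ∈ N) ∧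
      (dist q q' < δ → ∀ t ∈ Icc (0 : ℝ) 1, dist (γ q q' t) q ≤ K * dist q q') := by
  have key : ∀ q ∈ N, ∀ q' ∈ N, LipJoined N q q' → ∃ (γ : ℝ → Euc L) (k : NNReal),
      LipschitzWith k γ ∧ γ 0 = q ∧ γ 1 = q' ∧ (∀ t ∈ Icc (0 : ℝ) 1, γ t ∈ N) ∧
      (dist q q' < δ → ∀ t ∈ Icc (0 : ℝ) 1, dist (γ t) q ≤ K * dist q q') := by
    intro q hq q' hq' hJ
    by_cases hd : dist q q' < δ
    · refine ⟨_, _, segment_path hS q q', by simp [hid _ hq], by simp [hid _ hq'], fun t ht =>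
        hSN q hq _ (segment_mem_ball hd ht), fun _ t ht => ?_⟩
      have h1 := hS.dist_le_mul (q + t • (q' - q)) q
      rw [hid q hq] at h1
      refine h1.trans (mul_le_mul_of_nonneg_left ?_ K.2)
      rw [dist_eq_norm, add_sub_cancel_left, norm_smul, Real.norm_eq_abs, abs_of_nonneg ht.1,
        dist_comm q q', dist_eq_norm]
      exact mul_le_of_le_one_left (norm_nonneg _) ht.2
    · obtain ⟨γ, k, h1, h2, h3, h4⟩ := hJ
      exact ⟨γ, k, h1, h2, h3, h4, fun h => absurd h hd⟩
  choose! γ k h using key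
  exact ⟨γ, k, h⟩

theorem dist_toLp_le {f : Fin L → ℝ} {q : Euc L} {b : ℝ} (hb : 0 ≤ b) (h : ∀ l, |f l - q l| ≤ b) :
    dist (WithLp.toLp 2 f : Euc L) q ≤ (L + 1) * b := by
  rw [EuclideanSpace.dist_eq]
  refine Real.sqrt_le_iff.2 ⟨by positivity, ?_⟩
  calc ∑ l, dist ((WithLp.toLp 2 f : Euc L) l) (q l) ^ 2 ≤ ∑ _l : Fin L, b ^ 2 := by
        refine Finset.sum_le_sum fun l _ => pow_le_pow_left₀ dist_nonneg ?_ 2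
        rw [Real.dist_eq]; exact h l
    _ = L * b ^ 2 := by simp
    _ ≤ ((L + 1) * b) ^ 2 := by
        have : (L : ℝ) ≤ (L + 1) ^ 2 := by nlinarith [(Nat.cast_nonneg L : (0 : ℝ) ≤ L)]
        rw [mul_pow]
        exact mul_le_mul_of_nonneg_right this (sq_nonneg b)

/-- Maps into `N` which are close to the identity on a chain class of `N`, factor through a graph,
and have codimension two singularities which can be moved by translations `a`. -/
theorem IsClosedSubmanifold.exists_singular_maps {N : Set (Euc L)} (hN : IsClosedSubmanifold N) :
    ∃ (S : Euc L → Euc L) (K : NNReal) (ε h C : ℝ), LipschitzWith K S ∧ (∀ y ∈ N, S y = y) ∧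
      0 < ε ∧ 0 < h ∧ 0 ≤ C ∧ ∀ c ∈ N, ∃ F : (Fin L → ℝ) → Euc L → Euc L,
        (∀ a y, F a y ∈ N) ∧
        (∀ a, (∀ l, a l ∈ Icc (0 : ℝ) 1) → ∀ q ∈ chainClass N ε c, ∀ t ∈ Icc (0 : ℝ) 1,
          S (q + t • (F a q - q)) ∈ N) ∧
        ∀ a y y', 0 < gridGap ((fun l => y l / h) + a) →
          ‖F a y' - F a y‖ ≤ C / gridGap ((fun l => y l / h) + a) * ‖y' - y‖ := by
  obtain ⟨S, K, δ, hS, hδ, hid, hSN⟩ := hN.exists_retraction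
  obtain ⟨γ, k, hγ⟩ := exists_path_family hS hid hSN
  -- Chosen so that later `n v` is within `3δ₁` of `q`, two such points are within `6δ₁ < δ` of each
  -- other, and the path between them stays within `(6K + 3)δ₁ < δ` of `q`.
  set δ₁ : ℝ := δ / (10 * (K + 1)) with hδ₁
  have hK0 : (0 : ℝ) ≤ K := K.2
  have hδ₁0 : 0 < δ₁ := by positivity
  have hδ₁' : δ₁ * (10 * (K + 1)) = δ := by rw [hδ₁]; field_simp
  obtain ⟨A, hAN, hAfin, hAcov⟩ := hN.1.finite_cover_balls hδ₁0
  -- The mesh size: a vertex used at `q` differs from it by at most `2h` in each coordinate, one `h`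
  -- for the cell and one for the translation, hence by at most `δ₁` in norm.
  set h : ℝ := δ₁ / (2 * (L + 1)) with hh
  have hh0 : 0 < h := by positivity
  have hh' : (L + 1) * (2 * h) = δ₁ := by rw [hh]; field_simp
  -- All paths have endpoints in the finite net `A`, so one Lipschitz constant serves every class
  -- `c`.
  obtain ⟨k₀, hk₀⟩ : ∃ k₀ : NNReal, ∀ q ∈ A, ∀ q' ∈ A, k q q' ≤ k₀ := by
    obtain ⟨k₀, hk₀⟩ := ((hAfin.prod hAfin).image fun q => k q.1 q.2).bddAbove
    exact ⟨k₀, fun q hq q' hq' => hk₀ ⟨(q, q'), ⟨hq, hq'⟩, rfl⟩⟩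
  obtain ⟨R, hR⟩ := hN.1.isBounded.exists_norm_le
  set D : ℝ := R + R with hD
  refine ⟨S, K, δ, h, (8 * max D 0 + 3 * k₀) / h, hS, hid, hδ, hh0, by positivity, fun c hc => ?_⟩
  have hnear : ∀ q ∈ chainClass N δ c, ∃ a ∈ A ∩ chainClass N δ c, dist q a < δ₁ := by
    intro q hq
    have hqN := chainClass_subset hc hq
    obtain ⟨a, haA, hqa⟩ := mem_iUnion₂.1 (hAcov hqN)
    refine ⟨a, ⟨haA, mem_chainClass_of_dist_lt hc hq (hAN haA) (lt_of_lt_of_le hqa ?_)⟩, hqa⟩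
    nlinarith
  have hfin : (A ∩ chainClass N δ c).Finite := hAfin.inter_of_left _
  have hne : (A ∩ chainClass N δ c).Nonempty := by
    obtain ⟨a, ha, -⟩ := hnear c (self_mem_chainClass N δ c)
    exact ⟨a, ha⟩
  -- Each vertex is sent to a nearest net point of the class of `c`. Staying in one class guarantees
  -- that the images of any two vertices are joined by a path in `N`.
  have hvert : ∀ v : Fin L → ℤ, ∃ a ∈ A ∩ chainClass N δ c, ∀ a' ∈ A ∩ chainClass N δ c,
      dist a (WithLp.toLp 2 fun l => h * v l) ≤ dist a' (WithLp.toLp 2 fun l => h * v l) :=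
    fun v => exists_min_image _ (fun a => dist a (WithLp.toLp 2 fun l => h * v l)) hfin hne
  choose n hn hnmin using hvert
  have hnN : ∀ v, n v ∈ N := fun v => hAN (hn v).1
  have hJ : ∀ v w, LipJoined N (n v) (n w) := fun v w =>
    (lipJoined_of_mem_chainClass hS hid hSN hc (hn v).2).symm.trans
      (lipJoined_of_mem_chainClass hS hid hSN hc (hn w).2)
  set P : (Fin L → ℤ) → (Fin L → ℤ) → ℝ → Euc L := fun v w => γ (n v) (n w) with hP
  have hPp := fun v w => hγ (n v) (hnN v) (n w) (hnN w) (hJ v w)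
  have hP0 : ∀ v w, P v w 0 = P v v 0 := fun v w =>
    (hPp v w).2.1.trans (hPp v v).2.1.symm
  have hP1 : ∀ v w, P v w 1 = P w w 0 := fun v w =>
    (hPp v w).2.2.1.trans (hPp w w).2.1.symm
  have hPK : ∀ v w s t, ‖P v w s - P v w t‖ ≤ k₀ * |s - t| := by
    intro v w s t
    have h1 := (hPp v w).1.dist_le_mul s t
    rw [dist_eq_norm, Real.dist_eq] at h1
    refine h1.trans (mul_le_mul_of_nonneg_right ?_ (abs_nonneg _))
    exact_mod_cast hk₀ _ (hn v).1 _ (hn w).1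
  have hmem : ∀ y, gridMap P y ∈ N := by
    intro y
    obtain ⟨v, w, t, ht, e, -, -⟩ := exists_gridMap_eq P y
    rw [e]
    exact (hPp v w).2.2.2.1 t ht
  have hDist : ∀ y y', ‖gridMap P y - gridMap P y'‖ ≤ max D 0 := fun y y' =>
    ((norm_sub_le _ _).trans (add_le_add (hR _ (hmem y)) (hR _ (hmem y')))).trans (le_max_left _ _)
  refine ⟨fun a y => gridMap P ((fun l => y l / h) + a), fun a y => hmem _, ?_, ?_⟩
  · intro a ha q hq t ht
    have hqN := chainClass_subset hc hq
    obtain ⟨v, w, s, hs, e, hv, hw⟩ := exists_gridMap_eq P ((fun l => q l / h) + a)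
    have hdist : ∀ v : Fin L → ℤ, (∀ l, |v l - ((fun l => q l / h) + a) l| ≤ 1) →
        dist (n v) q ≤ 3 * δ₁ := by
      intro v hv
      have h1 : dist (WithLp.toLp 2 fun l => h * v l : Euc L) q ≤ δ₁ := by
        rw [← hh']
        refine dist_toLp_le (by positivity) fun l => ?_
        have h2 := hv l
        simp only [Pi.add_apply] at h2
        have h3 := ha l
        have h4 : h * v l - q l = h * ((v l - (q l / h + a l)) + a l) := by field_simp; ring
        rw [h4, abs_mul, abs_of_pos hh0, mul_comm]
        refine mul_le_mul_of_nonneg_right ((abs_add_le _ _).trans ?_) hh0.le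
        rw [abs_of_nonneg h3.1]
        linarith [h3.2]
      obtain ⟨a', ha', hqa'⟩ := hnear q hq
      have h5 := hnmin v a' ha'
      have h6 := dist_triangle (n v) (WithLp.toLp 2 fun l => h * v l : Euc L) q
      have h7 := dist_triangle_right a' (WithLp.toLp 2 fun l => h * v l : Euc L) q
      rw [dist_comm] at hqa'
      linarith
    have h1 := hdist v hv
    have h2 := hdist w hw
    have h3 : dist (n v) (n w) ≤ 6 * δ₁ := by linarith [dist_triangle_right (n v) (n w) q]
    have h4 : dist (n v) (n w) < δ := by nlinarith
    have h5 := (hPp v w).2.2.2.2 h4 s hs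
    refine hSN q hqN _ (segment_mem_ball ?_ ht)
    change dist q (gridMap P ((fun l => q l / h) + a)) < δ
    rw [e, dist_comm]
    have h6 := dist_triangle (P v w s) (n v) q
    have h7 : (K : ℝ) * dist (n v) (n w) ≤ K * (6 * δ₁) := mul_le_mul_of_nonneg_left h3 hK0
    change dist (P v w s) (n v) ≤ _ at h5
    nlinarith
  · intro a y y' hg
    refine (norm_gridMap_sub_le hP0 hP1 k₀.2 hPK hDist hg _).trans ?_
    have h1 : ‖((fun l => y' l / h) + a) - ((fun l => y l / h) + a)‖ ≤ ‖y' - y‖ / h := by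
      refine (pi_norm_le_iff_of_nonneg (by positivity)).2 fun l => ?_
      have h2 : ((fun l => y' l / h) + a - ((fun l => y l / h) + a)) l = (y' - y) l / h := by
        simp only [Pi.add_apply, Pi.sub_apply, PiLp.sub_apply]; ring
      rw [h2, norm_div, Real.norm_eq_abs h, abs_of_pos hh0]
      exact div_le_div_of_nonneg_right (PiLp.norm_apply_le (y' - y) l) hh0.le
    calc (8 * max D 0 + 3 * k₀) * ‖((fun l => y' l / h) + a) - ((fun l => y l / h) + a)‖ /
          gridGap ((fun l => y l / h) + a)
        ≤ (8 * max D 0 + 3 * k₀) * (‖y' - y‖ / h) / gridGap ((fun l => y l / h) + a) := by gcongr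
      _ = _ := by ring

end SingularMaps


/-! ### A Sobolev map into the target stays in one chain class on a ball. -/

section LocallyConstant
open Filter Topology

variable {m L : ℕ}

/-- A jump needs `‖Δ‖ ≥ ε`. Then either the linear part `t • g` exceeds `ε/2`, which happens only
where `g` is large, or the Taylor remainder does. In `L¹` both contributions vanish as `t → 0`. -/
theorem jump_quotient_le {E : Type*} [NormedAddCommGroup E] [NormedSpace ℝ E] {Δ g : E}
    {t ε j : ℝ} (ht : 0 < t) (hε : 0 < ε) (hj1 : j ≤ 2) (hj : ‖Δ‖ < ε → j = 0) :
    t⁻¹ * j ≤ (4 / ε) * (t⁻¹ * ‖Δ - t • g‖) + (4 / ε) * (if ε / 2 < t * ‖g‖ then ‖g‖ else 0) := by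
  have h0 : 0 ≤ (4 / ε) * (t⁻¹ * ‖Δ - t • g‖) := by positivity
  have h1 : 0 ≤ (4 / ε) * (if ε / 2 < t * ‖g‖ then ‖g‖ else 0) := by split_ifs <;> positivity
  rcases lt_or_ge ‖Δ‖ ε with h | h
  · rw [hj h, mul_zero]; positivity
  · have h2 : t⁻¹ * j ≤ t⁻¹ * 2 := mul_le_mul_of_nonneg_left hj1 (by positivity)
    refine h2.trans ?_
    by_cases hg : ε / 2 < t * ‖g‖
    · rw [if_pos hg]
      have : t⁻¹ * 2 ≤ (4 / ε) * ‖g‖ := by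
        rw [inv_mul_le_iff₀ ht, ← mul_assoc, mul_comm t, mul_assoc, div_mul_eq_mul_div,
          le_div_iff₀ hε]
        linarith
      linarith
    · have h3 : ε / 2 ≤ ‖Δ - t • g‖ := by
        have := norm_sub_norm_le Δ (t • g)
        rw [norm_smul, Real.norm_eq_abs, abs_of_pos ht] at this
        linarith
      have : t⁻¹ * 2 ≤ (4 / ε) * (t⁻¹ * ‖Δ - t • g‖) := by
        rw [mul_left_comm]
        refine mul_le_mul_of_nonneg_left ?_ (by positivity)
        rw [div_mul_eq_mul_div, le_div_iff₀ hε]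
        linarith
      linarith

theorem tendsto_lintegral_increment {Ω : Set (Euc m)} (hΩ : IsOpen Ω) {u : Euc m → Euc L}
    {G : Euc m → Euc m →L[ℝ] Euc L} (h : IsWeakGradient Ω u G) {K : Set (Euc m)}
    (hK : IsCompact K) (hKΩ : K ⊆ Ω) (e : Euc m) {t : ℕ → ℝ} (ht : ∀ n, 0 < t n)
    (ht0 : Tendsto t atTop (𝓝 0)) :
    Tendsto (fun n => ENNReal.ofReal (t n)⁻¹ *
      ∫⁻ z in K, ‖u (z + t n • e) - u z - t n • G z e‖ₑ) atTop (𝓝 0) := by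
  rw [ENNReal.tendsto_nhds_zero]
  intro ε hε
  have he : ‖e‖ₑ + 1 ≠ ⊤ := by simp
  obtain ⟨δ, hδ, hδ'⟩ := lintegral_increment_sub_le hΩ h hK hKΩ (ε := ε / (‖e‖ₑ + 1))
    (ENNReal.div_pos hε.ne' he)
  have hte : Tendsto (fun n => ‖t n • e‖) atTop (𝓝 0) := by
    have := (ht0.smul_const e).norm
    simpa using this
  filter_upwards [hte.eventually (gt_mem_nhds hδ)] with n hn
  have h1 := hδ' _ hn
  simp only [map_smul] at h1
  calc ENNReal.ofReal (t n)⁻¹ * ∫⁻ z in K, ‖u (z + t n • e) - u z - t n • G z e‖ₑ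
      ≤ ENNReal.ofReal (t n)⁻¹ * (ε / (‖e‖ₑ + 1) * ‖t n • e‖ₑ) := by gcongr
    _ = (ENNReal.ofReal (t n)⁻¹ * ENNReal.ofReal (t n)) * (ε / (‖e‖ₑ + 1) * ‖e‖ₑ) := by
        rw [enorm_smul, Real.enorm_eq_ofReal (ht n).le]; ring
    _ = ε / (‖e‖ₑ + 1) * ‖e‖ₑ := by
        rw [← ENNReal.ofReal_mul (by have := ht n; positivity), inv_mul_cancel₀ (ht n).ne',
          ENNReal.ofReal_one, one_mul]
    _ ≤ ε / (‖e‖ₑ + 1) * (‖e‖ₑ + 1) := by gcongr; exact le_self_add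
    _ ≤ ε := by rw [mul_comm]; exact ENNReal.mul_div_le

theorem tendsto_lintegral_truncated {g : Euc m → ℝ} {K : Set (Euc m)} (hg : IntegrableOn g K)
    (hg0 : ∀ z, 0 ≤ g z) {ε : ℝ} (hε : 0 < ε) {t : ℕ → ℝ}
    (ht0 : Tendsto t atTop (𝓝 0)) :
    Tendsto (fun n => ∫⁻ z in K, ENNReal.ofReal (if ε < t n * g z then g z else 0)) atTop (𝓝 0) := by
  have : (0 : ENNReal) = ∫⁻ _ in K, 0 := by simp
  rw [this]
  refine tendsto_lintegral_of_dominated_convergence' (fun z => ENNReal.ofReal (g z)) ?_ ?_ ?_ ?_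
  · intro n
    have h1 : AEMeasurable (fun z => {q : ℝ | ε < t n * q}.indicator (fun q => q) (g z))
        (volume.restrict K) :=
      (measurable_id.indicator (measurableSet_lt measurable_const (by fun_prop))).comp_aemeasurable
        hg.1.aemeasurable
    exact h1.ennreal_ofReal
  · intro n
    refine Eventually.of_forall fun z => ENNReal.ofReal_le_ofReal ?_
    split_ifs
    · exact le_rfl
    · exact hg0 z
  · exact hg.lintegral_lt_top.ne
  · refine Eventually.of_forall fun z => tendsto_const_nhds.congr' ?_
    have h1 : Tendsto (fun n => t n * g z) atTop (𝓝 0) := by simpa using ht0.mul_const (g z)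
    filter_upwards [h1.eventually (gt_mem_nhds hε)] with n hn
    rw [if_neg (not_lt.2 (le_of_lt hn)), ENNReal.ofReal_zero]

/-- A function which is locally constant as a function of the Sobolev map `u` has zero weak
gradient. -/
theorem isWeakGradient_zero_of_locally_const {Ω : Set (Euc m)} (hΩ : IsOpen Ω) {u : Euc m → Euc L}
    {G : Euc m → Euc m →L[ℝ] Euc L} (h : IsWeakGradient Ω u G) {L' : ℕ} {g : Euc m → Euc L'}
    (hgm : AEStronglyMeasurable g) (hg1 : ∀ z, ‖g z‖ ≤ 1) {A : Set (Euc m)}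
    (hA : ∀ᵐ z ∂(volume.restrict Ω), z ∈ A) {ε : ℝ} (hε : 0 < ε)
    (hgA : ∀ z ∈ A, ∀ z' ∈ A, ‖u z' - u z‖ < ε → g z' = g z) : IsWeakGradient Ω g 0 := by
  have hgloc : LocallyIntegrable g := by
    refine (locallyIntegrable_const (1 : ℝ)).mono hgm (Eventually.of_forall fun z => ?_)
    rw [norm_one]; exact hg1 z
  refine ⟨hgloc.locallyIntegrableOn _,
    (locallyIntegrable_const (0 : Euc m →L[ℝ] Euc L')).locallyIntegrableOn _,
    fun φ hφ hc hsupp e => ?_⟩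
  have hr : ∀ z, φ z • ((0 : Euc m → Euc m →L[ℝ] Euc L') z) e = 0 := fun z => by simp
  simp_rw [hr]
  rw [integral_zero, neg_zero, setIntegral_fderiv_smul_of_tsupport hsupp]
  set K := tsupport φ with hK
  have hKc : IsCompact K := hc
  obtain ⟨δ, hδ, hδΩ⟩ := hKc.exists_cthickening_subset_open hΩ hsupp
  set S := cthickening δ K with hS
  have hSc : IsCompact S := hKc.cthickening
  have hKS : K ⊆ S := self_subset_cthickening K
  set w := S.indicator g with hw
  have hwi : Integrable w :=
    (integrable_indicator_iff hSc.measurableSet).2 (hgloc.integrableOn_isCompact hSc)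
  set t : ℕ → ℝ := fun n => 1 / ((n : ℝ) + 1) with htdef
  have ht : ∀ n, 0 < t n := fun n => by positivity
  have ht0 : Tendsto t atTop (𝓝 0) := tendsto_one_div_add_atTop_nhds_zero_nat
  obtain ⟨B, hB⟩ := hc.exists_bound_of_continuous hφ.continuous
  have hB0 : 0 ≤ B := (norm_nonneg _).trans (hB 0)
  have hlim := tendsto_integral_test_quotient hwi (φ := φ) ⟨hφ, hc⟩ e ht ht0
  have hint : ∫ z, fderiv ℝ φ z e • w z = ∫ z, fderiv ℝ φ z e • g z := by
    congr 1; ext1 z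
    by_cases hz : z ∈ S
    · rw [hw, indicator_of_mem hz]
    · rw [image_eq_zero_of_notMem_tsupport fun h' => hz (hKS (tsupport_fderiv_subset ℝ h'))]
      simp
  rw [hint] at hlim
  refine tendsto_nhds_unique hlim ?_
  have hA' : ∀ᵐ z, z ∈ Ω → z ∈ A := (ae_restrict_iff' hΩ.measurableSet).1 hA
  set ρ := fun n => ENNReal.ofReal (t n)⁻¹ * ∫⁻ z in K, ‖u (z + t n • e) - u z - t n • G z e‖ₑ with hρ
  set τ := fun n => ∫⁻ z in K, ENNReal.ofReal (if ε / 2 < t n * ‖G z e‖ then ‖G z e‖ else 0) with hτ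
  have hGK : IntegrableOn (fun z => ‖G z e‖) K := by
    have h1 : IntegrableOn G K := h.2.1.integrableOn_compact_subset hsupp hKc
    have h2 := (ContinuousLinearMap.apply ℝ (Euc L) e).integrable_comp h1
    exact h2.norm
  have hρ0 : Tendsto ρ atTop (𝓝 0) := tendsto_lintegral_increment hΩ h hKc hsupp e ht ht0
  have hτ0 : Tendsto τ atTop (𝓝 0) :=
    tendsto_lintegral_truncated hGK (fun z => norm_nonneg _) (by positivity) ht0
  have hte : Tendsto (fun n => ‖t n • e‖) atTop (𝓝 0) := by
    have := (ht0.smul_const e).norm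
    simpa using this
  rw [tendsto_zero_iff_enorm_tendsto_zero]
  have hlim2 : Tendsto (fun n => ENNReal.ofReal (B * (4 / ε)) * (ρ n + τ n)) atTop (𝓝 0) := by
    have := ENNReal.Tendsto.const_mul (hρ0.add hτ0) (a := ENNReal.ofReal (B * (4 / ε)))
      (Or.inr ENNReal.ofReal_ne_top)
    simpa using this
  refine tendsto_of_tendsto_of_tendsto_of_le_of_le' tendsto_const_nhds hlim2
    (Eventually.of_forall fun _ => zero_le) ?_
  filter_upwards [hte.eventually (gt_mem_nhds hδ)] with n hn
  have htn := ht n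
  have hi1 : Integrable (fun z => φ z • w z) :=
    hwi.bdd_smul _ hφ.continuous.aestronglyMeasurable (Eventually.of_forall hB)
  have hi2 : Integrable (fun z => φ (z - t n • e) • w z) :=
    hwi.bdd_smul _ (hφ.continuous.comp (by fun_prop)).aestronglyMeasurable
      (Eventually.of_forall fun z => hB _)
  have hi3 : Integrable (fun z => φ z • w (z + t n • e)) :=
    (hwi.comp_add_right _).bdd_smul _ hφ.continuous.aestronglyMeasurable
      (Eventually.of_forall hB)
  have e1 : ∫ z, ((t n)⁻¹ * (φ z - φ (z - t n • e))) • w z =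
      ∫ z in K, (t n)⁻¹ • (φ z • (w z - w (z + t n • e))) := by
    rw [integral_smul, setIntegral_eq_integral_of_forall_compl_eq_zero (fun z hz => by
      rw [image_eq_zero_of_notMem_tsupport hz, zero_smul])]
    simp_rw [mul_smul, sub_smul, smul_sub]
    have hi1' : Integrable (fun z => (t n)⁻¹ • φ z • w z) := hi1.smul (t n)⁻¹
    have hi2' : Integrable (fun z => (t n)⁻¹ • φ (z - t n • e) • w z) := hi2.smul (t n)⁻¹
    rw [integral_sub hi1' hi2', integral_smul, integral_smul, integral_sub hi1 hi3, smul_sub]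
    congr 2
    rw [← integral_add_right_eq_self _ (t n • e)]
    simp
  have hA2 : ∀ᵐ z, z + t n • e ∈ Ω → z + t n • e ∈ A :=
    (measurePreserving_add_right volume (t n • e)).quasiMeasurePreserving.ae hA'
  have pt : ∀ᵐ z ∂(volume.restrict K), ‖(t n)⁻¹ • (φ z • (w z - w (z + t n • e)))‖ₑ ≤
      ENNReal.ofReal (B * (4 / ε)) * (ENNReal.ofReal (t n)⁻¹ *
        ‖u (z + t n • e) - u z - t n • G z e‖ₑ +
        ENNReal.ofReal (if ε / 2 < t n * ‖G z e‖ then ‖G z e‖ else 0)) := by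
    filter_upwards [ae_restrict_of_ae hA', ae_restrict_of_ae hA2,
      ae_restrict_mem hKc.measurableSet] with z hz1 hz2 hzK
    have hzS : z ∈ S := hKS hzK
    have hzS' : z + t n • e ∈ S := mem_cthickening_of_dist_le _ z δ K hzK (by
      rw [dist_eq_norm, add_sub_cancel_left]; exact hn.le)
    have hif : 0 ≤ if ε / 2 < t n * ‖G z e‖ then ‖G z e‖ else 0 := by split_ifs <;> positivity
    rw [← ofReal_norm, ← ofReal_norm, ← ENNReal.ofReal_mul (by positivity),
      ← ENNReal.ofReal_add (by positivity) hif, ← ENNReal.ofReal_mul (by positivity)]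
    refine ENNReal.ofReal_le_ofReal ?_
    rw [norm_smul, norm_smul, Real.norm_of_nonneg (by positivity : 0 ≤ (t n)⁻¹), hw,
      indicator_of_mem hzS, indicator_of_mem hzS']
    have h1 := jump_quotient_le (Δ := u (z + t n • e) - u z) (g := G z e) (t := t n) (ε := ε)
      (j := ‖g z - g (z + t n • e)‖) htn hε
      ((norm_sub_le _ _).trans (by linarith [hg1 z, hg1 (z + t n • e)])) fun hlt => by
        rw [hgA z (hz1 (hδΩ hzS)) _ (hz2 (hδΩ hzS')) hlt, sub_self, norm_zero]
    calc (t n)⁻¹ * (‖φ z‖ * ‖g z - g (z + t n • e)‖)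
        = ‖φ z‖ * ((t n)⁻¹ * ‖g z - g (z + t n • e)‖) := by ring
      _ ≤ B * ((4 / ε) * ((t n)⁻¹ * ‖u (z + t n • e) - u z - t n • G z e‖) +
          (4 / ε) * (if ε / 2 < t n * ‖G z e‖ then ‖G z e‖ else 0)) :=
          mul_le_mul (hB z) h1 (by positivity) hB0
      _ = _ := by ring
  rw [e1]
  have hm : AEMeasurable (fun z => ENNReal.ofReal (if ε / 2 < t n * ‖G z e‖ then ‖G z e‖ else 0))
      (volume.restrict K) := by
    have h1 : AEMeasurable (fun z => {q : ℝ | ε / 2 < t n * q}.indicator (fun q => q) (‖G z e‖))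
        (volume.restrict K) :=
      (measurable_id.indicator (measurableSet_lt measurable_const (by fun_prop))).comp_aemeasurable
        hGK.1.aemeasurable
    exact h1.ennreal_ofReal
  calc ‖∫ z in K, (t n)⁻¹ • (φ z • (w z - w (z + t n • e)))‖ₑ
      ≤ ∫⁻ z in K, ENNReal.ofReal (B * (4 / ε)) * (ENNReal.ofReal (t n)⁻¹ *
        ‖u (z + t n • e) - u z - t n • G z e‖ₑ +
        ENNReal.ofReal (if ε / 2 < t n * ‖G z e‖ then ‖G z e‖ else 0)) :=
        (enorm_integral_le_lintegral_enorm _).trans (lintegral_mono_ae pt)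
    _ = _ := by
        rw [lintegral_const_mul' _ _ ENNReal.ofReal_ne_top, lintegral_add_right' _ hm,
          lintegral_const_mul' _ _ ENNReal.ofReal_ne_top]

/-- A chain class is relatively open in `N`: it contains every point of `N` within `ε` of one of its
points. -/
theorem measurableSet_chainClass {N : Set (Euc L)} (hN : IsClosed N) {ε : ℝ} (hε : 0 < ε) {c : Euc L}
    (hc : c ∈ N) : MeasurableSet (chainClass N ε c) := by
  have : chainClass N ε c = N ∩ ⋃ q ∈ chainClass N ε c, ball q ε := by
    refine Subset.antisymm (fun q hq => ⟨chainClass_subset hc hq,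
      mem_iUnion₂.2 ⟨q, hq, mem_ball_self hε⟩⟩) ?_
    rintro q ⟨hqN, hq⟩
    obtain ⟨q', hq', hd⟩ := mem_iUnion₂.1 hq
    rw [mem_ball, dist_comm] at hd
    exact mem_chainClass_of_dist_lt hc hq' hqN hd
  rw [this]
  exact hN.measurableSet.inter (isOpen_biUnion fun _ _ => isOpen_ball).measurableSet

/-- A Sobolev map into `N` takes values in a single chain class on each ball. -/
theorem exists_chainClass {N : Set (Euc L)} (hN : IsCompact N) {Ω : Set (Euc m)} (hΩ : IsOpen Ω)
    {u : Euc m → Euc L} {G : Euc m → Euc m →L[ℝ] Euc L} (h : IsWeakGradient Ω u G)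
    (huN : ∀ᵐ z ∂(volume.restrict Ω), u z ∈ N) {ε : ℝ} (hε : 0 < ε) {x : Euc m} {R : ℝ}
    (hR : 0 < R) (hx : closedBall x R ⊆ Ω) :
    ∃ c ∈ N, ∀ᵐ z ∂(volume.restrict (closedBall x R)), u z ∈ chainClass N ε c := by
  obtain ⟨A, hAN, hAfin, hAcov⟩ := hN.finite_cover_balls hε
  -- Finitely many classes cover `N`, so one of them is hit on a set of positive measure.
  have huN' : ∀ᵐ z ∂(volume.restrict (closedBall x R)), u z ∈ N :=
    ae_restrict_of_ae_restrict_of_subset hx huN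
  obtain ⟨c, hcA, hc⟩ : ∃ c ∈ A, ¬ ∀ᵐ z ∂(volume.restrict (closedBall x R)),
      u z ∉ chainClass N ε c := by
    by_contra! hcon
    have h1 := (ae_ball_iff hAfin.countable).2 hcon
    have h2 : ∀ᵐ z ∂(volume.restrict (closedBall x R)), False := by
      filter_upwards [h1, huN'] with z hz hzN
      obtain ⟨a, ha, hza⟩ := mem_iUnion₂.1 (hAcov hzN)
      rw [mem_ball, dist_comm] at hza
      exact hz a ha (mem_chainClass_of_dist_lt (hAN ha) (self_mem_chainClass N ε a) hzN hza)
    rw [eventually_false_iff_eq_bot, ae_eq_bot, Measure.restrict_eq_zero] at h2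
    exact absurd h2 (measure_closedBall_pos volume x hR).ne'
  have hcN := hAN hcA
  have hms := measurableSet_chainClass hN.isClosed hε hcN
  refine ⟨c, hcN, ?_⟩
  classical
  set e₁ : Euc 1 := EuclideanSpace.single 0 1 with he₁
  have he₁1 : ‖e₁‖ = 1 := by simp [he₁]
  set f : Euc L → Euc 1 := (chainClass N ε c).indicator fun _ => e₁ with hf
  have hfm : Measurable f := measurable_const.indicator hms
  have hum : AEMeasurable u (volume.restrict Ω) := h.1.aestronglyMeasurable.aemeasurable
  -- Points of `N` at distance less than `ε` lie in the same class, so the indicator of the class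
  -- composed with `u` has zero weak gradient and is constant on the ball. The constant is `e₁`,
  -- since the class is hit with positive measure.
  have hg0 := isWeakGradient_zero_of_locally_const hΩ h (g := Ω.indicator fun z => f (u z))
    (ε := ε) (A := {z | z ∈ Ω ∧ u z ∈ N})
    ((aestronglyMeasurable_indicator_iff hΩ.measurableSet).2
      (hfm.comp_aemeasurable hum).aestronglyMeasurable)
    (fun z => by
      refine (norm_indicator_le_norm_self _ _).trans ((norm_indicator_le_norm_self _ _).trans ?_)
      rw [he₁1])
    (by filter_upwards [huN, ae_restrict_mem hΩ.measurableSet] with z h1 h2 using ⟨h2, h1⟩) hε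
    (by
      rintro z ⟨hz, hzN⟩ z' ⟨hz', hzN'⟩ hlt
      rw [indicator_of_mem hz, indicator_of_mem hz', hf]
      rw [← dist_eq_norm] at hlt
      by_cases hcl : u z ∈ chainClass N ε c
      · rw [dist_comm] at hlt
        rw [indicator_of_mem hcl, indicator_of_mem (mem_chainClass_of_dist_lt hcN hcl hzN' hlt)]
      · rw [indicator_of_notMem hcl, indicator_of_notMem fun hcl' =>
          hcl (mem_chainClass_of_dist_lt hcN hcl' hzN hlt)])
  obtain ⟨b, hb⟩ := ae_const_of_weakGradient_zero hΩ hg0 hR hx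
  have hgz : ∀ z ∈ closedBall x R, Ω.indicator (fun z => f (u z)) z = f (u z) := fun z hz =>
    indicator_of_mem (hx hz) _
  by_cases hbe : b = e₁
  · filter_upwards [hb, ae_restrict_mem measurableSet_closedBall] with z h1 h2
    rw [hgz z h2, hbe, hf] at h1
    by_contra hcl
    rw [indicator_of_notMem hcl] at h1
    rw [← h1, norm_zero] at he₁1
    exact zero_ne_one he₁1
  · refine absurd ?_ hc
    filter_upwards [hb, ae_restrict_mem measurableSet_closedBall] with z h1 h2 hcl
    rw [hgz z h2, hf, indicator_of_mem hcl] at h1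
    exact hbe h1.symm

end LocallyConstant


/-! ### Choosing a good translation of the grid by averaging. -/

section Selection
open Filter Topology

variable {α β : Type*} [MeasurableSpace α] [MeasurableSpace β]

theorem lintegral_lintegral_mul_le {P : Measure α} [SFinite P] {ν : Measure β} [SFinite ν]
    {k : α → β → ENNReal} (hk : Measurable (Function.uncurry k)) {J : ENNReal}
    (hJ : ∀ z, ∫⁻ a, k a z ∂P ≤ J) {g : β → ENNReal} (hg : AEMeasurable g ν) :
    AEMeasurable (fun a => ∫⁻ z, k a z * g z ∂ν) P ∧
      ∫⁻ a, ∫⁻ z, k a z * g z ∂ν ∂P ≤ J * ∫⁻ z, g z ∂ν := by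
  have hm : AEMeasurable (Function.uncurry fun a z => k a z * g z) (P.prod ν) :=
    hk.aemeasurable.mul hg.comp_snd
  refine ⟨hm.lintegral_prod_right', ?_⟩
  rw [lintegral_lintegral_swap hm, ← lintegral_const_mul'' _ hg]
  refine lintegral_mono fun z => ?_
  have hka : Measurable fun a => k a z := hk.comp (measurable_id.prodMk measurable_const)
  rw [lintegral_mul_const _ hka]
  gcongr
  exact hJ z

theorem ENNReal.le_one_add_rpow {p : ℝ} (hp : 1 ≤ p) (k : ENNReal) : k ≤ 1 + k ^ p := by
  rcases le_total k 1 with h | h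
  · exact h.trans le_self_add
  · refine le_trans ?_ le_add_self
    conv_lhs => rw [← ENNReal.rpow_one k]
    exact ENNReal.rpow_le_rpow_of_exponent_le h hp

/-- Choosing a good parameter `a` by averaging. -/
theorem exists_good_parameter {P : Measure α} [IsProbabilityMeasure P] {ν : Measure β}
    [IsFiniteMeasure ν] {p : ℝ} (hp : 1 ≤ p) {k : α → β → ENNReal}
    (hk : Measurable (Function.uncurry k)) {J : ENNReal} (hJt : J ≠ ⊤)
    (hJ : ∀ z, ∫⁻ a, k a z ^ p ∂P ≤ J) {f : β → ENNReal} (hf : AEMeasurable f ν)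
    (hft : ∫⁻ z, f z ∂ν ≠ ⊤) {A : Set β} {ι : Type*} [Countable ι]
    {q : ι → ℕ → β → ENNReal} (hq : ∀ j n, AEMeasurable (q j n) ν)
    (hqs : ∀ j n, ∫⁻ z, q j n z ∂ν ≤ (2 : ENNReal)⁻¹ ^ n) {good : α → Prop}
    (hgood : ∀ᵐ a ∂P, good a) :
    ∃ a, good a ∧ ∫⁻ z in A, k a z ^ p * f z ∂ν ≤ J * ∫⁻ z in A, f z ∂ν ∧
      ∫⁻ z, k a z ^ p * f z ∂ν ≠ ⊤ ∧ (∀ᵐ z ∂ν, k a z ≠ ⊤) ∧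
      ∀ j, Tendsto (fun n => ∫⁻ z, k a z * q j n z ∂ν) atTop (𝓝 0) := by
  have hkp : Measurable (Function.uncurry fun a z => k a z ^ p) := hk.pow_const p
  have hJ1 : ∀ z, ∫⁻ a, k a z ∂P ≤ 1 + J := by
    intro z
    calc ∫⁻ a, k a z ∂P ≤ ∫⁻ a, (1 + k a z ^ p) ∂P :=
          lintegral_mono fun a => ENNReal.le_one_add_rpow hp _
      _ ≤ 1 + J := by
          rw [lintegral_add_left measurable_const]
          exact add_le_add (by simp) (hJ z)
  have hJ1t : 1 + J ≠ ⊤ := ENNReal.add_ne_top.2 ⟨ENNReal.one_ne_top, hJt⟩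
  obtain ⟨m1, b1⟩ := lintegral_lintegral_mul_le (ν := ν.restrict A) hkp hJ hf.restrict
  obtain ⟨m2, b2⟩ := lintegral_lintegral_mul_le (ν := ν) hkp hJ hf
  obtain ⟨m3, b3⟩ := lintegral_lintegral_mul_le (ν := ν) hk hJ1 (g := fun _ => 1) aemeasurable_const
  have h2 : ∀ᵐ a ∂P, ∫⁻ z, k a z ^ p * f z ∂ν < ⊤ :=
    ae_lt_top' m2 (ne_top_of_le_ne_top (ENNReal.mul_ne_top hJt hft) b2)
  have h3 : ∀ᵐ a ∂P, ∀ᵐ z ∂ν, k a z ≠ ⊤ := by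
    have h3' : ∀ᵐ a ∂P, ∫⁻ z, k a z * 1 ∂ν < ⊤ :=
      ae_lt_top' m3 (ne_top_of_le_ne_top (ENNReal.mul_ne_top hJ1t (by simp)) b3)
    filter_upwards [h3'] with a ha
    simp only [mul_one] at ha
    have hka : Measurable fun z => k a z := hk.comp (measurable_const.prodMk measurable_id)
    filter_upwards [ae_lt_top hka ha.ne] with z hz using hz.ne
  -- The averages over `a` are at most `(1 + J) 2⁻ⁿ`, which is summable; so for almost every `a` the
  -- series over `n` converges and its terms tend to zero.
  have h4 : ∀ᵐ a ∂P, ∀ j, Tendsto (fun n => ∫⁻ z, k a z * q j n z ∂ν) atTop (𝓝 0) := by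
    refine ae_all_iff.2 fun j => ?_
    have hsum : ∫⁻ a, ∑' n, ∫⁻ z, k a z * q j n z ∂ν ∂P ≠ ⊤ := by
      rw [lintegral_tsum fun n => (lintegral_lintegral_mul_le hk hJ1 (hq j n)).1]
      refine ne_top_of_le_ne_top ?_ (ENNReal.tsum_le_tsum fun n =>
        ((lintegral_lintegral_mul_le hk hJ1 (hq j n)).2.trans
          (mul_le_mul_right (hqs j n) (1 + J))))
      rw [ENNReal.tsum_mul_left, ENNReal.tsum_geometric]
      refine ENNReal.mul_ne_top hJ1t ?_
      rw [ENNReal.one_sub_inv_two, inv_inv]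
      exact ENNReal.ofNat_ne_top
    have hm : AEMeasurable (fun a => ∑' n, ∫⁻ z, k a z * q j n z ∂ν) P :=
      AEMeasurable.tsum fun n => (lintegral_lintegral_mul_le hk hJ1 (hq j n)).1
    filter_upwards [ae_lt_top' hm hsum] with a ha
    exact ENNReal.tendsto_atTop_zero_of_tsum_ne_top ha.ne
  -- The parameters at which the integral over `A` does not exceed its mean form a set of positive
  -- measure, which therefore meets the almost sure conditions.
  have hpos := measure_le_lintegral_pos m1
  have hall := hgood.and (h2.and (h3.and h4))
  obtain ⟨a, ha1, ha2⟩ := ((frequently_ae_iff.2 hpos.ne').and_eventually hall).exists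
  exact ⟨a, ha2.1, ha1.trans b1, ha2.2.1.ne, ha2.2.2.1, ha2.2.2.2⟩

theorem ae_mem_unitCube (L : ℕ) : ∀ᵐ a ∂(unitCube L), ∀ l, a l ∈ Icc (0 : ℝ) 1 := by
  refine ae_all_iff.2 fun l => ?_
  exact (measurePreserving_eval (fun _ : Fin L => volume.restrict (Icc (0 : ℝ) 1)) l).quasiMeasurePreserving.ae
    (ae_restrict_mem measurableSet_Icc)

end Selection


/-! ### The two-stage deformation to a constant. -/

section Interpolation
open Filter Topology

variable {m L : ℕ}

/-- Moving `y` to `f c` in two stages: first to `f y`, then along `f` of the segment from `y` to `c`,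
with parameter `s ∈ [0, 2]`. -/
noncomputable def twoStage (S f : Euc L → Euc L) (c : Euc L) (s : ℝ) (y : Euc L) : Euc L :=
  S (y + clamp s • (f (y + clamp (s - 1) • (c - y)) - y))

theorem norm_add_smul_sub_le {E : Type*} [NormedAddCommGroup E] [NormedSpace ℝ E] {t t' : ℝ}
    (ht : t ∈ Icc (0 : ℝ) 1) (y y' q q' : E) {M : ℝ} (hy' : ‖y'‖ ≤ M) (hq' : ‖q'‖ ≤ M) :
    ‖(y' + t' • (q' - y')) - (y + t • (q - y))‖ ≤
      (1 - t) * ‖y' - y‖ + t * ‖q' - q‖ + 2 * M * |t' - t| := by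
  have e : (y' + t' • (q' - y')) - (y + t • (q - y)) =
      (1 - t) • (y' - y) + t • (q' - q) + (t' - t) • (q' - y') := by module
  rw [e]
  refine (norm_add₃_le).trans ?_
  rw [norm_smul, norm_smul, norm_smul, Real.norm_of_nonneg ht.1,
    Real.norm_of_nonneg (sub_nonneg.2 ht.2), Real.norm_eq_abs, mul_comm (2 * M)]
  gcongr
  calc ‖q' - y'‖ ≤ ‖q'‖ + ‖y'‖ := norm_sub_le _ _
    _ ≤ 2 * M := by linarith

/-- The increment is expanded about `y`, so that a Lipschitz bound for `f` is needed only from the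
single base point of the second stage. This one-sided control is all that a singular `f` offers. -/
theorem norm_twoStage_sub_le {S f : Euc L → Euc L} {K : NNReal} (hS : LipschitzWith K S) {c : Euc L}
    {M : ℝ} (hc : ‖c‖ ≤ M) {γ : ℝ} (hγ : 0 ≤ γ) {s s' : ℝ} {y y' : Euc L} (hy' : ‖y'‖ ≤ M)
    (hfM : ∀ z, ‖f z‖ ≤ M)
    (hf : ∀ z', ‖f z' - f (y + clamp (s - 1) • (c - y))‖ ≤ γ * ‖z' - (y + clamp (s - 1) • (c - y))‖) :
    ‖twoStage S f c s' y' - twoStage S f c s y‖ ≤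
      K * (1 + γ) * (‖y' - y‖ + 2 * M * |s' - s|) := by
  have hM : 0 ≤ M := (norm_nonneg _).trans hc
  set X := y + clamp (s - 1) • (c - y)
  set X' := y' + clamp (s' - 1) • (c - y')
  have hX : ‖X' - X‖ ≤ ‖y' - y‖ + 2 * M * |s' - s| := by
    refine (norm_add_smul_sub_le (clamp_mem (s - 1)) y y' c c hy' hc).trans ?_
    have h1 := abs_clamp_sub_le (s' - 1) (s - 1)
    rw [show s' - 1 - (s - 1) = s' - s by ring] at h1
    rw [sub_self, norm_zero, mul_zero, add_zero]
    have h2 := (clamp_mem (s - 1)).1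
    gcongr
    nlinarith [norm_nonneg (y' - y)]
  have h1 := norm_add_smul_sub_le (t' := clamp s') (clamp_mem s) y y' (f X) (f X') hy' (hfM X')
  have h2 := abs_clamp_sub_le s' s
  have h3 := clamp_mem s
  have h4 := hf X'
  have h5 : clamp s * ‖f X' - f X‖ ≤ γ * (‖y' - y‖ + 2 * M * |s' - s|) := by
    calc clamp s * ‖f X' - f X‖ ≤ 1 * ‖f X' - f X‖ := by gcongr; exact h3.2
      _ ≤ γ * (‖y' - y‖ + 2 * M * |s' - s|) := by
        rw [one_mul]; exact h4.trans (by gcongr)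
  have h6 : 2 * M * |clamp s' - clamp s| ≤ 2 * M * |s' - s| := by gcongr
  have h7 : (1 - clamp s) * ‖y' - y‖ ≤ ‖y' - y‖ := by nlinarith [norm_nonneg (y' - y), h3.1]
  calc ‖twoStage S f c s' y' - twoStage S f c s y‖ ≤ K * ‖(y' + clamp s' • (f X' - y')) -
        (y + clamp s • (f X - y))‖ := by
        have := hS.dist_le_mul (y' + clamp s' • (f X' - y')) (y + clamp s • (f X - y))
        rwa [dist_eq_norm, dist_eq_norm] at this
    _ ≤ K * ((1 + γ) * (‖y' - y‖ + 2 * M * |s' - s|)) := by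
        gcongr
        linarith
    _ = _ := by ring

/-- In the first stage the segment hypothesis applies. In the second the outer parameter is `1`, so
the value is a value of `f`, although the inner segment from `y` to `c` leaves `N`. -/
theorem twoStage_mem {N : Set (Euc L)} {S f : Euc L → Euc L} {c : Euc L} (hSN : ∀ y ∈ N, S y = y)
    (hf : ∀ y, f y ∈ N) {y : Euc L} (hy : ∀ t ∈ Icc (0 : ℝ) 1, S (y + t • (f y - y)) ∈ N) (s : ℝ) :
    twoStage S f c s y ∈ N := by
  unfold twoStage
  rcases le_total s 1 with h | h
  · rw [clamp_of_nonpos (sub_nonpos.2 h), zero_smul, add_zero]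
    exact hy _ (clamp_mem s)
  · rw [clamp_of_one_le h, one_smul, add_sub_cancel, hSN _ (hf _)]
    exact hf _

theorem twoStage_of_nonpos {N : Set (Euc L)} {S f : Euc L → Euc L} {c y : Euc L}
    (hSN : ∀ y ∈ N, S y = y) (hy : y ∈ N) {s : ℝ} (hs : s ≤ 0) : twoStage S f c s y = y := by
  unfold twoStage
  rw [clamp_of_nonpos hs, zero_smul, add_zero, hSN y hy]

theorem twoStage_of_two_le {N : Set (Euc L)} {S f : Euc L → Euc L} {c : Euc L} (y : Euc L)
    (hSN : ∀ y ∈ N, S y = y) (hf : ∀ y, f y ∈ N) {s : ℝ} (hs : 2 ≤ s) :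
    twoStage S f c s y = f c := by
  unfold twoStage
  rw [clamp_of_one_le (by linarith : (1 : ℝ) ≤ s), clamp_of_one_le (by linarith : (1 : ℝ) ≤ s - 1),
    one_smul, one_smul, add_sub_cancel, add_sub_cancel, hSN _ (hf _)]

theorem measurable_twoStage {S f : Euc L → Euc L} (hS : Continuous S) (hf : Measurable f) {c : Euc L}
    {s : Euc m → ℝ} (hs : Continuous s) {y : Euc m → Euc L} (hy : Measurable y) :
    Measurable fun z => twoStage S f c (s z) (y z) := by
  have h1 : Continuous fun z => clamp (s z) := lipschitzWith_clamp.continuous.comp hs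
  have h2 : Continuous fun z => clamp (s z - 1) :=
    lipschitzWith_clamp.continuous.comp (hs.sub continuous_const)
  exact hS.measurable.comp (hy.add (h1.measurable.smul
    ((hf.comp (hy.add (h2.measurable.smul (measurable_const.sub hy)))).sub hy)))

end Interpolation


/-! ### The Sobolev perturbation produced by a singular map. -/

section SingularCompetitor
open Filter Topology

variable {m L : ℕ}

/-- The Sobolev perturbation that deforms `y` to a constant near the centre of a ball, built from a
map `f` into the target whose local Lipschitz constant is controlled by `1 / gap`. -/
theorem exists_twoStage_perturbation {p : ℝ} (hp : 1 ≤ p) {N T : Set (Euc L)} {S f : Euc L → Euc L}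
    {K : NNReal} (hS : LipschitzWith K S) (hSN : ∀ y ∈ N, S y = y) {M : ℝ} (hM : ∀ y ∈ N, ‖y‖ ≤ M)
    {c : Euc L} (hc : c ∈ N) (hf : ∀ y, f y ∈ N) {gap : Euc L → ℝ} (hgc : Continuous gap)
    (hg0 : ∀ y, 0 ≤ gap y) (hg1 : ∀ y, gap y ≤ 1) {C₀ : ℝ} (hC₀ : 0 ≤ C₀)
    (hfl : ∀ y y', 0 < gap y → ‖f y' - f y‖ ≤ C₀ / gap y * ‖y' - y‖) (hTN : T ⊆ N)
    (hseg : ∀ q ∈ T, ∀ t ∈ Icc (0 : ℝ) 1, S (q + t • (f q - q)) ∈ N) {y : Euc m → Euc L}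
    (hym : Measurable y) (hyT : ∀ z, y z ∈ T) {x : Euc m} {ρ ρ' R : ℝ} (hρρ' : ρ < ρ')
    (hρ' : 0 < ρ') (hR : ρ' < R) {G : Euc m → Euc m →L[ℝ] Euc L}
    (hG : AEStronglyMeasurable G (volume.restrict (closedBall x R))) {k : Euc m → ENNReal}
    (hk : k = fun z => (ENNReal.ofReal (gap (y z +
      clamp (2 * (ρ' - ‖z - x‖) / (ρ' - ρ) - 1) • (c - y z))))⁻¹)
    (hkt : ∀ᵐ z ∂(volume.restrict (closedBall x R)), k z ≠ ⊤)
    (hfin : ∫⁻ z in closedBall x R, k z ^ p * ENNReal.ofReal (‖G z‖ + 4 * M / (ρ' - ρ)) ^ p ≠ ⊤)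
    {t : ℕ → ℝ} (ht : ∀ n, 0 < t n) (ht0 : Tendsto t atTop (𝓝 0))
    (hlim : ∀ j : Fin m, Tendsto (fun n => ∫⁻ z in closedBall x R, k z * (ENNReal.ofReal (t n)⁻¹ *
      ‖y (z + t n • EuclideanSpace.single j (1 : ℝ)) - y z -
        t n • G z (EuclideanSpace.single j (1 : ℝ))‖ₑ)) atTop (𝓝 0)) :
    ∃ (w : Euc m → Euc L) (H : Euc m → Euc m →L[ℝ] Euc L), (∀ z, y z + w z ∈ N) ∧
      (∀ z ∉ closedBall x ρ', w z = 0) ∧ (∃ q, ∀ z ∈ ball x ρ, y z + w z = q) ∧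
      MemLp w (ENNReal.ofReal p) ∧ IsWeakGradient univ w H ∧
      ∀ᵐ z ∂(volume.restrict (closedBall x R)), ‖H z‖ₑ ^ p ≤
        ENNReal.ofReal (m * L * (K + 1 + K * C₀)) ^ p *
          (k z ^ p * ENNReal.ofReal (‖G z‖ + 4 * M / (ρ' - ρ)) ^ p) := by
  have hd : 0 < ρ' - ρ := sub_pos.2 hρρ'
  have hM0 : 0 ≤ M := (norm_nonneg c).trans (hM c hc)
  set b : ℝ := 4 * M / (ρ' - ρ) with hb
  have hb0 : 0 ≤ b := by positivity
  -- Since the gap is at most `1`, this satisfies `K (1 + C₀ / gap) + 1 ≤ C₁ / gap`; the `1`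
  -- accounts for subtracting `y`.
  set C₁ : ℝ := K + 1 + K * C₀ with hC₁
  have hC₁0 : 0 ≤ C₁ := by positivity
  -- At least `2` on the inner ball, where the deformation is complete, and at most `0` off the
  -- outer one, where nothing moves. Its slope `2 / (ρ' - ρ)` times `2 * M` is `b`.
  set s : Euc m → ℝ := fun z => 2 * (ρ' - ‖z - x‖) / (ρ' - ρ) with hs
  have hsc : Continuous s := by fun_prop
  set X : Euc m → Euc L := fun z => y z + clamp (s z - 1) • (c - y z) with hX
  have hXm : Measurable X := by
    have h2 : Continuous fun z => clamp (s z - 1) :=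
      lipschitzWith_clamp.continuous.comp (hsc.sub continuous_const)
    exact hym.add (h2.measurable.smul (measurable_const.sub hym))
  have hyN : ∀ z, y z ∈ N := fun z => hTN (hyT z)
  have hK0 : (0 : ℝ) ≤ K := K.2
  set w : Euc m → Euc L := fun z => twoStage S f c (s z) (y z) - y z with hw
  set κ : Euc m → ℝ := fun z => C₁ / gap (X z) with hκ
  have hκm : Measurable κ := measurable_const.div (hgc.measurable.comp hXm)
  have hκ0 : ∀ z, 0 ≤ κ z := fun z => div_nonneg hC₁0 (hg0 _)
  have hκk : ∀ z, ENNReal.ofReal (κ z) ≤ ENNReal.ofReal C₁ * k z := by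
    intro z
    rw [hk]
    rcases (hg0 (X z)).eq_or_lt with h | h
    · simp only [hκ, ← h, div_zero, ENNReal.ofReal_zero, zero_le]
    · simp only [hκ]
      rw [ENNReal.ofReal_div_of_pos h, div_eq_mul_inv]
  have hgap : ∀ᵐ z ∂(volume.restrict (closedBall x R)), 0 < gap (X z) := by
    filter_upwards [hkt] with z hz
    rw [hk, Ne, ENNReal.inv_eq_top, ENNReal.ofReal_eq_zero, not_le] at hz
    exact hz
  have hmemN : ∀ z, y z + w z ∈ N := fun z => by
    rw [hw]
    simp only [add_sub_cancel]
    exact twoStage_mem hSN hf (hseg _ (hyT z)) _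
  have hw0 : ∀ z ∉ closedBall x ρ', w z = 0 := by
    intro z hz
    rw [mem_closedBall, dist_eq_norm, not_le] at hz
    have : s z ≤ 0 := div_nonpos_of_nonpos_of_nonneg (by linarith) hd.le
    simp only [hw]
    rw [twoStage_of_nonpos hSN (hyN z) this, sub_self]
  have hconst : ∀ z ∈ ball x ρ, y z + w z = f c := by
    intro z hz
    rw [mem_ball, dist_eq_norm] at hz
    simp only [hw, add_sub_cancel]
    refine twoStage_of_two_le _ hSN hf ?_
    rw [hs]
    simp only
    rw [le_div_iff₀ hd]
    linarith
  have hwM : ∀ z, ‖w z‖ ≤ 2 * M := by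
    intro z
    have e : w z = (y z + w z) - y z := by abel
    rw [e]
    refine (norm_sub_le _ _).trans ?_
    linarith [hM _ (hmemN z), hM _ (hyN z)]
  -- Nothing is known about `f` where the gap vanishes, but almost every `z` of the large ball
  -- avoids that set, and on the open set of positive gap `f` is continuous; so `f` may be replaced
  -- by a measurable function.
  have hwm : AEStronglyMeasurable w volume := by
    have hO : IsOpen {q : Euc L | 0 < gap q} := isOpen_lt continuous_const hgc
    have hfO : ContinuousOn f {q : Euc L | 0 < gap q} := by
      intro q hq
      refine ContinuousAt.continuousWithinAt ?_
      refine continuousAt_of_locally_lipschitz one_pos (C₀ / gap q) fun q' _ => ?_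
      rw [dist_eq_norm, dist_eq_norm]
      exact hfl q q' hq
    classical
    set f' : Euc L → Euc L := {q : Euc L | 0 < gap q}.piecewise f (fun _ => 0) with hf'
    have hf'm : Measurable f' :=
      hfO.measurable_piecewise continuousOn_const hO.measurableSet
    have hwm' : Measurable ((closedBall x R).indicator
        fun z => twoStage S f' c (s z) (y z) - y z) :=
      ((measurable_twoStage hS.continuous hf'm hsc hym).sub hym).indicator measurableSet_closedBall
    refine hwm'.aestronglyMeasurable.congr ?_
    filter_upwards [(ae_restrict_iff' measurableSet_closedBall).1 hgap] with z hz
    by_cases h : z ∈ closedBall x R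
    · rw [indicator_of_mem h]
      simp only [hw]
      congr 1
      have e : f' (X z) = f (X z) := piecewise_eq_of_mem {q : Euc L | 0 < gap q} _ _ (hz h)
      exact congrArg (fun v => S (y z + clamp (s z) • (v - y z))) e
    · rw [indicator_of_notMem h, hw0 z fun h' => h (closedBall_subset_closedBall hR.le h')]
  have hwLp : ∀ q : ENNReal, MemLp w q volume := by
    intro q
    have e : w = (closedBall x ρ').indicator w := by
      ext1 z
      by_cases h : z ∈ closedBall x ρ'
      · rw [indicator_of_mem h]
      · rw [indicator_of_notMem h, hw0 z h]
    rw [e, memLp_indicator_iff_restrict measurableSet_closedBall]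
    have : IsFiniteMeasure (volume.restrict (closedBall x ρ')) :=
      isFiniteMeasure_restrict.2 measure_closedBall_lt_top.ne
    exact MemLp.of_bound hwm.restrict (2 * M) (Eventually.of_forall hwM)
  have hwi : Integrable w := memLp_one_iff_integrable.1 (hwLp 1)
  have : IsFiniteMeasure (volume.restrict (closedBall x R)) :=
    isFiniteMeasure_restrict.2 measure_closedBall_lt_top.ne
  have hGi : IntegrableOn (fun z => κ z * (‖G z‖ + b)) (closedBall x R) := by
    have hm : AEStronglyMeasurable (fun z => κ z * (‖G z‖ + b)) (volume.restrict (closedBall x R)) :=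
      hκm.aestronglyMeasurable.mul (hG.norm.add aestronglyMeasurable_const)
    have hp0 : 0 < p := by linarith
    have hLp : MemLp (fun z => κ z * (‖G z‖ + b)) (ENNReal.ofReal p)
        (volume.restrict (closedBall x R)) := by
      refine ⟨hm, ?_⟩
      rw [eLpNorm_lt_top_iff_lintegral_rpow_enorm_lt_top (by simpa using hp0) (by simp),
        ENNReal.toReal_ofReal hp0.le]
      refine lt_of_le_of_lt (b := ∫⁻ z in closedBall x R, ENNReal.ofReal C₁ ^ p *
        (k z ^ p * ENNReal.ofReal (‖G z‖ + b) ^ p)) (lintegral_mono fun z => ?_) ?_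
      · rw [← ENNReal.mul_rpow_of_nonneg _ _ hp0.le, ← ENNReal.mul_rpow_of_nonneg _ _ hp0.le,
          ← mul_assoc]
        refine ENNReal.rpow_le_rpow ?_ hp0.le
        rw [Real.enorm_eq_ofReal (by have := hκ0 z; positivity), ENNReal.ofReal_mul (hκ0 z)]
        gcongr
        exact hκk z
      · rw [lintegral_const_mul' _ _ (ENNReal.rpow_ne_top_of_nonneg hp0.le ENNReal.ofReal_ne_top)]
        exact ENNReal.mul_lt_top (ENNReal.rpow_lt_top_of_nonneg hp0.le ENNReal.ofReal_ne_top)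
          hfin.lt_top
    exact hLp.integrable (by simpa using hp)
  have hinc : ∀ᵐ z ∂(volume.restrict (closedBall x R)), ∀ z',
      ‖w z' - w z‖ ≤ κ z * (‖y z' - y z‖ + b * ‖z' - z‖) := by
    filter_upwards [hgap] with z hz z'
    have h1 := norm_twoStage_sub_le hS (hM c hc) (div_nonneg hC₀ (hg0 (X z))) (s := s z) (s' := s z')
      (y := y z) (hM _ (hyN z')) (fun q => hM _ (hf q)) fun q => hfl (X z) q hz
    have h2 : 2 * M * |s z' - s z| ≤ b * ‖z' - z‖ := by
      have e : s z' - s z = 2 / (ρ' - ρ) * (‖z - x‖ - ‖z' - x‖) := by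
        simp only [hs]; field_simp; ring
      rw [e, abs_mul, abs_of_nonneg (by positivity : 0 ≤ 2 / (ρ' - ρ))]
      have h3 : |‖z - x‖ - ‖z' - x‖| ≤ ‖z' - z‖ := by
        refine (abs_norm_sub_norm_le _ _).trans (le_of_eq ?_)
        rw [sub_sub_sub_cancel_right, norm_sub_rev]
      calc 2 * M * (2 / (ρ' - ρ) * |‖z - x‖ - ‖z' - x‖|)
          ≤ 2 * M * (2 / (ρ' - ρ) * ‖z' - z‖) := by gcongr
        _ = b * ‖z' - z‖ := by rw [hb]; ring
    have h3 : K * (1 + C₀ / gap (X z)) + 1 ≤ κ z := by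
      simp only [hκ]
      rw [le_div_iff₀ hz]
      have e : (K * (1 + C₀ / gap (X z)) + 1) * gap (X z) = (K + 1) * gap (X z) + K * C₀ := by
        field_simp
        ring
      rw [e, hC₁]
      nlinarith [hg1 (X z)]
    have e : w z' - w z = (twoStage S f c (s z') (y z') - twoStage S f c (s z) (y z)) -
        (y z' - y z) := by simp only [hw]; abel
    rw [e]
    have h4 : 0 ≤ K * (1 + C₀ / gap (X z)) := by positivity
    calc _ ≤ K * (1 + C₀ / gap (X z)) * (‖y z' - y z‖ + 2 * M * |s z' - s z|) + ‖y z' - y z‖ :=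
          (norm_sub_le _ _).trans (by gcongr)
      _ ≤ K * (1 + C₀ / gap (X z)) * (‖y z' - y z‖ + b * ‖z' - z‖) +
          1 * (‖y z' - y z‖ + b * ‖z' - z‖) := by
          gcongr
          rw [one_mul]
          have : 0 ≤ b * ‖z' - z‖ := by positivity
          linarith
      _ ≤ _ := by
          rw [← add_mul]
          gcongr
  have hlim' : ∀ j : Fin m, ∃ t : ℕ → ℝ, (∀ n, 0 < t n) ∧ Tendsto t atTop (𝓝 0) ∧
      Tendsto (fun n => ENNReal.ofReal (t n)⁻¹ * ∫⁻ z in closedBall x R, ENNReal.ofReal (κ z) *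
        ‖y (z + t n • EuclideanSpace.single j (1 : ℝ)) - y z -
          t n • G z (EuclideanSpace.single j (1 : ℝ))‖ₑ) atTop (𝓝 0) := by
    intro j
    refine ⟨t, ht, ht0, ?_⟩
    have h1 := ENNReal.Tendsto.const_mul (hlim j) (Or.inr (ENNReal.ofReal_ne_top (r := C₁)))
    rw [mul_zero] at h1
    refine tendsto_of_tendsto_of_tendsto_of_le_of_le tendsto_const_nhds h1 (fun _ => zero_le)
      fun n => ?_
    simp only
    rw [← lintegral_const_mul' _ _ ENNReal.ofReal_ne_top,
      ← lintegral_const_mul' _ _ ENNReal.ofReal_ne_top]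
    refine lintegral_mono fun z => ?_
    calc _ = ENNReal.ofReal (κ z) * (ENNReal.ofReal (t n)⁻¹ *
          ‖y (z + t n • EuclideanSpace.single j (1 : ℝ)) - y z -
          t n • G z (EuclideanSpace.single j (1 : ℝ))‖ₑ) := by ring
      _ ≤ (ENNReal.ofReal C₁ * k z) * (ENNReal.ofReal (t n)⁻¹ *
          ‖y (z + t n • EuclideanSpace.single j (1 : ℝ)) - y z -
          t n • G z (EuclideanSpace.single j (1 : ℝ))‖ₑ) := by gcongr; exact hκk z
      _ = _ := by ring
  have hth : cthickening (R - ρ') (closedBall x ρ') ⊆ closedBall x R := by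
    rw [cthickening_closedBall (by linarith) hρ'.le]
    exact closedBall_subset_closedBall (by linarith)
  obtain ⟨H, hH, hHb⟩ := exists_weakGradient_of_increment_le (isCompact_closedBall x R)
    (sub_pos.2 hR) hth hw0 hwi hκ0 hb0 hinc hGi hlim'
  refine ⟨w, H, hmemN, hw0, ⟨f c, hconst⟩, hwLp _, hH, ?_⟩
  filter_upwards [ae_restrict_of_ae hHb, ae_restrict_mem measurableSet_closedBall] with z hz hzm
  have hp0 : 0 ≤ p := by linarith
  rw [indicator_of_mem hzm] at hz
  rw [← ENNReal.mul_rpow_of_nonneg _ _ hp0, ← ENNReal.mul_rpow_of_nonneg _ _ hp0]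
  refine ENNReal.rpow_le_rpow ?_ hp0
  have hmL : (0 : ℝ) ≤ m * L := by positivity
  calc ‖H z‖ₑ = ENNReal.ofReal ‖H z‖ := (ofReal_norm _).symm
    _ ≤ ENNReal.ofReal (m * L * (κ z * (‖G z‖ + b))) := ENNReal.ofReal_le_ofReal hz
    _ = ENNReal.ofReal (m * L) * (ENNReal.ofReal (κ z) * ENNReal.ofReal (‖G z‖ + b)) := by
        rw [ENNReal.ofReal_mul hmL, ENNReal.ofReal_mul (hκ0 z)]
    _ ≤ ENNReal.ofReal (m * L) * ((ENNReal.ofReal C₁ * k z) * ENNReal.ofReal (‖G z‖ + b)) := by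
        gcongr; exact hκk z
    _ = _ := by
        rw [ENNReal.ofReal_mul hmL]; ring

end SingularCompetitor


/-! ### The perturbation for a well chosen translation of the grid. -/

section SelectedCompetitor
open Filter Topology

variable {m L : ℕ}

/-- A subsequence of the steps `1/(n + 1)` makes the Taylor remainders summable, as needed for one
parameter to serve all `n` in `exists_good_parameter`. -/
theorem exists_summable_increments {Ω : Set (Euc m)} (hΩ : IsOpen Ω) {u : Euc m → Euc L}
    {G : Euc m → Euc m →L[ℝ] Euc L} (h : IsWeakGradient Ω u G) {K : Set (Euc m)}
    (hK : IsCompact K) (hKΩ : K ⊆ Ω) : ∃ t : ℕ → ℝ, (∀ n, 0 < t n) ∧ Tendsto t atTop (𝓝 0) ∧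
      ∀ (j : Fin m) n, ENNReal.ofReal (t n)⁻¹ * ∫⁻ z in K,
        ‖u (z + t n • EuclideanSpace.single j (1 : ℝ)) - u z -
          t n • G z (EuclideanSpace.single j (1 : ℝ))‖ₑ ≤ (2 : ENNReal)⁻¹ ^ n := by
  set τ : ℕ → ℝ := fun n => 1 / ((n : ℝ) + 1) with hτ
  have hτ0 : Tendsto τ atTop (𝓝 0) := tendsto_one_div_add_atTop_nhds_zero_nat
  have hτp : ∀ n, 0 < τ n := fun n => by positivity
  have hev : ∀ n : ℕ, ∃ k ≥ n, ∀ j : Fin m, ENNReal.ofReal (τ k)⁻¹ * ∫⁻ z in K,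
        ‖u (z + τ k • EuclideanSpace.single j (1 : ℝ)) - u z -
          τ k • G z (EuclideanSpace.single j (1 : ℝ))‖ₑ ≤ (2 : ENNReal)⁻¹ ^ n := by
    intro n
    have hpos : (0 : ENNReal) < (2 : ENNReal)⁻¹ ^ n := ENNReal.pow_pos (by simp) n
    have h1 := eventually_all.2 fun j : Fin m =>
      (tendsto_lintegral_increment hΩ h hK hKΩ (EuclideanSpace.single j (1 : ℝ)) hτp
        hτ0).eventually_le_const hpos
    obtain ⟨k, hk, hkn⟩ := (h1.and (eventually_ge_atTop n)).exists
    exact ⟨k, hkn, hk⟩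
  choose k hk hkb using hev
  exact ⟨fun n => τ (k n), fun n => hτp _, hτ0.comp (tendsto_atTop_mono hk tendsto_id),
    fun j n => hkb n j⟩

theorem exists_measurable_representative {T : Set (Euc L)} (hT : MeasurableSet T) {c : Euc L}
    (hc : c ∈ T) {B : Set (Euc m)} {u : Euc m → Euc L}
    (hu : AEStronglyMeasurable u (volume.restrict B))
    (huT : ∀ᵐ z ∂(volume.restrict B), u z ∈ T) :
    ∃ y : Euc m → Euc L, Measurable y ∧ (∀ z, y z ∈ T) ∧ ∀ᵐ z ∂(volume.restrict B), u z = y z := by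
  classical
  refine ⟨fun z => if hu.mk u z ∈ T then hu.mk u z else c, ?_, fun z => ?_, ?_⟩
  · exact Measurable.ite (hu.stronglyMeasurable_mk.measurable hT) hu.stronglyMeasurable_mk.measurable
      measurable_const
  · dsimp only
    split_ifs with h
    · exact h
    · exact hc
  · filter_upwards [hu.ae_eq_mk, huT] with z h1 h2
    rw [h1] at h2
    rw [if_pos h2, h1]

theorem lintegral_ofReal_add_rpow_le {α E : Type*} [MeasurableSpace α] [NormedAddCommGroup E] {p : ℝ}
    (hp : 1 ≤ p) (ν : Measure α) (g : α → E) {b : ℝ} (hb : 0 ≤ b) :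
    ∫⁻ z, ENNReal.ofReal (‖g z‖ + b) ^ p ∂ν ≤
      (2 : ENNReal) ^ (p - 1) * (∫⁻ z, ‖g z‖ₑ ^ p ∂ν + ENNReal.ofReal b ^ p * ν univ) := by
  have h1 : ∀ z, ENNReal.ofReal (‖g z‖ + b) ^ p ≤
      (2 : ENNReal) ^ (p - 1) * (‖g z‖ₑ ^ p + ENNReal.ofReal b ^ p) := by
    intro z
    rw [ENNReal.ofReal_add (norm_nonneg _) hb, ofReal_norm]
    exact ENNReal.rpow_add_le_mul_rpow_add_rpow _ _ hp
  refine (lintegral_mono h1).trans (le_of_eq ?_)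
  rw [lintegral_const_mul' _ _ (ENNReal.rpow_ne_top_of_nonneg (by linarith) ENNReal.ofNat_ne_top),
    lintegral_add_right _ measurable_const, lintegral_const]

theorem aemeasurable_increment_quotient {ν : Measure (Euc m)} {y : Euc m → Euc L}
    (hy : Measurable y) {G : Euc m → Euc m →L[ℝ] Euc L} (hG : AEStronglyMeasurable G ν) (t : ℝ)
    (e : Euc m) : AEMeasurable (fun z => ENNReal.ofReal t⁻¹ * ‖y (z + t • e) - y z - t • G z e‖ₑ) ν := by
  have h1 : AEStronglyMeasurable (fun z => G z e) ν :=
    (ContinuousLinearMap.apply ℝ (Euc L) e).continuous.comp_aestronglyMeasurable hG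
  have h2 : Measurable fun z => y (z + t • e) - y z :=
    (hy.comp (measurable_id.add_const _)).sub hy
  have h3 : AEStronglyMeasurable (fun z => t • G z e) ν := h1.const_smul t
  exact (h2.aestronglyMeasurable.sub h3).enorm.const_mul _

theorem continuous_gridGap_div_add (h : ℝ) (a : Fin L → ℝ) :
    Continuous fun q : Euc L => gridGap ((fun l => q l / h) + a) := by
  have h1 : Continuous fun (q : Euc L) (l : Fin L) => q l / h := by fun_prop
  have h2 : Continuous fun q : Euc L => (fun l => q l / h) + a := h1.add continuous_const
  exact continuous_gridGap.comp h2

theorem measurable_inv_gridGap {X : Euc m → Euc L} (hX : Measurable X) (h : ℝ) :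
    Measurable (Function.uncurry fun (a : Fin L → ℝ) z =>
      (ENNReal.ofReal (gridGap ((fun l => X z l / h) + a)))⁻¹) := by
  have h1 : Measurable fun q : (Fin L → ℝ) × Euc m => (fun l => X q.2 l / h) + q.1 := by
    refine Measurable.add (measurable_pi_lambda _ fun l => ?_) measurable_fst
    have h2 : Measurable fun v : Euc L => v l / h :=
      (by fun_prop : Continuous fun v : Euc L => v l / h).measurable
    exact h2.comp (hX.comp measurable_snd)
  exact (ENNReal.measurable_ofReal.comp (continuous_gridGap.measurable.comp h1)).inv

/-- On a ball `u` takes values in one chain class, for which the singular maps are available. The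
mean of `gap^{-p}` over translations is bounded uniformly in the point because `p < 2`, so some
translation costs only the constant `J`. That constant depends on `N`, `p` and `L`, not on `u` or
the radii. -/
theorem IsClosedSubmanifold.exists_singular_perturbation {N : Set (Euc L)}
    (hN : IsClosedSubmanifold N) {p : ℝ} (hp : 1 ≤ p) (hp2 : p < 2) (m : ℕ) :
    ∃ (C : ENNReal) (M : ℝ), C ≠ ⊤ ∧ 0 ≤ M ∧ ∀ (Ω : Set (Euc m)) (u : Euc m → Euc L)
      (G : Euc m → Euc m →L[ℝ] Euc L) (x : Euc m) (ρ ρ' R : ℝ), IsOpen Ω → IsWeakGradient Ω u G →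
      (∀ᵐ z ∂(volume.restrict Ω), u z ∈ N) → ρ < ρ' → 0 < ρ' → ρ' < R → closedBall x R ⊆ Ω →
      ∫⁻ z in closedBall x R, ‖G z‖ₑ ^ p ≠ ⊤ →
      ∃ (w : Euc m → Euc L) (H : Euc m → Euc m →L[ℝ] Euc L),
        (∀ᵐ z ∂(volume.restrict Ω), u z + w z ∈ N) ∧ (∀ z ∉ closedBall x ρ', w z = 0) ∧
        (∃ q, ∀ᵐ z ∂(volume.restrict (ball x ρ)), u z + w z = q) ∧
        MemLp w (ENNReal.ofReal p) ∧ IsWeakGradient univ w H ∧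
        ∫⁻ z in closedBall x ρ', ‖H z‖ₑ ^ p ≠ ⊤ ∧
        ∫⁻ z in closedBall x ρ' \ ball x ρ, ‖H z‖ₑ ^ p ≤ C *
          ∫⁻ z in closedBall x ρ' \ ball x ρ, ENNReal.ofReal (‖G z‖ + 4 * M / (ρ' - ρ)) ^ p := by
  obtain ⟨S, K, ε, h, C₀, hS, hSN, hε, hh, hC₀, hF⟩ := hN.exists_singular_maps
  obtain ⟨J, hJt, hJ⟩ := exists_lintegral_gridGap_le L (by linarith : 0 < p) hp2
  obtain ⟨M, hM⟩ := hN.1.isBounded.exists_norm_le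
  have hp0 : 0 ≤ p := by linarith
  refine ⟨ENNReal.ofReal (m * L * (K + 1 + K * C₀)) ^ p * J, max M 0,
    ENNReal.mul_ne_top (ENNReal.rpow_ne_top_of_nonneg hp0 ENNReal.ofReal_ne_top) hJt,
    le_max_right _ _, ?_⟩
  intro Ω u G x ρ ρ' R hΩ hG huN hρ hρ' hR hx hGp
  have hM' : ∀ y ∈ N, ‖y‖ ≤ max M 0 := fun y hy => (hM y hy).trans (le_max_left _ _)
  obtain ⟨c, hcN, huT⟩ := exists_chainClass hN.1 hΩ hG huN hε (by linarith) hx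
  obtain ⟨F, hFN, hFseg, hFlip⟩ := hF c hcN
  set T := chainClass N ε c with hT
  have hTN : T ⊆ N := chainClass_subset hcN
  have hTm : MeasurableSet T := measurableSet_chainClass hN.1.isClosed hε hcN
  have hGm : AEStronglyMeasurable G (volume.restrict (closedBall x R)) :=
    (hG.2.1.integrableOn_compact_subset hx (isCompact_closedBall x R)).aestronglyMeasurable
  have hum : AEStronglyMeasurable u (volume.restrict (closedBall x R)) :=
    (hG.1.integrableOn_compact_subset hx (isCompact_closedBall x R)).aestronglyMeasurable
  obtain ⟨y, hym, hyT, huy⟩ :=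
    exists_measurable_representative hTm (self_mem_chainClass N ε c) hum huT
  have hyG : IsWeakGradient (ball x R) y G :=
    (hG.mono (ball_subset_closedBall.trans hx)).congr
      (ae_restrict_of_ae_restrict_of_subset ball_subset_closedBall huy)
      (Eventually.of_forall fun _ => rfl)
  -- An intermediate radius: increments of the representative `y` are controlled only on compact
  -- subsets of the open ball of radius `R`, on which it agrees with `u`.
  set R₁ : ℝ := (ρ' + R) / 2 with hR₁
  have hR1 : ρ' < R₁ := by rw [hR₁]; linarith
  have hR1R : R₁ < R := by rw [hR₁]; linarith
  have hsub : closedBall x R₁ ⊆ closedBall x R := closedBall_subset_closedBall hR1R.le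
  obtain ⟨t, ht, ht0, hts⟩ := exists_summable_increments isOpen_ball hyG
    (isCompact_closedBall x R₁) (closedBall_subset_ball hR1R)
  have hGm1 : AEStronglyMeasurable G (volume.restrict (closedBall x R₁)) := hGm.mono_set hsub
  set b : ℝ := 4 * max M 0 / (ρ' - ρ) with hb
  have hd : 0 < ρ' - ρ := sub_pos.2 hρ
  have hb0 : 0 ≤ b := by positivity
  set X : Euc m → Euc L := fun z => y z + clamp (2 * (ρ' - ‖z - x‖) / (ρ' - ρ) - 1) • (c - y z)
    with hX
  have hXm : Measurable X := by
    have h2 : Continuous fun z : Euc m => clamp (2 * (ρ' - ‖z - x‖) / (ρ' - ρ) - 1) :=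
      lipschitzWith_clamp.continuous.comp (by fun_prop)
    exact hym.add (h2.measurable.smul (measurable_const.sub hym))
  set gap : (Fin L → ℝ) → Euc L → ℝ := fun a q => gridGap ((fun l => q l / h) + a) with hgap
  set k : (Fin L → ℝ) → Euc m → ENNReal := fun a z => (ENNReal.ofReal (gap a (X z)))⁻¹ with hk
  have hkm : Measurable (Function.uncurry k) := measurable_inv_gridGap hXm h
  have hkJ : ∀ z, ∫⁻ a, k a z ^ p ∂(unitCube L) ≤ J := by
    intro z
    refine le_trans (lintegral_mono fun a => ?_) (hJ fun l => X z l / h)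
    simp only [hk, hgap]
    rw [ENNReal.inv_rpow, ENNReal.rpow_neg]
  have hfm : AEMeasurable (fun z => ENNReal.ofReal (‖G z‖ + b) ^ p)
      (volume.restrict (closedBall x R₁)) :=
    (hGm1.norm.aemeasurable.add aemeasurable_const).ennreal_ofReal.pow_const p
  have hft : ∫⁻ z in closedBall x R₁, ENNReal.ofReal (‖G z‖ + b) ^ p ≠ ⊤ := by
    refine ne_top_of_le_ne_top ?_ (lintegral_ofReal_add_rpow_le hp
      (volume.restrict (closedBall x R₁)) G hb0)
    refine ENNReal.mul_ne_top (ENNReal.rpow_ne_top_of_nonneg (by linarith) ENNReal.ofNat_ne_top)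
      (ENNReal.add_ne_top.2 ⟨ne_top_of_le_ne_top hGp (lintegral_mono_set hsub), ?_⟩)
    rw [Measure.restrict_apply_univ]
    exact ENNReal.mul_ne_top (ENNReal.rpow_ne_top_of_nonneg hp0 ENNReal.ofReal_ne_top)
      measure_closedBall_lt_top.ne
  have : IsFiniteMeasure (volume.restrict (closedBall x R₁)) :=
    isFiniteMeasure_restrict.2 measure_closedBall_lt_top.ne
  set q : Fin m → ℕ → Euc m → ENNReal := fun j n z => ENNReal.ofReal (t n)⁻¹ *
    ‖y (z + t n • EuclideanSpace.single j (1 : ℝ)) - y z -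
      t n • G z (EuclideanSpace.single j (1 : ℝ))‖ₑ with hq
  have hqm : ∀ j n, AEMeasurable (q j n) (volume.restrict (closedBall x R₁)) := fun j n =>
    aemeasurable_increment_quotient hym hGm1 (t n) _
  have hqs : ∀ j n, ∫⁻ z in closedBall x R₁, q j n z ≤ (2 : ENNReal)⁻¹ ^ n := by
    intro j n
    rw [hq]
    simp only
    rw [lintegral_const_mul' _ _ ENNReal.ofReal_ne_top]
    exact hts j n
  -- The quantitative bound is requested on the annulus only; on the full ball finiteness is enough,
  -- since the competitor is constant inside.
  obtain ⟨a, ha, hA, hfin, hkt, hlim⟩ := exists_good_parameter hp hkm hJt hkJ hfm hft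
    (A := closedBall x ρ' \ ball x ρ) hqm hqs (ae_mem_unitCube L)
  obtain ⟨w, H, hwN, hw0, ⟨v, hv⟩, hwp, hH, hHb⟩ := exists_twoStage_perturbation hp hS hSN hM' hcN
    (hFN a) (gap := gap a) (continuous_gridGap_div_add h a)
    (fun _ => gridGap_nonneg _) (fun _ => (gridGap_le_half _).trans (by norm_num)) hC₀
    (fun q q' hq => hFlip a q q' hq) hTN (hFseg a ha) hym hyT hρ hρ' hR1 hGm1 (k := k a) rfl hkt hfin
    ht ht0 hlim
  have hCt : ENNReal.ofReal (m * L * (K + 1 + K * C₀)) ^ p ≠ ⊤ :=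
    ENNReal.rpow_ne_top_of_nonneg hp0 ENNReal.ofReal_ne_top
  refine ⟨w, H, ?_, hw0, ⟨v, ?_⟩, hwp, hH, ?_, ?_⟩
  · have h1 := ae_imp_of_ae_restrict huy
    filter_upwards [ae_restrict_of_ae h1, huN] with z hz hzN
    by_cases hzR : z ∈ closedBall x R
    · rw [hz hzR]
      exact hwN z
    · rw [hw0 z fun h' => hzR (closedBall_subset_closedBall hR.le h'), add_zero]
      exact hzN
  · filter_upwards [ae_restrict_of_ae_restrict_of_subset (ball_subset_closedBall.trans
      (closedBall_subset_closedBall (by linarith : ρ ≤ R))) huy, ae_restrict_mem measurableSet_ball]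
      with z hz hzm
    rw [hz]
    exact hv z hzm
  · refine ne_top_of_le_ne_top ?_ ((lintegral_mono_set
      (closedBall_subset_closedBall hR1.le)).trans (lintegral_mono_ae hHb))
    rw [lintegral_const_mul' _ _ hCt]
    exact ENNReal.mul_ne_top hCt hfin
  · have hAs : closedBall x ρ' \ ball x ρ ⊆ closedBall x R₁ :=
      sdiff_subset.trans (closedBall_subset_closedBall hR1.le)
    rw [Measure.restrict_restrict (measurableSet_closedBall.diff measurableSet_ball),
      inter_eq_left.2 hAs] at hA
    refine (lintegral_mono_ae (ae_restrict_of_ae_restrict_of_subset hAs hHb)).trans ?_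
    rw [lintegral_const_mul' _ _ hCt, mul_assoc (ENNReal.ofReal _ ^ p) J]
    exact mul_le_mul_right hA _

end SelectedCompetitor


/-! ### Comparison of the energy on a ball with that on an annulus. -/

section Comparison
open Filter Topology

variable {m L : ℕ}

theorem IsWeakGradient.ae_eq_zero_of_const {U : Set (Euc m)} (hU : IsOpen U) {u : Euc m → Euc L}
    {G : Euc m → Euc m →L[ℝ] Euc L} (h : IsWeakGradient U u G) {q : Euc L}
    (hq : ∀ᵐ z ∂(volume.restrict U), u z = q) : ∀ᵐ z ∂(volume.restrict U), G z = 0 :=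
  h.ae_unique hU ((isWeakGradient_const q).congr (hq.mono fun _ h => h.symm)
    (Eventually.of_forall fun _ => rfl))

theorem memLp_of_eq_zero_off {F : Type*} [NormedAddCommGroup F] {p : ℝ} (hp : 0 < p)
    {B : Set (Euc m)} (hB : MeasurableSet B) {H : Euc m → F} (hm : AEStronglyMeasurable H volume)
    (hout : ∀ᵐ z, z ∉ B → H z = 0) (hfin : ∫⁻ z in B, ‖H z‖ₑ ^ p ≠ ⊤) :
    MemLp H (ENNReal.ofReal p) volume := by
  refine ⟨hm, ?_⟩
  rw [eLpNorm_lt_top_iff_lintegral_rpow_enorm_lt_top (by simpa using hp) (by simp),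
    ENNReal.toReal_ofReal hp.le]
  refine lt_of_le_of_lt (le_of_eq ?_) hfin.lt_top
  rw [← lintegral_indicator hB]
  refine lintegral_congr_ae ?_
  filter_upwards [hout] with z hz
  by_cases h : z ∈ B
  · rw [indicator_of_mem h]
  · rw [indicator_of_notMem h, hz h, enorm_zero, ENNReal.zero_rpow_of_pos hp]

theorem IsWeakGradient.memLp_of_eq_zero_off {p : ℝ} (hp : 0 < p) {B : Set (Euc m)}
    (hB : IsClosed B) {w : Euc m → Euc L} {H : Euc m → Euc m →L[ℝ] Euc L}
    (hH : IsWeakGradient univ w H) (hw0 : ∀ z ∉ B, w z = 0) (hHp : ∫⁻ z in B, ‖H z‖ₑ ^ p ≠ ⊤) :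
    (∀ᵐ z, z ∉ B → H z = 0) ∧ MemLp H (ENNReal.ofReal p) volume := by
  have hHout : ∀ᵐ z, z ∉ B → H z = 0 := by
    have h1 := (hH.mono (subset_univ Bᶜ)).ae_eq_zero_of_const hB.isOpen_compl (q := 0)
      ((ae_restrict_iff' hB.isOpen_compl.measurableSet).2 (Eventually.of_forall hw0))
    exact (ae_restrict_iff' hB.isOpen_compl.measurableSet).1 h1
  have hHm : AEStronglyMeasurable H volume := by
    have := hH.2.1.aestronglyMeasurable
    rwa [Measure.restrict_univ] at this
  exact ⟨hHout, _root_.memLp_of_eq_zero_off hp hB.measurableSet hHm hHout hHp⟩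

theorem memLp_fun_add {F : Type*} [NormedAddCommGroup F] {ν : Measure (Euc m)} {q : ENNReal}
    {f g : Euc m → F} (hf : MemLp f q ν) (hg : MemLp g q ν) : MemLp (fun z => f z + g z) q ν :=
  hf.add hg

theorem memLp_congr_fun {F : Type*} [NormedAddCommGroup F] {ν : Measure (Euc m)} {q : ENNReal}
    {f g : Euc m → F} (h : ∀ᵐ z ∂ν, f z = g z) (hg : MemLp g q ν) : MemLp f q ν :=
  (memLp_congr_ae h).2 hg

theorem MemW1p.add_perturbation {p : ℝ} {Ω : Set (Euc m)} (hΩ : IsOpen Ω) {N : Set (Euc L)}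
    {u : Euc m → Euc L} (hu : MemW1p p Ω N u) {w : Euc m → Euc L} {H : Euc m → Euc m →L[ℝ] Euc L}
    (hwN : ∀ᵐ z ∂(volume.restrict Ω), u z + w z ∈ N) (hwp : MemLp w (ENNReal.ofReal p))
    (hH : IsWeakGradient univ w H) (hHp : MemLp H (ENNReal.ofReal p) volume) :
    IsWeakGradient Ω (fun z => u z + w z) (fun z => weakGrad Ω u z + H z) ∧
      MemW1p p Ω N (fun z => u z + w z) ∧ ∀ᵐ z ∂(volume.restrict Ω),
        gradNorm Ω (fun z => u z + w z) z ^ p = hsNorm (weakGrad Ω u z + H z) ^ p := by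
  have hG : IsWeakGradient Ω u (weakGrad Ω u) := by
    obtain ⟨G, hG⟩ := hu.exists_weakGradient
    exact hG.weakGrad
  have hv : IsWeakGradient Ω (fun z => u z + w z) (fun z => weakGrad Ω u z + H z) :=
    hG.add (hH.mono (subset_univ _))
  have hvG := hv.weakGrad_ae_eq hΩ
  have hsum : MemLp (fun z => weakGrad Ω u z + H z) (ENNReal.ofReal p) (volume.restrict Ω) :=
    memLp_fun_add hu.memLp_weakGrad (hHp.restrict Ω)
  refine ⟨hv, ⟨memLp_fun_add hu.memLp (hwp.restrict Ω), ⟨_, hv⟩, memLp_congr_fun hvG hsum, hwN⟩, ?_⟩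
  filter_upwards [hvG] with z hz
  rw [gradNorm_eq_hsNorm, hz]

/-- The contributions off `B` are equal and finite, so they cancel, and `g` contributes nothing on
`b`. -/
theorem setIntegral_le_of_eq_off {Ω B b : Set (Euc m)} (hB : MeasurableSet B) (hb : MeasurableSet b)
    (hΩ : MeasurableSet Ω) (hbB : b ⊆ B) (hBΩ : B ⊆ Ω) {f g : Euc m → ℝ} (hf : IntegrableOn f Ω)
    (hg : IntegrableOn g Ω) (hle : ∫ z in Ω, f z ≤ ∫ z in Ω, g z)
    (hout : ∀ᵐ z, z ∈ Ω \ B → g z = f z) (hin : ∀ᵐ z ∂(volume.restrict b), g z = 0) :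
    ∫ z in B, f z ≤ ∫ z in B \ b, g z := by
  have e1 := setIntegral_sdiff hB hf hBΩ
  have e2 := setIntegral_sdiff hB hg hBΩ
  have e3 := setIntegral_sdiff hb (hg.mono_set hBΩ) hbB
  have e4 : ∫ z in b, g z = 0 := (integral_congr_ae hin).trans (integral_zero _ _)
  have e5 := setIntegral_congr_ae (hΩ.diff hB) hout
  linarith

/-- Minimality tested against a perturbation supported in a closed ball that makes the map constant
on a smaller ball: only the energy in the annulus is left. -/
theorem IsPMinimizing.energy_le_annulus {p : ℝ} (hp : 1 ≤ p) {Ω : Set (Euc m)} (hΩ : IsOpen Ω)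
    {N : Set (Euc L)} {u : Euc m → Euc L} (hu : IsPMinimizing p Ω N u) {x : Euc m} {ρ ρ' : ℝ}
    (hρ : ρ < ρ') (hx : closedBall x ρ' ⊆ Ω) {w : Euc m → Euc L}
    {H : Euc m → Euc m →L[ℝ] Euc L} (hwN : ∀ᵐ z ∂(volume.restrict Ω), u z + w z ∈ N)
    (hw0 : ∀ z ∉ closedBall x ρ', w z = 0) {q : Euc L}
    (hq : ∀ᵐ z ∂(volume.restrict (ball x ρ)), u z + w z = q) (hwp : MemLp w (ENNReal.ofReal p))
    (hH : IsWeakGradient univ w H) (hHp : ∫⁻ z in closedBall x ρ', ‖H z‖ₑ ^ p ≠ ⊤) :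
    IntegrableOn (fun z => hsNorm (weakGrad Ω u z + H z) ^ p) (closedBall x ρ' \ ball x ρ) ∧
    ∫ z in closedBall x ρ', gradNorm Ω u z ^ p ≤
      ∫ z in closedBall x ρ' \ ball x ρ, hsNorm (weakGrad Ω u z + H z) ^ p := by
  have hp0 : 0 < p := by linarith
  obtain ⟨hHout, hHLp⟩ := hH.memLp_of_eq_zero_off hp0 isClosed_closedBall hw0 hHp
  obtain ⟨hv, hvW, hvn⟩ := hu.1.add_perturbation hΩ hwN hwp hH hHLp
  have hbc : ball x ρ ⊆ closedBall x ρ' :=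
    ball_subset_closedBall.trans (closedBall_subset_closedBall hρ.le)
  have hin : ∀ᵐ z ∂(volume.restrict (ball x ρ)), weakGrad Ω u z + H z = 0 :=
    (hv.mono (hbc.trans hx)).ae_eq_zero_of_const isOpen_ball hq
  have hmin := hu.2 (closedBall x ρ') (fun z => u z + w z) (isCompact_closedBall x ρ') hx hvW
    ((ae_restrict_iff' (hΩ.measurableSet.diff measurableSet_closedBall)).2
      (Eventually.of_forall fun z hz => by
        rw [hw0 z hz.2, add_zero]))
  unfold pEnergy at hmin
  have hiv : IntegrableOn (fun z => hsNorm (weakGrad Ω u z + H z) ^ p) Ω :=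
    (hvW.integrableOn_gradNorm_rpow hp0).congr hvn
  rw [integral_congr_ae hvn] at hmin
  refine ⟨hiv.mono_set (sdiff_subset.trans hx), setIntegral_le_of_eq_off measurableSet_closedBall
    measurableSet_ball hΩ.measurableSet hbc hx (hu.1.integrableOn_gradNorm_rpow hp0) hiv hmin ?_ ?_⟩
  · filter_upwards [hHout] with z h1 hz
    rw [h1 hz.2, add_zero, gradNorm_eq_hsNorm]
  · filter_upwards [hin] with z h1
    have h0 : hsNorm (0 : Euc m →L[ℝ] Euc L) = 0 :=
      le_antisymm ((hsNorm_le_opNorm _).trans (by rw [norm_zero, mul_zero])) (hsNorm_nonneg _)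
    rw [h1, h0, Real.zero_rpow hp0.ne']

/-- A Caccioppoli type inequality on annuli for minimizers into a compact manifold, when `p < 2`. -/
theorem IsClosedSubmanifold.exists_energy_le_annulus {N : Set (Euc L)}
    (hN : IsClosedSubmanifold N) {p : ℝ} (hp : 1 ≤ p) (hp2 : p < 2) (m : ℕ) :
    ∃ C : ℝ, 0 ≤ C ∧ ∀ (Ω : Set (Euc m)) (u : Euc m → Euc L) (x : Euc m) (ρ ρ' R : ℝ), IsOpen Ω →
      IsPMinimizing p Ω N u → ρ < ρ' → 0 < ρ' → ρ' < R → closedBall x R ⊆ Ω →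
      ∫ z in closedBall x ρ', gradNorm Ω u z ^ p ≤
        C * ((∫ z in closedBall x ρ' \ ball x ρ, gradNorm Ω u z ^ p) +
          ((ρ' - ρ) ^ p)⁻¹ * volume.real (closedBall x ρ')) := by
  obtain ⟨C, M, hC, hM, hmain⟩ := hN.exists_singular_perturbation hp hp2 m
  have hp0 : 0 < p := by linarith
  set c₁ : ENNReal := ENNReal.ofReal (Real.sqrt m) ^ p * 2 ^ (p - 1) with hc₁
  set D : ENNReal := ENNReal.ofReal (4 * M) ^ p with hD
  set C' : ENNReal := c₁ * (1 + C * 2 ^ (p - 1) * (1 + D)) with hC'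
  have h2t : (2 : ENNReal) ^ (p - 1) ≠ ⊤ :=
    ENNReal.rpow_ne_top_of_nonneg (by linarith) ENNReal.ofNat_ne_top
  have hDt : D ≠ ⊤ := ENNReal.rpow_ne_top_of_nonneg hp0.le ENNReal.ofReal_ne_top
  have hc₁t : c₁ ≠ ⊤ :=
    ENNReal.mul_ne_top (ENNReal.rpow_ne_top_of_nonneg hp0.le ENNReal.ofReal_ne_top) h2t
  have hC't : C' ≠ ⊤ := ENNReal.mul_ne_top hc₁t (ENNReal.add_ne_top.2 ⟨ENNReal.one_ne_top,
    ENNReal.mul_ne_top (ENNReal.mul_ne_top hC h2t) (ENNReal.add_ne_top.2 ⟨ENNReal.one_ne_top, hDt⟩)⟩)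
  refine ⟨C'.toReal, ENNReal.toReal_nonneg, ?_⟩
  intro Ω u x ρ ρ' R hΩ hu hρ hρ' hR hx
  have hd : 0 < ρ' - ρ := sub_pos.2 hρ
  have hG : IsWeakGradient Ω u (weakGrad Ω u) := by
    obtain ⟨G, hG⟩ := hu.1.exists_weakGradient
    exact hG.weakGrad
  have hGp : ∫⁻ z in closedBall x R, ‖weakGrad Ω u z‖ₑ ^ p ≠ ⊤ := by
    have h1 := (hu.1.memLp_weakGrad.mono_measure (Measure.restrict_mono hx le_rfl)).2
    rw [eLpNorm_lt_top_iff_lintegral_rpow_enorm_lt_top (by simpa using hp0) (by simp),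
      ENNReal.toReal_ofReal hp0.le] at h1
    exact h1.ne
  obtain ⟨w, H, hwN, hw0, ⟨q, hq⟩, hwp, hH, hHp, hHA⟩ :=
    hmain Ω u (weakGrad Ω u) x ρ ρ' R hΩ hG hu.1.mem_target hρ hρ' hR hx hGp
  have hxρ : closedBall x ρ' ⊆ Ω := (closedBall_subset_closedBall hR.le).trans hx
  obtain ⟨hiA, hle⟩ := hu.energy_le_annulus hp hΩ hρ hxρ hwN hw0 hq hwp hH hHp
  set A : Set (Euc m) := closedBall x ρ' \ ball x ρ with hA
  have hAΩ : A ⊆ Ω := sdiff_subset.trans hxρ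
  have hgi : IntegrableOn (fun z => gradNorm Ω u z ^ p) A :=
    (hu.1.integrableOn_gradNorm_rpow hp0).mono_set hAΩ
  have hg0 : ∀ z, 0 ≤ gradNorm Ω u z := fun z => by
    rw [gradNorm_eq_hsNorm]; exact hsNorm_nonneg _
  set a : ENNReal := ∫⁻ z in A, ‖weakGrad Ω u z‖ₑ ^ p with ha
  have ha_le : a ≤ ENNReal.ofReal (∫ z in A, gradNorm Ω u z ^ p) := by
    rw [ofReal_integral_eq_lintegral_ofReal hgi
      (Eventually.of_forall fun z => Real.rpow_nonneg (hg0 z) p)]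
    refine lintegral_mono fun z => ?_
    rw [← ENNReal.ofReal_rpow_of_nonneg (hg0 z) hp0.le, ← ofReal_norm]
    refine ENNReal.rpow_le_rpow (ENNReal.ofReal_le_ofReal ?_) hp0.le
    rw [gradNorm_eq_hsNorm]
    exact opNorm_le_hsNorm _
  set e : ENNReal := ENNReal.ofReal (((ρ' - ρ) ^ p)⁻¹ * volume.real (closedBall x ρ')) with he
  have hHA' : ∫⁻ z in A, ‖H z‖ₑ ^ p ≤ C * 2 ^ (p - 1) * (a + D * e) := by
    refine hHA.trans ?_
    rw [mul_assoc]
    refine mul_le_mul_right ?_ _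
    refine (lintegral_ofReal_add_rpow_le hp (volume.restrict A) (weakGrad Ω u)
      (by positivity : 0 ≤ 4 * M / (ρ' - ρ))).trans ?_
    refine mul_le_mul_right (add_le_add le_rfl ?_) _
    have hDe : D * e =
        ENNReal.ofReal (4 * M / (ρ' - ρ)) ^ p * volume (closedBall x ρ') := by
      rw [hD, he, ← ENNReal.ofReal_toReal (measure_closedBall_lt_top (μ := volume) (x := x)).ne,
        ENNReal.ofReal_rpow_of_nonneg (by positivity) hp0.le,
        ENNReal.ofReal_rpow_of_nonneg (by positivity) hp0.le, ← ENNReal.ofReal_mul (by positivity),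
        ← ENNReal.ofReal_mul (by positivity), Real.div_rpow (by positivity) hd.le, ← mul_assoc,
        ← div_eq_mul_inv, Measure.real]
    rw [Measure.restrict_apply_univ, hDe]
    exact mul_le_mul_right (measure_mono sdiff_subset) _
  have hHm : AEMeasurable (fun z => ‖weakGrad Ω u z‖ₑ ^ p) (volume.restrict A) :=
    ((hu.1.memLp_weakGrad.mono_measure (Measure.restrict_mono hAΩ le_rfl)).1.enorm).pow_const p
  have hb : ENNReal.ofReal (∫ z in A, hsNorm (weakGrad Ω u z + H z) ^ p) ≤
      c₁ * (a + ∫⁻ z in A, ‖H z‖ₑ ^ p) := by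
    rw [ofReal_integral_eq_lintegral_ofReal hiA
      (Eventually.of_forall fun z => Real.rpow_nonneg (hsNorm_nonneg _) p), ha,
      ← lintegral_add_left' hHm, ← lintegral_const_mul' _ _ hc₁t]
    refine lintegral_mono fun z => ?_
    rw [← ENNReal.ofReal_rpow_of_nonneg (hsNorm_nonneg _) hp0.le, hc₁, mul_assoc]
    have h1 : ENNReal.ofReal (hsNorm (weakGrad Ω u z + H z)) ≤
        ENNReal.ofReal (Real.sqrt m) * (‖weakGrad Ω u z‖ₑ + ‖H z‖ₑ) := by
      rw [← ofReal_norm, ← ofReal_norm, ← ENNReal.ofReal_add (norm_nonneg _) (norm_nonneg _),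
        ← ENNReal.ofReal_mul (Real.sqrt_nonneg _)]
      refine ENNReal.ofReal_le_ofReal ((hsNorm_le_opNorm _).trans ?_)
      gcongr
      exact norm_add_le _ _
    refine (ENNReal.rpow_le_rpow h1 hp0.le).trans ?_
    rw [ENNReal.mul_rpow_of_nonneg _ _ hp0.le]
    exact mul_le_mul_right (ENNReal.rpow_add_le_mul_rpow_add_rpow _ _ hp) _
  have hae : a + C * 2 ^ (p - 1) * (a + D * e) ≤ (1 + C * 2 ^ (p - 1) * (1 + D)) * (a + e) := by
    have h1 : a + D * e ≤ (1 + D) * (a + e) := by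
      rw [add_mul, one_mul, mul_add D]
      exact add_le_add le_self_add le_add_self
    calc a + C * 2 ^ (p - 1) * (a + D * e)
        ≤ (a + e) + C * 2 ^ (p - 1) * ((1 + D) * (a + e)) :=
          add_le_add le_self_add (mul_le_mul_right h1 _)
      _ = _ := by ring
  have hfin : ENNReal.ofReal (∫ z in closedBall x ρ', gradNorm Ω u z ^ p) ≤ C' * (a + e) := by
    refine (ENNReal.ofReal_le_ofReal hle).trans (hb.trans ?_)
    rw [show C' * (a + e) = c₁ * ((1 + C * 2 ^ (p - 1) * (1 + D)) * (a + e)) from mul_assoc _ _ _]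
    exact mul_le_mul_right ((add_le_add le_rfl hHA').trans hae) _
  have hI0 : 0 ≤ ∫ z in A, gradNorm Ω u z ^ p :=
    integral_nonneg fun z => Real.rpow_nonneg (hg0 z) p
  have hfin' : ENNReal.ofReal (∫ z in closedBall x ρ', gradNorm Ω u z ^ p) ≤
      ENNReal.ofReal (C'.toReal * ((∫ z in A, gradNorm Ω u z ^ p) +
          ((ρ' - ρ) ^ p)⁻¹ * volume.real (closedBall x ρ'))) := by
    rw [ENNReal.ofReal_mul ENNReal.toReal_nonneg, ENNReal.ofReal_toReal hC't,
      ENNReal.ofReal_add hI0 (by positivity)]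
    exact hfin.trans (mul_le_mul_right (add_le_add ha_le le_rfl) _)
  exact (ENNReal.ofReal_le_ofReal_iff (by positivity)).1 hfin'

end Comparison


/-! ### Hole filling and the scale invariant energy bound. -/

section HoleFilling
open Filter Topology

variable {m L : ℕ}

/-- Iterating `n` times gives a geometric series of ratio `θ μ < 1` plus a multiple of the a priori
bound `M` that tends to zero; so `M` does not enter the conclusion. -/
theorem le_of_forall_le_mul_succ_add {a : ℕ → ℝ} {θ μ B M : ℝ} (hθ : 0 ≤ θ) (hμ : 1 ≤ μ)
    (hθμ : θ * μ < 1) (hB : 0 ≤ B) (hM : 0 ≤ M) (haM : ∀ i, a i ≤ M)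
    (ha : ∀ i, a i ≤ θ * a (i + 1) + B * μ ^ i) : a 0 ≤ B / (1 - θ * μ) := by
  set τ := θ * μ with hτ
  have hμ0 : 0 < μ := by linarith
  have hτ0 : 0 ≤ τ := by positivity
  have hτ1 : 0 < 1 - τ := by linarith
  have key : ∀ n i, a i ≤ μ ^ i * (τ ^ n * M + B / (1 - τ)) := by
    intro n
    induction n with
    | zero =>
      intro i
      have h1 : 1 ≤ μ ^ i := one_le_pow₀ hμ
      have h2 : 0 ≤ B / (1 - τ) := by positivity
      rw [pow_zero, one_mul]
      nlinarith [haM i]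
    | succ n ih =>
      intro i
      calc a i ≤ θ * a (i + 1) + B * μ ^ i := ha i
        _ ≤ θ * (μ ^ (i + 1) * (τ ^ n * M + B / (1 - τ))) + B * μ ^ i := by
            gcongr
            exact ih _
        _ = μ ^ i * (τ ^ (n + 1) * M + (τ * (B / (1 - τ)) + B)) := by rw [hτ]; ring
        _ = _ := by
            congr 2
            field_simp
            ring
  have hlim : Tendsto (fun n => μ ^ 0 * (τ ^ n * M + B / (1 - τ))) atTop
      (𝓝 (μ ^ 0 * (0 * M + B / (1 - τ)))) :=
    (((tendsto_pow_atTop_nhds_zero_of_lt_one hτ0 hθμ).mul_const M).add_const _).const_mul _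
  have := ge_of_tendsto' hlim fun n => key n 0
  simpa using this

/-- Minimizers into a compact manifold have scale invariant energy bounds when `p < 2`. -/
theorem IsClosedSubmanifold.exists_energy_bound {N : Set (Euc L)} (hN : IsClosedSubmanifold N)
    {p : ℝ} (hp : 1 ≤ p) (hp2 : p < 2) (m : ℕ) :
    ∃ E : ℝ, 0 ≤ E ∧ ∀ (Ω : Set (Euc m)) (u : Euc m → Euc L) (x : Euc m) (r : ℝ), IsOpen Ω →
      IsPMinimizing p Ω N u → 0 < r → closedBall x (2 * r) ⊆ Ω →
      ∫ z in ball x r, gradNorm Ω u z ^ p ≤ E * r ^ ((m : ℝ) - p) := by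
  obtain ⟨C, hC, hmain⟩ := hN.exists_energy_le_annulus hp hp2 m
  have hp0 : 0 < p := by linarith
  -- The annulus energy is the outer energy minus the inner one; moving `C` times the inner energy
  -- to the left and dividing by `1 + C` produces a factor less than `1`.
  set θ : ℝ := C / (1 + C) with hθ
  have hθ0 : 0 ≤ θ := by positivity
  have hθ1 : θ < 1 := by rw [hθ, div_lt_one (by positivity)]; linarith
  -- Chosen so that `θ < lam^p < 1`: the growth `lam^{-p}` of the error at each step is then beaten
  -- by the factor `θ`.
  set lam : ℝ := ((1 + θ) / 2) ^ p⁻¹ with hlam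
  have hlp : lam ^ p = (1 + θ) / 2 := by
    rw [hlam, Real.rpow_inv_rpow (by positivity) hp0.ne']
  have hl0 : 0 < lam := by positivity
  have hl1 : lam < 1 := Real.rpow_lt_one (by positivity) (by linarith) (by positivity)
  set μ : ℝ := (lam ^ p)⁻¹ with hμ
  have hμ1 : 1 ≤ μ := by
    rw [hμ, hlp]
    exact (one_le_inv₀ (by positivity)).2 (by linarith)
  have hθμ : θ * μ < 1 := by
    rw [hμ, hlp, ← div_eq_mul_inv, div_lt_one (by positivity)]
    linarith
  set D : ℝ := θ * (2 ^ p * ((1 - lam) ^ p)⁻¹ * (2 ^ m * volume.real (ball (0 : Euc m) 1))) with hD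
  have hl1' : 0 < 1 - lam := by linarith
  have hD0 : 0 ≤ D := by positivity
  have hτ : 0 < 1 - θ * μ := by linarith
  refine ⟨D / (1 - θ * μ), by positivity, ?_⟩
  intro Ω u x r hΩ hu hr hx
  have hgi : IntegrableOn (fun z => gradNorm Ω u z ^ p) Ω :=
    hu.1.integrableOn_gradNorm_rpow hp0
  have hg0 : ∀ z, 0 ≤ gradNorm Ω u z ^ p := fun z => by
    rw [gradNorm_eq_hsNorm]; exact Real.rpow_nonneg (hsNorm_nonneg _) _
  have hmono : ∀ {A A' : Set (Euc m)}, A ⊆ A' → A' ⊆ Ω →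
      ∫ z in A, gradNorm Ω u z ^ p ≤ ∫ z in A', gradNorm Ω u z ^ p := fun h h' =>
    setIntegral_mono_set (hgi.mono_set h') (Eventually.of_forall hg0) h.eventuallyLE
  set V : ℝ := volume.real (ball x (2 * r)) with hV
  have hVr : V = r ^ m * (2 ^ m * volume.real (ball (0 : Euc m) 1)) := by
    rw [hV, Measure.real, Measure.addHaar_ball_of_pos _ _ (by positivity), finrank_euclideanSpace_fin,
      ENNReal.toReal_mul, ENNReal.toReal_ofReal (by positivity), mul_pow, Measure.real]
    ring
  have step : ∀ ρ ρ'', 0 < ρ → ρ < ρ'' → ρ'' < 2 * r →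
      ∫ z in ball x ρ, gradNorm Ω u z ^ p ≤
        θ * (∫ z in ball x ρ'', gradNorm Ω u z ^ p) + θ * (2 ^ p * ((ρ'' - ρ) ^ p)⁻¹ * V) := by
    intro ρ ρ'' hρ hρρ hρ2
    set ρ' := (ρ + ρ'') / 2 with hρ'
    have h1 : ρ < ρ' := by rw [hρ']; linarith
    have h2 : ρ' < ρ'' := by rw [hρ']; linarith
    have hsub : closedBall x ρ'' ⊆ Ω := (closedBall_subset_closedBall hρ2.le).trans hx
    have hsub' : closedBall x ρ' ⊆ Ω := (closedBall_subset_closedBall h2.le).trans hsub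
    have h3 := hmain Ω u x ρ ρ' ρ'' hΩ hu h1 (by linarith) h2 hsub
    have hbc : ball x ρ ⊆ closedBall x ρ' :=
      ball_subset_closedBall.trans (closedBall_subset_closedBall h1.le)
    rw [setIntegral_sdiff measurableSet_ball (hgi.mono_set hsub') hbc] at h3
    have h4 := hmono hbc hsub'
    have h5 := hmono (closedBall_subset_ball h2) (ball_subset_closedBall.trans hsub)
    have h6 : ((ρ' - ρ) ^ p)⁻¹ * volume.real (closedBall x ρ') ≤ 2 ^ p * ((ρ'' - ρ) ^ p)⁻¹ * V := by
      have e : ρ' - ρ = (ρ'' - ρ) / 2 := by rw [hρ']; ring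
      have hd : 0 < ρ'' - ρ := by linarith
      rw [e, Real.div_rpow hd.le (by norm_num), inv_div, div_eq_mul_inv]
      gcongr
      exact measureReal_mono (closedBall_subset_ball (h2.trans hρ2)) measure_ball_lt_top.ne
    set a := ∫ z in ball x ρ, gradNorm Ω u z ^ p
    set b := ∫ z in closedBall x ρ', gradNorm Ω u z ^ p
    set d := ∫ z in ball x ρ'', gradNorm Ω u z ^ p
    set v := 2 ^ p * ((ρ'' - ρ) ^ p)⁻¹ * V
    have h7 : C * (b - a + ((ρ' - ρ) ^ p)⁻¹ * volume.real (closedBall x ρ')) ≤ C * (d - a + v) := by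
      gcongr
    rw [← mul_add, hθ, div_mul_eq_mul_div, le_div_iff₀ (by positivity)]
    linarith
  -- The radii increase from `r` towards `2r` with gaps `r(1 - lam) lam^i`, so the factor gap to the
  -- power `-p` grows exactly like `μ^i`.
  set R : ℕ → ℝ := fun i => r * (2 - lam ^ i) with hR
  have hRlt : ∀ i, R i < 2 * r := fun i => by
    have : 0 < r * lam ^ i := by positivity
    simp only [hR]
    linarith
  have hRpos : ∀ i, 0 < R i := fun i => by
    have : lam ^ i ≤ 1 := pow_le_one₀ hl0.le hl1.le
    exact mul_pos hr (by linarith)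
  have hRd : ∀ i, R (i + 1) - R i = r * (1 - lam) * lam ^ i := fun i => by
    simp only [hR]; ring
  have hdp : ∀ i, 0 < r * (1 - lam) * lam ^ i := fun i => by positivity
  set B : ℝ := D * r ^ ((m : ℝ) - p) with hB
  have hrec : ∀ i, ∫ z in ball x (R i), gradNorm Ω u z ^ p ≤
      θ * (∫ z in ball x (R (i + 1)), gradNorm Ω u z ^ p) + B * μ ^ i := by
    intro i
    refine (step (R i) (R (i + 1)) (hRpos i) (by linarith [hRd i, hdp i]) (hRlt _)).trans
      (le_of_eq ?_)
    congr 1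
    have e1 : (lam ^ i) ^ p = (lam ^ p) ^ i := by
      rw [← Real.rpow_natCast, ← Real.rpow_natCast, ← Real.rpow_mul hl0.le, ← Real.rpow_mul hl0.le,
        mul_comm]
    rw [hRd, Real.mul_rpow (by positivity) (by positivity), Real.mul_rpow hr.le hl1'.le, e1, hB, hD,
      hVr, Real.rpow_sub hr, Real.rpow_natCast, hμ, inv_pow, mul_inv, mul_inv]
    ring
  have hfin := le_of_forall_le_mul_succ_add hθ0 hμ1 hθμ (by positivity : 0 ≤ B)
    (integral_nonneg fun z => hg0 z : 0 ≤ ∫ z in closedBall x (2 * r), gradNorm Ω u z ^ p)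
    (fun i => hmono ((ball_subset_ball (hRlt i).le).trans ball_subset_closedBall) hx) hrec
  have hR0 : R 0 = r := by simp only [hR, pow_zero]; ring
  rw [hR0] at hfin
  refine hfin.trans (le_of_eq ?_)
  rw [hB]
  ring

end HoleFilling

/-- The constant `C` is chosen after `m, p, ψ, η, σ, rbar` and the target `N ⊆ ℝᴸ` only; for `p ≥ 2`
it does not depend on the target either. The hypothesis on `Ω` says that the closed balls
`B(y, σ r t_b)`, `y ∈ B_r(x)`, on which the normalized energies live, are contained in `Ω`. -/
theorem mainTheorem4 (m : ℕ) (p : ℝ) (hp : 1 < p) (hpm : p < m)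
    (ψ : ℝ → ℝ) (ta tb ξ : ℝ) (hψ : IsProfile ψ ta tb ξ)
    (η σ rbar : ℝ) (hη : 0 < η) (hσ : 1 < σ) (hrbar : 0 < rbar) (hrbar1 : rbar ≤ 1) :
    ∃ C : (L : ℕ) → Set (Euc L) → ℝ,
      (2 ≤ p → ∀ (L L' : ℕ) (N : Set (Euc L)) (N' : Set (Euc L')), C L N = C L' N') ∧
      ∀ (L : ℕ) (N : Set (Euc L)), IsClosedSubmanifold N →
        ∀ (k : ℕ), 1 ≤ k → k ≤ m →
        ∀ (Ω : Set (Euc m)), IsOpen Ω →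
        ∀ (u : Euc m → Euc L), IsPMinimizing p Ω N u →
        ∀ (x : Euc m) (r : ℝ), 0 < r → Metric.ball x ((1 + σ * tb) * r) ⊆ Ω →
          ¬ IsAlmostInvariant p Ω u η (k + 1) x (rbar * r) →
        ∀ (μ : MeasureTheory.Measure (Euc m)), IsRadonOn Ω μ →
          MeasureTheory.IntegrableOn
            (fun y => normalizedEnergy p ψ Ω u y (σ * r) - normalizedEnergy p ψ Ω u y r)
            (Metric.ball x r) μ ∧
          jonesNumber k μ x r ^ 2 ≤ C L N * (r ^ k)⁻¹ *
            ∫ y in Metric.ball x r,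
              (normalizedEnergy p ψ Ω u y (σ * r) - normalizedEnergy p ψ Ω u y r) ∂μ := by
  have hη' : 0 < η * rbar ^ ((m : ℝ) - p) := mul_pos hη (Real.rpow_pos_of_pos hrbar _)
  set c₂ : ℝ → ℝ := fun c₀ =>
    m * (m + 1) / (c₀ * ((σ - 1) * (p * σ ^ (p - m - 1) * ξ / (2 * σ)))) with hc₂
  have hsub : ∀ (x : Euc m) {r : ℝ}, 0 < r → closedBall x (2 * r) ⊆ ball x ((1 + σ * tb) * r) := by
    intro x r hr
    refine closedBall_subset_ball ?_
    have h1 := hψ.two_lt_ta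
    have h2 := hψ.ta_lt_tb
    have h3 : 1 * 2 < σ * tb := by nlinarith
    nlinarith
  rcases le_or_gt 2 p with hp2 | hp2
  · refine ⟨fun _ _ => c₂ (η * rbar ^ ((m : ℝ) - p)), fun _ _ _ _ _ => rfl, ?_⟩
    intro L N _ k _ _ Ω hΩ u hu x r hr hx hinv μ hμ
    have hxr : ball x r ⊆ Ω :=
      ((ball_subset_closedBall.trans (closedBall_subset_closedBall (by linarith))).trans
        (hsub x hr)).trans hx
    exact jonesNumber_sq_le_of_coercive hp hpm hΩ hu hψ hσ hr hx hη'
      (coercive_of_two_le hp2 hu.1 hr hrbar hrbar1 hxr hinv) hμ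
  -- The energy constant is chosen as a function of the target before `u`, `Ω`, `x` and `r` are
  -- given; sets that are not closed submanifolds receive the value `0`.
  · have hE : ∀ (L : ℕ) (N : Set (Euc L)), ∃ E : ℝ, 0 ≤ E ∧ (IsClosedSubmanifold N →
        ∀ (Ω : Set (Euc m)) (u : Euc m → Euc L) (x : Euc m) (r : ℝ), IsOpen Ω →
        IsPMinimizing p Ω N u → 0 < r → closedBall x (2 * r) ⊆ Ω →
        ∫ z in ball x r, gradNorm Ω u z ^ p ≤ E * r ^ ((m : ℝ) - p)) := by
      intro L N
      by_cases hN : IsClosedSubmanifold N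
      · obtain ⟨E, hE, h⟩ := hN.exists_energy_bound hp.le hp2 m
        exact ⟨E, hE, fun _ => h⟩
      · exact ⟨0, le_rfl, fun h => absurd h hN⟩
    choose E hE0 hE using hE
    -- The absorption threshold of `coercive_of_lt_two`; the summand `1` keeps it positive and
    -- finite when `E` is zero.
    set δ : ∀ L : ℕ, Set (Euc L) → ℝ := fun L N => η * rbar ^ ((m : ℝ) - p) / 2 / (E L N + 1)
      with hδ
    have hδ0 : ∀ L N, 0 < δ L N := fun L N => by
      have := hE0 L N
      positivity
    refine ⟨fun L N => c₂ ((δ L N ^ ((p - 2) / p))⁻¹ * (η * rbar ^ ((m : ℝ) - p) / 2)),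
      fun h => absurd hp2 (not_lt.2 h), ?_⟩
    intro L N hN k _ _ Ω hΩ u hu x r hr hx hinv μ hμ
    have hx2 : closedBall x (2 * r) ⊆ Ω := (hsub x hr).trans hx
    have hxr : ball x r ⊆ Ω :=
      (ball_subset_closedBall.trans (closedBall_subset_closedBall (by linarith))).trans hx2
    have hδE : δ L N * E L N ≤ η * rbar ^ ((m : ℝ) - p) / 2 := by
      have h1 := hE0 L N
      simp only [hδ]
      rw [div_mul_eq_mul_div, div_le_iff₀ (by positivity)]
      nlinarith
    have hc : 0 < (δ L N ^ ((p - 2) / p))⁻¹ * (η * rbar ^ ((m : ℝ) - p) / 2) :=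
      mul_pos (inv_pos.2 (Real.rpow_pos_of_pos (hδ0 L N) _)) (by linarith)
    exact jonesNumber_sq_le_of_coercive hp hpm hΩ hu hψ hσ hr hx hc
      (coercive_of_lt_two hp hp2 hu.1 hr hrbar hrbar1 hxr hinv (hE L N hN Ω u x r hΩ hu hr hx2)
        (hδ0 L N) hδE) hμ
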